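/- **Setting.** Let $\mu>0$, $\eta\ge 0$, $\mathbb S(G)=\mu\big(G+G^t-\tfrac23(\operatorname{tr}G)\mathbb I\big)+\eta(\operatorname{tr}G)\mathbb I$. Let $\gamma>3/2$ and $p\in C[0,\infty)\cap C^2(0,\infty)$ with $p(0)=0$, $p'>0$ on $(0,\infty)$ and $\lim_{s\to\infty}p'(s)/s^{\gamma-1}=a$ for some $a>0$. Let $\bar\rho>0$, $H(s)=s\int_{\bar\rho}^{s}p(z)z^{-2}\,dz$ ($H(0)=0$) and $$e(s,v)=\tfrac12 s|v|^2+H(s)-H'(\bar\rho)(s-\bar\rho)-H(\bar\rho).$$ Let $T>0$ and let $\Omega\subset\mathbb R^3$ be an unbounded domain with uniformly Lipschitz boundary: there are $r>0$, $L\ge0$ such that for every $x\in\partial\Omega$, after a rigid motion, $\Omega\cap B(x,r)$ is the part of $B(x,r)$ strictly above the graph of an $L$-Lipschitz function of two variables. Let $f\in L^1(0,T;L^1\cap L^\infty(\Omega;\mathbb R^3))$, and let $\rho_0\ge0$, $u_0$ be measurable on $\Omega$ with $e(\rho_0,u_0)\in L^1(\Omega)$. Consider the compressible Navier–Stokes system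 $$\partial_t\rho+\operatorname{div}(\rho u)=0,\qquad \partial_t(\rho u)+\operatorname{div}(\rho u\otimes u)+\nabla p(\rho)=\operatorname{div}\mathbb S(\nabla u)+\rho f$$ in $(0,T)\times\Omega$ with $u|_{\partial\Omega}=0$ and $\rho\to\bar\rho$, $u\to0$ as $|x|\to\infty$. Let $D^{1,2}_0(\Omega)$ be the completion of $C_c^\infty(\Omega)$ in the norm $\|\nabla\varphi\|_{L^2}$, a subspace of $L^6(\Omega)$. *Energy inequality:* for a.a. $\tau\in(0,T)$, with all integrals convergent, $$\int_\Omega e(\rho,u)(\tau)\,dx+\int_0^\tau\!\!\int_\Omega\mathbb S(\nabla u):\nabla u\,dx\,dt\le\int_\Omega e(\rho_0,u_0)\,dx+\int_0^\tau\!\!\int_\Omega\rho f\cdot u\,dx\,dt.\tag{E}$$ *Finite energy weak solution* with data $(\rho_0,u_0)$: measurable $(\rho,u)$ with $\rho\ge0$ a.e., $\rho-\bar\rho\in L^\infty(0,T;L^2+L^\gamma(\Omega))$, $u\in L^2(0,T;D^{1,2}_0(\Omega;\mathbb R^3))$, $\rho u\in L^\infty(0,T;L^2+L^{2\gamma/(\gamma+1)}(\Omega;\mathbb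 R^3))$, $p(\rho)\in L^1_{\rm loc}([0,T]\times\Omega)$; up to modification on null sets $\rho-\bar\rho\in C_{\rm weak}([0,T];L^2+L^\gamma(\Omega))$ and $\rho u\in C_{\rm weak}([0,T];L^2+L^{2\gamma/(\gamma+1)}(\Omega;\mathbb R^3))$; for every $\tau\in[0,T]$ $$\int_\Omega\rho(\tau)\varphi(\tau)\,dx-\int_\Omega\rho_0\varphi(0)\,dx=\int_0^\tau\!\!\int_\Omega\big(\rho\,\partial_t\varphi+\rho u\cdot\nabla\varphi\big)\,dx\,dt$$ for all $\varphi\in C_c^\infty([0,T]\times\overline\Omega)$, and $$\int_\Omega(\rho u)(\tau)\cdot\varphi(\tau)\,dx-\int_\Omega\rho_0u_0\cdot\varphi(0)\,dx=\int_0^\tau\!\!\int_\Omega\big(\rho u\cdot\partial_t\varphi+(\rho u\otimes u):\nabla\varphi+p(\rho)\operatorname{div}\varphi-\mathbb S(\nabla u):\nabla\varphi+\rho f\cdot\varphi\big)\,dx\,dt$$ for all $\varphi\in C_c^\infty([0,T]\times\Omega;\mathbb R^3)$; and (E) holds. *Strong solution* with data $(\rho_0,u_0)$: $(\tilde\rho,\tilde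 u)$ with $\tilde u\in L^2(0,T;D_0^{1,2}(\Omega;\mathbb R^3))$ whose weak derivatives $\partial_t\tilde\rho,\nabla\tilde\rho,\partial_t\tilde u,\nabla\tilde u,\nabla^2\tilde u$ are locally integrable functions on $(0,T)\times\Omega$, such that $$\partial_t\tilde\rho+\operatorname{div}(\tilde\rho\tilde u)=0,\qquad \tilde\rho(\partial_t\tilde u+\tilde u\cdot\nabla\tilde u)+\nabla p(\tilde\rho)=\operatorname{div}\mathbb S(\nabla\tilde u)+\tilde\rho f$$ hold a.e. in $(0,T)\times\Omega$, and $\tilde\rho(t)\to\rho_0$, $\tilde u(t)\to u_0$ in $L^1_{\rm loc}(\Omega)$ as $t\to0^+$ (outside a null set of times). **Theorem 4.2.** Let $(\rho,u)$ be a finite energy weak solution with initial data $(\rho_0,u_0)$. Let $(\tilde\rho,\tilde u)$ be a strong solution with the same initial data that satisfies the energy inequality (E) and belongs to the class $$0<\inf_{(0,T)\times\Omega}\tilde\rho\le\tilde\rho\le\sup_{(0,T)\times\Omega}\tilde\rho<\infty,$$ $$\nabla\tilde\rho\in L^2(0,T;L^2\cap L^q(\Omega;\mathbb R^3)),\qquad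 \nabla^2\tilde u\in L^2(0,T;L^2\cap L^q(\Omega;\mathbb R^{3\times3\times3})),\qquad q>\max\Big\{3;\frac{3}{\gamma-1}\Big\}.$$ Then $\rho=\tilde\rho$ and $u=\tilde u$ a.e. in $(0,T)\times\Omega$. -/

import Mathlib

open MeasureTheory Set Filter Topology
open scoped ContDiff NNReal ENNReal

noncomputable section

namespace CNS

/-- Physical space with its Euclidean norm. -/
abbrev E3 : Type := EuclideanSpace ℝ (Fin 3)

/-- The space-time cylinder `(0, T) × Ω`. -/
def cyl (T : ℝ) (Ω : Set E3) : Set (ℝ × E3) := Ioo 0 T ×ˢ Ω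

/-! ### The domain -/

/-- Uniformly Lipschitz boundary: with one radius `r` and one Lipschitz constant `L` for all
boundary points, near each boundary point `Ω` is, after a rigid motion, the part of the ball of
radius `r` that lies strictly above the graph of an `L`-Lipschitz function of two variables. -/
def UniformlyLipschitzBoundary (Ω : Set E3) : Prop :=
  ∃ (r : ℝ) (L : ℝ≥0), 0 < r ∧ ∀ x ∈ frontier Ω,
    ∃ (A : E3 ≃ₗᵢ[ℝ] E3) (g : EuclideanSpace ℝ (Fin 2) → ℝ), LipschitzWith L g ∧
      ∀ y ∈ Metric.ball x r, y ∈ Ω ↔ g !₂[A (y - x) 0, A (y - x) 1] < A (y - x) 2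

/-! ### Constitutive relations -/

/-- `p ∈ C[0,∞) ∩ C²(0,∞)`, `p(0) = 0`, `p' > 0` on `(0,∞)`, and `p'(s) / s^(γ-1)` has a positive
limit as `s → ∞`, for an exponent `γ > 3/2`. -/
structure PressureLaw (p : ℝ → ℝ) (γ : ℝ) : Prop where
  three_halves_lt : 3 / 2 < γ
  continuousOn : ContinuousOn p (Ici 0)
  contDiffOn : ContDiffOn ℝ 2 p (Ioi 0)
  zero : p 0 = 0
  deriv_pos : ∀ s, 0 < s → 0 < deriv p s
  growth : ∃ a : ℝ, 0 < a ∧ Tendsto (fun s : ℝ => deriv p s / s ^ (γ - 1)) atTop (𝓝 a)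

/-- The pressure potential `H(s) = s ∫_{ρbar}^s p(z)/z² dz`. The value at `s = 0` is `0`, which is
the limit of `H` at `0` because `p` is continuous with `p(0) = 0`. -/
def potential (p : ℝ → ℝ) (ρbar s : ℝ) : ℝ := s * ∫ z in ρbar..s, p z / z ^ 2

/-- The energy density `½ s |v|² + H(s) - H'(ρbar) (s - ρbar) - H(ρbar)`. -/
def energyDensity (p : ℝ → ℝ) (ρbar s : ℝ) (v : E3) : ℝ :=
  1 / 2 * s * ‖v‖ ^ 2 + potential p ρbar s
    - deriv (potential p ρbar) ρbar * (s - ρbar) - potential p ρbar ρbar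

/-- The viscous stress `μ (G + Gᵗ - (2/3) (tr G) I) + η (tr G) I`. -/
def stress (μ η : ℝ) (G : Matrix (Fin 3) (Fin 3) ℝ) : Matrix (Fin 3) (Fin 3) ℝ :=
  μ • (G + G.transpose - (2 / 3 * G.trace) • 1) + (η * G.trace) • 1

/-- The contraction `A : B = ∑ A_ij B_ij`. -/
def contract (A B : Matrix (Fin 3) (Fin 3) ℝ) : ℝ := ∑ i, ∑ j, A i j * B i j

/-- The matrix `v ⊗ w`. -/
def tensor (v w : E3) : Matrix (Fin 3) (Fin 3) ℝ := fun i j => v i * w j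

/-! ### Classical derivatives of test functions -/

/-- The gradient matrix `(∇φ)_ij = ∂_j φ_i` of a smooth vector field. -/
def jac (φ : E3 → E3) (x : E3) : Matrix (Fin 3) (Fin 3) ℝ :=
  fun i j => fderiv ℝ φ x (EuclideanSpace.single j 1) i

/-- `φ ∈ C_c^∞([0,T] × closure Ω)`: restrictions of functions in `C_c^∞(ℝ × ℝ³)`. -/
def IsScalarTest (φ : ℝ → E3 → ℝ) : Prop :=
  ContDiff ℝ ∞ (Function.uncurry φ) ∧ HasCompactSupport (Function.uncurry φ)

/-- `φ ∈ C_c^∞([0,T] × Ω; ℝ³)`: restrictions to `[0,T] × Ω` of functions in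
`C_c^∞(ℝ × Ω; ℝ³)`. -/
def IsVectorTest (Ω : Set E3) (φ : ℝ → E3 → E3) : Prop :=
  ContDiff ℝ ∞ (Function.uncurry φ) ∧ HasCompactSupport (Function.uncurry φ) ∧
    tsupport (Function.uncurry φ) ⊆ univ ×ˢ Ω

/-! ### Function spaces -/

section Spaces

variable {F : Type*} [NormedAddCommGroup F]

/-- `g ∈ L^r(0,T; L^s(Ω))`: `g` is measurable on the cylinder and `t ↦ ‖g(t)‖_{L^s(Ω)}` has
finite `L^r(0,T)` norm. -/
def MemLtLx (T : ℝ) (Ω : Set E3) (r s : ℝ≥0∞) (g : ℝ → E3 → F) : Prop :=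
  AEStronglyMeasurable (Function.uncurry g) (volume.restrict (cyl T Ω)) ∧
    eLpNorm (fun t => eLpNorm (g t) s (volume.restrict Ω)) r (volume.restrict (Ioo 0 T)) < ⊤

/-- `g` lies in the ball of radius `C` of `L^r(Ω) + L^s(Ω)`, with an explicit splitting. -/
def SumLpBound (Ω : Set E3) (r s : ℝ≥0∞) (C : ℝ≥0∞) (g : E3 → F) : Prop :=
  ∃ g₁ g₂ : E3 → F, MemLp g₁ r (volume.restrict Ω) ∧ MemLp g₂ s (volume.restrict Ω) ∧
    g =ᵐ[volume.restrict Ω] g₁ + g₂ ∧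
    eLpNorm g₁ r (volume.restrict Ω) + eLpNorm g₂ s (volume.restrict Ω) ≤ C

/-- `g ∈ L^∞(0,T; L^r(Ω) + L^s(Ω))`. -/
def MemLinftySum (T : ℝ) (Ω : Set E3) (r s : ℝ≥0∞) (g : ℝ → E3 → F) : Prop :=
  AEStronglyMeasurable (Function.uncurry g) (volume.restrict (cyl T Ω)) ∧
    ∃ C : ℝ≥0, ∀ᵐ t ∂(volume.restrict (Ioo 0 T)), SumLpBound Ω r s C (g t)

end Spaces

/-- `g ∈ C_weak([0,T]; L^2(Ω) + L^s(Ω))` for a finite exponent `s > 1`: every `g(t)` lies in the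
space, and `t ↦ ∫ g(t) ψ` is continuous on `[0,T]` for every `ψ` in the dual space
`L^2(Ω) ∩ L^{s'}(Ω)`, where `s' = s / (s - 1)`. -/
def WeaklyContinuous (T : ℝ) (Ω : Set E3) (s : ℝ) (g : ℝ → E3 → ℝ) : Prop :=
  (∀ t ∈ Icc 0 T, ∃ C : ℝ≥0, SumLpBound Ω 2 (ENNReal.ofReal s) C (g t)) ∧
    ∀ ψ : E3 → ℝ, MemLp ψ 2 (volume.restrict Ω) →
      MemLp ψ (ENNReal.ofReal (s / (s - 1))) (volume.restrict Ω) →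
      ContinuousOn (fun t => ∫ x in Ω, g t x * ψ x) (Icc 0 T)

/-- `v ∈ D₀^{1,2}(Ω; ℝ³)` with gradient `G`: the completion of `C_c^∞(Ω; ℝ³)` in the norm
`‖∇φ‖_{L²}`, realized inside `L⁶(Ω; ℝ³)` by the Sobolev inequality. -/
def MemD012 (Ω : Set E3) (v : E3 → E3) (G : E3 → Matrix (Fin 3) (Fin 3) ℝ) : Prop :=
  MemLp v 6 (volume.restrict Ω) ∧
  (∀ i j, MemLp (fun x => G x i j) 2 (volume.restrict Ω)) ∧
  ∃ φ : ℕ → E3 → E3,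
    (∀ n, ContDiff ℝ ∞ (φ n) ∧ HasCompactSupport (φ n) ∧ tsupport (φ n) ⊆ Ω) ∧
    Tendsto (fun n => eLpNorm (φ n - v) 6 (volume.restrict Ω)) atTop (𝓝 0) ∧
    ∀ i j, Tendsto (fun n => eLpNorm (fun x => jac (φ n) x i j - G x i j) 2
      (volume.restrict Ω)) atTop (𝓝 0)

/-- `u ∈ L²(0,T; D₀^{1,2}(Ω; ℝ³))` with spatial gradient `Du`. -/
def MemL2D012 (T : ℝ) (Ω : Set E3) (u : ℝ → E3 → E3)
    (Du : ℝ → E3 → Matrix (Fin 3) (Fin 3) ℝ) : Prop :=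
  AEStronglyMeasurable (Function.uncurry u) (volume.restrict (cyl T Ω)) ∧
  (∀ᵐ t ∂(volume.restrict (Ioo 0 T)), MemD012 Ω (u t) (Du t)) ∧
  ∀ i j, MemLtLx T Ω 2 2 (fun t x => Du t x i j)

/-- `g` is the weak derivative of `h` in the space-time direction `e` on `(0,T) × Ω`. -/
def HasWeakDeriv (T : ℝ) (Ω : Set E3) (e : ℝ × E3) (h g : ℝ → E3 → ℝ) : Prop :=
  LocallyIntegrableOn (Function.uncurry h) (cyl T Ω) ∧
  LocallyIntegrableOn (Function.uncurry g) (cyl T Ω) ∧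
  ∀ φ : ℝ × E3 → ℝ, ContDiff ℝ ∞ φ → HasCompactSupport φ → tsupport φ ⊆ cyl T Ω →
    ∫ z in cyl T Ω, h z.1 z.2 * fderiv ℝ φ z e = - ∫ z in cyl T Ω, g z.1 z.2 * φ z

/-- The direction of time. -/
def dirT : ℝ × E3 := (1, 0)

/-- The direction of the `j`-th space coordinate. -/
def dirX (j : Fin 3) : ℝ × E3 := (0, EuclideanSpace.single j 1)

/-! ### Solutions -/

/-- Initial data of finite energy: `ρ₀ ≥ 0` and the energy density of `(ρ₀, u₀)` is integrable. -/
structure FiniteEnergyData (Ω : Set E3) (p : ℝ → ℝ) (ρbar : ℝ)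
    (ρ₀ : E3 → ℝ) (u₀ : E3 → E3) : Prop where
  measurable_density : AEStronglyMeasurable ρ₀ (volume.restrict Ω)
  measurable_velocity : AEStronglyMeasurable u₀ (volume.restrict Ω)
  nonneg : ∀ᵐ x ∂(volume.restrict Ω), 0 ≤ ρ₀ x
  integrable : IntegrableOn (fun x => energyDensity p ρbar (ρ₀ x) (u₀ x)) Ω

/-- The energy inequality: for almost all `τ ∈ (0,T)`,
`E(τ) + ∫₀^τ ∫ S(∇u) : ∇u ≤ E(0) + ∫₀^τ ∫ ρ f · u`, where all the integrals converge. -/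
structure EnergyInequality (T : ℝ) (Ω : Set E3) (μ η : ℝ) (p : ℝ → ℝ) (ρbar : ℝ)
    (f : ℝ → E3 → E3) (ρ₀ : E3 → ℝ) (u₀ : E3 → E3) (ρ : ℝ → E3 → ℝ) (u : ℝ → E3 → E3)
    (Du : ℝ → E3 → Matrix (Fin 3) (Fin 3) ℝ) : Prop where
  integrable_dissipation :
    IntegrableOn (fun z : ℝ × E3 => contract (stress μ η (Du z.1 z.2)) (Du z.1 z.2)) (cyl T Ω)
  integrable_work :
    IntegrableOn (fun z : ℝ × E3 => ρ z.1 z.2 * inner ℝ (f z.1 z.2) (u z.1 z.2)) (cyl T Ω)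
  inequality : ∀ᵐ τ ∂(volume.restrict (Ioo 0 T)),
    IntegrableOn (fun x => energyDensity p ρbar (ρ τ x) (u τ x)) Ω ∧
    (∫ x in Ω, energyDensity p ρbar (ρ τ x) (u τ x))
        + ∫ z in cyl τ Ω, contract (stress μ η (Du z.1 z.2)) (Du z.1 z.2)
      ≤ (∫ x in Ω, energyDensity p ρbar (ρ₀ x) (u₀ x))
        + ∫ z in cyl τ Ω, ρ z.1 z.2 * inner ℝ (f z.1 z.2) (u z.1 z.2)

/-- Finite energy weak solutions, with the spatial gradient `Du` of the velocity displayed. The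
density and the momentum are functions on `(0,T) × Ω` up to null sets; `ρc` and `m` below are their
weakly continuous representatives, which give a meaning to the values at every time. -/
structure IsFEWSWithGradient (T : ℝ) (Ω : Set E3) (μ η : ℝ) (p : ℝ → ℝ) (γ ρbar : ℝ)
    (f : ℝ → E3 → E3) (ρ₀ : E3 → ℝ) (u₀ : E3 → E3) (ρ : ℝ → E3 → ℝ) (u : ℝ → E3 → E3)
    (Du : ℝ → E3 → Matrix (Fin 3) (Fin 3) ℝ) : Prop where
  density_class : MemLinftySum T Ω 2 (ENNReal.ofReal γ) (fun t x => ρ t x - ρbar)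
  density_nonneg : ∀ᵐ z ∂(volume.restrict (cyl T Ω)), 0 ≤ ρ z.1 z.2
  velocity_class : MemL2D012 T Ω u Du
  momentum_class :
    MemLinftySum T Ω 2 (ENNReal.ofReal (2 * γ / (γ + 1))) (fun t x => ρ t x • u t x)
  pressure_class : ∀ K : Set E3, IsCompact K → K ⊆ Ω →
    IntegrableOn (fun z : ℝ × E3 => p (ρ z.1 z.2)) (Ioo 0 T ×ˢ K)
  continuity_eq : ∃ ρc : ℝ → E3 → ℝ,
    WeaklyContinuous T Ω γ (fun t x => ρc t x - ρbar) ∧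
    (∀ᵐ t ∂(volume.restrict (Ioo 0 T)), ρc t =ᵐ[volume.restrict Ω] ρ t) ∧
    ∀ τ ∈ Icc 0 T, ∀ φ : ℝ → E3 → ℝ, IsScalarTest φ →
      (∫ x in Ω, ρc τ x * φ τ x) - ∫ x in Ω, ρ₀ x * φ 0 x
        = ∫ z in cyl τ Ω,
            (ρ z.1 z.2 * deriv (fun t => φ t z.2) z.1
              + ρ z.1 z.2 * fderiv ℝ (φ z.1) z.2 (u z.1 z.2))
  momentum_eq : ∃ m : ℝ → E3 → E3,
    (∀ i, WeaklyContinuous T Ω (2 * γ / (γ + 1)) (fun t x => m t x i)) ∧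
    (∀ᵐ t ∂(volume.restrict (Ioo 0 T)), m t =ᵐ[volume.restrict Ω] fun x => ρ t x • u t x) ∧
    ∀ τ ∈ Icc 0 T, ∀ φ : ℝ → E3 → E3, IsVectorTest Ω φ →
      (∫ x in Ω, inner ℝ (m τ x) (φ τ x)) - ∫ x in Ω, ρ₀ x * inner ℝ (u₀ x) (φ 0 x)
        = ∫ z in cyl τ Ω,
            (ρ z.1 z.2 * inner ℝ (u z.1 z.2) (deriv (fun t => φ t z.2) z.1)
              + ρ z.1 z.2 * contract (tensor (u z.1 z.2) (u z.1 z.2)) (jac (φ z.1) z.2)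
              + p (ρ z.1 z.2) * (jac (φ z.1) z.2).trace
              - contract (stress μ η (Du z.1 z.2)) (jac (φ z.1) z.2)
              + ρ z.1 z.2 * inner ℝ (f z.1 z.2) (φ z.1 z.2))
  energy : EnergyInequality T Ω μ η p ρbar f ρ₀ u₀ ρ u Du

/-- `(ρ, u)` is a finite energy weak solution on `(0,T) × Ω` with no-slip boundary condition, far
field `(ρbar, 0)`, force `f` and initial data `(ρ₀, u₀)`. -/
def IsFiniteEnergyWeakSolution (T : ℝ) (Ω : Set E3) (μ η : ℝ) (p : ℝ → ℝ) (γ ρbar : ℝ)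
    (f : ℝ → E3 → E3) (ρ₀ : E3 → ℝ) (u₀ : E3 → E3) (ρ : ℝ → E3 → ℝ) (u : ℝ → E3 → E3) : Prop :=
  ∃ Du, IsFEWSWithGradient T Ω μ η p γ ρbar f ρ₀ u₀ ρ u Du

/-- The functions `v(t)` attain `v₀` in `L¹_loc(Ω)` as `t → 0+`, up to a null set of times. -/
def AttainsInitially {F : Type*} [NormedAddCommGroup F] (T : ℝ) (Ω : Set E3)
    (v : ℝ → E3 → F) (v₀ : E3 → F) : Prop :=
  ∀ K : Set E3, IsCompact K → K ⊆ Ω →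
    Tendsto (fun t => eLpNorm (v t - v₀) 1 (volume.restrict K))
      (𝓝 0 ⊓ ae (volume.restrict (Ioo 0 T))) (𝓝 0)

/-- Strong solutions that satisfy the energy inequality and belong to the regularity class with
exponent `q`. Here `ρt`, `gρ` are the weak time derivative and the weak gradient of `ρ`, and `ut`,
`Du`, `D2u` the weak time derivative, the weak gradient and the weak second gradient of `u`:
`Du i j = ∂_j u_i` and `D2u i j k = ∂_k ∂_j u_i`. The equations hold almost everywhere. -/
structure IsStrongSolutionWithDerivatives (T : ℝ) (Ω : Set E3) (μ η : ℝ) (p : ℝ → ℝ) (ρbar : ℝ)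
    (f : ℝ → E3 → E3) (q : ℝ) (ρ₀ : E3 → ℝ) (u₀ : E3 → E3) (ρ : ℝ → E3 → ℝ) (u : ℝ → E3 → E3)
    (ρt : ℝ → E3 → ℝ) (gρ : ℝ → E3 → E3) (ut : ℝ → E3 → E3)
    (Du : ℝ → E3 → Matrix (Fin 3) (Fin 3) ℝ)
    (D2u : ℝ → E3 → Fin 3 → Fin 3 → Fin 3 → ℝ) : Prop where
  density_bounds : ∃ c C : ℝ, 0 < c ∧
    ∀ᵐ z ∂(volume.restrict (cyl T Ω)), c ≤ ρ z.1 z.2 ∧ ρ z.1 z.2 ≤ C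
  velocity_class : MemL2D012 T Ω u Du
  density_dt : HasWeakDeriv T Ω dirT ρ ρt
  density_dx : ∀ j, HasWeakDeriv T Ω (dirX j) ρ (fun t x => gρ t x j)
  velocity_dt : ∀ i, HasWeakDeriv T Ω dirT (fun t x => u t x i) (fun t x => ut t x i)
  velocity_dx : ∀ i j,
    HasWeakDeriv T Ω (dirX j) (fun t x => u t x i) (fun t x => Du t x i j)
  velocity_dxx : ∀ i j k,
    HasWeakDeriv T Ω (dirX k) (fun t x => Du t x i j) (fun t x => D2u t x i j k)
  density_reg : MemLtLx T Ω 2 2 gρ ∧ MemLtLx T Ω 2 (ENNReal.ofReal q) gρ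
  velocity_reg : ∀ i j k, MemLtLx T Ω 2 2 (fun t x => D2u t x i j k) ∧
    MemLtLx T Ω 2 (ENNReal.ofReal q) (fun t x => D2u t x i j k)
  /-- `∂_t ρ + div (ρ u) = 0` -/
  continuity_eq : ∀ᵐ z ∂(volume.restrict (cyl T Ω)),
    ρt z.1 z.2 + inner ℝ (u z.1 z.2) (gρ z.1 z.2) + ρ z.1 z.2 * (Du z.1 z.2).trace = 0
  /-- `ρ (∂_t u + u · ∇u) + ∇p(ρ) = div S(∇u) + ρ f` -/
  momentum_eq : ∀ᵐ z ∂(volume.restrict (cyl T Ω)), ∀ i,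
    ρ z.1 z.2 * (ut z.1 z.2 i + ∑ j, u z.1 z.2 j * Du z.1 z.2 i j)
        + deriv p (ρ z.1 z.2) * gρ z.1 z.2 i
      = (∑ j, stress μ η (fun a b => D2u z.1 z.2 a b j) i j) + ρ z.1 z.2 * f z.1 z.2 i
  density_initial : AttainsInitially T Ω ρ ρ₀
  velocity_initial : AttainsInitially T Ω u u₀
  energy : EnergyInequality T Ω μ η p ρbar f ρ₀ u₀ ρ u Du

/-- `(ρ, u)` is a strong solution of the no-slip problem on `(0,T) × Ω` with far field
`(ρbar, 0)`, force `f` and initial data `(ρ₀, u₀)` that satisfies the energy inequality and belongs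
to the regularity class with exponent `q`. -/
def IsStrongSolution (T : ℝ) (Ω : Set E3) (μ η : ℝ) (p : ℝ → ℝ) (ρbar : ℝ)
    (f : ℝ → E3 → E3) (q : ℝ) (ρ₀ : E3 → ℝ) (u₀ : E3 → E3)
    (ρ : ℝ → E3 → ℝ) (u : ℝ → E3 → E3) : Prop :=
  ∃ ρt gρ ut Du D2u,
    IsStrongSolutionWithDerivatives T Ω μ η p ρbar f q ρ₀ u₀ ρ u ρt gρ ut Du D2u

end CNS

end

noncomputable section

namespace CNS

open ENNReal (ofReal HolderTriple toReal_nonneg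
  ofReal_le_ofReal ofReal_one ofReal_toReal ofReal_ne_top
  toReal_mono toReal_le_of_le_ofReal one_le_ofReal)
open Metric (ball closedBall)
open MeasureTheory.Measure (ae_ae_of_ae_prod)
open intervalIntegral (integral_of_le)
open Function (uncurry)

/-- The gradient matrices. -/
notation "M33" => Matrix (Fin 3) (Fin 3) ℝ

variable {α β : Type*} [MeasurableSpace α] [MeasurableSpace β] {lam : Measure α}
  {T γ ρbar c C q μ η b M ε B κ s τ δ L σ : ℝ} {Ω K : Set E3} {p G a G' : ℝ → ℝ} {ν : Measure E3}
  {k ζ v F ρ₀ φ ψ : E3 → ℝ} {u U f gr : ℝ → E3 → E3} {ρ r g h : ℝ → E3 → ℝ} {Du DU : ℝ → E3 → M33}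
  {D2U : ℝ → E3 → Fin 3 → Fin 3 → Fin 3 → ℝ} {u₀ : E3 → E3} {J : Fin 3 → ℝ → E3 → ℝ}

/-- The restriction of the Lebesgue measure to the time interval `(0, T)`. -/
notation:max "dt(" T ")" => Measure.restrict (volume : Measure ℝ) (Ioo 0 T)

/-- The restriction of the Lebesgue measure to a set in space. -/
notation:max "dx(" S ")" => Measure.restrict (volume : Measure E3) S

lemma restrict_le {m : Measure α} {s t : Set α} (h : s ⊆ t) : m.restrict s ≤ m.restrict t :=
  Measure.restrict_mono_set m h

lemma dx_le (h : K ⊆ Ω) : dx(K) ≤ dx(Ω) := restrict_le h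

lemma ae_mem_Ioo : ∀ᵐ t ∂dt(T), t ∈ Ioo 0 T := ae_restrict_mem measurableSet_Ioo

lemma intervalIntegral_eq_Ioo {a : ℝ} (h : a ≤ b) (f : ℝ → ℝ) :
    ∫ t in a..b, f t = ∫ t in Ioo a b, f t := by
  rw [integral_of_le h, integral_Ioc_eq_integral_Ioo]

lemma intervalIntegral_congr_dt {f g : ℝ → ℝ} (hτ : τ ∈ Ioo 0 T) (h : f =ᵐ[dt(T)] g) :
    ∫ t in 0..τ, f t = ∫ t in 0..τ, g t := by
  rw [intervalIntegral_eq_Ioo hτ.1.le, intervalIntegral_eq_Ioo hτ.1.le]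
  exact integral_congr_ae (ae_mono (restrict_le (Ioo_subset_Ioo_right hτ.2.le)) h)

/-! ### The pressure potential -/

/-- The derivative of the pressure potential. -/
def potentialDeriv (p : ℝ → ℝ) (ρbar s : ℝ) : ℝ := (∫ z in ρbar..s, p z / z ^ 2) + p s / s

/-- The relative pressure potential `H(s) - H(r) - H'(r) (s - r)`. -/
def relPot (p : ℝ → ℝ) (ρbar s r : ℝ) : ℝ :=
  potential p ρbar s - potential p ρbar r - potentialDeriv p ρbar r * (s - r)

section Pressure

lemma PressureLaw.differentiableAt (hp : PressureLaw p γ) (hs : 0 < s) :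
    HasDerivAt p (deriv p s) s :=
  ((hp.contDiffOn.differentiableOn (by norm_num)).differentiableAt (Ioi_mem_nhds hs)).hasDerivAt

lemma PressureLaw.contDiffOn_deriv (hp : PressureLaw p γ) : ContDiffOn ℝ 1 (deriv p) (Ioi 0) :=
  ((contDiffOn_succ_iff_deriv_of_isOpen (n := 1) isOpen_Ioi).1
    (by simpa [one_add_one_eq_two] using hp.contDiffOn)).2.2

lemma PressureLaw.hasDerivAt_deriv (hp : PressureLaw p γ) (hs : 0 < s) :
    HasDerivAt (deriv p) (deriv (deriv p) s) s :=
  ((hp.contDiffOn_deriv.differentiableOn (by norm_num)).differentiableAt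
    (Ioi_mem_nhds hs)).hasDerivAt

lemma PressureLaw.continuousOn_deriv (hp : PressureLaw p γ) : ContinuousOn (deriv p) (Ioi 0) :=
  hp.contDiffOn_deriv.continuousOn

lemma PressureLaw.continuousOn_deriv_deriv (hp : PressureLaw p γ) :
    ContinuousOn (deriv (deriv p)) (Ioi 0) :=
  ((contDiffOn_succ_iff_deriv_of_isOpen (n := 0) isOpen_Ioi).1
    (by simpa using hp.contDiffOn_deriv)).2.2.continuousOn

lemma PressureLaw.strictMonoOn (hp : PressureLaw p γ) : StrictMonoOn p (Ici 0) :=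
  strictMonoOn_of_deriv_pos (convex_Ici 0) hp.continuousOn
    (by intro x hx; rw [interior_Ici] at hx; exact hp.deriv_pos x hx)

lemma PressureLaw.nonneg (hp : PressureLaw p γ) (hs : 0 ≤ s) : 0 ≤ p s := by
  have := hp.strictMonoOn.monotoneOn (mem_Ici.2 le_rfl) hs hs
  rwa [hp.zero] at this

lemma PressureLaw.pos (hp : PressureLaw p γ) (hs : 0 < s) : 0 < p s := by
  have := hp.strictMonoOn (mem_Ici.2 le_rfl) hs.le hs
  rwa [hp.zero] at this

lemma PressureLaw.continuousOn_div_sq (hp : PressureLaw p γ) :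
    ContinuousOn (fun z => p z / z ^ 2) (Ioi 0) :=
  (hp.continuousOn.mono Ioi_subset_Ici_self).div (by fun_prop)
    (fun z hz => pow_ne_zero _ (ne_of_gt hz))

lemma PressureLaw.intervalIntegrable_div_sq (hp : PressureLaw p γ) {a : ℝ} (ha : 0 < a)
    (hb : 0 < b) :
    IntervalIntegrable (fun z => p z / z ^ 2) volume a b :=
  (hp.continuousOn_div_sq.mono (fun _ hx => lt_of_lt_of_le (lt_min ha hb) hx.1)).intervalIntegrable

lemma hasDerivAt_potential_integral (hp : PressureLaw p γ) (hρ : 0 < ρbar) (hs : 0 < s) :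
    HasDerivAt (fun s => ∫ z in ρbar..s, p z / z ^ 2) (p s / s ^ 2) s :=
  intervalIntegral.integral_hasDerivAt_right (hp.intervalIntegrable_div_sq hρ hs)
    (hp.continuousOn_div_sq.stronglyMeasurableAtFilter isOpen_Ioi s hs)
    (hp.continuousOn_div_sq.continuousAt (Ioi_mem_nhds hs))

lemma hasDerivAt_potential (hp : PressureLaw p γ) (hρ : 0 < ρbar) (hs : 0 < s) :
    HasDerivAt (potential p ρbar) (potentialDeriv p ρbar s) s := by
  have h := (hasDerivAt_id s).mul (hasDerivAt_potential_integral hp hρ hs)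
  refine h.congr_deriv ?_
  have := hs.ne'
  simp only [potentialDeriv, id]
  field_simp

lemma hasDerivAt_potentialDeriv (hp : PressureLaw p γ) (hρ : 0 < ρbar) (hs : 0 < s) :
    HasDerivAt (potentialDeriv p ρbar) (deriv p s / s) s := by
  have h := (hasDerivAt_potential_integral hp hρ hs).add
    ((hp.differentiableAt hs).div (hasDerivAt_id s) hs.ne')
  refine h.congr_deriv ?_
  have := hs.ne'
  simp only [id]
  field_simp
  ring

lemma mul_potentialDeriv {r : ℝ} (hr : r ≠ 0) :
    r * potentialDeriv p ρbar r = potential p ρbar r + p r := by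
  simp only [potentialDeriv, potential]
  field_simp

lemma energyDensity_eq (hp : PressureLaw p γ) (hρ : 0 < ρbar) (s : ℝ) (v : E3) :
    energyDensity p ρbar s v = 1 / 2 * s * ‖v‖ ^ 2 + relPot p ρbar s ρbar := by
  simp only [energyDensity, relPot, (hasDerivAt_potential hp hρ hρ).deriv]
  ring

lemma exists_slope_eq {f f' : ℝ → ℝ} {a x y : ℝ} (hx : x ∈ Icc a b) (hy : y ∈ Icc a b)
    (hf : ∀ z ∈ Icc a b, HasDerivAt f (f' z) z) (hxy : x < y) :
    ∃ ξ ∈ Ioo x y, f y - f x = f' ξ * (y - x) := by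
  obtain ⟨ξ, hξ, h⟩ := exists_hasDerivAt_eq_slope f f' hxy
    (fun z hz => (hf z ⟨hx.1.trans hz.1, hz.2.trans hy.2⟩).continuousAt.continuousWithinAt)
    (fun z hz => hf z ⟨hx.1.trans hz.1.le, hz.2.le.trans hy.2⟩)
  refine ⟨ξ, hξ, ?_⟩
  rw [h, div_mul_cancel₀ _ (sub_ne_zero.2 hxy.ne')]

lemma nonneg_of_deriv_mul_sub_nonneg {f f' : ℝ → ℝ} {a r : ℝ} (hr : r ∈ Icc a b)
    (hf : ∀ z ∈ Icc a b, HasDerivAt f (f' z) z) (h0 : f r = 0)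
    (h : ∀ z ∈ Icc a b, 0 ≤ f' z * (z - r)) (hs : s ∈ Icc a b) : 0 ≤ f s := by
  rcases lt_trichotomy s r with hsr | rfl | hsr
  · obtain ⟨ξ, hξ, e⟩ := exists_slope_eq hs hr hf hsr
    have h1 := h ξ ⟨hs.1.trans hξ.1.le, hξ.2.le.trans hr.2⟩
    have h2 : f' ξ ≤ 0 := by
      by_contra! h3
      nlinarith [mul_pos h3 (sub_pos.2 hξ.2)]
    nlinarith
  · exact h0.ge
  · obtain ⟨ξ, hξ, e⟩ := exists_slope_eq hr hs hf hsr
    have h1 := h ξ ⟨hr.1.trans hξ.1.le, hξ.2.le.trans hs.2⟩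
    have h2 : 0 ≤ f' ξ := by
      by_contra! h3
      nlinarith [mul_pos (neg_pos.2 h3) (sub_pos.2 hξ.1)]
    nlinarith

lemma mul_sub_sq_le_of_le_deriv2 {f f' f'' : ℝ → ℝ} {a r m : ℝ} (hr : r ∈ Icc a b)
    (hf : ∀ z ∈ Icc a b, HasDerivAt f (f' z) z) (hf' : ∀ z ∈ Icc a b, HasDerivAt f' (f'' z) z)
    (h0 : f r = 0) (h1 : f' r = 0) (hm : ∀ z ∈ Icc a b, m ≤ f'' z) (hs : s ∈ Icc a b) :
    m / 2 * (s - r) ^ 2 ≤ f s := by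
  have key : ∀ z ∈ Icc a b, 0 ≤ (f' z - m * (z - r)) * (z - r) := by
    intro z hz
    have hd : ∀ x ∈ Icc a b, HasDerivAt (fun x => f' x - m * (x - r)) (f'' x - m) x := by
      intro x hx
      exact ((hf' x hx).sub (((hasDerivAt_id x).sub_const r).const_mul m)).congr_deriv (by simp)
    rcases lt_trichotomy z r with hzr | rfl | hzr
    · obtain ⟨ξ, hξ, e⟩ := exists_slope_eq hz hr hd hzr
      have := hm ξ ⟨hz.1.trans hξ.1.le, hξ.2.le.trans hr.2⟩
      simp only [h1, sub_self, mul_zero] at e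
      have h3 : f' z - m * (z - r) = (f'' ξ - m) * (z - r) := by linarith
      rw [h3, mul_assoc]
      exact mul_nonneg (by linarith) (mul_self_nonneg _)
    · simp
    · obtain ⟨ξ, hξ, e⟩ := exists_slope_eq hr hz hd hzr
      have := hm ξ ⟨hr.1.trans hξ.1.le, hξ.2.le.trans hz.2⟩
      simp only [h1, sub_self, mul_zero, sub_zero] at e
      rw [e, mul_assoc]
      exact mul_nonneg (by linarith) (mul_self_nonneg _)
  have := nonneg_of_deriv_mul_sub_nonneg (f := fun z => f z - m / 2 * (z - r) ^ 2)
    (f' := fun z => f' z - m * (z - r)) hr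
    (fun z hz => by
      refine ((hf z hz).sub ((((hasDerivAt_id z).sub_const r).pow 2).const_mul (m / 2))).congr_deriv
        ?_
      simp; ring) (by simp [h0]) key hs
  linarith

lemma abs_le_mul_sub_sq_of_abs_deriv2_le {f f' f'' : ℝ → ℝ} {a r : ℝ} (hr : r ∈ Icc a b)
    (hf : ∀ z ∈ Icc a b, HasDerivAt f (f' z) z) (hf' : ∀ z ∈ Icc a b, HasDerivAt f' (f'' z) z)
    (h0 : f r = 0) (h1 : f' r = 0) (hM : ∀ z ∈ Icc a b, |f'' z| ≤ M) (hs : s ∈ Icc a b) :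
    |f s| ≤ M / 2 * (s - r) ^ 2 := by
  have h2 := mul_sub_sq_le_of_le_deriv2 (m := -M) hr hf hf' h0 h1
    (fun z hz => (abs_le.1 (hM z hz)).1) hs
  have h3 := mul_sub_sq_le_of_le_deriv2 (f := fun z => - f z) (f' := fun z => - f' z)
    (f'' := fun z => - f'' z) (m := -M) hr (fun z hz => (hf z hz).neg)
    (fun z hz => (hf' z hz).neg) (by simp [h0]) (by simp [h1])
    (fun z hz => by simpa using (abs_le.1 (hM z hz)).2) hs
  rw [abs_le]
  constructor <;> linarith

lemma hasDerivAt_relPot (hp : PressureLaw p γ) (hρ : 0 < ρbar) (r : ℝ) (hs : 0 < s) :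
    HasDerivAt (fun s => relPot p ρbar s r) (potentialDeriv p ρbar s - potentialDeriv p ρbar r)
      s := by
  exact (((hasDerivAt_potential hp hρ hs).sub_const _).sub
    (((hasDerivAt_id s).sub_const r).const_mul (potentialDeriv p ρbar r))).congr_deriv (by simp)

lemma potentialDeriv_monotoneOn (hp : PressureLaw p γ) (hρ : 0 < ρbar) :
    MonotoneOn (potentialDeriv p ρbar) (Ioi 0) := by
  intro x hx y hy hxy
  rcases hxy.eq_or_lt with rfl | hlt
  · exact le_rfl
  obtain ⟨ξ, hξ, e⟩ := exists_slope_eq (left_mem_Icc.2 hxy) (right_mem_Icc.2 hxy)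
    (fun z hz => hasDerivAt_potentialDeriv hp hρ (lt_of_lt_of_le hx hz.1)) hlt
  have hξ0 : 0 < ξ := lt_trans hx hξ.1
  have := mul_pos (div_pos (hp.deriv_pos ξ hξ0) hξ0) (sub_pos.2 hlt)
  linarith

lemma relPot_zero_left {r : ℝ} (hr : 0 < r) : relPot p ρbar 0 r = p r := by
  have := mul_potentialDeriv (p := p) (ρbar := ρbar) hr.ne'
  simp only [relPot, potential, zero_mul] at *
  linarith

lemma relPot_self (r : ℝ) : relPot p ρbar r r = 0 := by simp [relPot]

lemma relPot_nonneg (hp : PressureLaw p γ) (hρ : 0 < ρbar) {r : ℝ} (hs : 0 ≤ s) (hr : 0 < r) :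
    0 ≤ relPot p ρbar s r := by
  rcases hs.eq_or_lt with rfl | hs
  · rw [relPot_zero_left hr]; exact hp.nonneg hr.le
  refine nonneg_of_deriv_mul_sub_nonneg (f := fun s => relPot p ρbar s r) (a := min s r)
    (b := max s r) ⟨min_le_right _ _, le_max_right _ _⟩
    (fun z hz => hasDerivAt_relPot hp hρ r (lt_of_lt_of_le (lt_min hs hr) hz.1)) (relPot_self r)
    (fun z hz => ?_) ⟨min_le_left _ _, le_max_left _ _⟩
  have hz0 : 0 < z := lt_of_lt_of_le (lt_min hs hr) hz.1
  rcases le_total z r with h | h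
  · exact mul_nonneg_of_nonpos_of_nonpos
      (sub_nonpos.2 (potentialDeriv_monotoneOn hp hρ hz0 hr h)) (sub_nonpos.2 h)
  · exact mul_nonneg (sub_nonneg.2 (potentialDeriv_monotoneOn hp hρ hr hz0 h)) (sub_nonneg.2 h)

lemma relPot_antitone (hp : PressureLaw p γ) (hρ : 0 < ρbar) {s' r : ℝ} (hs : 0 ≤ s) (hss : s ≤ s')
    (hr : s' < r) : relPot p ρbar s' r ≤ relPot p ρbar s r := by
  rcases hs.eq_or_lt with rfl | hs
  · -- `H(s') - H'(r) s' ≤ 0` on `[0, r]`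
    have hr0 : 0 < r := lt_of_le_of_lt hss hr
    rcases hss.eq_or_lt with rfl | hs'
    · exact le_rfl
    have h1 : (∫ z in ρbar..s', p z / z ^ 2) ≤ ∫ z in ρbar..r, p z / z ^ 2 := by
      rw [← sub_nonneg, intervalIntegral.integral_interval_sub_left
        (hp.intervalIntegrable_div_sq hρ hr0) (hp.intervalIntegrable_div_sq hρ hs')]
      exact intervalIntegral.integral_nonneg hr.le
        (fun z hz => div_nonneg (hp.nonneg (hs'.le.trans hz.1)) (sq_nonneg z))
    have h2 := mul_nonneg hs'.le (div_nonneg (hp.nonneg hr0.le) hr0.le)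
    have h3 := mul_le_mul_of_nonneg_left h1 hs'.le
    simp only [relPot, potential, potentialDeriv, zero_mul]
    nlinarith
  · rcases hss.eq_or_lt with rfl | hlt
    · exact le_rfl
    have hr0 : 0 < r := by linarith
    obtain ⟨ξ, hξ, e⟩ := exists_slope_eq (left_mem_Icc.2 hss) (right_mem_Icc.2 hss)
      (fun z hz => hasDerivAt_relPot hp hρ r (lt_of_lt_of_le hs hz.1)) hlt
    have hξ0 : 0 < ξ := lt_trans hs hξ.1
    have := potentialDeriv_monotoneOn hp hρ hξ0 hr0 (hξ.2.le.trans hr.le)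
    nlinarith

lemma PressureLaw.exists_growth (hp : PressureLaw p γ) : ∃ a Z : ℝ, 0 < a ∧ 1 ≤ Z ∧
    ∀ s, Z ≤ s → a * s ^ (γ - 1) ≤ deriv p s ∧ deriv p s ≤ 4 * a * s ^ (γ - 1) := by
  obtain ⟨a, ha, h⟩ := hp.growth
  obtain ⟨Z, hZ⟩ := eventually_atTop.1
    (h.eventually (Icc_mem_nhds (show a / 2 < a by linarith) (show a < 2 * a by linarith)))
  refine ⟨a / 2, max Z 1, by linarith, le_max_right _ _, fun s hs => ?_⟩
  have hs0 : 0 < s := lt_of_lt_of_le one_pos ((le_max_right _ _).trans hs)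
  have hpos : 0 < s ^ (γ - 1) := Real.rpow_pos_of_pos hs0 _
  have := hZ s ((le_max_left _ _).trans hs)
  rw [le_div_iff₀ hpos, div_le_iff₀ hpos] at this
  constructor <;> linarith [this.1, this.2]

/-- Superlinear lower bound of the relative potential for large densities. -/
lemma exists_relPot_lower (hp : PressureLaw p γ) (hρ : 0 < ρbar) (C : ℝ) :
    ∃ B κ : ℝ, 0 < κ ∧ 1 ≤ B ∧ C < B ∧ ∀ r, 0 < r → r ≤ C → ∀ s, B ≤ s →
      κ * s ^ γ ≤ relPot p ρbar s r := by
  obtain ⟨a, Z, ha, hZ, hg⟩ := hp.exists_growth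
  have hγ := hp.three_halves_lt
  set Y := max Z C with hY
  have hY1 : 1 ≤ Y := hZ.trans (le_max_left _ _)
  refine ⟨4 * Y, a / (4 * 4 ^ (γ - 1)), by positivity, by linarith,
    by linarith [le_max_right Z C], fun r hr hrC s hs => ?_⟩
  have hs0 : 0 < s := by linarith
  have key : ∀ ξ ∈ Icc (s / 2) s, a / 2 * (s / 4) ^ (γ - 1)
      ≤ potentialDeriv p ρbar ξ - potentialDeriv p ρbar r := by
    intro ξ hξ
    have hξ0 : 0 < ξ := by linarith [hξ.1]
    obtain ⟨ζ, hζ, e⟩ := exists_slope_eq (f := potentialDeriv p ρbar) (a := ξ / 2) (b := ξ)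
      (left_mem_Icc.2 (by linarith)) (right_mem_Icc.2 (by linarith))
      (fun z hz => hasDerivAt_potentialDeriv hp hρ (by linarith [hz.1])) (by linarith)
    have hζ0 : 0 < ζ := by linarith [hζ.1]
    have h1 : a * (s / 4) ^ (γ - 1) ≤ deriv p ζ := by
      refine le_trans ?_ (hg ζ (by linarith [hζ.1, hξ.1, le_max_left Z C])).1
      gcongr
      · linarith
      · linarith [hζ.1, hξ.1]
    have h2 : potentialDeriv p ρbar r ≤ potentialDeriv p ρbar (ξ / 2) :=
      potentialDeriv_monotoneOn hp hρ hr (show 0 < ξ / 2 by linarith)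
        (by linarith [hξ.1, le_max_right Z C])
    have h3 : deriv p ζ / 2 ≤ deriv p ζ / ζ * (ξ - ξ / 2) := by
      rw [div_mul_eq_mul_div, le_div_iff₀ hζ0]
      nlinarith [hp.deriv_pos ζ hζ0, hζ.2]
    linarith
  obtain ⟨ξ, hξ, e⟩ := exists_slope_eq (f := fun s => relPot p ρbar s r) (a := s / 2) (b := s)
    (left_mem_Icc.2 (by linarith)) (right_mem_Icc.2 (by linarith))
    (fun z hz => hasDerivAt_relPot hp hρ r (by linarith [hz.1])) (by linarith)
  have h0 := relPot_nonneg hp hρ (show 0 ≤ s / 2 by linarith) hr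
  have h1 := key ξ ⟨hξ.1.le, hξ.2.le⟩
  have h2 : a / (4 * 4 ^ (γ - 1)) * s ^ γ = a / 2 * (s / 4) ^ (γ - 1) * (s / 2) := by
    have : s ^ γ = s ^ (γ - 1) * s := by
      rw [Real.rpow_sub_one hs0.ne', div_mul_cancel₀ _ hs0.ne']
    rw [Real.div_rpow hs0.le (by norm_num), this]
    field_simp
    ring
  have h3 := mul_le_mul_of_nonneg_right h1 (show 0 ≤ s / 2 by linarith)
  rw [h2]
  have e' : relPot p ρbar s r - relPot p ρbar (s / 2) r
      = (potentialDeriv p ρbar ξ - potentialDeriv p ρbar r) * (s / 2) := by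
    rw [e]; ring
  linarith

lemma exists_pressure_upper (hp : PressureLaw p γ) (B : ℝ) (hB : 1 ≤ B) :
    ∃ M : ℝ, 0 < M ∧ ∀ s, B ≤ s → p s ≤ M * s ^ γ := by
  obtain ⟨a, Z, ha, hZ, hg⟩ := hp.exists_growth
  have hγ := hp.three_halves_lt
  refine ⟨p Z + 4 * a, by linarith [hp.pos (show 0 < Z by linarith)], fun s hs => ?_⟩
  have hs0 : 0 < s := by linarith
  have h1 : 1 ≤ s ^ γ := Real.one_le_rpow (by linarith) (by linarith)
  have hpZ : 0 ≤ p Z := hp.nonneg (by linarith)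
  rcases le_or_gt s Z with h | h
  · have := hp.strictMonoOn.monotoneOn hs0.le (show (0 : ℝ) ≤ Z by linarith) h
    nlinarith
  · obtain ⟨ξ, hξ, e⟩ := exists_slope_eq (f := p) (left_mem_Icc.2 h.le) (right_mem_Icc.2 h.le)
      (fun z hz => hp.differentiableAt (by linarith [hz.1])) h
    have h2 := (hg ξ hξ.1.le).2
    have h3 : ξ ^ (γ - 1) ≤ s ^ (γ - 1) :=
      Real.rpow_le_rpow (by linarith [hξ.1]) hξ.2.le (by linarith)
    have h4 : s ^ γ = s ^ (γ - 1) * s := by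
      rw [Real.rpow_sub_one hs0.ne', div_mul_cancel₀ _ hs0.ne']
    have h5 : 0 < s ^ (γ - 1) := Real.rpow_pos_of_pos hs0 _
    have h6 : deriv p ξ * (s - Z) ≤ 4 * a * s ^ (γ - 1) * s := by
      apply mul_le_mul _ (by linarith) (by linarith) (by positivity)
      nlinarith
    nlinarith

/-- The function of the density `s` that measures the distance to the reference density `r`. -/
def devEnergy (γ B s r : ℝ) : ℝ := if s ≤ B then (s - r) ^ 2 else s ^ γ

lemma devEnergy_le (hs : 0 ≤ s) (r r' : ℝ) :
    devEnergy γ B s r ≤ 2 * (devEnergy γ B s r' + (r - r') * (r - r')) := by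
  unfold devEnergy
  split_ifs
  · nlinarith [sq_nonneg (s - r' + (r - r'))]
  · have := Real.rpow_nonneg hs γ
    nlinarith [mul_self_nonneg (r - r')]

/-- The bounds of the pressure and of the relative potential, uniform for reference densities in a
compact subinterval of `(0, ∞)`. -/
structure RelPotBounds (p : ℝ → ℝ) (γ ρbar c C B κ K : ℝ) : Prop where
  κ_pos : 0 < κ
  one_le : 1 ≤ B
  lt : C < B
  K_pos : 0 < K
  lower : ∀ r ∈ Icc c C, ∀ s, 0 ≤ s → devEnergy γ B s r ≤ κ⁻¹ * relPot p ρbar s r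
  remainder : ∀ r ∈ Icc c C, ∀ s, 0 ≤ s →
    |p s - p r - deriv p r * (s - r)| ≤ K * devEnergy γ B s r

lemma exists_relPotBounds (hp : PressureLaw p γ) (hρ : 0 < ρbar) (hc : 0 < c) (hcC : c ≤ C) :
    ∃ B κ K : ℝ, RelPotBounds p γ ρbar c C B κ K := by
  obtain ⟨B, κ₁, hκ₁, hB1, hCB, hlow⟩ := exists_relPot_lower hp hρ C
  obtain ⟨P, hP0, hP⟩ := exists_pressure_upper hp B hB1
  have hγ := hp.three_halves_lt
  have hI : ∀ z ∈ Icc (c / 2) B, 0 < z := fun z hz => by linarith [hz.1]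
  have hcI : Icc c C ⊆ Icc (c / 2) B := Icc_subset_Icc (by linarith) hCB.le
  obtain ⟨z, hz, hmin⟩ := isCompact_Icc.exists_isMinOn ⟨c, hcI ⟨le_rfl, hcC⟩⟩
    ((hp.continuousOn_deriv.mono hI).div continuousOn_id fun z hz => (hI z hz).ne')
  set m := deriv p z / z
  have hm : 0 < m := div_pos (hp.deriv_pos _ (hI z hz)) (hI z hz)
  obtain ⟨D, hD⟩ := isCompact_Icc.exists_bound_of_continuousOn (hp.continuousOn_deriv_deriv.mono hI)
  have hD0 : 0 ≤ D := (norm_nonneg _).trans (hD z hz)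
  obtain ⟨D₁, hD₁⟩ := isCompact_Icc.exists_bound_of_continuousOn (hp.continuousOn_deriv.mono hI)
  have hD₁0 : 0 ≤ D₁ := (norm_nonneg _).trans (hD₁ z hz)
  have hquad : ∀ r ∈ Icc c C, ∀ s ∈ Icc (c / 2) B, m / 2 * (s - r) ^ 2 ≤ relPot p ρbar s r :=
    fun r hr s hs => mul_sub_sq_le_of_le_deriv2 (hcI hr)
      (fun z hz => hasDerivAt_relPot hp hρ r (hI z hz))
      (fun z hz => (hasDerivAt_potentialDeriv hp hρ (hI z hz)).sub_const _) (relPot_self r)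
      (sub_self _) (fun z hz => hmin hz) hs
  have hpC : 0 < p C := hp.pos (by linarith)
  have hK : 0 ≤ 4 * (p C + D₁ * C) / c ^ 2 := by have := hc.le.trans hcC; positivity
  refine ⟨B, min κ₁ (m / 8), 4 * (p C + D₁ * C) / c ^ 2 + D + (P + D₁), by positivity, hB1, hCB,
    by linarith, fun r hr s hs => ?_, fun r hr s hs => ?_⟩
  · have h0 : 0 < min κ₁ (m / 8) := by positivity
    rw [inv_mul_eq_div, le_div_iff₀ h0]
    unfold devEnergy
    split_ifs with hsB
    · refine (mul_le_mul_of_nonneg_left (min_le_right _ _) (sq_nonneg _)).trans ?_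
      rcases le_or_gt s (c / 2) with h | h
      · refine le_trans ?_ (relPot_antitone hp hρ hs h (by linarith [hr.1]))
        refine le_trans ?_ (hquad r hr (c / 2) ⟨le_rfl, by linarith [hr.1, hr.2]⟩)
        have : (s - r) ^ 2 ≤ 4 * (c / 2 - r) ^ 2 := by nlinarith [hr.1]
        nlinarith
      · linarith [hquad r hr s ⟨h.le, hsB⟩, mul_nonneg hm.le (sq_nonneg (s - r))]
    · refine (mul_le_mul_of_nonneg_left (min_le_left _ _) (Real.rpow_nonneg hs γ)).trans ?_
      rw [mul_comm]
      exact hlow r (by linarith [hr.1]) hr.2 s (not_le.1 hsB).le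
  · have hr0 : 0 < r := by linarith [hr.1]
    have hd := (le_abs_self _).trans (hD₁ r (hcI hr))
    have hdr := hp.deriv_pos r hr0
    have hpr := hp.pos hr0
    have hmono : ∀ {x y}, 0 ≤ x → x ≤ y → p x ≤ p y := fun hx hxy =>
      hp.strictMonoOn.monotoneOn hx (hx.trans hxy) hxy
    rw [add_mul]
    unfold devEnergy
    split_ifs with hsB
    · have h2 := sq_nonneg (s - r)
      have h3 : 0 ≤ (P + D₁) * (s - r) ^ 2 := by positivity
      rcases le_or_gt s (c / 2) with h | h
      · have h1 : |p s - p r - deriv p r * (s - r)| ≤ p C + D₁ * C := by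
          have h4 : deriv p r * (r - s) ≤ D₁ * C :=
            mul_le_mul hd (by linarith [hr.2]) (by linarith [hr.1]) hD₁0
          have h5 := mul_nonneg hdr.le (by linarith [hr.1] : 0 ≤ r - s)
          rw [abs_le]
          constructor <;> linarith [hp.nonneg hs, hmono hr0.le hr.2,
            hmono hs (by linarith [hr.1] : s ≤ r)]
        have h4 : c ^ 2 ≤ 4 * (s - r) ^ 2 := by nlinarith [hr.1]
        have h5 : p C + D₁ * C ≤ 4 * (p C + D₁ * C) / c ^ 2 * (s - r) ^ 2 := by
          rw [div_mul_eq_mul_div, le_div_iff₀ (by positivity)]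
          nlinarith [(abs_nonneg _).trans h1]
        linarith [mul_nonneg hD0 h2, add_mul (4 * (p C + D₁ * C) / c ^ 2) D ((s - r) ^ 2)]
      · have h1 := abs_le_mul_sub_sq_of_abs_deriv2_le
          (f := fun s => p s - p r - deriv p r * (s - r))
          (f' := fun s => deriv p s - deriv p r) (hcI hr)
          (fun z hz => (((hp.differentiableAt (hI z hz)).sub_const _).sub
            (((hasDerivAt_id z).sub_const r).const_mul (deriv p r))).congr_deriv (by simp))
          (fun z hz => (hp.hasDerivAt_deriv (hI z hz)).sub_const _) (by simp) (by simp) hD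
          ⟨h.le, hsB⟩
        linarith [mul_nonneg hK h2, mul_nonneg hD0 h2,
          add_mul (4 * (p C + D₁ * C) / c ^ 2) D ((s - r) ^ 2)]
    · have hsB := (not_le.1 hsB).le
      have h3 := hP s hsB
      have h4 : 0 ≤ deriv p r * (s - r) := mul_nonneg hdr.le (by linarith [hr.2])
      have h5 : deriv p r * (s - r) ≤ D₁ * s ^ γ := mul_le_mul hd
        (by linarith [Real.self_le_rpow_of_one_le (hB1.trans hsB) (by linarith : 1 ≤ γ)])
        (by linarith [hr.2]) hD₁0
      have h6 := hmono hr0.le (by linarith [hr.2] : r ≤ s)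
      have h7 := Real.rpow_nonneg hs γ
      refine le_trans ?_ (le_add_of_nonneg_left (a := (P + D₁) * s ^ γ) (b := (_ + D) * s ^ γ)
        (mul_nonneg (add_nonneg hK hD0) h7))
      rw [abs_le, add_mul]
      constructor <;> linarith

end Pressure

/-! ### Mixed Lebesgue norms -/

section Mix

variable {ν : Measure β} {r r₁ r₂ r₃ s s₁ s₂ s₃ : ℝ≥0∞} {g g₁ g₂ h : α → β → ℝ}

lemma measurable_eLpNorm_prod {F : Type*} [NormedAddCommGroup F] [SFinite ν]
    {g : α × β → F} (hg : StronglyMeasurable g) (s : ℝ≥0∞) :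
    Measurable (fun t => eLpNorm (fun y => g (t, y)) s ν) := by
  rcases eq_or_ne s 0 with rfl | hs0
  · simp
  rcases eq_or_ne s ⊤ with rfl | hst
  · refine measurable_of_Iic fun c => ?_
    have : (fun t => eLpNorm (fun y => g (t, y)) ⊤ ν) ⁻¹' Iic c
        = (fun t => ν (Prod.mk t ⁻¹' {z | c < ‖g z‖ₑ})) ⁻¹' {0} := by
      ext t
      simp only [mem_preimage, mem_Iic, eLpNorm_exponent_top, mem_singleton_iff]
      constructor
      · intro h
        have h1 := ae_le_eLpNormEssSup (f := fun y => g (t, y)) (μ := ν)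
        rw [← nonpos_iff_eq_zero, ← (show ν {y | ¬ ‖g (t, y)‖ₑ ≤ eLpNormEssSup
          (fun y => g (t, y)) ν} = 0 from h1)]
        exact measure_mono fun y hy => not_le.2 (lt_of_le_of_lt h hy)
      · intro h
        refine eLpNormEssSup_le_of_ae_enorm_bound ?_
        rw [ae_iff]
        simpa [not_le] using h
    rw [this]
    exact (measurable_measure_prodMk_left (ν := ν) (measurableSet_lt measurable_const hg.enorm))
      (measurableSet_singleton 0)
  · simp only [eLpNorm_eq_lintegral_rpow_enorm_toReal hs0 hst]
    exact (Measurable.lintegral_prod_right' (ν := ν) (hg.enorm.pow_const s.toReal)).pow_const _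

lemma aemeasurable_eLpNorm_prod {F : Type*} [NormedAddCommGroup F] [SFinite ν]
    {g : α × β → F} (hg : AEStronglyMeasurable g (lam.prod ν)) (s : ℝ≥0∞) :
    AEMeasurable (fun t => eLpNorm (fun y => g (t, y)) s ν) lam := by
  refine ⟨_, measurable_eLpNorm_prod (ν := ν) hg.stronglyMeasurable_mk s, ?_⟩
  filter_upwards [ae_ae_of_ae_prod hg.ae_eq_mk] with t ht
  exact eLpNorm_congr_ae ht

/-- `g ∈ L^r(lam; L^s(ν))` for scalar functions of two variables. -/
structure Mix (lam : Measure α) (ν : Measure β) (r s : ℝ≥0∞) (g : α → β → ℝ) : Prop where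
  meas : AEStronglyMeasurable (uncurry g) (lam.prod ν)
  memLp : ∀ᵐ t ∂lam, MemLp (g t) s ν
  norm : MemLp (fun t => (eLpNorm (g t) s ν).toReal) r lam

lemma aestronglyMeasurable_toReal_eLpNorm [SFinite ν]
    (hg : AEStronglyMeasurable (uncurry g) (lam.prod ν)) :
    AEStronglyMeasurable (fun t => (eLpNorm (g t) s ν).toReal) lam :=
  (aemeasurable_eLpNorm_prod hg s).ennreal_toReal.aestronglyMeasurable

lemma Mix.of_bound [SFinite ν] {N : α → ℝ}
    (hg : AEStronglyMeasurable (uncurry g) (lam.prod ν)) (hN : MemLp N r lam)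
    (h : ∀ᵐ t ∂lam, eLpNorm (g t) s ν ≤ ofReal (N t)) : Mix lam ν r s g := by
  refine ⟨hg, ?_, hN.mono (aestronglyMeasurable_toReal_eLpNorm hg) ?_⟩
  · filter_upwards [h, hg.prodMk_left] with t ht ht'
    exact ⟨ht', ht.trans_lt ENNReal.ofReal_lt_top⟩
  · filter_upwards [h] with t ht
    rw [Real.norm_of_nonneg toReal_nonneg]
    refine (toReal_mono ofReal_ne_top ht).trans ?_
    rw [ENNReal.toReal_ofReal', Real.norm_eq_abs]
    exact max_le (le_abs_self _) (abs_nonneg _)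

lemma Mix.of_eLpNorm [SFinite ν] (hg : AEStronglyMeasurable (uncurry g) (lam.prod ν))
    (hr : r ≠ 0) (h : eLpNorm (fun t => eLpNorm (g t) s ν) r lam < ⊤) : Mix lam ν r s g := by
  have hae : ∀ᵐ t ∂lam, eLpNorm (g t) s ν < ⊤ := by
    have hm := aemeasurable_eLpNorm_prod hg s
    rcases eq_or_ne r ⊤ with rfl | hrt
    · rw [eLpNorm_exponent_top] at h
      filter_upwards [ae_le_eLpNormEssSup (f := fun t => eLpNorm (g t) s ν) (μ := lam)] with t ht
      exact lt_of_le_of_lt ht h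
    · rw [eLpNorm_eq_lintegral_rpow_enorm_toReal hr hrt] at h
      have h1 : ∫⁻ t, ‖eLpNorm (g t) s ν‖ₑ ^ r.toReal ∂lam < ⊤ := by
        by_contra h2
        rw [not_lt, top_le_iff] at h2
        rw [h2, ENNReal.top_rpow_of_pos (one_div_pos.2 (ENNReal.toReal_pos hr hrt))] at h
        exact lt_irrefl _ h
      filter_upwards [ae_lt_top' (hm.enorm.pow_const _) h1.ne] with t ht
      by_contra h2
      rw [not_lt, top_le_iff] at h2
      simp [h2, ENNReal.toReal_pos hr hrt] at ht
  refine ⟨hg, ?_, aestronglyMeasurable_toReal_eLpNorm hg, ?_⟩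
  · filter_upwards [hae, hg.prodMk_left] with t ht ht'
    exact ⟨ht', ht⟩
  · refine lt_of_le_of_lt (eLpNorm_mono_enorm_ae ?_) h
    filter_upwards [hae] with t ht
    rw [Real.enorm_of_nonneg toReal_nonneg, ofReal_toReal ht.ne]
    simp

lemma Mix.mono_ae [SFinite ν] (hh : Mix lam ν r s h)
    (hg : AEStronglyMeasurable (uncurry g) (lam.prod ν))
    (hle : ∀ᵐ t ∂lam, ∀ᵐ y ∂ν, |g t y| ≤ |h t y|) : Mix lam ν r s g := by
  refine Mix.of_bound hg hh.norm ?_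
  filter_upwards [hle, hh.memLp] with t ht ht'
  rw [ofReal_toReal ht'.2.ne]
  exact eLpNorm_mono_ae ht

lemma Mix.congr [SFinite ν] (hh : Mix lam ν r s h)
    (hle : uncurry g =ᵐ[lam.prod ν] uncurry h) : Mix lam ν r s g := by
  refine hh.mono_ae (hh.meas.congr hle.symm) ?_
  filter_upwards [ae_ae_of_ae_prod hle] with t ht
  filter_upwards [ht] with y hy
  exact le_of_eq (congrArg abs hy)

lemma Mix.mul [SFinite ν] [HolderTriple r₁ r₂ r₃] [HolderTriple s₁ s₂ s₃]
    (h₁ : Mix lam ν r₁ s₁ g₁) (h₂ : Mix lam ν r₂ s₂ g₂) :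
    Mix lam ν r₃ s₃ (fun t y => g₁ t y * g₂ t y) := by
  have hN : MemLp ((fun t => (eLpNorm (g₁ t) s₁ ν).toReal)
      * fun t => (eLpNorm (g₂ t) s₂ ν).toReal) r₃ lam := h₂.norm.mul h₁.norm
  refine Mix.of_bound (h₁.meas.mul h₂.meas) hN ?_
  filter_upwards [h₁.memLp, h₂.memLp] with t ht₁ ht₂
  simp only [Pi.mul_apply]
  rw [ENNReal.ofReal_mul toReal_nonneg, ofReal_toReal ht₁.2.ne, ofReal_toReal ht₂.2.ne]
  have h := eLpNorm_smul_le_mul_eLpNorm (p := s₁) (q := s₂) (r := s₃) ht₂.1 ht₁.1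
  exact h

lemma Mix.const_mul [SFinite ν] (c : ℝ) (h₁ : Mix lam ν r s g) :
    Mix lam ν r s (fun t y => c * g t y) := by
  refine Mix.of_bound (N := fun t => |c| * (eLpNorm (g t) s ν).toReal)
    (h₁.meas.const_mul c) (h₁.norm.const_mul |c|) ?_
  filter_upwards [h₁.memLp] with t ht
  rw [ENNReal.ofReal_mul (abs_nonneg _), ofReal_toReal ht.2.ne]
  have := eLpNorm_const_smul_le (c := c) (f := g t) (p := s) (μ := ν)
  refine this.trans (le_of_eq ?_)
  rw [Real.enorm_eq_ofReal_abs]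

lemma Mix.neg [SFinite ν] (h₁ : Mix lam ν r s g) : Mix lam ν r s (fun t y => - g t y) :=
  h₁.mono_ae h₁.meas.neg (.of_forall fun t => .of_forall fun y => by simp)

lemma Mix.add [SFinite ν] (hs : 1 ≤ s) (h₁ : Mix lam ν r s g₁) (h₂ : Mix lam ν r s g₂) :
    Mix lam ν r s (fun t y => g₁ t y + g₂ t y) := by
  refine Mix.of_bound (h₁.meas.add h₂.meas) (h₁.norm.add h₂.norm) ?_
  filter_upwards [h₁.memLp, h₂.memLp] with t ht₁ ht₂
  simp only [Pi.add_apply]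
  rw [ENNReal.ofReal_add toReal_nonneg toReal_nonneg,
    ofReal_toReal ht₁.2.ne, ofReal_toReal ht₂.2.ne]
  exact eLpNorm_add_le ht₁.1 ht₂.1 hs

lemma Mix.sub [SFinite ν] (hs : 1 ≤ s) (h₁ : Mix lam ν r s g₁) (h₂ : Mix lam ν r s g₂) :
    Mix lam ν r s (fun t y => g₁ t y - g₂ t y) := by
  simpa only [sub_eq_add_neg] using h₁.add hs h₂.neg

lemma Mix.zero : Mix lam ν r s (fun _ _ => 0) :=
  ⟨aestronglyMeasurable_const, .of_forall fun _ => MemLp.zero,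
    by simp [show (fun _ : β => (0 : ℝ)) = 0 from rfl]⟩

lemma Mix.sum [SFinite ν] {ι : Type*} (S : Finset ι) (hs : 1 ≤ s) {G : ι → α → β → ℝ}
    (h₁ : ∀ i ∈ S, Mix lam ν r s (G i)) : Mix lam ν r s (fun t y => ∑ i ∈ S, G i t y) := by
  classical
  induction S using Finset.induction_on with
  | empty => simpa using Mix.zero
  | insert i S hi ih =>
    simp only [Finset.sum_insert hi]
    exact (h₁ i (Finset.mem_insert_self _ _)).add hs
      (ih fun j hj => h₁ j (Finset.mem_insert_of_mem hj))

lemma Mix.mono_left [SFinite ν] [IsFiniteMeasure lam] (h₁ : Mix lam ν r₁ s g) (hr : r₂ ≤ r₁) :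
    Mix lam ν r₂ s g :=
  ⟨h₁.meas, h₁.memLp, h₁.norm.mono_exponent hr⟩

lemma Mix.mono_right [IsFiniteMeasure ν] (h₁ : Mix lam ν r s₁ g) (hs : s₂ ≤ s₁) :
    Mix lam ν r s₂ g := by
  rcases eq_or_ne s₂ 0 with rfl | hs0
  · exact Mix.of_bound (N := fun _ => 0) h₁.meas (by simp)
      (.of_forall fun t => by simp)
  have hfin : ν univ ^ (1 / s₂.toReal - 1 / s₁.toReal) ≠ ⊤ := by
    refine ENNReal.rpow_ne_top_of_nonneg ?_ (measure_ne_top _ _)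
    rw [sub_nonneg]
    rcases eq_or_ne s₁ ⊤ with rfl | hst
    · simp
    · have h2 := ne_top_of_le_ne_top hst hs
      exact one_div_le_one_div_of_le (ENNReal.toReal_pos hs0 h2) (toReal_mono hst hs)
  refine Mix.of_bound (N := fun t => (eLpNorm (g t) s₁ ν).toReal
      * (ν univ ^ (1 / s₂.toReal - 1 / s₁.toReal)).toReal) h₁.meas (h₁.norm.mul_const _) ?_
  filter_upwards [h₁.memLp] with t ht
  rw [ENNReal.ofReal_mul toReal_nonneg, ofReal_toReal ht.2.ne, ofReal_toReal hfin]
  exact eLpNorm_le_eLpNorm_mul_rpow_measure_univ hs ht.1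

lemma Mix.of_abs_le [SFinite ν] (hg : AEStronglyMeasurable (uncurry g) (lam.prod ν))
    (h : ∀ᵐ t ∂lam, ∀ᵐ y ∂ν, |g t y| ≤ C) : Mix lam ν ⊤ ⊤ g := by
  refine Mix.of_bound (N := fun _ => C) hg (memLp_top_const _) ?_
  filter_upwards [h] with t ht
  rw [eLpNorm_exponent_top]
  refine eLpNormEssSup_le_of_ae_enorm_bound ?_
  filter_upwards [ht] with y hy
  rw [Real.enorm_eq_ofReal_abs]
  exact ofReal_le_ofReal hy

lemma Mix.integrable [SFinite ν] (h₁ : Mix lam ν 1 1 g) : Integrable (uncurry g) (lam.prod ν) := by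
  rw [integrable_prod_iff h₁.meas]
  refine ⟨h₁.memLp.mono fun t ht => memLp_one_iff_integrable.1 ht, ?_⟩
  refine (memLp_one_iff_integrable.1 h₁.norm).congr ?_
  filter_upwards [h₁.memLp] with t ht
  rw [toReal_eLpNorm ht.1]
  simp [lpNorm_one_eq_integral_norm ht.1]

lemma Mix.of_integrable [SFinite ν] [SFinite lam]
    (h₁ : Integrable (uncurry g) (lam.prod ν)) : Mix lam ν 1 1 g := by
  have h2 := (integrable_prod_iff h₁.1).1 h₁
  refine ⟨h₁.1, h2.1.mono fun t ht => memLp_one_iff_integrable.2 ht, ?_⟩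
  refine memLp_one_iff_integrable.2 (h2.2.congr ?_)
  filter_upwards [h2.1] with t ht
  have ht' : Integrable (g t) ν := ht
  rw [toReal_eLpNorm ht'.1, lpNorm_one_eq_integral_norm ht'.1]
  rfl

lemma Mix.restrict_right [SFinite ν] {ν' : Measure β} [SFinite ν'] [SFinite lam] (hν : ν' ≤ ν)
    (h₁ : Mix lam ν r s g) : Mix lam ν' r s g := by
  refine Mix.of_bound (h₁.meas.mono_measure (Measure.prod_mono le_rfl hν)) h₁.norm ?_
  filter_upwards [h₁.memLp] with t ht
  rw [ofReal_toReal ht.2.ne]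
  exact eLpNorm_mono_measure _ hν

lemma eLpNorm_le_interpolation {f : β → ℝ} {a b : ℝ≥0∞} {θ : ℝ} (hθ : θ ∈ Ioo (0 : ℝ) 1)
    (hs : s⁻¹ = ofReal θ * a⁻¹ + ofReal (1 - θ) * b⁻¹)
    (hf : AEStronglyMeasurable f ν) : eLpNorm f s ν ≤ eLpNorm f a ν + eLpNorm f b ν := by
  have h1θ : 0 < 1 - θ := by linarith [hθ.2]
  have e1 : ∀ (θ : ℝ) (a : ℝ≥0∞), 0 < θ → (ofReal θ * a⁻¹)⁻¹ * ofReal θ = a := by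
    intro θ a h
    have h0 : ofReal θ ≠ 0 := by simpa using h
    rw [ENNReal.mul_inv (Or.inl h0) (Or.inl ofReal_ne_top), inv_inv, mul_right_comm,
      ENNReal.inv_mul_cancel h0 ofReal_ne_top, one_mul]
  have : HolderTriple (ofReal θ * a⁻¹)⁻¹ (ofReal (1 - θ) * b⁻¹)⁻¹ s :=
    ⟨by rw [inv_inv, inv_inv, hs]⟩
  have hfn := hf.norm
  have h1 : eLpNorm ((fun y => ‖f y‖ ^ θ) • (fun y => ‖f y‖ ^ (1 - θ))) s ν
      ≤ eLpNorm (fun y => ‖f y‖ ^ θ) (ofReal θ * a⁻¹)⁻¹ ν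
        * eLpNorm (fun y => ‖f y‖ ^ (1 - θ)) (ofReal (1 - θ) * b⁻¹)⁻¹ ν :=
    eLpNorm_smul_le_mul_eLpNorm ((Real.continuous_rpow_const h1θ.le).comp_aestronglyMeasurable hfn)
      ((Real.continuous_rpow_const hθ.1.le).comp_aestronglyMeasurable hfn)
  rw [eLpNorm_norm_rpow f hθ.1, eLpNorm_norm_rpow f h1θ, e1 θ a hθ.1, e1 (1 - θ) b h1θ] at h1
  have h2 : eLpNorm ((fun y => ‖f y‖ ^ θ) • (fun y => ‖f y‖ ^ (1 - θ))) s ν = eLpNorm f s ν := by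
    refine eLpNorm_congr_norm_ae (.of_forall fun y => ?_)
    simp only [Pi.smul_apply', smul_eq_mul]
    rw [← Real.rpow_add_of_nonneg (norm_nonneg _) hθ.1.le h1θ.le]
    simp
  rw [h2] at h1
  refine h1.trans ?_
  set A := eLpNorm f a ν
  set B := eLpNorm f b ν
  calc A ^ θ * B ^ (1 - θ) ≤ (A + B) ^ θ * (A + B) ^ (1 - θ) := by
        gcongr
        · exact hθ.1.le
        · exact le_self_add
        · exact le_add_self
    _ = A + B := by
        rw [← ENNReal.rpow_add_of_nonneg _ _ hθ.1.le h1θ.le]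
        simp

lemma Mix.interpolate [SFinite ν] {a b : ℝ≥0∞} {θ : ℝ} (hθ : θ ∈ Ioo (0 : ℝ) 1)
    (hs : s⁻¹ = ofReal θ * a⁻¹ + ofReal (1 - θ) * b⁻¹)
    (ha : Mix lam ν r a g) (hb : Mix lam ν r b g) : Mix lam ν r s g := by
  refine Mix.of_bound ha.meas (ha.norm.add hb.norm) ?_
  filter_upwards [ha.memLp, hb.memLp] with t h1 h2
  simp only [Pi.add_apply]
  rw [ENNReal.ofReal_add toReal_nonneg toReal_nonneg, ofReal_toReal h1.2.ne, ofReal_toReal h2.2.ne]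
  exact eLpNorm_le_interpolation hθ hs h1.1

end Mix

/-! ### Mollification -/

section Mollify

variable {G : E3 → ℝ} {p p' : ℝ≥0∞}

lemma tendsto_eLpNorm_translate_sub (hp : 1 ≤ p) (hpt : p ≠ ⊤) (hF : MemLp F p) :
    Tendsto (fun z : E3 => eLpNorm (fun x => F (x - z) - F x) p) (𝓝 0) (𝓝 0) := by
  have : Fact (1 ≤ p) := ⟨hp⟩
  let g : E3 → C(E3, E3) := fun z => ⟨fun x => x - z, by fun_prop⟩
  have hg : Continuous g := by
    refine ContinuousMap.continuous_of_continuous_uncurry _ ?_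
    simp only [g, Function.uncurry_def, ContinuousMap.coe_mk]
    fun_prop
  have hgm : ∀ z, MeasurePreserving (g z) := fun z => measurePreserving_sub_right volume z
  have hc := (continuous_const (y := hF.toLp F)).compMeasurePreservingLp hg hgm hpt
  have h := (hc.tendsto 0).edist (tendsto_const_nhds (x := hF.toLp F))
  have e0 : edist (Lp.compMeasurePreserving (g 0) (hgm 0) (hF.toLp F)) (hF.toLp F) = 0 := by
    rw [Lp.toLp_compMeasurePreserving, Lp.edist_toLp_toLp]
    have e : F ∘ ⇑(g 0) - F = 0 := by
      ext x
      simp [g]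
    rw [e, eLpNorm_zero]
  rw [e0] at h
  refine h.congr fun z => ?_
  rw [Lp.toLp_compMeasurePreserving, Lp.edist_toLp_toLp]
  rfl

/-- Smooth averaging kernels of radius `ε`. -/
structure IsKernel (k : E3 → ℝ) (ε : ℝ) : Prop where
  contDiff : ContDiff ℝ ∞ k
  nonneg : ∀ z, 0 ≤ k z
  integral_eq_one : ∫ z, k z = 1
  eq_zero : ∀ z, ε < ‖z‖ → k z = 0

lemma IsKernel.hasCompactSupport (hk : IsKernel k ε) : HasCompactSupport k :=
  HasCompactSupport.of_support_subset_isCompact (isCompact_closedBall (0 : E3) ε) fun z hz => by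
    by_contra h
    exact hz (hk.eq_zero z (by simpa using h))

lemma IsKernel.integrable (hk : IsKernel k ε) : Integrable k :=
  hk.contDiff.continuous.integrable_of_hasCompactSupport hk.hasCompactSupport

lemma IsKernel.neg (hk : IsKernel k ε) : IsKernel (fun z => k (-z)) ε :=
  ⟨hk.contDiff.comp contDiff_neg, fun z => hk.nonneg _, by
    rw [integral_neg_eq_self]; exact hk.integral_eq_one, fun z hz => hk.eq_zero _ (by simpa)⟩

lemma isKernel_normed {c : E3} (φ : ContDiffBump c) (h : ‖c‖ + φ.rOut ≤ ε) :
    IsKernel (φ.normed volume) ε := by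
  refine ⟨φ.contDiff_normed, φ.nonneg_normed, φ.integral_normed, fun z hz => ?_⟩
  by_contra h0
  have : z ∈ Function.support (φ.normed volume) := h0
  rw [φ.support_normed_eq, Metric.mem_ball, dist_eq_norm] at this
  have h2 := norm_le_norm_add_norm_sub' z c
  linarith

/-- The mollification `y ↦ ∫ F(x) k(y - x) dx`. -/
def mollify (k F : E3 → ℝ) (y : E3) : ℝ := ∫ x, F x * k (y - x)

lemma mollify_eq (k F : E3 → ℝ) (y : E3) : mollify k F y = ∫ z, F (y - z) * k z := by
  rw [mollify, ← integral_sub_left_eq_self (fun x => F x * k (y - x)) volume y]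
  simp

lemma IsKernel.abs_integral_mul_sub_le {T : E3 → ℝ} (hk : IsKernel k ε)
    (hT : Integrable (fun z => k z * T z)) (h : ∀ z, ‖z‖ ≤ ε → |T z - c| ≤ δ) :
    |(∫ z, k z * T z) - c| ≤ δ := by
  have h1 : (∫ z, k z * T z) - c = ∫ z, k z * (T z - c) := by
    simp only [mul_sub]
    rw [integral_sub hT (hk.integrable.mul_const c), integral_mul_const, hk.integral_eq_one,
      one_mul]
  have h2 : ∀ z, |k z * (T z - c)| ≤ k z * δ := fun z => by
    rw [abs_mul, abs_of_nonneg (hk.nonneg z)]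
    rcases le_or_gt ‖z‖ ε with hz | hz
    · exact mul_le_mul_of_nonneg_left (h z hz) (hk.nonneg z)
    · simp [hk.eq_zero z hz]
  rw [h1, ← Real.norm_eq_abs]
  refine (norm_integral_le_of_norm_le (hk.integrable.mul_const δ) (.of_forall h2)).trans ?_
  rw [integral_mul_const, hk.integral_eq_one, one_mul]

variable [HolderTriple p p' 1]

lemma integral_abs_translate_mul_le (hF : MemLp F p) (hG : MemLp G p') (z : E3) :
    Integrable (fun y => F (y - z) * G y) ∧
      ∫ y, ‖F (y - z) * G y‖ ≤ (eLpNorm F p).toReal * (eLpNorm G p').toReal := by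
  have hFz : MemLp (fun y => F (y - z)) p :=
    hF.comp_measurePreserving (measurePreserving_sub_right volume z)
  have hmem : MemLp ((fun y => F (y - z)) * G) 1 := hG.mul hFz
  refine ⟨memLp_one_iff_integrable.1 hmem, ?_⟩
  have h1 := eLpNorm_smul_le_mul_eLpNorm (p := p) (q := p') (r := 1) hG.1 hFz.1
  have h2 : eLpNorm (fun y => F (y - z)) p = eLpNorm F p :=
    eLpNorm_comp_measurePreserving hF.1 (measurePreserving_sub_right volume z)
  rw [h2] at h1
  have h3 := toReal_mono (ENNReal.mul_ne_top hF.2.ne hG.2.ne) h1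
  rw [ENNReal.toReal_mul] at h3
  refine le_trans (le_of_eq ?_) h3
  change _ = (eLpNorm ((fun y => F (y - z)) * G) 1 volume).toReal
  rw [toReal_eLpNorm hmem.1, lpNorm_one_eq_integral_norm hmem.1]
  rfl

lemma integrable_translate_mul (hk : IsKernel k ε) (hF : MemLp F p) (hG : MemLp G p') :
    Integrable (fun z : E3 × E3 => k z.2 * (F (z.1 - z.2) * G z.1)) (volume.prod volume) := by
  have hm : AEStronglyMeasurable (fun z : E3 × E3 => k z.2 * (F (z.1 - z.2) * G z.1))
      (volume.prod volume) := by
    refine AEStronglyMeasurable.mul ?_ (AEStronglyMeasurable.mul ?_ ?_)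
    · exact (hk.contDiff.continuous.comp continuous_snd).aestronglyMeasurable
    · exact hF.1.comp_quasiMeasurePreserving
        (quasiMeasurePreserving_sub_of_right_invariant volume volume)
    · exact hG.1.comp_fst
  rw [integrable_prod_iff' hm]
  have h := fun z => integral_abs_translate_mul_le hF hG z
  refine ⟨.of_forall fun z => (h z).1.const_mul (k z), ?_⟩
  refine (hk.integrable.mul_const ((eLpNorm F p).toReal * (eLpNorm G p').toReal)).mono'
    hm.norm.prod_swap.integral_prod_right' (.of_forall fun z => ?_)
  simp only [norm_mul, integral_const_mul]
  rw [← norm_mul, norm_mul, norm_norm, Real.norm_of_nonneg (hk.nonneg z), Real.norm_of_nonneg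
    (integral_nonneg fun y => by positivity)]
  refine mul_le_mul_of_nonneg_left ?_ (hk.nonneg z)
  simpa only [norm_mul] using (h z).2

lemma integral_mollify_mul (hk : IsKernel k ε) (hF : MemLp F p) (hG : MemLp G p') :
    ∫ y, mollify k F y * G y = ∫ z, k z * ∫ y, F (y - z) * G y := by
  have h := integral_integral_swap (f := fun y z => k z * (F (y - z) * G y))
    (integrable_translate_mul hk hF hG)
  simp only [integral_const_mul] at h
  rw [← h]
  refine integral_congr_ae (.of_forall fun y => ?_)
  simp only
  rw [mollify_eq, ← integral_mul_const]
  exact integral_congr_ae (.of_forall fun z => by simp only; ring)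

lemma integrable_kernel_mul (hk : IsKernel k ε) (hF : MemLp F p) (hG : MemLp G p') :
    Integrable (fun z => k z * ∫ y, F (y - z) * G y) := by
  have h := (integrable_translate_mul hk hF hG).integral_prod_right
  simpa only [integral_const_mul] using h

lemma abs_integral_mollify_mul_le (hk : IsKernel k ε) (hF : MemLp F p) (hG : MemLp G p') :
    |∫ y, mollify k F y * G y| ≤ (eLpNorm F p).toReal * (eLpNorm G p').toReal := by
  rw [integral_mollify_mul hk hF hG]
  have := hk.abs_integral_mul_sub_le (c := 0)
    (δ := (eLpNorm F p).toReal * (eLpNorm G p').toReal) (integrable_kernel_mul hk hF hG)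
    (fun z _ => by
      rw [sub_zero, ← Real.norm_eq_abs]
      exact (norm_integral_le_integral_norm _).trans (integral_abs_translate_mul_le hF hG z).2)
  simpa using this

lemma abs_integral_mollify_mul_sub_le (hk : IsKernel k ε) (hF : MemLp F p) (hG : MemLp G p')
    (h : ∀ z : E3, ‖z‖ ≤ ε → (eLpNorm (fun x => F (x - z) - F x) p).toReal ≤ δ) :
    |(∫ y, mollify k F y * G y) - ∫ y, F y * G y| ≤ δ * (eLpNorm G p').toReal := by
  rw [integral_mollify_mul hk hF hG]
  refine hk.abs_integral_mul_sub_le (integrable_kernel_mul hk hF hG) fun z hz => ?_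
  have hFz : MemLp (fun y => F (y - z)) p :=
    hF.comp_measurePreserving (measurePreserving_sub_right volume z)
  have h0 := integral_abs_translate_mul_le hF hG 0
  simp only [sub_zero] at h0
  have h1 := integral_abs_translate_mul_le (hFz.sub hF) hG 0
  simp only [sub_zero, Pi.sub_apply] at h1
  rw [← integral_sub (integral_abs_translate_mul_le hF hG z).1 h0.1, ← Real.norm_eq_abs]
  simp only [← sub_mul]
  refine (norm_integral_le_integral_norm _).trans (h1.2.trans ?_)
  exact mul_le_mul_of_nonneg_right (h z hz) toReal_nonneg

/-- Mollification converges in the duality of Lebesgue spaces. -/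
lemma tendsto_integral_mollify_mul {k : ℕ → E3 → ℝ} {ε : ℕ → ℝ} (hk : ∀ n, IsKernel (k n) (ε n))
    (hε : Tendsto ε atTop (𝓝 0)) (hp : 1 ≤ p) (hpt : p ≠ ⊤) (hF : MemLp F p) (hG : MemLp G p') :
    Tendsto (fun n => ∫ y, mollify (k n) F y * G y) atTop (𝓝 (∫ y, F y * G y)) := by
  rw [Metric.tendsto_atTop]
  intro δ hδ
  set N := (eLpNorm G p').toReal
  have hN : 0 ≤ N := toReal_nonneg
  have h1 := (tendsto_eLpNorm_translate_sub hp hpt hF).eventually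
    (gt_mem_nhds (show (0 : ℝ≥0∞) < ofReal (δ / (N + 1)) by
      rw [ENNReal.ofReal_pos]; positivity))
  obtain ⟨η, hη, h2⟩ := Metric.eventually_nhds_iff.1 h1
  obtain ⟨n₀, hn₀⟩ := eventually_atTop.1 (hε.eventually (gt_mem_nhds hη))
  refine ⟨n₀, fun n hn => ?_⟩
  rw [Real.dist_eq]
  refine (abs_integral_mollify_mul_sub_le (δ := δ / (N + 1)) (hk n) hF hG fun z hz =>
    ?_).trans_lt ?_
  · have := h2 (y := z) (by rw [dist_zero_right]; exact hz.trans_lt (hn₀ n hn))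
    exact toReal_le_of_le_ofReal (by positivity) this.le
  · rw [div_mul_eq_mul_div, div_lt_iff₀ (by positivity)]
    nlinarith

end Mollify

section MollifyLOne

lemma contDiff_mollify (hk : IsKernel k ε) (hF : LocallyIntegrable F) :
    ContDiff ℝ ∞ (mollify k F) := by
  have h := hk.hasCompactSupport.contDiff_convolution_right (ContinuousLinearMap.mul ℝ ℝ) hF
    hk.contDiff
  exact h

lemma fderiv_mollify (hk : IsKernel k ε) (hF : LocallyIntegrable F) (y v : E3) :
    fderiv ℝ (mollify k F) y v = ∫ x, F x * fderiv ℝ k (y - x) v := by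
  have h := hk.hasCompactSupport.hasFDerivAt_convolution_right (ContinuousLinearMap.mul ℝ ℝ) hF
    (hk.contDiff.of_le (by norm_num)) y
  have e : mollify k F = MeasureTheory.convolution F k (ContinuousLinearMap.mul ℝ ℝ) volume := rfl
  rw [e, h.fderiv, convolution_precompR_apply _ hF (hk.hasCompactSupport.fderiv ℝ)
    ((hk.contDiff.continuous_fderiv (by simp)))]
  rfl

/-- Mollification converges in `L¹`. -/
lemma tendsto_eLpNorm_mollify_sub {k : ℕ → E3 → ℝ} {ε : ℕ → ℝ} (hk : ∀ n, IsKernel (k n) (ε n))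
    (hε : Tendsto ε atTop (𝓝 0)) (hF : Integrable F) :
    Tendsto (fun n => eLpNorm (fun y => mollify (k n) F y - F y) 1) atTop (𝓝 0) := by
  have hF1 : MemLp F 1 := memLp_one_iff_integrable.2 hF
  rw [ENNReal.tendsto_nhds_zero]
  intro δ hδ
  obtain ⟨δ', hδ', hδδ⟩ := ENNReal.lt_iff_exists_real_btwn.1 hδ
  have hδ'0 : 0 < δ' := ENNReal.ofReal_pos.1 hδδ.1
  have h1 := (tendsto_eLpNorm_translate_sub le_rfl ENNReal.one_ne_top hF1).eventually
    (gt_mem_nhds hδδ.1)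
  obtain ⟨η, hη, h2⟩ := Metric.eventually_nhds_iff.1 h1
  filter_upwards [hε.eventually (gt_mem_nhds hη)] with n hn
  have hcm : AEStronglyMeasurable (fun y => mollify (k n) F y - F y) volume :=
    (contDiff_mollify (hk n) hF.locallyIntegrable).continuous.aestronglyMeasurable.sub hF.1
  have hmi : Integrable (mollify (k n) F) := by
    have := hF.integrable_convolution (ContinuousLinearMap.mul ℝ ℝ) (hk n).integrable
    exact this
  have hint : Integrable (fun y => mollify (k n) F y - F y) := hmi.sub hF
  -- test with the sign of the difference
  set S : E3 → ℝ := fun y => SignType.sign (mollify (k n) F y - F y) with hS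
  have hSm : MemLp S ⊤ := by
    refine memLp_top_of_bound (C := 1) ?_ (.of_forall fun y => ?_)
    · have : Measurable (fun x : ℝ => ((SignType.sign x : SignType) : ℝ)) := by
        have : (fun x : ℝ => ((SignType.sign x : SignType) : ℝ))
            = fun x => if 0 < x then 1 else if x < 0 then -1 else 0 := by
          ext x
          rw [sign_apply]
          split_ifs <;> simp
        rw [this]
        exact Measurable.ite measurableSet_Ioi measurable_const
          (Measurable.ite measurableSet_Iio measurable_const measurable_const)
      exact (this.comp_aemeasurable hcm.aemeasurable).aestronglyMeasurable
    · simp only [hS]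
      rcases SignType.sign (mollify (k n) F y - F y) <;> simp
  have h3 := abs_integral_mollify_mul_sub_le (p := 1) (p' := ⊤) (δ := δ') (hk n) hF1 hSm
    (fun z hz => toReal_le_of_le_ofReal hδ'0.le
      (h2 (y := z) (by rw [dist_zero_right]; exact hz.trans_lt hn)).le)
  have hS1 : (eLpNorm S ⊤).toReal ≤ 1 := by
    refine toReal_le_of_le_ofReal zero_le_one ?_
    rw [eLpNorm_exponent_top]
    refine eLpNormEssSup_le_of_ae_bound (.of_forall fun y => ?_)
    simp only [hS]
    rcases SignType.sign (mollify (k n) F y - F y) <;> simp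
  have h4 : (∫ y, mollify (k n) F y * S y) - ∫ y, F y * S y = ∫ y, ‖mollify (k n) F y - F y‖ := by
    have i1 : Integrable (fun y => mollify (k n) F y * S y) :=
      memLp_one_iff_integrable.1 (hSm.mul (p := 1) (q := ⊤) (memLp_one_iff_integrable.2 hmi))
    have i2 : Integrable (fun y => F y * S y) :=
      memLp_one_iff_integrable.1 (hSm.mul (p := 1) (q := ⊤) hF1)
    rw [← integral_sub i1 i2]
    refine integral_congr_ae (.of_forall fun y => ?_)
    simp only [hS]
    rw [← sub_mul, Real.norm_eq_abs, self_mul_sign]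
  rw [h4] at h3
  refine le_trans ?_ hδδ.2.le
  rw [eLpNorm_one_eq_lintegral_enorm, ← ofReal_integral_norm_eq_lintegral_enorm hint]
  refine ofReal_le_ofReal ?_
  have h5 := (le_abs_self _).trans h3
  exact h5.trans (by nlinarith)

end MollifyLOne

/-! ### Slices of weak derivatives -/

/-- `φ ∈ C_c^∞(U)`. -/
def IsTestOn {A : Type*} [NormedAddCommGroup A] [NormedSpace ℝ A] (U : Set A) (φ : A → ℝ) : Prop :=
  ContDiff ℝ ∞ φ ∧ HasCompactSupport φ ∧ tsupport φ ⊆ U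

section Slice

variable {A B : Type*} [NormedAddCommGroup A] [NormedSpace ℝ A] [NormedAddCommGroup B] [NormedSpace ℝ B]

lemma IsTestOn.continuous {U : Set A} {φ : A → ℝ} (h : IsTestOn U φ) : Continuous φ :=
  h.1.continuous

lemma IsTestOn.continuous_fderiv {U : Set A} {φ : A → ℝ} (h : IsTestOn U φ) (e : A) :
    Continuous (fun x => fderiv ℝ φ x e) :=
  (h.1.continuous_fderiv (by simp)).clm_apply continuous_const

lemma IsTestOn.eq_zero {K : Set A} {φ : A → ℝ} (h : IsTestOn K φ) {x : A} (hx : x ∉ K) :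
    φ x = 0 := by
  by_contra h0
  exact hx (h.2.2 (subset_tsupport _ h0))

lemma IsTestOn.fderiv_eq_zero {K : Set A} {φ : A → ℝ} (h : IsTestOn K φ) {x : A} (hx : x ∉ K) :
    fderiv ℝ φ x = 0 := by
  by_contra h0
  exact hx (h.2.2 (support_fderiv_subset ℝ h0))

variable [FiniteDimensional ℝ A] [FiniteDimensional ℝ B]

lemma exists_countable_dense_isTestOn {K : Set A} (hK : IsCompact K) (e : A) :
    ∃ D : Set (A → ℝ), D.Countable ∧ (∀ ψ ∈ D, IsTestOn K ψ) ∧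
      ∀ φ, IsTestOn K φ → ∀ ε > 0, ∃ ψ ∈ D, ∀ x ∈ K,
        |φ x - ψ x| < ε ∧ |fderiv ℝ φ x e - fderiv ℝ ψ x e| < ε := by
  have : CompactSpace K := isCompact_iff_compactSpace.1 hK
  let S := {φ : A → ℝ // IsTestOn K φ}
  let J : S → C(K, ℝ) × C(K, ℝ) := fun φ =>
    (⟨fun x => φ.1 x, φ.2.continuous.comp continuous_subtype_val⟩,
      ⟨fun x => fderiv ℝ φ.1 x e, (φ.2.continuous_fderiv e).comp continuous_subtype_val⟩)
  obtain ⟨D, hD, hDd⟩ := TopologicalSpace.exists_countable_dense (range J)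
  choose s hs using fun y : range J => y.2
  refine ⟨(fun y => (s y).1) '' D, hD.image _, ?_, ?_⟩
  · rintro _ ⟨y, _, rfl⟩
    exact (s y).2
  · intro φ hφ ε hε
    obtain ⟨y, hy, hyd⟩ := Metric.dense_iff.1 hDd ⟨J ⟨φ, hφ⟩, mem_range_self _⟩ ε hε
    refine ⟨(s y).1, mem_image_of_mem _ hyd, fun x hx => ?_⟩
    have h1 : dist (J (s y)) (J ⟨φ, hφ⟩) < ε := by
      rw [hs y]; exact hy
    rw [Prod.dist_eq, max_lt_iff] at h1
    have h2 := (ContinuousMap.dist_apply_le_dist (⟨x, hx⟩ : K)).trans_lt h1.1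
    have h3 := (ContinuousMap.dist_apply_le_dist (⟨x, hx⟩ : K)).trans_lt h1.2
    rw [dist_comm, Real.dist_eq] at h2 h3
    exact ⟨h2, h3⟩

lemma exists_compact_exhaustion {U : Set A} (hU : IsOpen U) : ∃ K : ℕ → Set A,
    (∀ n, IsCompact (K n) ∧ K n ⊆ U) ∧ ∀ K', IsCompact K' → K' ⊆ U → ∃ n, K' ⊆ K n := by
  have : LocallyCompactSpace U := hU.locallyCompactSpace
  have : SigmaCompactSpace U := inferInstance
  let K := CompactExhaustion.choice U
  refine ⟨fun n => Subtype.val '' (K n), fun n => ⟨(K.isCompact n).image continuous_subtype_val,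
    by rintro _ ⟨x, _, rfl⟩; exact x.2⟩, fun K' hK' hsub => ?_⟩
  have h1 : IsCompact ((Subtype.val : U → A) ⁻¹' K') :=
    Topology.IsInducing.subtypeVal.isCompact_preimage' hK' (by simpa using hsub)
  obtain ⟨n, hn⟩ := K.exists_superset_of_isCompact h1
  exact ⟨n, fun x hx => ⟨⟨x, hsub hx⟩, hn hx, rfl⟩⟩

variable [MeasurableSpace A] [BorelSpace A] [MeasurableSpace B] [BorelSpace B]

/-- A weak identity in a product splits into weak identities on almost every slice. -/
lemma ae_slice_weak_derivative {U : Set A} {V : Set B} (hU : IsOpen U) (hV : IsOpen V) (e : A)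
    {μA : Measure A} {μB : Measure B} [SFinite μA] [SFinite μB]
    {h g : A → B → ℝ}
    (hh : ∀ K K', IsCompact K → K ⊆ U → IsCompact K' → K' ⊆ V →
      Integrable (uncurry h) ((μA.restrict K).prod (μB.restrict K')))
    (hg : ∀ K K', IsCompact K → K ⊆ U → IsCompact K' → K' ⊆ V →
      Integrable (uncurry g) ((μA.restrict K).prod (μB.restrict K')))
    (hw : ∀ φ ψ, IsTestOn U φ → IsTestOn V ψ →
      ∫ b, ψ b * ∫ a in U, (h a b * fderiv ℝ φ a e + g a b * φ a) ∂μA ∂μB = 0) :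
    ∀ᵐ b ∂(μB.restrict V), (∀ K, IsCompact K → K ⊆ U → IntegrableOn (fun a => h a b) K μA ∧
        IntegrableOn (fun a => g a b) K μA) ∧
      ∀ φ, IsTestOn U φ → ∫ a in U, h a b * fderiv ℝ φ a e ∂μA = - ∫ a in U, g a b * φ a ∂μA := by
  obtain ⟨K, hK, hKex⟩ := exists_compact_exhaustion hU
  obtain ⟨K', hK', hKex'⟩ := exists_compact_exhaustion hV
  -- integrability of slices
  have hint : ∀ᵐ b ∂(μB.restrict V), ∀ n, IntegrableOn (fun a => h a b) (K n) μA ∧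
      IntegrableOn (fun a => g a b) (K n) μA := by
    rw [ae_all_iff]
    intro n
    have h1 : ∀ᵐ b ∂(μB.restrict (⋃ m, K' m)), IntegrableOn (fun a => h a b) (K n) μA ∧
        IntegrableOn (fun a => g a b) (K n) μA := by
      rw [ae_restrict_iUnion_iff]
      intro m
      have i1 := (hh (K n) (K' m) (hK n).1 (hK n).2 (hK' m).1 (hK' m).2).prod_left_ae
      have i2 := (hg (K n) (K' m) (hK n).1 (hK n).2 (hK' m).1 (hK' m).2).prod_left_ae
      filter_upwards [i1, i2] with b h1 h2
      exact ⟨h1, h2⟩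
    refine ae_restrict_of_ae_restrict_of_subset (fun x hx => ?_) h1
    obtain ⟨m, hm⟩ := hKex' {x} isCompact_singleton (singleton_subset_iff.2 hx)
    exact mem_iUnion.2 ⟨m, hm rfl⟩
  -- a fixed test function
  have hfix : ∀ n, ∀ φ, IsTestOn (K n) φ → ∀ᵐ b ∂(μB.restrict V),
      ∫ a in U, (h a b * fderiv ℝ φ a e + g a b * φ a) ∂μA = 0 := by
    intro n φ hφ
    have hφU : IsTestOn U φ := ⟨hφ.1, hφ.2.1, hφ.2.2.trans (hK n).2⟩
    have e1 : ∀ b, ∫ a in U, (h a b * fderiv ℝ φ a e + g a b * φ a) ∂μA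
        = ∫ a in K n, (h a b * fderiv ℝ φ a e + g a b * φ a) ∂μA := fun b =>
      setIntegral_eq_of_subset_of_forall_sdiff_eq_zero hU.measurableSet (hK n).2
        (fun a ha => by rw [hφ.fderiv_eq_zero ha.2, hφ.eq_zero ha.2]; simp)
    rw [ae_restrict_iff' hV.measurableSet]
    refine IsOpen.ae_eq_zero_of_integral_contDiff_smul_eq_zero hV ?_ ?_
    · rw [locallyIntegrableOn_iff hV.isLocallyClosed]
      intro k hkV hk
      simp only [e1]
      obtain ⟨C₁, hC₁⟩ := (hK n).1.exists_bound_of_continuousOn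
        (hφ.continuous_fderiv e).continuousOn
      obtain ⟨C₂, hC₂⟩ := (hK n).1.exists_bound_of_continuousOn hφ.continuous.continuousOn
      have hmem : ∀ᵐ z ∂((μA.restrict (K n)).prod (μB.restrict k)), z.1 ∈ K n := by
        have : ∀ᵐ a ∂(μA.restrict (K n)), a ∈ K n := ae_restrict_mem (hK n).1.measurableSet
        exact Measure.quasiMeasurePreserving_fst.ae this
      have i1 := (hh (K n) k (hK n).1 (hK n).2 hk hkV).mul_bdd (c := C₁)
        (g := fun z : A × B => fderiv ℝ φ z.1 e)
        ((hφ.continuous_fderiv e).comp continuous_fst).aestronglyMeasurable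
        (by filter_upwards [hmem] with z hz using hC₁ _ hz)
      have i2 := (hg (K n) k (hK n).1 (hK n).2 hk hkV).mul_bdd (c := C₂)
        (g := fun z : A × B => φ z.1)
        (hφ.continuous.comp continuous_fst).aestronglyMeasurable
        (by filter_upwards [hmem] with z hz using hC₂ _ hz)
      exact (i1.add i2).integral_prod_right
    · intro ψ h1 h2 h3
      exact hw φ ψ hφU ⟨h1, h2, h3⟩
  choose D hDc hDt hDd using fun n => exists_countable_dense_isTestOn (hK n).1 e
  have hall : ∀ᵐ b ∂(μB.restrict V), ∀ n, ∀ φ ∈ D n,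
      ∫ a in U, (h a b * fderiv ℝ φ a e + g a b * φ a) ∂μA = 0 := by
    rw [ae_all_iff]
    intro n
    rw [ae_ball_iff (hDc n)]
    exact fun φ hφ => hfix n φ (hDt n φ hφ)
  filter_upwards [hint, hall] with b hb1 hb2
  refine ⟨fun k hk hkU => ?_, fun φ hφ => ?_⟩
  · obtain ⟨n, hn⟩ := hKex k hk hkU
    exact ⟨(hb1 n).1.mono_set hn, (hb1 n).2.mono_set hn⟩
  · obtain ⟨n, hn⟩ := hKex (tsupport φ) hφ.2.1 hφ.2.2
    have hφn : IsTestOn (K n) φ := ⟨hφ.1, hφ.2.1, hn⟩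
    have hintφ : ∀ ψ, IsTestOn (K n) ψ → IntegrableOn (fun a => h a b * fderiv ℝ ψ a e) (K n) μA ∧
        IntegrableOn (fun a => g a b * ψ a) (K n) μA := fun ψ hψ =>
      ⟨(hb1 n).1.mul_continuousOn (hψ.continuous_fderiv e).continuousOn (hK n).1,
        (hb1 n).2.mul_continuousOn hψ.continuous.continuousOn (hK n).1⟩
    have hres : ∀ ψ, IsTestOn (K n) ψ → ∫ a in U, h a b * fderiv ℝ ψ a e ∂μA
          = ∫ a in K n, h a b * fderiv ℝ ψ a e ∂μA ∧
        ∫ a in U, g a b * ψ a ∂μA = ∫ a in K n, g a b * ψ a ∂μA ∧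
        ∫ a in U, (h a b * fderiv ℝ ψ a e + g a b * ψ a) ∂μA
          = ∫ a in K n, (h a b * fderiv ℝ ψ a e + g a b * ψ a) ∂μA := fun ψ hψ =>
      ⟨setIntegral_eq_of_subset_of_forall_sdiff_eq_zero hU.measurableSet (hK n).2
          (fun a ha => by rw [hψ.fderiv_eq_zero ha.2]; simp),
        setIntegral_eq_of_subset_of_forall_sdiff_eq_zero hU.measurableSet (hK n).2
          (fun a ha => by rw [hψ.eq_zero ha.2]; simp),
        setIntegral_eq_of_subset_of_forall_sdiff_eq_zero hU.measurableSet (hK n).2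
          (fun a ha => by rw [hψ.fderiv_eq_zero ha.2, hψ.eq_zero ha.2]; simp)⟩
    rw [(hres φ hφn).1, (hres φ hφn).2.1, ← sub_eq_zero, sub_neg_eq_add,
      ← integral_add (hintφ φ hφn).1 (hintφ φ hφn).2]
    set N := ∫ a in K n, (|h a b| + |g a b|) ∂μA with hN
    have hN0 : 0 ≤ N := integral_nonneg fun a => by positivity
    have hNi : IntegrableOn (fun a => |h a b| + |g a b|) (K n) μA :=
      (hb1 n).1.norm.add (hb1 n).2.norm
    by_contra hne
    set I := ∫ a in K n, (h a b * fderiv ℝ φ a e + g a b * φ a) ∂μA with hI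
    have hIpos : 0 < |I| := abs_pos.2 hne
    obtain ⟨ψ, hψD, hψ⟩ := hDd n φ hφn (|I| / (N + 1)) (by positivity)
    have hψt := hDt n ψ hψD
    have h0 := hb2 n ψ hψD
    rw [(hres ψ hψt).2.2] at h0
    have h1 : I = ∫ a in K n, ((h a b * (fderiv ℝ φ a e - fderiv ℝ ψ a e)
        + g a b * (φ a - ψ a))) ∂μA := by
      have j1 : IntegrableOn (fun a => h a b * fderiv ℝ φ a e + g a b * φ a) (K n) μA :=
        (hintφ φ hφn).1.add (hintφ φ hφn).2
      have j2 : IntegrableOn (fun a => h a b * fderiv ℝ ψ a e + g a b * ψ a) (K n) μA :=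
        (hintφ ψ hψt).1.add (hintφ ψ hψt).2
      rw [← sub_zero I, ← h0, hI, ← integral_sub j1 j2]
      exact integral_congr_ae (.of_forall fun a => by simp only; ring)
    have h2 : |I| ≤ |I| / (N + 1) * N := by
      nth_rewrite 1 [h1]
      rw [← Real.norm_eq_abs, hN, ← integral_const_mul]
      refine norm_integral_le_of_norm_le (hNi.const_mul _) ?_
      filter_upwards [ae_restrict_mem (hK n).1.measurableSet] with a ha
      have h3 := hψ a ha
      rw [Real.norm_eq_abs]
      refine (abs_add_le _ _).trans ?_
      rw [abs_mul, abs_mul, mul_add]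
      have := mul_le_mul_of_nonneg_left h3.1.le (abs_nonneg (g a b))
      have := mul_le_mul_of_nonneg_left h3.2.le (abs_nonneg (h a b))
      linarith
    rw [div_mul_eq_mul_div, le_div_iff₀ (by positivity)] at h2
    nlinarith

end Slice

/-! ### Absolutely continuous functions of time -/

section OneDim

lemma absolutelyContinuousOnInterval_comp {f : ℝ → ℝ} {a : ℝ} {K : ℝ≥0} {S : Set ℝ}
    (hG : LipschitzOnWith K G S) (hf : AbsolutelyContinuousOnInterval f a b)
    (hS : ∀ x ∈ uIcc a b, f x ∈ S) : AbsolutelyContinuousOnInterval (fun x => G (f x)) a b := by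
  rw [absolutelyContinuousOnInterval_iff] at hf ⊢
  intro ε hε
  obtain ⟨δ, hδ, h⟩ := hf (ε / (K + 1)) (by positivity)
  refine ⟨δ, hδ, fun E hE hlen => ?_⟩
  have h1 := h E hE hlen
  rw [lt_div_iff₀ (by positivity)] at h1
  refine lt_of_le_of_lt ?_ h1
  rw [Finset.sum_mul]
  refine Finset.sum_le_sum fun i hi => ?_
  have hmem := hE.1 i hi
  have h2 := hG.dist_le_mul _ (hS _ hmem.1) _ (hS _ hmem.2)
  refine h2.trans ?_
  nlinarith [dist_nonneg (x := f (E.2 i).1) (y := f (E.2 i).2)]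

lemma absolutelyContinuousOnInterval_primitive (ha : IntervalIntegrable a volume 0 T) :
    AbsolutelyContinuousOnInterval (fun t => c + ∫ s in 0..t, a s) 0 T := by
  have h1 := ha.absolutelyContinuousOnInterval_intervalIntegral (c := 0) left_mem_uIcc
  have h2 : AbsolutelyContinuousOnInterval (fun _ : ℝ => c) 0 T :=
    ((LipschitzWith.const c).lipschitzOnWith).absolutelyContinuousOnInterval
  exact h2.add h1

lemma ae_hasDerivAt_primitive (ha : IntervalIntegrable a volume 0 T) :
    ∀ᵐ t, t ∈ uIcc 0 T → HasDerivAt (fun t => c + ∫ s in 0..t, a s) (a t) t := by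
  filter_upwards [ha.ae_hasDerivAt_integral] with t ht htT
  exact (ht htT 0 left_mem_uIcc).const_add c

/-- Chain rule for primitives of integrable functions. -/
lemma comp_primitive_eq (hG : ∀ x, HasDerivAt G (G' x) x) (hG' : Continuous G')
    (ha : IntervalIntegrable a volume 0 T) :
    IntervalIntegrable (fun t => G' (c + ∫ s in 0..t, a s) * a t) volume 0 T ∧
    G (c + ∫ s in 0..T, a s) = G c
      + ∫ t in 0..T, G' (c + ∫ s in 0..t, a s) * a t := by
  set f := fun t => c + ∫ s in 0..t, a s with hf
  have hac : AbsolutelyContinuousOnInterval f 0 T := absolutelyContinuousOnInterval_primitive ha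
  have hcf : ContinuousOn f (uIcc 0 T) := hac.continuousOn
  obtain ⟨M, hM⟩ := isCompact_uIcc.exists_bound_of_continuousOn hcf
  obtain ⟨K, hK⟩ := (isCompact_Icc (a := -M) (b := M)).exists_bound_of_continuousOn hG'.continuousOn
  have hLip : LipschitzOnWith K.toNNReal G (Icc (-M) M) := by
    refine (convex_Icc _ _).lipschitzOnWith_of_nnnorm_hasDerivWithin_le
      (fun x _ => (hG x).hasDerivWithinAt) fun x hx => ?_
    rw [← NNReal.coe_le_coe, coe_nnnorm]
    exact (hK x hx).trans (Real.le_coe_toNNReal K)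
  have hacG : AbsolutelyContinuousOnInterval (fun t => G (f t)) 0 T :=
    absolutelyContinuousOnInterval_comp hLip hac (fun x hx => abs_le.1 (hM x hx))
  have h1 := hacG.integral_deriv_eq_sub
  have hae : ∀ᵐ t, t ∈ uIcc 0 T → deriv (fun t => G (f t)) t = G' (f t) * a t := by
    filter_upwards [ae_hasDerivAt_primitive (c := c) ha] with t ht htT
    exact ((hG (f t)).comp t (ht htT)).deriv
  have h2 : ∫ t in 0..T, deriv (fun t => G (f t)) t = ∫ t in 0..T, G' (f t) * a t :=
    intervalIntegral.integral_congr_ae (by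
      filter_upwards [hae] with t ht htT
      exact ht (uIoc_subset_uIcc htT))
  refine ⟨ha.continuousOn_mul (hG'.comp_continuousOn hcf), ?_⟩
  rw [h2] at h1
  have h3 : f 0 = c := by simp [hf]
  rw [h3] at h1
  change G (f T) = _
  linarith

/-- Product rule for primitives of integrable functions. -/
lemma primitive_mul_primitive_eq {b : ℝ → ℝ} {d : ℝ} (ha : IntervalIntegrable a volume 0 T)
    (hb : IntervalIntegrable b volume 0 T) :
    (c + ∫ s in 0..T, a s) * (d + ∫ s in 0..T, b s) = c * d
      + ∫ t in 0..T, (a t * (d + ∫ s in 0..t, b s)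
        + (c + ∫ s in 0..t, a s) * b t) := by
  have h1 := (absolutelyContinuousOnInterval_primitive (c := c) ha).integral_deriv_mul_eq_sub
    (absolutelyContinuousOnInterval_primitive (c := d) hb)
  simp only [intervalIntegral.integral_same, add_zero] at h1
  rw [← sub_eq_iff_eq_add', ← h1]
  refine intervalIntegral.integral_congr_ae ?_
  filter_upwards [ae_hasDerivAt_primitive (c := c) ha, ae_hasDerivAt_primitive (c := d) hb]
    with t h2 h3 htT
  rw [(h2 (uIoc_subset_uIcc htT)).deriv, (h3 (uIoc_subset_uIcc htT)).deriv]

lemma exists_Icc_of_isCompact_subset_Ioo (hT : 0 < T) {K : Set ℝ} (hK : IsCompact K)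
    (h : K ⊆ Ioo 0 T) : ∃ a b, 0 < a ∧ a ≤ b ∧ b < T ∧ K ⊆ Icc a b := by
  rcases K.eq_empty_or_nonempty with rfl | hne
  · exact ⟨T / 2, T / 2, by linarith, le_rfl, by linarith, empty_subset _⟩
  obtain ⟨a, ha, hmin⟩ := hK.exists_isMinOn hne continuousOn_id
  obtain ⟨b, hb, hmax⟩ := hK.exists_isMaxOn hne continuousOn_id
  exact ⟨a, b, (h ha).1, hmin hb, (h hb).2, fun x hx => ⟨hmin hx, hmax hx⟩⟩

/-- A test function of integral zero is the derivative of a test function. -/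
lemma exists_isTestOn_deriv_eq (hT : 0 < T) {φ : ℝ → ℝ} (hφ : IsTestOn (Ioo 0 T) φ)
    (h0 : ∫ t, φ t = 0) : ∃ θ, IsTestOn (Ioo 0 T) θ ∧ ∀ t, HasDerivAt θ (φ t) t := by
  obtain ⟨a, b, ha, hab, hb, hK⟩ := exists_Icc_of_isCompact_subset_Ioo hT hφ.2.1 hφ.2.2
  have hd : ∀ t, HasDerivAt (fun t => ∫ s in a..t, φ s) (φ t) t := fun t =>
    hφ.1.continuous.integral_hasStrictDerivAt a t |>.hasDerivAt
  have hz : ∀ t, t ∉ Icc a b → φ t = 0 := fun t ht => by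
    by_contra h
    exact ht (hK (subset_tsupport _ h))
  have hsupp : Function.support (fun t => ∫ s in a..t, φ s) ⊆ Icc a b := by
    intro t ht
    by_contra hn
    refine ht ?_
    rcases lt_or_ge t a with h | h
    · simp only
      rw [intervalIntegral.integral_symm, intervalIntegral_eq_Ioo h.le]
      rw [setIntegral_eq_zero_of_forall_eq_zero, neg_zero]
      exact fun x hx => hz x fun hx' => not_lt.2 hx'.1 hx.2
    · have hbt : b < t := by
        by_contra hle
        exact hn ⟨h, not_lt.1 hle⟩
      simp only
      rw [integral_of_le h, ← integral_Icc_eq_integral_Ioc,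
        setIntegral_eq_integral_of_forall_compl_eq_zero]
      · exact h0
      · exact fun x hx => hz x fun hx' => hx ⟨hx'.1, hx'.2.trans hbt.le⟩
  have hts : tsupport (fun t => ∫ s in a..t, φ s) ⊆ Icc a b := closure_minimal hsupp isClosed_Icc
  refine ⟨fun t => ∫ s in a..t, φ s, ⟨?_, ?_, ?_⟩, hd⟩
  · rw [contDiff_infty_iff_deriv]
    refine ⟨fun t => (hd t).differentiableAt, ?_⟩
    rw [show deriv (fun t => ∫ s in a..t, φ s) = φ from funext fun t => (hd t).deriv]
    exact hφ.1
  · exact HasCompactSupport.of_support_subset_isCompact isCompact_Icc hsupp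
  · exact hts.trans fun x hx => ⟨lt_of_lt_of_le ha hx.1, lt_of_le_of_lt hx.2 hb⟩

lemma exists_isTestOn_integral_eq_one (hT : 0 < T) : ∃ θ, IsTestOn (Ioo 0 T) θ ∧ ∫ t, θ t = 1 := by
  let φ : ContDiffBump (T / 2) := ⟨T / 8, T / 4, by linarith, by linarith⟩
  refine ⟨φ.normed volume, ⟨φ.contDiff_normed, φ.hasCompactSupport_normed, ?_⟩, φ.integral_normed⟩
  rw [φ.tsupport_normed_eq, Real.closedBall_eq_Icc]
  intro x hx
  have h1 := hx.1
  have h2 := hx.2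
  change T / 2 - T / 4 ≤ x at h1
  change x ≤ T / 2 + T / 4 at h2
  constructor <;> linarith

/-- A function with an integrable weak derivative is a primitive. -/
lemma exists_ae_eq_primitive (hT : 0 < T) {h : ℝ → ℝ} (hh : IntegrableOn h (Ioo 0 T))
    (ha : IntegrableOn a (Ioo 0 T))
    (hw : ∀ φ, IsTestOn (Ioo 0 T) φ → ∫ t in Ioo 0 T, h t * fderiv ℝ φ t 1 = - ∫ t in Ioo 0 T,
      a t * φ t) :
    ∃ c, ∀ᵐ t ∂dt(T), h t = c + ∫ s in 0..t, a s := by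
  have hai : IntervalIntegrable a volume 0 T := by
    rw [intervalIntegrable_iff_integrableOn_Ioo_of_le hT.le]; exact ha
  set A := fun t => ∫ s in 0..t, a s with hA
  have hAc : ContinuousOn A (uIcc 0 T) := by
    simpa using (absolutelyContinuousOnInterval_primitive (c := 0) hai).continuousOn
  have hAi : IntegrableOn A (Ioo 0 T) := (hAc.integrableOn_compact isCompact_uIcc).mono_set (by
      rw [uIcc_of_le hT.le]; exact Ioo_subset_Icc_self)
  have hIoo : ∀ F : ℝ → ℝ, ∫ t in Ioo 0 T, F t = ∫ t in 0..T, F t := fun F => by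
    rw [intervalIntegral_eq_Ioo hT.le]
  have hbdd : ∀ {F : ℝ → ℝ}, IntegrableOn F (Ioo 0 T) → ∀ {ψ : ℝ → ℝ}, Continuous ψ →
      HasCompactSupport ψ → IntegrableOn (fun t => F t * ψ t) (Ioo 0 T) := by
    intro F hF ψ hψ hψc
    obtain ⟨C, hC⟩ := hψ.bounded_above_of_compact_support hψc
    exact hF.mul_bdd hψ.aestronglyMeasurable (.of_forall hC)
  have hz : ∀ {φ : ℝ → ℝ}, IsTestOn (Ioo 0 T) φ → φ 0 = 0 ∧ φ T = 0 := fun hφ =>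
    ⟨hφ.eq_zero (by simp), hφ.eq_zero (by simp)⟩
  have hAw : ∀ φ, IsTestOn (Ioo 0 T) φ →
      ∫ t in Ioo 0 T, A t * fderiv ℝ φ t 1 = - ∫ t in Ioo 0 T, a t * φ t := by
    intro φ hφ
    have hφi : IntervalIntegrable (fun t => fderiv ℝ φ t 1) volume 0 T :=
      (hφ.continuous_fderiv 1).intervalIntegrable _ _
    have e : ∀ t, ∫ s in 0..t, fderiv ℝ φ s 1 = φ t := fun t => by
      rw [intervalIntegral.integral_eq_sub_of_hasDerivAt (f := φ) (f' := fun s => fderiv ℝ φ s 1)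
        (fun s _ => (hφ.1.differentiable (by simp) s).hasDerivAt)
        ((hφ.continuous_fderiv 1).intervalIntegrable _ _), (hz hφ).1, sub_zero]
    have h1 := primitive_mul_primitive_eq (c := 0) (d := 0) hai hφi
    simp only [e, zero_add, mul_zero, (hz hφ).2] at h1
    rw [intervalIntegral.integral_add] at h1
    · rw [hIoo, hIoo]; linarith
    · exact hai.mul_continuousOn hφ.continuous.continuousOn
    · exact hφi.continuousOn_mul hAc
  obtain ⟨θ₀, hθ₀, hθ₁⟩ := exists_isTestOn_integral_eq_one hT
  set c := ∫ t in Ioo 0 T, (h t - A t) * θ₀ t with hc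
  refine ⟨c, ?_⟩
  rw [ae_restrict_iff' measurableSet_Ioo]
  have hgi : IntegrableOn (fun t => h t - A t) (Ioo 0 T) := hh.sub hAi
  have := isOpen_Ioo.ae_eq_zero_of_integral_contDiff_smul_eq_zero (U := Ioo 0 T) (μ := volume)
    (f := fun t => (h t - A t) - c)
    ((hgi.sub (integrableOn_const (by simp))).locallyIntegrableOn) (fun ψ h1 h2 h3 => ?_)
  · filter_upwards [this] with t ht htT
    linarith [ht htT]
  have hψ : IsTestOn (Ioo 0 T) ψ := ⟨h1, h2, h3⟩
  have hψi : Integrable ψ := h1.continuous.integrable_of_hasCompactSupport h2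
  have hθi : Integrable θ₀ := hθ₀.1.continuous.integrable_of_hasCompactSupport hθ₀.2.1
  have htest : IsTestOn (Ioo 0 T) (fun t => ψ t - (∫ s, ψ s) * θ₀ t) := by
    refine ⟨h1.sub (contDiff_const.mul hθ₀.1), h2.sub hθ₀.2.1.mul_left, ?_⟩
    refine (tsupport_sub _ _).trans (union_subset h3 ?_)
    exact (closure_mono (Function.support_mul_subset_right _ _)).trans hθ₀.2.2
  obtain ⟨θ, hθ, hθd⟩ := exists_isTestOn_deriv_eq hT htest (by
    rw [integral_sub hψi (hθi.const_mul _), integral_const_mul, hθ₁]; ring)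
  have hfd : ∀ t, fderiv ℝ θ t 1 = ψ t - (∫ s, ψ s) * θ₀ t := fun t => (hθd t).deriv
  have h5 : ∫ t in Ioo 0 T, (h t - A t) * (ψ t - (∫ s, ψ s) * θ₀ t) = 0 := by
    simp only [← hfd, sub_mul]
    rw [integral_sub (hbdd hh (hθ.continuous_fderiv 1) (hθ.2.1.fderiv_apply ℝ 1))
      (hbdd hAi (hθ.continuous_fderiv 1) (hθ.2.1.fderiv_apply ℝ 1)), hw θ hθ, hAw θ hθ, sub_self]
  have h6 : ∫ t in Ioo 0 T, ψ t = ∫ t, ψ t :=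
    setIntegral_eq_integral_of_forall_compl_eq_zero fun t ht => hψ.eq_zero ht
  have h7 : ∫ t in Ioo 0 T, (h t - A t) * ψ t = (∫ s, ψ s) * c := by
    have e : ∀ t, (h t - A t) * (ψ t - (∫ s, ψ s) * θ₀ t)
        = (h t - A t) * ψ t - (∫ s, ψ s) * ((h t - A t) * θ₀ t) := fun t => by ring
    simp only [e] at h5
    rw [integral_sub (hbdd hgi h1.continuous h2)
      ((hbdd hgi hθ₀.1.continuous hθ₀.2.1).const_mul _), integral_const_mul] at h5
    linarith
  rw [← setIntegral_eq_integral_of_forall_compl_eq_zero (s := Ioo 0 T)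
    (fun t ht => by rw [hψ.eq_zero ht, zero_smul])]
  simp only [smul_eq_mul]
  have e : ∀ t, ψ t * (h t - A t - c) = (h t - A t) * ψ t - ψ t * c := fun t => by ring
  simp only [e]
  rw [integral_sub (hbdd hgi h1.continuous h2) (hψi.integrableOn.mul_const c), h7,
    integral_mul_const, h6, sub_self]

end OneDim

/-! ### Weak gradients in space -/

/-- The `j`-th coordinate vector. -/
abbrev bv (j : Fin 3) : E3 := EuclideanSpace.single j 1

/-- `g` is the weak gradient of `v` on `Ω`. -/
structure HasWeakGrad (Ω : Set E3) (v : E3 → ℝ) (g : Fin 3 → E3 → ℝ) : Prop where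
  integrableOn : ∀ K, IsCompact K → K ⊆ Ω → IntegrableOn v K
  integrableOn_grad : ∀ j K, IsCompact K → K ⊆ Ω → IntegrableOn (g j) K
  eq : ∀ j φ, IsTestOn Ω φ → ∫ x in Ω, v x * fderiv ℝ φ x (bv j) = - ∫ x in Ω, g j x * φ x

lemma fderiv_comp_const_sub (hk : Differentiable ℝ k) (y x v : E3) :
    fderiv ℝ (fun x => k (y - x)) x v = - fderiv ℝ k (y - x) v := by
  have h := ((hk (y - x)).hasFDerivAt).comp x ((hasFDerivAt_id x).const_sub y)
  have e : fderiv ℝ (fun x => k (y - x)) x = _ := h.fderiv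
  rw [e]
  simp

lemma isTestOn_comp_const_sub {S U : Set E3} (hk : ContDiff ℝ ∞ k) (hS : IsCompact S)
    (h : ∀ z, z ∉ S → k z = 0) {y : E3} (hU : ∀ z ∈ S, y - z ∈ U) :
    IsTestOn U (fun x => k (y - x)) := by
  have hc : IsCompact ((fun z => y - z) '' S) := hS.image (by fun_prop)
  have hsub : tsupport (fun x => k (y - x)) ⊆ (fun z => y - z) '' S := by
    refine closure_minimal (fun x hx => ?_) hc.isClosed
    refine ⟨y - x, ?_, by simp⟩
    by_contra hn
    exact hx (h _ hn)
  refine ⟨hk.comp (contDiff_const.sub contDiff_id), hc.of_isClosed_subset isClosed_closure hsub,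
    hsub.trans ?_⟩
  rintro _ ⟨z, hz, rfl⟩
  exact hU z hz

lemma exists_isKernel (hε : 0 < ε) : ∃ k, IsKernel k ε := by
  let φ : ContDiffBump (0 : E3) := ⟨ε / 2, ε, by linarith, by linarith⟩
  exact ⟨φ.normed volume, isKernel_normed φ (by simp [φ])⟩

lemma IsKernel.isTestOn (hk : IsKernel k ε) {y : E3} {U : Set E3} (hU : closedBall y ε ⊆ U) :
    IsTestOn U (fun x => k (y - x)) := by
  refine isTestOn_comp_const_sub hk.contDiff (isCompact_closedBall (0 : E3) ε)
    (fun z hz => hk.eq_zero z (by simpa using hz)) (fun z hz => hU ?_)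
  simpa using hz

lemma HasWeakGrad.fderiv_mollify_eq {K' : Set E3} {g : Fin 3 → E3 → ℝ} (hv : HasWeakGrad Ω v g)
    (hK' : IsCompact K') (hK'Ω : K' ⊆ Ω) (hΩ : MeasurableSet Ω) (hk : IsKernel k ε) {y : E3}
    (hy : closedBall y ε ⊆ K') (j : Fin 3) :
    fderiv ℝ (mollify k (K'.indicator v)) y (bv j) = mollify k (K'.indicator (g j)) y := by
  have hvi : Integrable (K'.indicator v) :=
    (integrable_indicator_iff hK'.measurableSet).2 (hv.integrableOn K' hK' hK'Ω)
  rw [fderiv_mollify hk hvi.locallyIntegrable, mollify]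
  have h := hv.eq j _ (hk.isTestOn (hy.trans hK'Ω))
  have e0 : ∀ x, x ∉ K' → k (y - x) = 0 ∧ fderiv ℝ k (y - x) = 0 := by
    intro x hx
    have hx' : ε < ‖y - x‖ := by
      by_contra h'
      refine hx (hy ?_)
      rw [Metric.mem_closedBall, dist_eq_norm, norm_sub_rev]
      exact not_lt.1 h'
    refine ⟨hk.eq_zero _ hx', ?_⟩
    have : k =ᶠ[𝓝 (y - x)] fun _ => 0 := by
      filter_upwards [(isOpen_lt continuous_const continuous_norm).mem_nhds hx'] with z hz
      exact hk.eq_zero z hz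
    rw [this.fderiv_eq]
    simp
  have e1 : ∫ x, K'.indicator v x * fderiv ℝ k (y - x) (bv j)
      = - ∫ x in Ω, v x * fderiv ℝ (fun x => k (y - x)) x (bv j) := by
    rw [← integral_neg, ← integral_indicator hΩ]
    refine integral_congr_ae (.of_forall fun x => ?_)
    simp only [fderiv_comp_const_sub (hk.contDiff.differentiable (by simp))]
    by_cases hx : x ∈ K'
    · simp [hx, hK'Ω hx]
    · simp only [(e0 x hx).2, indicator_of_notMem hx]
      by_cases hx' : x ∈ Ω <;> simp [hx', (e0 x hx).2]
  have e2 : ∫ x, K'.indicator (g j) x * k (y - x) = ∫ x in Ω, g j x * k (y - x) := by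
    rw [← integral_indicator hΩ]
    refine integral_congr_ae (.of_forall fun x => ?_)
    by_cases hx : x ∈ K'
    · simp [hx, hK'Ω hx]
    · simp only [indicator_of_notMem hx, zero_mul]
      by_cases hx' : x ∈ Ω <;> simp [hx', (e0 x hx).1]
  rw [e1, e2, h, neg_neg]

lemma tendsto_integral_mul_of_eLpNorm_one {f : ℕ → E3 → ℝ} {u : ℕ → E3 → ℝ}
    (hf : Tendsto (fun n => eLpNorm (fun x => f n x - F x) 1 volume) atTop (𝓝 0))
    (hfm : ∀ n, Integrable (fun x => f n x - F x)) (hu : ∀ n x, |u n x| ≤ C) :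
    Tendsto (fun n => ∫ x, u n x * (f n x - F x)) atTop (𝓝 0) := by
  have hC : 0 ≤ C := (abs_nonneg _).trans (hu 0 0)
  have h1 : Tendsto (fun n => C * (eLpNorm (fun x => f n x - F x) 1 volume).toReal) atTop
    (𝓝 0) := by
    have := ((ENNReal.tendsto_toReal ENNReal.zero_ne_top).comp hf).const_mul C
    simpa using this
  refine squeeze_zero_norm (fun n => ?_) h1
  rw [toReal_eLpNorm (hfm n).1, lpNorm_one_eq_integral_norm (hfm n).1, ← integral_const_mul]
  refine norm_integral_le_of_norm_le ((hfm n).norm.const_mul C) (.of_forall fun x => ?_)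
  rw [norm_mul]
  exact mul_le_mul_of_nonneg_right (hu n x) (norm_nonneg _)

/-- Chain rule for weak gradients. -/
lemma HasWeakGrad.comp (hΩ : IsOpen Ω) {g : Fin 3 → E3 → ℝ} (hv : HasWeakGrad Ω v g)
    (hG : ∀ x, HasDerivAt G (G' x) x) (hG' : Continuous G') (hC : ∀ x, |G' x| ≤ C) :
    HasWeakGrad Ω (fun x => G (v x)) (fun j x => G' (v x) * g j x) := by
  have hC0 : 0 ≤ C := (abs_nonneg _).trans (hC 0)
  have hGc : Continuous G := continuous_iff_continuousAt.2 fun x => (hG x).continuousAt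
  have hLip : ∀ x y, |G x - G y| ≤ C * |x - y| := fun x y =>
    convex_univ.norm_image_sub_le_of_norm_hasDerivWithin_le (f := G)
      (fun x _ => (hG x).hasDerivWithinAt) (fun x _ => hC x) (mem_univ y) (mem_univ x)
  have hvm : ∀ K, IsCompact K → K ⊆ Ω → AEStronglyMeasurable v dx(K) :=
    fun K h1 h2 => (hv.integrableOn K h1 h2).1
  refine ⟨fun K h1 h2 => ?_, fun j K h1 h2 => ?_, fun j φ hφ => ?_⟩
  · have i1 : IntegrableOn (fun x => C * |v x| + |G 0|) K :=
      ((hv.integrableOn K h1 h2).norm.const_mul C).add (integrableOn_const h1.measure_lt_top.ne)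
    refine i1.mono' (hGc.comp_aestronglyMeasurable (hvm K h1 h2)) (.of_forall fun x => ?_)
    have := hLip (v x) 0
    rw [sub_zero] at this
    rw [Real.norm_eq_abs]
    have h3 := abs_add_le (G (v x) - G 0) (G 0)
    rw [sub_add_cancel] at h3
    linarith
  · exact (hv.integrableOn_grad j K h1 h2).bdd_mul
      (hG'.comp_aestronglyMeasurable (hvm K h1 h2)) (.of_forall fun x => hC _)
  · obtain ⟨δ, hδ, hsub⟩ := hφ.2.1.exists_cthickening_subset_open hΩ hφ.2.2
    set K := tsupport φ
    set K' := Metric.cthickening δ K with hK'def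
    have hK' : IsCompact K' := hφ.2.1.cthickening
    have hKK' : K ⊆ K' := Metric.self_subset_cthickening _
    have hvi : Integrable (K'.indicator v) :=
      (integrable_indicator_iff hK'.measurableSet).2 (hv.integrableOn K' hK' hsub)
    have hgi : Integrable (K'.indicator (g j)) :=
      (integrable_indicator_iff hK'.measurableSet).2 (hv.integrableOn_grad j K' hK' hsub)
    set ε : ℕ → ℝ := fun n => δ / (n + 1) with hε
    have hε0 : ∀ n, 0 < ε n := fun n => by positivity
    have hεt : Tendsto ε atTop (𝓝 0) :=
      tendsto_const_nhds.div_atTop (tendsto_natCast_atTop_atTop.atTop_add tendsto_const_nhds)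
    choose k hk using fun n => exists_isKernel (hε0 n)
    have hcv := tendsto_eLpNorm_mollify_sub hk hεt hvi
    have hcg := tendsto_eLpNorm_mollify_sub hk hεt hgi
    have hmi : ∀ n {F : E3 → ℝ}, Integrable F → Integrable (mollify (k n) F) := fun n F hF =>
      hF.integrable_convolution (ContinuousLinearMap.mul ℝ ℝ) (hk n).integrable
    have hmeas := tendstoInMeasure_of_tendsto_eLpNorm (p := 1) (f := fun n => mollify (k n)
      (K'.indicator v)) (g := K'.indicator v) one_ne_zero (fun n => (hmi n hvi).1) hvi.1 hcv
    obtain ⟨ns, hns, hae⟩ := hmeas.exists_seq_tendsto_ae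
    set V : ℕ → E3 → ℝ := fun n => mollify (k (ns n)) (K'.indicator v) with hV
    set W : ℕ → E3 → ℝ := fun n => mollify (k (ns n)) (K'.indicator (g j)) with hW
    have hVs : ∀ n, ContDiff ℝ ∞ (V n) := fun n => contDiff_mollify (hk _) hvi.locallyIntegrable
    have hVW : ∀ n, ∀ y ∈ K, fderiv ℝ (V n) y (bv j) = W n y := fun n y hy =>
      hv.fderiv_mollify_eq hK' hsub hΩ.measurableSet (hk _)
        ((Metric.closedBall_subset_closedBall (by
          simp only [hε]
          exact div_le_self hδ.le (by linarith [Nat.cast_nonneg (α := ℝ) (ns n)]))).trans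
          (Metric.closedBall_subset_cthickening hy δ)) j
    have hφc := hφ.continuous
    have hφ'c := hφ.continuous_fderiv (bv j)
    obtain ⟨M, hM⟩ := hφc.bounded_above_of_compact_support hφ.2.1
    obtain ⟨M', hM'⟩ := hφ'c.bounded_above_of_compact_support (hφ.2.1.fderiv_apply ℝ (bv j))
    -- the identity for the mollified functions
    have hid : ∀ n, ∫ x, G (V n x) * fderiv ℝ φ x (bv j) = - ∫ x, G' (V n x) * W n x * φ x := by
      intro n
      have hd : ∀ x, HasFDerivAt (fun x => G (V n x)) (G' (V n x) • fderiv ℝ (V n) x) x :=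
        fun x => (hG (V n x)).comp_hasFDerivAt x ((hVs n).differentiable (by simp) x).hasFDerivAt
      have hVc := (hVs n).continuous
      have hV'c : Continuous (fun x => fderiv ℝ (V n) x (bv j)) :=
        ((hVs n).continuous_fderiv (by simp)).clm_apply continuous_const
      have h1 := integral_mul_fderiv_eq_neg_fderiv_mul_of_integrable (μ := (volume : Measure E3))
        (f := fun x => G (V n x)) (g := φ) (v := bv j)
        (by
          simp only [(hd _).fderiv, _root_.smul_apply, smul_eq_mul]
          exact (((hG'.comp hVc).mul hV'c).mul hφc).integrable_of_hasCompactSupport hφ.2.1.mul_left)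
        (((hGc.comp hVc).mul hφ'c).integrable_of_hasCompactSupport
            (hφ.2.1.fderiv_apply ℝ (bv j)).mul_left)
        (((hGc.comp hVc).mul hφc).integrable_of_hasCompactSupport hφ.2.1.mul_left)
        (fun x _ => (hd x).differentiableAt) (fun x _ => hφ.1.differentiable (by simp) x)
      rw [h1]
      congr 1
      refine integral_congr_ae (.of_forall fun x => ?_)
      simp only [(hd x).fderiv, _root_.smul_apply, smul_eq_mul]
      by_cases hx : x ∈ K
      · rw [hVW n x hx]
      · rw [image_eq_zero_of_notMem_tsupport hx]; simp
    -- limit of the left-hand side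
    have hGi : Integrable (fun x => G (K'.indicator v x) * fderiv ℝ φ x (bv j)) := by
      have : Integrable (fun x => (C * |K'.indicator v x| * M' +
          |G 0| * |fderiv ℝ φ x (bv j)|)) :=
        ((hvi.norm.const_mul C).mul_const M').add
          ((hφ'c.integrable_of_hasCompactSupport (hφ.2.1.fderiv_apply ℝ (bv j))).norm.const_mul _)
      refine this.mono' ((hGc.comp_aestronglyMeasurable hvi.1).mul hφ'c.aestronglyMeasurable)
        (.of_forall fun x => ?_)
      have h3 := hLip (K'.indicator v x) 0
      rw [sub_zero] at h3
      have h4 := abs_add_le (G (K'.indicator v x) - G 0) (G 0)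
      rw [sub_add_cancel] at h4
      rw [norm_mul]
      have h5 := hM' x
      simp only [Real.norm_eq_abs] at h5 ⊢
      calc _ ≤ (C * |K'.indicator v x| + |G 0|) * |fderiv ℝ φ x (bv j)| := by
            exact mul_le_mul_of_nonneg_right (by linarith) (abs_nonneg _)
        _ = C * |K'.indicator v x| * |fderiv ℝ φ x (bv j)| + |G 0| * |fderiv ℝ φ x (bv j)| := by
            ring
        _ ≤ _ := by
            have : 0 ≤ C * |K'.indicator v x| := by positivity
            gcongr
    have hVi : ∀ n, Integrable (fun x => V n x - K'.indicator v x) := fun n => (hmi _ hvi).sub hvi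
    have hWi : ∀ n, Integrable (fun x => W n x - K'.indicator (g j) x) := fun n =>
      (hmi _ hgi).sub hgi
    have hL : Tendsto (fun n => ∫ x, G (V n x) * fderiv ℝ φ x (bv j)) atTop
        (𝓝 (∫ x, G (K'.indicator v x) * fderiv ℝ φ x (bv j))) := by
      rw [tendsto_iff_norm_sub_tendsto_zero]
      have hb : Tendsto (fun n => C * M' * ∫ x, ‖V n x - K'.indicator v x‖) atTop (𝓝 0) := by
        have := ((ENNReal.tendsto_toReal ENNReal.zero_ne_top).comp
          (hcv.comp hns.tendsto_atTop)).const_mul (C * M')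
        simp only [ENNReal.toReal_zero, mul_zero] at this
        refine this.congr fun n => ?_
        simp only [Function.comp]
        rw [toReal_eLpNorm (hVi n).1, lpNorm_one_eq_integral_norm (hVi n).1]
      refine squeeze_zero (fun n => norm_nonneg _) (fun n => ?_) hb
      have hVc := (hVs n).continuous
      have i1 : Integrable (fun x => G (V n x) * fderiv ℝ φ x (bv j)) :=
        ((hGc.comp hVc).mul hφ'c).integrable_of_hasCompactSupport
            (hφ.2.1.fderiv_apply ℝ (bv j)).mul_left
      rw [← integral_sub i1 hGi, ← integral_const_mul]
      refine norm_integral_le_of_norm_le ((hVi n).norm.const_mul _) (.of_forall fun x => ?_)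
      rw [← sub_mul, norm_mul]
      have h3 := hLip (V n x) (K'.indicator v x)
      have h4 := hM' x
      simp only [Real.norm_eq_abs] at h4 ⊢
      calc _ ≤ C * |V n x - K'.indicator v x| * M' := by gcongr
        _ = _ := by ring
    -- limit of the right-hand side
    have hR : Tendsto (fun n => ∫ x, G' (V n x) * W n x * φ x) atTop
        (𝓝 (∫ x, G' (K'.indicator v x) * K'.indicator (g j) x * φ x)) := by
      have h1 := tendsto_integral_mul_of_eLpNorm_one (C := C * M)
        (u := fun n x => G' (V n x) * φ x) (f := W) (F := K'.indicator (g j))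
        (hcg.comp hns.tendsto_atTop) hWi (fun n x => by
          rw [abs_mul]
          exact mul_le_mul (hC _) (hM x) (abs_nonneg _) hC0)
      have h2 : Tendsto (fun n => ∫ x, G' (V n x) * φ x * K'.indicator (g j) x) atTop
          (𝓝 (∫ x, G' (K'.indicator v x) * φ x * K'.indicator (g j) x)) := by
        refine tendsto_integral_of_dominated_convergence
          (fun x => C * M * |K'.indicator (g j) x|) (fun n => ?_) (hgi.norm.const_mul _)
          (fun n => .of_forall fun x => ?_) ?_
        · exact ((hG'.comp (hVs n).continuous).mul hφc).aestronglyMeasurable.mul hgi.1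
        · rw [norm_mul, norm_mul]
          exact mul_le_mul_of_nonneg_right (mul_le_mul (hC _) (hM x) (norm_nonneg _) hC0)
            (norm_nonneg _)
        · filter_upwards [hae] with x hx
          exact (((hG'.tendsto _).comp hx).mul_const _).mul_const _
      have h3 := h1.add h2
      rw [zero_add] at h3
      have e : ∀ x, G' (K'.indicator v x) * K'.indicator (g j) x * φ x
          = G' (K'.indicator v x) * φ x * K'.indicator (g j) x := fun x => by ring
      simp only [e]
      refine h3.congr fun n => ?_
      have hbd : ∀ x, ‖G' (V n x) * φ x‖ ≤ C * M := fun x => by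
        rw [norm_mul]
        exact mul_le_mul (hC _) (hM x) (norm_nonneg _) hC0
      have hm := ((hG'.comp (hVs n).continuous).mul hφc).aestronglyMeasurable
        (μ := (volume : Measure E3))
      have i1 : Integrable (fun x => G' (V n x) * φ x * (W n x - K'.indicator (g j) x)) :=
        (hWi n).bdd_mul hm (.of_forall hbd)
      have i2 : Integrable (fun x => G' (V n x) * φ x * K'.indicator (g j) x) :=
        hgi.bdd_mul hm (.of_forall hbd)
      rw [← integral_add i1 i2]
      refine integral_congr_ae (.of_forall fun x => ?_)
      ring
    have hlim := tendsto_nhds_unique (hL.congr hid) hR.neg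
    have e1 : ∫ x in Ω, G (v x) * fderiv ℝ φ x (bv j)
        = ∫ x, G (K'.indicator v x) * fderiv ℝ φ x (bv j) := by
      rw [← integral_indicator hΩ.measurableSet]
      refine integral_congr_ae (.of_forall fun x => ?_)
      by_cases hx : x ∈ K
      · simp [hKK' hx, hφ.2.2 hx]
      · have : fderiv ℝ φ x = 0 := by
          by_contra h; exact hx (support_fderiv_subset ℝ h)
        by_cases hx' : x ∈ Ω <;> simp [this, hx']
    have e2 : ∫ x in Ω, G' (v x) * g j x * φ x
        = ∫ x, G' (K'.indicator v x) * K'.indicator (g j) x * φ x := by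
      rw [← integral_indicator hΩ.measurableSet]
      refine integral_congr_ae (.of_forall fun x => ?_)
      by_cases hx : x ∈ K
      · simp [hKK' hx, hφ.2.2 hx]
      · have : φ x = 0 := image_eq_zero_of_notMem_tsupport hx
        by_cases hx' : x ∈ Ω <;> simp [this, hx']
    rw [e1, e2]
    exact hlim

/-! ### The uniform cone property -/

lemma subset_of_disjoint_frontier {S : Set E3} (hS : IsPreconnected S) (hΩ : IsOpen Ω)
    (h : Disjoint S (frontier Ω)) (hne : (S ∩ Ω).Nonempty) : S ⊆ Ω := by
  have hcov : S ⊆ Ω ∪ (closure Ω)ᶜ := by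
    intro x hx
    by_cases hx' : x ∈ Ω
    · exact Or.inl hx'
    · refine Or.inr fun hc => disjoint_left.1 h hx ?_
      exact ⟨hc, by rwa [hΩ.interior_eq]⟩
  have hd : Disjoint Ω (closure Ω)ᶜ := disjoint_left.2 fun x hx hx' => hx' (subset_closure hx)
  rcases hS.subset_or_subset hΩ isClosed_closure.isOpen_compl hd hcov with h1 | h1
  · exact h1
  · obtain ⟨x, hx, hx'⟩ := hne
    exact absurd (subset_closure hx') (h1 hx)

/-- A domain with uniformly Lipschitz boundary has the uniform interior cone property. -/
lemma UniformlyLipschitzBoundary.exists_cone (hΩ : IsOpen Ω) (hL : UniformlyLipschitzBoundary Ω) :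
    ∃ h δ : ℝ, 0 < h ∧ 0 < δ ∧ δ ≤ 1 ∧ ∀ x₀ : E3, ∃ e : E3, ‖e‖ ≤ 1 ∧
      ∀ y ∈ Ω ∩ ball x₀ h, ∀ s ∈ Ioc 0 h, ∀ b : E3, ‖b‖ ≤ δ → y + s • (e + b) ∈ Ω := by
  obtain ⟨r, L, hr, H⟩ := hL
  have hL0 : (0 : ℝ) ≤ L := L.2
  set δ : ℝ := 1 / (2 * (1 + L)) with hδdef
  have hδ : 0 < δ := by positivity
  have hδL : (1 + L) * δ = 1 / 2 := by rw [hδdef]; field_simp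
  have hδ1 : δ ≤ 1 / 2 := by nlinarith
  refine ⟨r / 8, δ, by positivity, hδ, by linarith, fun x₀ => ?_⟩
  by_cases hx : ∃ x ∈ frontier Ω, dist x x₀ < r / 2
  · obtain ⟨x, hxf, hxd⟩ := hx
    obtain ⟨A, g, hg, hA⟩ := H x hxf
    refine ⟨A.symm (EuclideanSpace.single 2 1), by simp, fun y hy s hs b hb => ?_⟩
    have hy1 : dist y x₀ < r / 8 := hy.2
    have hyx : dist y x < 5 / 8 * r := by
      have := dist_triangle y x₀ x
      rw [dist_comm x₀ x] at this
      linarith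
    have hz : ‖s • (A.symm (EuclideanSpace.single 2 1) + b)‖ ≤ r / 4 := by
      rw [norm_smul, Real.norm_eq_abs, abs_of_pos hs.1]
      have h1 := norm_add_le (A.symm (EuclideanSpace.single 2 1)) b
      have h2 : ‖A.symm (EuclideanSpace.single 2 (1 : ℝ))‖ = 1 := by simp
      rw [h2] at h1
      have h3 : ‖A.symm (EuclideanSpace.single 2 (1 : ℝ)) + b‖ ≤ 2 := by linarith
      calc s * ‖A.symm (EuclideanSpace.single 2 (1 : ℝ)) + b‖ ≤ r / 8 * 2 :=
            mul_le_mul hs.2 h3 (norm_nonneg _) (by positivity)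
        _ = r / 4 := by ring
    have hball : y + s • (A.symm (EuclideanSpace.single 2 1) + b) ∈ ball x r := by
      rw [Metric.mem_ball]
      have h1 := dist_triangle (y + s • (A.symm (EuclideanSpace.single 2 1) + b)) y x
      rw [dist_self_add_left] at h1
      linarith
    have hy2 := (hA y (Metric.mem_ball.2 (by linarith))).1 hy.1
    rw [hA _ hball]
    have e0 : A (y + s • (A.symm (EuclideanSpace.single 2 1) + b) - x)
        = A (y - x) + s • (EuclideanSpace.single 2 1 + A b) := by
      rw [add_sub_right_comm]
      simp
    rw [e0]
    have hAb : ∀ i, |(A b) i| ≤ δ := fun i => by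
      have := EuclideanSpace.norm_eq (A b)
      have h1 : ‖(A b) i‖ ≤ ‖A b‖ := PiLp.norm_apply_le _ _
      rw [A.norm_map] at h1
      exact h1.trans hb
    have hdist : dist (!₂[(A (y - x) + s • (EuclideanSpace.single 2 1 + A b) : E3) 0,
        (A (y - x) + s • (EuclideanSpace.single 2 1 + A b) : E3) 1] : EuclideanSpace ℝ (Fin 2))
        !₂[A (y - x) 0, A (y - x) 1] ≤ s * δ := by
      rw [EuclideanSpace.dist_eq]
      have hn := EuclideanSpace.norm_eq (A b)
      rw [A.norm_map, Fin.sum_univ_three] at hn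
      refine Real.sqrt_le_iff.2 ⟨by positivity [hs.1], ?_⟩
      have h2 : (A b) 0 ^ 2 + (A b) 1 ^ 2 ≤ δ ^ 2 := by
        have h3 : ‖b‖ ^ 2 = (A b) 0 ^ 2 + (A b) 1 ^ 2 + (A b) 2 ^ 2 := by
          rw [hn, Real.sq_sqrt (by positivity)]
          simp
        have h4 : ‖b‖ ^ 2 ≤ δ ^ 2 := by gcongr
        nlinarith [sq_nonneg ((A b) 2)]
      simp [Fin.sum_univ_two, Real.dist_eq, sq_abs]
      nlinarith [sq_nonneg s]
    have h5 := hg.dist_le_mul (!₂[(A (y - x) + s • (EuclideanSpace.single 2 1 + A b) : E3) 0,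
        (A (y - x) + s • (EuclideanSpace.single 2 1 + A b) : E3) 1] : EuclideanSpace ℝ (Fin 2))
        !₂[A (y - x) 0, A (y - x) 1]
    have h6 : (L : ℝ) * dist (!₂[(A (y - x) + s • (EuclideanSpace.single 2 1 + A b) : E3) 0,
        (A (y - x) + s • (EuclideanSpace.single 2 1 + A b) : E3) 1] : EuclideanSpace ℝ (Fin 2))
        !₂[A (y - x) 0, A (y - x) 1] ≤ L * (s * δ) := mul_le_mul_of_nonneg_left hdist hL0
    rw [Real.dist_eq] at h5
    have h7 := (abs_le.1 (h5.trans h6)).2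
    have h8 : (A (y - x) + s • (EuclideanSpace.single 2 1 + A b) : E3) 2
        = A (y - x) 2 + s * (1 + (A b) 2) := by
      simp
      ring
    rw [h8]
    have h9 := (abs_le.1 (hAb 2)).1
    have h10 : L * (s * δ) < s * (1 + (A b) 2) := by
      have : L * δ < 1 + (A b) 2 := by nlinarith
      calc L * (s * δ) = s * (L * δ) := by ring
        _ < _ := mul_lt_mul_of_pos_left this hs.1
    linarith
  · push Not at hx
    refine ⟨0, by simp, fun y hy s hs b hb => ?_⟩
    have hsub : ball x₀ (r / 2) ⊆ Ω := by
      refine subset_of_disjoint_frontier (convex_ball _ _).isPreconnected hΩ ?_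
        ⟨y, Metric.ball_subset_ball (by linarith) hy.2, hy.1⟩
      refine disjoint_left.2 fun z hz hz' => ?_
      exact absurd (Metric.mem_ball.1 hz) (not_lt.2 (hx z hz'))
    refine hsub (Metric.mem_ball.2 ?_)
    have h1 := dist_triangle (y + s • (0 + b)) y x₀
    rw [dist_self_add_left, zero_add, norm_smul, Real.norm_eq_abs, abs_of_pos hs.1] at h1
    have h2 : s * ‖b‖ ≤ r / 8 * 1 :=
      mul_le_mul hs.2 (hb.trans (by linarith)) (norm_nonneg _) (by positivity)
    have h3 : dist y x₀ < r / 8 := hy.2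
    rw [zero_add]
    linarith

/-! ### Scaled kernels supported in a cone -/

/-- The kernel `κ`, scaled to size `s` and moved into the direction `e`. -/
def coneKernel (κ : E3 → ℝ) (e : E3) (s : ℝ) (z : E3) : ℝ := s⁻¹ ^ 3 * κ (s⁻¹ • z - e)

/-- The flux `z_j / s` times the cone kernel, whose divergence is minus the derivative of the
kernel in the scale. -/
def coneFlux (κ : E3 → ℝ) (e : E3) (j : Fin 3) (s : ℝ) (z : E3) : ℝ :=
  s⁻¹ * z j * coneKernel κ e s z

/-- The divergence of the flux, up to the factor `s⁻¹ ^ 4`, in the scaled variable. -/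
def coneDiv (κ : E3 → ℝ) (e : E3) (w : E3) : ℝ := 3 * κ (w - e) + fderiv ℝ κ (w - e) w

section Cone

variable {κ : E3 → ℝ} {e : E3}

lemma coneKernel_eq_zero (hκ : IsKernel κ δ) (hs : 0 < s) {z : E3}
    (hz : ∀ b : E3, ‖b‖ ≤ δ → z ≠ s • (e + b)) : coneKernel κ e s z = 0 := by
  have : κ (s⁻¹ • z - e) = 0 := by
    refine hκ.eq_zero _ ?_
    by_contra h
    refine hz _ (not_lt.1 h) ?_
    rw [add_sub_cancel, smul_smul, mul_inv_cancel₀ hs.ne', one_smul]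
  rw [coneKernel, this, mul_zero]

lemma contDiff_coneKernel (hκ : IsKernel κ δ) : ContDiff ℝ ∞ (coneKernel κ e s) :=
  contDiff_const.mul (hκ.contDiff.comp ((contDiff_id.const_smul _).sub contDiff_const))

lemma contDiff_coneFlux (hκ : IsKernel κ δ) (j : Fin 3) : ContDiff ℝ ∞ (coneFlux κ e j s) := by
  have : ContDiff ℝ ∞ (fun z : E3 => z j) := (EuclideanSpace.proj (𝕜 := ℝ) j : E3 →L[ℝ] ℝ).contDiff
  exact (contDiff_const.mul this).mul (contDiff_coneKernel hκ)

lemma norm_cone_le (he : ‖e‖ ≤ 1) (hδ : δ ≤ 1) (hs : 0 < s) {b : E3} (hb : ‖b‖ ≤ δ) :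
    ‖s • (e + b)‖ ≤ 2 * s := by
  rw [norm_smul, Real.norm_eq_abs, abs_of_pos hs]
  have := norm_add_le e b
  nlinarith

lemma isKernel_coneKernel (hκ : IsKernel κ δ) (he : ‖e‖ ≤ 1) (hδ : δ ≤ 1) (hs : 0 < s) :
    IsKernel (coneKernel κ e s) (2 * s) := by
  refine ⟨contDiff_coneKernel hκ, fun z => mul_nonneg (by positivity) (hκ.nonneg _), ?_,
    fun z hz => ?_⟩
  · have h1 := Measure.integral_comp_smul (volume : Measure E3) (fun w => κ (w - e)) s⁻¹
    simp only [coneKernel]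
    rw [integral_const_mul, h1, integral_sub_right_eq_self (fun w => κ w), hκ.integral_eq_one]
    simp only [finrank_euclideanSpace, Fintype.card_fin, smul_eq_mul, mul_one]
    rw [abs_of_pos (by positivity)]
    field_simp
  · refine coneKernel_eq_zero hκ hs fun b hb hzb => ?_
    have := norm_cone_le he hδ hs hb
    rw [← hzb] at this
    linarith

lemma hasFDerivAt_coneKernel (hκ : IsKernel κ δ) (z : E3) : HasFDerivAt (coneKernel κ e s)
      (s⁻¹ ^ 3 • (fderiv ℝ κ (s⁻¹ • z - e)).comp (s⁻¹ • ContinuousLinearMap.id ℝ E3)) z := by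
  have h1 : HasFDerivAt (fun z : E3 => s⁻¹ • z - e) (s⁻¹ • ContinuousLinearMap.id ℝ E3) z :=
    ((hasFDerivAt_id z).const_smul s⁻¹).sub_const e
  have h2 := ((hκ.contDiff.differentiable (by simp) (s⁻¹ • z - e)).hasFDerivAt).comp z h1
  exact h2.const_mul (s⁻¹ ^ 3)

lemma sum_coord_smul (z : E3) : ∑ j, z j • bv j = z := by
  ext i
  simp [bv, Pi.single_apply]

lemma sum_fderiv_coneFlux (hκ : IsKernel κ δ) (z : E3) :
    ∑ j, fderiv ℝ (coneFlux κ e j s) z (bv j) = s⁻¹ ^ 4 * coneDiv κ e (s⁻¹ • z) := by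
  have h : ∀ j, fderiv ℝ (coneFlux κ e j s) z (bv j) = s⁻¹ * coneKernel κ e s z
        + s⁻¹ * z j * (s⁻¹ ^ 4 * fderiv ℝ κ (s⁻¹ • z - e) (bv j)) := by
    intro j
    have h1 : HasFDerivAt (fun z : E3 => s⁻¹ * z j)
        (s⁻¹ • (EuclideanSpace.proj (𝕜 := ℝ) j : E3 →L[ℝ] ℝ)) z :=
      ((EuclideanSpace.proj (𝕜 := ℝ) j : E3 →L[ℝ] ℝ).hasFDerivAt).const_mul s⁻¹
    have h2 : HasFDerivAt (coneFlux κ e j s) _ z := h1.mul (hasFDerivAt_coneKernel hκ z)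
    rw [h2.fderiv]
    simp [bv]
    ring
  simp only [h, Finset.sum_add_distrib, Finset.sum_const, Finset.card_univ, Fintype.card_fin]
  have h3 : ∑ j, s⁻¹ * z j * (s⁻¹ ^ 4 * fderiv ℝ κ (s⁻¹ • z - e) (bv j))
      = s⁻¹ ^ 4 * fderiv ℝ κ (s⁻¹ • z - e) (s⁻¹ • z) := by
    have h4 : ∀ ℓ : E3 →L[ℝ] ℝ, ℓ z = ∑ j, z j * ℓ (bv j) := fun ℓ => by
      conv_lhs => rw [← sum_coord_smul z]
      simp [map_sum]
    rw [map_smul, h4, smul_eq_mul, Finset.mul_sum, Finset.mul_sum]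
    exact Finset.sum_congr rfl fun j _ => by ring
  rw [h3, coneDiv, coneKernel]
  simp
  ring

lemma hasDerivAt_coneKernel (hκ : IsKernel κ δ) (hs : 0 < s) (z : E3) :
    HasDerivAt (fun s => coneKernel κ e s z) (-(s⁻¹ ^ 4 * coneDiv κ e (s⁻¹ • z))) s := by
  have h0 : HasDerivAt (fun s : ℝ => s⁻¹) (-(s ^ 2)⁻¹) s := hasDerivAt_inv hs.ne'
  have h1 : HasDerivAt (fun s : ℝ => s⁻¹ • z - e) (-(s ^ 2)⁻¹ • z) s :=
    (h0.smul_const z).sub_const e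
  have h2 := ((hκ.contDiff.differentiable (by simp) (s⁻¹ • z - e)).hasFDerivAt).comp_hasDerivAt s h1
  have h3 := (h0.pow 3).mul h2
  refine h3.congr_deriv ?_
  simp only [coneDiv, map_smul, smul_eq_mul, Function.comp]
  simp
  field_simp
  ring

lemma continuous_coneDiv (hκ : IsKernel κ δ) : Continuous (coneDiv κ e) := by
  have h1 := hκ.contDiff.continuous
  have h2 := hκ.contDiff.continuous_fderiv (by simp)
  unfold coneDiv
  fun_prop

lemma coneDiv_eq_zero (hκ : IsKernel κ δ) {w : E3} (hw : δ < ‖w - e‖) : coneDiv κ e w = 0 := by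
  have h1 : κ =ᶠ[𝓝 (w - e)] fun _ => 0 := by
    filter_upwards [(isOpen_lt continuous_const continuous_norm).mem_nhds hw] with z hz
    exact hκ.eq_zero z hz
  rw [coneDiv, hκ.eq_zero _ hw, h1.fderiv_eq]
  simp

lemma exists_abs_coneDiv_le (hκ : IsKernel κ δ) : ∃ M, ∀ w, |coneDiv κ e w| ≤ M := by
  have hc : HasCompactSupport (coneDiv κ e) := by
    refine HasCompactSupport.of_support_subset_isCompact (isCompact_closedBall e δ) fun w hw => ?_
    by_contra hn
    exact hw (coneDiv_eq_zero hκ (by simpa [dist_eq_norm] using hn))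
  obtain ⟨M, hM⟩ := (continuous_coneDiv hκ).bounded_above_of_compact_support hc
  exact ⟨M, hM⟩

end Cone

/-! ### Morrey's inequality -/

lemma abs_integral_mul_le {ν : Measure α} {F G : α → ℝ} {p p' : ℝ≥0∞} [HolderTriple p p' 1]
    (hF : MemLp F p ν) (hG : MemLp G p' ν) :
    |∫ x, F x * G x ∂ν| ≤ (eLpNorm F p ν).toReal * (eLpNorm G p' ν).toReal := by
  have hmem : MemLp (F * G) 1 ν := hG.mul hF
  have h1 := eLpNorm_smul_le_mul_eLpNorm (p := p) (q := p') (r := 1) hG.1 hF.1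
  have h3 := toReal_mono (ENNReal.mul_ne_top hF.2.ne hG.2.ne) h1
  rw [ENNReal.toReal_mul] at h3
  rw [← Real.norm_eq_abs]
  refine le_trans ((norm_integral_le_integral_norm _).trans (le_of_eq ?_)) h3
  change _ = (eLpNorm (F * G) 1 ν).toReal
  rw [toReal_eLpNorm hmem.1, lpNorm_one_eq_integral_norm hmem.1]
  rfl

lemma integrableOn_mul_of_tsupport_subset (hv : ∀ K, IsCompact K → K ⊆ Ω → IntegrableOn v K)
    (hψ : Continuous ψ) (hc : HasCompactSupport ψ) (hs : tsupport ψ ⊆ Ω) :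
    IntegrableOn (fun x => v x * ψ x) Ω := by
  have h1 : IntegrableOn (fun x => v x * ψ x) (tsupport ψ) :=
    (hv _ hc hs).mul_continuousOn hψ.continuousOn hc
  refine ((integrableOn_iff_integrable_of_support_subset ?_).1 h1).integrableOn
  intro x hx
  by_contra h
  exact hx (by simp [image_eq_zero_of_notMem_tsupport h])

lemma eLpNorm_le_of_bound_closedBall {f : E3 → ℝ} {R : ℝ} {y : E3} (hR : 0 ≤ R)
    (hB : ∀ x, |f x| ≤ B) (h0 : ∀ x ∉ closedBall y R, f x = 0) (p : ℝ≥0∞) :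
    eLpNorm f p volume ≤ (ofReal (R ^ 3) * volume (ball (0 : E3) 1)) ^ p.toReal⁻¹ * ofReal B := by
  have e : f = (closedBall y R).indicator f := by
    ext x
    by_cases hx : x ∈ closedBall y R
    · rw [indicator_of_mem hx]
    · rw [indicator_of_notMem hx, h0 x hx]
  rw [e, eLpNorm_indicator_eq_eLpNorm_restrict Metric.isClosed_closedBall.measurableSet]
  have h1 := eLpNorm_le_of_ae_bound (p := p) (μ := volume.restrict (closedBall y R))
    (f := f) (C := B) (.of_forall hB)
  rw [Measure.restrict_apply_univ, Measure.addHaar_closedBall _ _ hR] at h1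
  simpa using h1

section Cone

variable {κ : E3 → ℝ} {e : E3} {h : ℝ} {y : E3} {g : Fin 3 → E3 → ℝ}

lemma isTestOn_of_cone (hΩ : ∀ b : E3, ‖b‖ ≤ δ → y + s • (e + b) ∈ Ω) (hk : ContDiff ℝ ∞ k)
    (h0 : ∀ z : E3, (∀ b : E3, ‖b‖ ≤ δ → z ≠ s • (e + b)) → k z = 0) :
    IsTestOn Ω (fun x => k (x - y)) := by
  have hS : IsCompact ((fun b : E3 => -(s • (e + b))) '' closedBall 0 δ) :=
    (isCompact_closedBall _ _).image (by fun_prop)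
  have := isTestOn_comp_const_sub (k := fun z => k (-z)) (U := Ω) (y := y)
    (hk.comp contDiff_neg) hS (fun z hz => h0 _ fun b hb hzb => hz
      ⟨b, by simpa using hb, by simp [← hzb]⟩) (by
      rintro _ ⟨b, hb, rfl⟩
      rw [sub_neg_eq_add]
      exact hΩ b (by simpa using hb))
  simpa using this

lemma fderiv_comp_sub_const (k : E3 → ℝ) (y x : E3) :
    fderiv ℝ (fun x => k (x - y)) x = fderiv ℝ k (x - y) := by
  rw [fderiv_comp_sub]

lemma cone_average_sub (hκ : IsKernel κ δ) (hΩo : IsOpen Ω) (hv : HasWeakGrad Ω v g) (hs : 0 < s)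
    (hsh : s ≤ h)
    (hΩ : ∀ t ∈ Ioc 0 h, ∀ b : E3, ‖b‖ ≤ δ → y + t • (e + b) ∈ Ω) :
    (∫ x in Ω, v x * coneKernel κ e h (x - y)) - ∫ x in Ω, v x * coneKernel κ e s (x - y)
      = ∫ t in s..h, ∑ j, ∫ x in Ω, g j x * coneFlux κ e j t (x - y) := by
  set Kc : Set E3 := (fun z : ℝ × E3 => y + z.1 • (e + z.2)) '' (Icc s h ×ˢ closedBall 0 δ)
    with hKcdef
  have hKc : IsCompact Kc := (isCompact_Icc.prod (isCompact_closedBall _ _)).image (by fun_prop)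
  have hKcΩ : Kc ⊆ Ω := by
    rintro _ ⟨⟨t, b⟩, ⟨ht, hb⟩, rfl⟩
    exact hΩ t ⟨hs.trans_le ht.1, ht.2⟩ b (by simpa using hb)
  have hout : ∀ x ∉ Kc, ∀ t ∈ Icc s h, ∀ b : E3, ‖b‖ ≤ δ → x - y ≠ t • (e + b) := by
    intro x hx t ht b hb hxb
    exact hx ⟨(t, b), ⟨ht, by simpa using hb⟩, by simp [← hxb]⟩
  have hdiv0 : ∀ x ∉ Kc, ∀ t ∈ Icc s h, coneDiv κ e (t⁻¹ • (x - y)) = 0 := by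
    intro x hx t ht
    refine coneDiv_eq_zero hκ ?_
    by_contra hn
    have ht0 : t ≠ 0 := (hs.trans_le ht.1).ne'
    refine hout x hx t ht _ (not_lt.1 hn) ?_
    rw [add_sub_cancel, smul_smul, mul_inv_cancel₀ ht0, one_smul]
  have hset : ∀ f : E3 → ℝ, (∀ x ∉ Kc, f x = 0) → ∫ x in Ω, f x = ∫ x in Kc, f x := fun f hf =>
    setIntegral_eq_of_subset_of_forall_sdiff_eq_zero hΩo.measurableSet hKcΩ fun x hx => hf x hx.2
  have hsI : s ∈ Icc s h := ⟨le_rfl, hsh⟩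
  have hhI : h ∈ Icc s h := ⟨hsh, le_rfl⟩
  have hK0 : ∀ t ∈ Icc s h, ∀ x ∉ Kc, v x * coneKernel κ e t (x - y) = 0 := fun t ht x hx => by
    rw [coneKernel_eq_zero hκ (hs.trans_le ht.1) (hout x hx t ht), mul_zero]
  have hvK : IntegrableOn v Kc := hv.integrableOn Kc hKc hKcΩ
  have hKi : ∀ t ∈ Icc s h, IntegrableOn (fun x => v x * coneKernel κ e t (x - y)) Kc :=
    fun t ht => hvK.mul_continuousOn (((contDiff_coneKernel hκ).continuous.comp
      (continuous_id.sub continuous_const)).continuousOn) hKc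
  rw [hset _ (hK0 h hhI), hset _ (hK0 s hsI), ← integral_sub (hKi h hhI) (hKi s hsI)]
  obtain ⟨M, hM⟩ := exists_abs_coneDiv_le (e := e) hκ
  have hftc : ∀ x, v x * coneKernel κ e h (x - y) - v x * coneKernel κ e s (x - y)
      = ∫ t in s..h, -(v x * (t⁻¹ ^ 4 * coneDiv κ e (t⁻¹ • (x - y)))) := by
    intro x
    have hc : ContinuousOn (fun t : ℝ => t⁻¹) (uIcc s h) := by
      rw [uIcc_of_le hsh]
      exact continuousOn_inv₀.mono fun t ht => (hs.trans_le ht.1).ne'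
    have h1 := intervalIntegral.integral_eq_sub_of_hasDerivAt (a := s) (b := h)
      (f := fun t => v x * coneKernel κ e t (x - y))
      (f' := fun t => v x * -(t⁻¹ ^ 4 * coneDiv κ e (t⁻¹ • (x - y))))
      (fun t ht => by
        rw [uIcc_of_le hsh] at ht
        exact (hasDerivAt_coneKernel hκ (hs.trans_le ht.1) _).const_mul _)
      (by
        refine ContinuousOn.intervalIntegrable (continuousOn_const.mul ((hc.pow 4).mul
          ((continuous_coneDiv hκ).comp_continuousOn (hc.smul continuousOn_const))).neg))
    rw [← h1]
    simp only [mul_neg]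
  simp only [hftc]
  rw [← intervalIntegral_integral_swap]
  · refine intervalIntegral.integral_congr fun t ht => ?_
    rw [uIcc_of_le hsh] at ht
    have ht0 : 0 < t := hs.trans_le ht.1
    have htest : ∀ j, IsTestOn Ω (fun x => coneFlux κ e j t (x - y)) := fun j =>
      isTestOn_of_cone (hΩ t ⟨ht0, ht.2⟩) (contDiff_coneFlux hκ j) fun z hz => by
        rw [coneFlux, coneKernel_eq_zero hκ ht0 hz, mul_zero]
    have hsum : ∀ x, v x * (t⁻¹ ^ 4 * coneDiv κ e (t⁻¹ • (x - y)))
        = ∑ j, v x * fderiv ℝ (fun x => coneFlux κ e j t (x - y)) x (bv j) := by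
      intro x
      rw [← Finset.mul_sum, ← sum_fderiv_coneFlux hκ]
      simp only [fderiv_comp_sub_const]
    change ∫ x in Kc, -(v x * (t⁻¹ ^ 4 * coneDiv κ e (t⁻¹ • (x - y)))) = _
    rw [integral_neg, ← hset _ (fun x hx => by rw [hdiv0 x hx t ht]; simp)]
    simp only [hsum]
    rw [integral_finsetSum]
    · rw [← Finset.sum_neg_distrib]
      refine Finset.sum_congr rfl fun j _ => ?_
      rw [hv.eq j _ (htest j), neg_neg]
    · intro j _
      refine integrableOn_mul_of_tsupport_subset hv.integrableOn ((htest j).continuous_fderiv _)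
        ((htest j).2.1.fderiv_apply ℝ _) ?_
      exact (tsupport_fderiv_apply_subset ℝ _).trans (htest j).2.2
  · have hfin : IsFiniteMeasure (volume.restrict (uIoc s h)) :=
      ⟨by rw [Measure.restrict_apply_univ, uIoc]; exact measure_Ioc_lt_top⟩
    have hv2 : Integrable (fun z : ℝ × E3 => v z.2)
        ((volume.restrict (uIoc s h)).prod dx(Kc)) := hvK.comp_snd _
    have h3 : Integrable (fun z : ℝ × E3 => (z.1⁻¹ ^ 4 * coneDiv κ e (z.1⁻¹ • (z.2 - y))) * v z.2)
        ((volume.restrict (uIoc s h)).prod dx(Kc)) := by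
      refine hv2.bdd_mul (c := s⁻¹ ^ 4 * M) ?_ ?_
      · have hm : Measurable (fun z : ℝ × E3 => z.1⁻¹) := measurable_fst.inv
        refine Measurable.aestronglyMeasurable ((hm.pow_const 4).mul
          ((continuous_coneDiv hκ).measurable.comp (hm.smul (measurable_snd.sub_const y))))
      · have : ∀ᵐ t ∂(volume.restrict (uIoc s h)), t ∈ uIoc s h :=
          ae_restrict_mem measurableSet_uIoc
        have h4 := Measure.quasiMeasurePreserving_fst (μ := volume.restrict (uIoc s h))
          (ν := dx(Kc)) |>.ae this
        filter_upwards [h4] with z hz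
        rw [uIoc_of_le hsh] at hz
        have hz0 : 0 < z.1 := hs.trans hz.1
        rw [norm_mul, Real.norm_eq_abs, Real.norm_eq_abs, abs_of_pos (by positivity)]
        have : z.1⁻¹ ≤ s⁻¹ := inv_anti₀ hs hz.1.le
        exact mul_le_mul (by gcongr) (hM _) (abs_nonneg _) (by positivity)
    refine h3.neg.congr (.of_forall fun z => ?_)
    simp only [Pi.neg_apply, uncurry]
    ring

end Cone

lemma ae_of_forall_ball {h : ℝ} (hh : 0 < h) {P : E3 → Prop}
    (H : ∀ x₀, ∀ᵐ x ∂(volume.restrict (Ω ∩ ball x₀ h)), P x) : ∀ᵐ x ∂dx(Ω), P x := by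
  have hcov : Ω = ⋃ n, Ω ∩ ball (TopologicalSpace.denseSeq E3 n) h := by
    rw [← inter_iUnion]
    refine (inter_eq_left.2 fun x _ => ?_).symm
    obtain ⟨n, hn⟩ := (TopologicalSpace.denseRange_denseSeq E3).exists_dist_lt x hh
    exact mem_iUnion.2 ⟨n, hn⟩
  rw [hcov, ae_restrict_iUnion_iff]
  exact fun n => H _

lemma exists_morrey (hΩ : IsOpen Ω) (hL : UniformlyLipschitzBoundary Ω) (hq : 3 < q) {r r' : ℝ≥0∞}
    (hr : 1 ≤ r) [HolderTriple r r' 1] :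
    ∃ C : ℝ, 0 ≤ C ∧ ∀ (v : E3 → ℝ) (g : Fin 3 → E3 → ℝ), HasWeakGrad Ω v g →
      MemLp v r dx(Ω) → (∀ j, MemLp (g j) (ofReal q) dx(Ω)) →
      ∀ᵐ x ∂dx(Ω), |v x| ≤ C * ((eLpNorm v r dx(Ω)).toReal
        + ∑ j, (eLpNorm (g j) (ofReal q) dx(Ω)).toReal) := by
  obtain ⟨h, δ, hh, hδ, hδ1, hcone⟩ := hL.exists_cone hΩ
  obtain ⟨κ, hκ⟩ := exists_isKernel hδ
  obtain ⟨B, hB⟩ := hκ.contDiff.continuous.bounded_above_of_compact_support hκ.hasCompactSupport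
  have hB0 : 0 ≤ B := (norm_nonneg _).trans (hB 0)
  set V : ℝ := (volume (ball (0 : E3) 1)).toReal with hV
  have hVe : volume (ball (0 : E3) 1) = ofReal V := (ofReal_toReal measure_ball_lt_top.ne).symm
  have hV0 : 0 ≤ V := toReal_nonneg
  have hconj : Real.HolderConjugate q (q / (q - 1)) :=
    Real.HolderConjugate.conjExponent (by linarith)
  have : HolderTriple (ofReal q) (ofReal (q / (q - 1))) 1 := hconj.ennrealOfReal
  have hq' : (ofReal (q / (q - 1))).toReal⁻¹ = 1 - q⁻¹ := by
    rw [ENNReal.toReal_ofReal (div_nonneg (by linarith) (by linarith)), inv_div]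
    field_simp
  set C₁ : ℝ := ((ofReal ((2 * h) ^ 3) * volume (ball (0 : E3) 1)) ^ r'.toReal⁻¹
    * ofReal (h⁻¹ ^ 3 * B)).toReal with hC₁
  set c : ℝ := (8 * V) ^ (1 - q⁻¹) * (2 * B) with hc
  have hc0 : 0 ≤ c := by positivity
  have hq1 : 0 < 1 - 3 / q := by
    rw [sub_pos, div_lt_one (by linarith)]
    exact hq
  set C₂ : ℝ := c * (h ^ (1 - 3 / q) / (1 - 3 / q)) with hC₂
  have hC₂0 : 0 ≤ C₂ := by positivity
  refine ⟨C₁ + C₂, add_nonneg toReal_nonneg hC₂0, fun v g hv hvr hgq => ?_⟩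
  set N := (eLpNorm v r dx(Ω)).toReal
  set G := fun j => (eLpNorm (g j) (ofReal q) dx(Ω)).toReal with hG
  have hN0 : 0 ≤ N := toReal_nonneg
  have hG0 : 0 ≤ ∑ j, G j := Finset.sum_nonneg fun j _ => toReal_nonneg
  refine ae_of_forall_ball hh fun x₀ => ?_
  obtain ⟨e, he, hcone⟩ := hcone x₀
  have hKb : ∀ s, 0 < s → ∀ z, |coneKernel κ e s z| ≤ s⁻¹ ^ 3 * B := fun s hs z => by
    rw [coneKernel, abs_mul, abs_of_pos (by positivity)]
    exact mul_le_mul_of_nonneg_left (hB _) (by positivity)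
  have hK0 : ∀ s, 0 < s → ∀ y x, x ∉ closedBall y (2 * s) →
      coneKernel κ e s (x - y) = 0 := fun s hs y x hx => by
    refine (isKernel_coneKernel hκ he hδ1 hs).eq_zero _ ?_
    rw [Metric.mem_closedBall, not_le, dist_eq_norm] at hx
    exact hx
  have hbound : ∀ y ∈ Ω ∩ ball x₀ h, ∀ s ∈ Ioc 0 h,
      |∫ x in Ω, v x * coneKernel κ e s (x - y)| ≤ (C₁ + C₂) * (N + ∑ j, G j) := by
    intro y hy s hs
    have hcy := hcone y hy
    have hAh : |∫ x in Ω, v x * coneKernel κ e h (x - y)| ≤ N * C₁ := by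
      have h1 := eLpNorm_le_of_bound_closedBall (f := fun x => coneKernel κ e h (x - y)) (y := y)
        (by positivity : 0 ≤ 2 * h) (fun x => hKb h hh _) (hK0 h hh y) r'
      have h2 : (ofReal ((2 * h) ^ 3) * volume (ball (0 : E3) 1)) ^ r'.toReal⁻¹
          * ofReal (h⁻¹ ^ 3 * B) ≠ ⊤ := by
        refine ENNReal.mul_ne_top (ENNReal.rpow_ne_top_of_nonneg (by positivity) ?_) (by simp)
        exact ENNReal.mul_ne_top (by simp) measure_ball_lt_top.ne
      have h3 : eLpNorm (fun x => coneKernel κ e h (x - y)) r' dx(Ω) ≤ _ :=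
        (eLpNorm_mono_measure _ Measure.restrict_le_self).trans h1
      refine (abs_integral_mul_le hvr ⟨?_, h3.trans_lt h2.lt_top⟩).trans
        (mul_le_mul_of_nonneg_left (toReal_mono h2 h3) hN0)
      exact ((contDiff_coneKernel hκ).continuous.comp
        (continuous_id.sub continuous_const)).aestronglyMeasurable
    have hflux : ∀ t ∈ Ioc s h, ‖∑ j, ∫ x in Ω, g j x * coneFlux κ e j t (x - y)‖
        ≤ (∑ j, G j) * (c * t ^ (-(3 / q))) := by
      intro t ht
      have ht0 : 0 < t := hs.1.trans ht.1
      rw [Finset.sum_mul]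
      refine (norm_sum_le _ _).trans (Finset.sum_le_sum fun j _ => ?_)
      have h1 := eLpNorm_le_of_bound_closedBall (f := fun x => coneFlux κ e j t (x - y)) (y := y)
        (B := 2 * (t⁻¹ ^ 3 * B))
        (by positivity : 0 ≤ 2 * t) (fun x => by
          by_cases hx : x ∈ closedBall y (2 * t)
          · rw [coneFlux, abs_mul]
            refine mul_le_mul ?_ (hKb t ht0 _) (abs_nonneg _) (by norm_num)
            rw [abs_mul, abs_of_pos (by positivity)]
            have h2 : ‖(x - y) j‖ ≤ ‖x - y‖ := PiLp.norm_apply_le _ _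
            rw [Metric.mem_closedBall, dist_eq_norm] at hx
            calc t⁻¹ * |(x - y) j| ≤ t⁻¹ * (2 * t) :=
                  mul_le_mul_of_nonneg_left (h2.trans hx) (by positivity)
              _ = 2 := by field_simp
          · rw [coneFlux, hK0 t ht0 y x hx]
            simp
            positivity) (fun x hx => by rw [coneFlux, hK0 t ht0 y x hx, mul_zero])
        (ofReal (q / (q - 1)))
      have h2 : (ofReal ((2 * t) ^ 3) * volume (ball (0 : E3) 1))
          ^ (ofReal (q / (q - 1))).toReal⁻¹ * ofReal (2 * (t⁻¹ ^ 3 * B))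
          = ofReal (c * t ^ (-(3 / q))) := by
        rw [hq', hVe, ← ENNReal.ofReal_mul (by positivity), ENNReal.ofReal_rpow_of_nonneg
          (by positivity) (by rw [sub_nonneg]; exact inv_le_one_of_one_le₀ (by linarith)),
          ← ENNReal.ofReal_mul (by positivity)]
        congr 1
        have e1 : (2 * t) ^ 3 * V = (8 * V) * t ^ (3 : ℝ) := by
          rw [show (3 : ℝ) = ((3 : ℕ) : ℝ) by norm_num, Real.rpow_natCast]
          ring
        rw [e1, Real.mul_rpow (by positivity) (by positivity), ← Real.rpow_mul ht0.le, hc]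
        have e2 : t⁻¹ ^ 3 = t ^ (-3 : ℝ) := by
          rw [Real.rpow_neg ht0.le, inv_pow, show (3 : ℝ) = ((3 : ℕ) : ℝ) by norm_num,
            Real.rpow_natCast]
        have e3 : t ^ (3 * (1 - q⁻¹)) * t ^ (-3 : ℝ) = t ^ (-(3 / q)) := by
          rw [← Real.rpow_add ht0]
          congr 1
          field_simp
          ring
        rw [e2, ← e3]
        ring
      rw [h2] at h1
      have h3 : eLpNorm (fun x => coneFlux κ e j t (x - y)) (ofReal (q / (q - 1)))
          dx(Ω) ≤ _ := (eLpNorm_mono_measure _ Measure.restrict_le_self).trans h1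
      refine (abs_integral_mul_le (hgq j) ⟨?_, h3.trans_lt ENNReal.ofReal_lt_top⟩).trans ?_
      · exact ((contDiff_coneFlux hκ j).continuous.comp
          (continuous_id.sub continuous_const)).aestronglyMeasurable
      · refine mul_le_mul_of_nonneg_left ?_ toReal_nonneg
        exact toReal_le_of_le_ofReal (by positivity) h3
    have hint : IntervalIntegrable (fun t => (∑ j, G j) * (c * t ^ (-(3 / q)))) volume s h :=
      ((intervalIntegral.intervalIntegrable_rpow' (by linarith)).const_mul c).const_mul _
    have hdiff := cone_average_sub hκ hΩ hv hs.1 hs.2 hcy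
    have h4 := intervalIntegral.norm_integral_le_of_norm_le hs.2 (.of_forall hflux) hint
    rw [← hdiff, intervalIntegral.integral_const_mul, intervalIntegral.integral_const_mul,
      integral_rpow (Or.inl (by linarith)), show -(3 / q) + 1 = 1 - 3 / q by ring] at h4
    have h5 : c * ((h ^ (1 - 3 / q) - s ^ (1 - 3 / q)) / (1 - 3 / q)) ≤ C₂ := by
      rw [hC₂]
      gcongr
      exact sub_le_self _ (Real.rpow_nonneg hs.1.le _)
    have h6 := mul_le_mul_of_nonneg_left h5 hG0
    rw [Real.norm_eq_abs] at h4
    have h7 := abs_sub_abs_le_abs_sub (∫ x in Ω, v x * coneKernel κ e s (x - y))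
      (∫ x in Ω, v x * coneKernel κ e h (x - y))
    rw [abs_sub_comm] at h7
    have hC₁0 : 0 ≤ C₁ := toReal_nonneg
    nlinarith [mul_nonneg hC₁0 hG0, mul_nonneg hC₂0 hN0]
  -- passage to the limit
  set F : E3 → ℝ := (Ω ∩ ball x₀ (3 * h)).indicator v with hF
  have hm3 : MeasurableSet (Ω ∩ ball x₀ (3 * h)) := hΩ.measurableSet.inter measurableSet_ball
  have hFi : Integrable F := by
    refine (integrable_indicator_iff hm3).2 ?_
    have : Fact (volume (Ω ∩ ball x₀ (3 * h)) < ⊤) :=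
      ⟨(measure_mono inter_subset_right).trans_lt measure_ball_lt_top⟩
    exact memLp_one_iff_integrable.1
      ((hvr.mono_measure (restrict_le inter_subset_left)).mono_exponent hr)
  set s : ℕ → ℝ := fun n => h / (n + 1) with hs
  have hs0 : ∀ n, s n ∈ Ioc 0 h := fun n => ⟨by positivity,
    div_le_self hh.le (by linarith [Nat.cast_nonneg (α := ℝ) n])⟩
  have hst : Tendsto (fun n => 2 * s n) atTop (𝓝 0) := by
    have : Tendsto s atTop (𝓝 0) :=
      tendsto_const_nhds.div_atTop (tendsto_natCast_atTop_atTop.atTop_add tendsto_const_nhds)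
    simpa using this.const_mul 2
  have hk : ∀ n, IsKernel (fun z => coneKernel κ e (s n) (-z)) (2 * s n) := fun n =>
    (isKernel_coneKernel hκ he hδ1 (hs0 n).1).neg
  have hconv := tendsto_eLpNorm_mollify_sub hk hst hFi
  have hmeas := tendstoInMeasure_of_tendsto_eLpNorm (p := 1)
    (f := fun n => mollify (fun z => coneKernel κ e (s n) (-z)) F) (g := F) one_ne_zero
    (fun n => (hFi.integrable_convolution (ContinuousLinearMap.mul ℝ ℝ) (hk n).integrable).1)
    hFi.1 hconv
  obtain ⟨ns, -, hae⟩ := hmeas.exists_seq_tendsto_ae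
  have hmS : MeasurableSet (Ω ∩ ball x₀ h) := hΩ.measurableSet.inter measurableSet_ball
  filter_upwards [ae_restrict_of_ae hae, ae_restrict_mem hmS] with y hy hyS
  have hyF : F y = v y := indicator_of_mem (s := Ω ∩ ball x₀ (3 * h))
    ⟨hyS.1, Metric.ball_subset_ball (by linarith) hyS.2⟩ _
  rw [hyF] at hy
  refine le_of_tendsto hy.abs (.of_forall fun n => ?_)
  have e1 : mollify (fun z => coneKernel κ e (s (ns n)) (-z)) F y
      = ∫ x in Ω, v x * coneKernel κ e (s (ns n)) (x - y) := by
    rw [mollify, ← integral_indicator hΩ.measurableSet]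
    refine integral_congr_ae (.of_forall fun x => ?_)
    simp only [neg_sub]
    by_cases hx : x ∈ Ω
    · rw [indicator_of_mem hx]
      by_cases hx3 : x ∈ ball x₀ (3 * h)
      · rw [hF, indicator_of_mem (s := Ω ∩ ball x₀ (3 * h)) ⟨hx, hx3⟩]
      · have : coneKernel κ e (s (ns n)) (x - y) = 0 := by
          refine hK0 _ (hs0 _).1 y x fun hxy => hx3 ?_
          have h1 := dist_triangle x y x₀
          have h2 : dist y x₀ < h := hyS.2
          have h3 : dist x y ≤ 2 * s (ns n) := hxy
          rw [Metric.mem_ball]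
          linarith [(hs0 (ns n)).2]
        rw [this, mul_zero, mul_zero]
    · rw [indicator_of_notMem hx, hF, indicator_of_notMem fun h => hx h.1, zero_mul]
  rw [e1]
  exact hbound y hyS _ (hs0 _)

/-! ### Operations on weak gradients -/

lemma IsTestOn.integrableOn_mul (hv : ∀ K, IsCompact K → K ⊆ Ω → IntegrableOn v K)
    (hφ : IsTestOn Ω φ) : IntegrableOn (fun x => v x * φ x) Ω :=
  integrableOn_mul_of_tsupport_subset hv hφ.continuous hφ.2.1 hφ.2.2

lemma IsTestOn.integrableOn_mul_fderiv (hv : ∀ K, IsCompact K → K ⊆ Ω → IntegrableOn v K)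
    (hφ : IsTestOn Ω φ) (e : E3) : IntegrableOn (fun x => v x * fderiv ℝ φ x e) Ω :=
  integrableOn_mul_of_tsupport_subset hv (hφ.continuous_fderiv e) (hφ.2.1.fderiv_apply ℝ e)
    ((tsupport_fderiv_apply_subset ℝ e).trans hφ.2.2)

lemma IsTestOn.smooth_mul (hζ : ContDiff ℝ ∞ ζ) (hφ : IsTestOn Ω φ) :
    IsTestOn Ω (fun x => ζ x * φ x) :=
  ⟨hζ.mul hφ.1, hφ.2.1.mul_left, (tsupport_mul_subset_right).trans hφ.2.2⟩

lemma fderiv_smooth_mul (hζ : ContDiff ℝ ∞ ζ) (hφ : ContDiff ℝ ∞ φ) (x e : E3) :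
    fderiv ℝ (fun x => ζ x * φ x) x e = ζ x * fderiv ℝ φ x e + fderiv ℝ ζ x e * φ x := by
  have := ((hζ.differentiable (by simp) x).hasFDerivAt.mul
    (hφ.differentiable (by simp) x).hasFDerivAt).fderiv
  rw [show (fun x => ζ x * φ x) = ζ * φ from rfl, this]
  simp
  ring

section WeakGrad

variable {v₁ v₂ : E3 → ℝ} {g g₁ g₂ : Fin 3 → E3 → ℝ}

lemma HasWeakGrad.add (h₁ : HasWeakGrad Ω v₁ g₁) (h₂ : HasWeakGrad Ω v₂ g₂) :
    HasWeakGrad Ω (fun x => v₁ x + v₂ x) (fun j x => g₁ j x + g₂ j x) := by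
  refine ⟨fun K hK hKΩ => (h₁.integrableOn K hK hKΩ).add (h₂.integrableOn K hK hKΩ),
    fun j K hK hKΩ => (h₁.integrableOn_grad j K hK hKΩ).add (h₂.integrableOn_grad j K hK hKΩ),
    fun j φ hφ => ?_⟩
  simp only [add_mul]
  rw [integral_add (hφ.integrableOn_mul_fderiv h₁.integrableOn _)
    (hφ.integrableOn_mul_fderiv h₂.integrableOn _),
    integral_add (hφ.integrableOn_mul (h₁.integrableOn_grad j))
    (hφ.integrableOn_mul (h₂.integrableOn_grad j)), h₁.eq j φ hφ, h₂.eq j φ hφ]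
  ring

lemma HasWeakGrad.smooth_mul (hζ : ContDiff ℝ ∞ ζ) (h : HasWeakGrad Ω v g) :
    HasWeakGrad Ω (fun x => ζ x * v x) (fun j x => fderiv ℝ ζ x (bv j) * v x + ζ x * g j x) := by
  have hζc := hζ.continuous
  have hζ'c : ∀ j : Fin 3, Continuous fun x => fderiv ℝ ζ x (bv j) := fun j =>
    (hζ.continuous_fderiv (by simp)).clm_apply continuous_const
  refine ⟨fun K hK hKΩ => (h.integrableOn K hK hKΩ).continuousOn_mul hζc.continuousOn hK,
    fun j K hK hKΩ => ((h.integrableOn K hK hKΩ).continuousOn_mul (hζ'c j).continuousOn hK).add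
      ((h.integrableOn_grad j K hK hKΩ).continuousOn_mul hζc.continuousOn hK), fun j φ hφ => ?_⟩
  have h1 := h.eq j _ (hφ.smooth_mul hζ)
  simp only [fderiv_smooth_mul hζ hφ.1] at h1
  have i1 : IntegrableOn (fun x => v x * (ζ x * fderiv ℝ φ x (bv j))) Ω :=
    integrableOn_mul_of_tsupport_subset h.integrableOn (hζc.mul (hφ.continuous_fderiv _))
      (hφ.2.1.fderiv_apply ℝ _).mul_left
      (tsupport_mul_subset_right.trans ((tsupport_fderiv_apply_subset ℝ _).trans hφ.2.2))
  have i2 : IntegrableOn (fun x => v x * (fderiv ℝ ζ x (bv j) * φ x)) Ω :=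
    integrableOn_mul_of_tsupport_subset h.integrableOn ((hζ'c j).mul hφ.continuous)
      hφ.2.1.mul_left (tsupport_mul_subset_right.trans hφ.2.2)
  have i3 : IntegrableOn (fun x => g j x * (ζ x * φ x)) Ω :=
    (hφ.smooth_mul hζ).integrableOn_mul (h.integrableOn_grad j)
  have e2 : ∫ x in Ω, v x * (ζ x * fderiv ℝ φ x (bv j) + fderiv ℝ ζ x (bv j) * φ x)
      = (∫ x in Ω, v x * (ζ x * fderiv ℝ φ x (bv j)))
        + ∫ x in Ω, v x * (fderiv ℝ ζ x (bv j) * φ x) := by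
    rw [← integral_add i1 i2]
    simp only [mul_add]
  have e3 : ∫ x in Ω, (fderiv ℝ ζ x (bv j) * v x + ζ x * g j x) * φ x
      = (∫ x in Ω, v x * (fderiv ℝ ζ x (bv j) * φ x)) + ∫ x in Ω, g j x * (ζ x * φ x) := by
    rw [← integral_add i2 i3]
    exact integral_congr_ae (.of_forall fun x => by ring)
  rw [e3, ← neg_eq_iff_eq_neg.2 h1, e2, show ∫ x in Ω, ζ x * v x * fderiv ℝ φ x (bv j)
      = ∫ x in Ω, v x * (ζ x * fderiv ℝ φ x (bv j)) from
      integral_congr_ae (.of_forall fun x => by ring)]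
  ring

end WeakGrad

/-! ### The homogeneous Sobolev space -/

lemma memLp_mul {ν : Measure α} {p q r : ℝ≥0∞} [HolderTriple p q r] {f g : α → ℝ}
    (hf : MemLp f p ν) (hg : MemLp g q ν) : MemLp (fun x => f x * g x) r ν := hg.mul hf

lemma eLpNorm_mul_le {ν : Measure α} {p q r : ℝ≥0∞} [HolderTriple p q r] {f g : α → ℝ}
    (hf : AEStronglyMeasurable f ν) (hg : AEStronglyMeasurable g ν) :
    eLpNorm (fun x => f x * g x) r ν ≤ eLpNorm f p ν * eLpNorm g q ν := by
  have h := eLpNorm_smul_le_mul_eLpNorm (p := p) (q := q) (r := r) hg hf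
  exact h

lemma tendsto_integral_mul {ν : Measure α} {p p' : ℝ≥0∞} [HolderTriple p p' 1] {f g : α → ℝ}
    {F G : ℕ → α → ℝ} (hf : MemLp f p ν) (hg : MemLp g p' ν) (hF : ∀ n, MemLp (F n) p ν)
    (hG : ∀ n, MemLp (G n) p' ν)
    (hFt : Tendsto (fun n => eLpNorm (fun x => F n x - f x) p ν) atTop (𝓝 0))
    (hGt : Tendsto (fun n => eLpNorm (fun x => G n x - g x) p' ν) atTop (𝓝 0)) :
    Tendsto (fun n => ∫ x, F n x * G n x ∂ν) atTop (𝓝 (∫ x, f x * g x ∂ν)) := by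
  have hF0 := (ENNReal.tendsto_toReal ENNReal.zero_ne_top).comp hFt
  have hG0 := (ENNReal.tendsto_toReal ENNReal.zero_ne_top).comp hGt
  have hi : ∀ {F G : α → ℝ}, MemLp F p ν → MemLp G p' ν → Integrable (fun x => F x * G x) ν :=
    fun hF hG => memLp_one_iff_integrable.1 (memLp_mul hF hG)
  have e : ∀ n, ∫ x, F n x * G n x ∂ν = (∫ x, (F n x - f x) * (G n x - g x) ∂ν)
      + ((∫ x, (F n x - f x) * g x ∂ν) + (∫ x, f x * (G n x - g x) ∂ν))
      + ∫ x, f x * g x ∂ν := by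
    intro n
    have i1 := hi ((hF n).sub hf) ((hG n).sub hg)
    have i2 := hi ((hF n).sub hf) hg
    have i3 := hi hf ((hG n).sub hg)
    have i4 := hi hf hg
    simp only [Pi.sub_apply] at i1 i2 i3
    have i23 : Integrable (fun x => (F n x - f x) * g x + f x * (G n x - g x)) ν := i2.add i3
    have i123 : Integrable (fun x => (F n x - f x) * (G n x - g x)
      + ((F n x - f x) * g x + f x * (G n x - g x))) ν := i1.add i23
    rw [← integral_add i2 i3, ← integral_add i1 i23, ← integral_add i123 i4]
    exact integral_congr_ae (.of_forall fun x => by ring)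
  simp only [e]
  have hz1 : Tendsto (fun n => ∫ x, (F n x - f x) * (G n x - g x) ∂ν) atTop (𝓝 0) := by
    refine squeeze_zero_norm (fun n => abs_integral_mul_le ((hF n).sub hf) ((hG n).sub hg)) ?_
    simpa using hF0.mul hG0
  have hz2 : Tendsto (fun n => ∫ x, (F n x - f x) * g x ∂ν) atTop (𝓝 0) := by
    refine squeeze_zero_norm (fun n => abs_integral_mul_le ((hF n).sub hf) hg) ?_
    simpa using hF0.mul_const _
  have hz3 : Tendsto (fun n => ∫ x, f x * (G n x - g x) ∂ν) atTop (𝓝 0) := by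
    refine squeeze_zero_norm (fun n => abs_integral_mul_le hf ((hG n).sub hg)) ?_
    simpa using hG0.const_mul _
  simpa using (hz1.add (hz2.add hz3)).add_const (∫ x, f x * g x ∂ν)

lemma abs_coord_le (x : E3) (i : Fin 3) : |x i| ≤ ‖x‖ := by
  rw [← Real.norm_eq_abs]
  exact PiLp.norm_apply_le _ _

lemma eLpNorm_coord_le {ν : Measure α} (p : ℝ≥0∞) (v : α → E3) (i : Fin 3) :
    eLpNorm (fun x => v x i) p ν ≤ eLpNorm v p ν :=
  eLpNorm_mono fun x => abs_coord_le (v x) i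

lemma aestronglyMeasurable_coord {ν : Measure α} {v : α → E3} (hv : AEStronglyMeasurable v ν)
    (i : Fin 3) : AEStronglyMeasurable (fun x => v x i) ν :=
  (EuclideanSpace.proj (𝕜 := ℝ) i : E3 →L[ℝ] ℝ).continuous.comp_aestronglyMeasurable hv

lemma memLp_coord {ν : Measure α} {p : ℝ≥0∞} {v : α → E3} (hv : MemLp v p ν) (i : Fin 3) :
    MemLp (fun x => v x i) p ν :=
  ⟨aestronglyMeasurable_coord hv.1 i, (eLpNorm_coord_le p v i).trans_lt hv.2⟩

lemma norm_fderiv_le_sum (f : E3 → ℝ) (x : E3) : ‖fderiv ℝ f x‖ ≤ ∑ j, |fderiv ℝ f x (bv j)| := by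
  refine ContinuousLinearMap.opNorm_le_bound _ (Finset.sum_nonneg fun j _ => abs_nonneg _)
    fun z => ?_
  conv_lhs => rw [← sum_coord_smul z]
  rw [map_sum, Finset.sum_mul]
  refine (norm_sum_le _ _).trans (Finset.sum_le_sum fun i _ => ?_)
  rw [map_smul, norm_smul, mul_comm]
  exact mul_le_mul_of_nonneg_left (abs_coord_le z i) (norm_nonneg _)

section Comp

variable {φ : E3 → E3}

lemma isTestOn_coord (h : ContDiff ℝ ∞ φ ∧ HasCompactSupport φ ∧ tsupport φ ⊆ Ω) (i : Fin 3) :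
    IsTestOn Ω (fun x => φ x i) := by
  have hsub : Function.support (fun x => φ x i) ⊆ Function.support φ := fun x hx h0 => hx (by
    change φ x i = 0
    rw [h0]; rfl)
  refine ⟨(EuclideanSpace.proj (𝕜 := ℝ) i : E3 →L[ℝ] ℝ).contDiff.comp h.1, ?_,
    (closure_mono hsub).trans h.2.2⟩
  exact h.2.1.of_isClosed_subset isClosed_closure (closure_mono hsub)

lemma jac_eq (hφ : ContDiff ℝ ∞ φ) (x : E3) (i j : Fin 3) :
    jac φ x i j = fderiv ℝ (fun x => φ x i) x (bv j) := by
  have h := ((EuclideanSpace.proj (𝕜 := ℝ) i : E3 →L[ℝ] ℝ).hasFDerivAt).comp x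
    (hφ.differentiable (by simp) x).hasFDerivAt
  have e : fderiv ℝ (fun x => φ x i) x = _ := h.fderiv
  rw [e]
  rfl

end Comp

lemma exists_sobolev_fderiv : ∃ C : ℝ≥0, ∀ φ : E3 → ℝ, ContDiff ℝ 1 φ → HasCompactSupport φ →
    eLpNorm φ ((6 : ℝ≥0) : ℝ≥0∞) volume ≤ C * eLpNorm (fderiv ℝ φ) ((2 : ℝ≥0) : ℝ≥0∞) volume :=
  ⟨_, fun _ h1 h2 => eLpNorm_le_eLpNorm_fderiv_of_eq (volume : Measure E3) h1 h2 (by norm_num)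
    (by simp) (by simp; norm_num)⟩

lemma exists_sobolev : ∃ C : ℝ≥0, ∀ φ : E3 → ℝ, ContDiff ℝ ∞ φ → HasCompactSupport φ →
    eLpNorm φ 6 volume ≤ C * ∑ j, eLpNorm (fun x => fderiv ℝ φ x (bv j)) 2 volume := by
  obtain ⟨C, hC⟩ := exists_sobolev_fderiv
  rw [show ((6 : ℝ≥0) : ℝ≥0∞) = 6 by norm_num, show ((2 : ℝ≥0) : ℝ≥0∞) = 2 by norm_num] at hC
  refine ⟨C, fun φ h1 h2 => (hC φ (h1.of_le (by norm_num)) h2).trans (mul_le_mul_right ?_ _)⟩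
  have h3 : eLpNorm (fderiv ℝ φ) 2 volume
      ≤ eLpNorm (∑ j : Fin 3, fun x => |fderiv ℝ φ x (bv j)|) 2 volume := by
    refine eLpNorm_mono fun x => ?_
    rw [Finset.sum_apply, Real.norm_eq_abs,
      abs_of_nonneg (Finset.sum_nonneg fun j _ => abs_nonneg _)]
    exact norm_fderiv_le_sum φ x
  refine h3.trans ((eLpNorm_sum_le (fun j _ => ?_) (by norm_num)).trans
    (Finset.sum_le_sum fun j _ => le_of_eq (eLpNorm_norm fun x => fderiv ℝ φ x (bv j))))
  exact ((h1.continuous_fderiv (by simp)).clm_apply continuous_const).abs.aestronglyMeasurable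

section D012

variable {v : E3 → E3} {G : E3 → M33}

lemma MemD012.memLp_coord (h : MemD012 Ω v G) (i : Fin 3) :
    MemLp (fun x => v x i) 6 dx(Ω) := CNS.memLp_coord h.1 i

/-- Component-wise form of the approximation by test functions. -/
lemma MemD012.exists_isTestOn (h : MemD012 Ω v G) (i : Fin 3) : ∃ φ : ℕ → E3 → ℝ,
    (∀ n, IsTestOn Ω (φ n)) ∧
    Tendsto (fun n => eLpNorm (fun x => φ n x - v x i) 6 dx(Ω)) atTop (𝓝 0) ∧
    ∀ j, Tendsto (fun n => eLpNorm (fun x => fderiv ℝ (φ n) x (bv j) - G x i j) 2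
      dx(Ω)) atTop (𝓝 0) := by
  obtain ⟨-, -, φ, hφ, h6, h2⟩ := h
  refine ⟨fun n x => φ n x i, fun n => isTestOn_coord (hφ n) i, ?_, fun j => ?_⟩
  · exact tendsto_of_tendsto_of_tendsto_of_le_of_le tendsto_const_nhds h6 (fun _ => zero_le)
      fun n => eLpNorm_coord_le 6 (φ n - v) i
  · refine (h2 i j).congr fun n => ?_
    simp only [jac_eq (hφ n).1]

lemma IsTestOn.memLp (h : IsTestOn Ω φ) (p : ℝ≥0∞) (ν : Measure E3) [IsFiniteMeasureOnCompacts ν] :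
    MemLp φ p ν :=
  h.continuous.memLp_of_hasCompactSupport h.2.1

lemma IsTestOn.memLp_fderiv (h : IsTestOn Ω φ) (e : E3) (p : ℝ≥0∞) (ν : Measure E3)
    [IsFiniteMeasureOnCompacts ν] : MemLp (fun x => fderiv ℝ φ x e) p ν :=
  (h.continuous_fderiv e).memLp_of_hasCompactSupport (h.2.1.fderiv_apply ℝ e)

lemma tendsto_eLpNorm_of_sub {ν : Measure α} {p : ℝ≥0∞} (hp : 1 ≤ p) {f : α → ℝ} {F : ℕ → α → ℝ}
    (hf : MemLp f p ν) (hF : ∀ n, MemLp (F n) p ν)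
    (hFt : Tendsto (fun n => eLpNorm (fun x => F n x - f x) p ν) atTop (𝓝 0)) :
    Tendsto (fun n => eLpNorm (F n) p ν) atTop (𝓝 (eLpNorm f p ν)) := by
  refine tendsto_of_tendsto_of_tendsto_of_le_of_le
    (g := fun n => eLpNorm f p ν - eLpNorm (fun x => F n x - f x) p ν)
    (h := fun n => eLpNorm f p ν + eLpNorm (fun x => F n x - f x) p ν) ?_ ?_ ?_ ?_
  · have := ENNReal.Tendsto.sub (tendsto_const_nhds (x := eLpNorm f p ν) (f := atTop)) hFt
      (Or.inl hf.2.ne)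
    simpa using this
  · simpa using tendsto_const_nhds.add hFt
  · intro n
    simp only
    rw [tsub_le_iff_right]
    have e : f = fun x => F n x - (F n x - f x) := by ext x; ring
    conv_lhs => rw [e]
    exact eLpNorm_sub_le (hF n).1 ((hF n).1.sub hf.1) hp
  · intro n
    have e : F n = fun x => f x + (F n x - f x) := by ext x; ring
    change eLpNorm (F n) p ν ≤ _
    conv_lhs => rw [e]
    exact eLpNorm_add_le hf.1 ((hF n).1.sub hf.1) hp

lemma exists_sobolev_memD012 : ∃ C : ℝ≥0, ∀ (Ω : Set E3) (v : E3 → E3)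
    (G : E3 → M33), IsOpen Ω → MemD012 Ω v G → ∀ i,
    eLpNorm (fun x => v x i) 6 dx(Ω) ≤ C * ∑ j, eLpNorm (fun x => G x i j) 2 dx(Ω) := by
  obtain ⟨C, hC⟩ := exists_sobolev
  refine ⟨C, fun Ω v G hΩ h i => ?_⟩
  obtain ⟨φ, hφ, h6, h2⟩ := h.exists_isTestOn i
  have t1 := tendsto_eLpNorm_of_sub (by norm_num) (h.memLp_coord i) (fun n => (hφ n).memLp 6 _) h6
  have t2 := fun j => tendsto_eLpNorm_of_sub (by norm_num) (h.2.1 i j)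
    (fun n => (hφ n).memLp_fderiv (bv j) 2 _) (h2 j)
  have hres : ∀ (p : ℝ≥0∞) (f : E3 → ℝ), tsupport f ⊆ Ω →
      eLpNorm f p volume = eLpNorm f p dx(Ω) := fun p f hf => by
    rw [← eLpNorm_indicator_eq_eLpNorm_restrict hΩ.measurableSet,
      indicator_eq_self.2 ((subset_tsupport f).trans hf)]
  refine le_of_tendsto_of_tendsto t1 (ENNReal.Tendsto.const_mul
    (tendsto_finsetSum _ fun j _ => t2 j) (Or.inr ENNReal.coe_ne_top))
    (.of_forall fun n => ?_)
  have := hC (φ n) (hφ n).1 (hφ n).2.1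
  rw [hres _ _ (hφ n).2.2] at this
  refine this.trans (le_of_eq ?_)
  congr 1
  exact Finset.sum_congr rfl fun j _ =>
    hres _ _ ((tsupport_fderiv_apply_subset ℝ _).trans (hφ n).2.2)

/-- Integration by parts against a field with weak gradient in `Ω`; the cut-off `χ` need not vanish
near the boundary. -/
lemma MemD012.integral_mul_eq (h : MemD012 Ω v G) {a : E3 → ℝ} {b : Fin 3 → E3 → ℝ}
    (hab : HasWeakGrad Ω a b) (ha : MemLp a 2 dx(Ω))
    (hb : ∀ j, MemLp (b j) 2 dx(Ω)) {χ : E3 → ℝ} (hχ : IsTestOn univ χ)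
    (i j : Fin 3) :
    ∫ x in Ω, b j x * (χ x * v x i)
      = - ∫ x in Ω, a x * (fderiv ℝ χ x (bv j) * v x i + χ x * G x i j) := by
  obtain ⟨φ, hφ, h6, h2⟩ := h.exists_isTestOn i
  have hT : HolderTriple 3 6 2 := ⟨by
    rw [← ENNReal.toReal_eq_toReal_iff' (by simp) (by simp), ENNReal.toReal_add (by simp) (by simp)]
    norm_num⟩
  have hmul : ∀ {ψ : E3 → ℝ}, MemLp ψ 3 dx(Ω) →
      Tendsto (fun n => eLpNorm (fun x => ψ x * φ n x - ψ x * v x i) 2 dx(Ω)) atTop (𝓝 0) := by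
    intro ψ hψ
    have h0 := ENNReal.Tendsto.const_mul h6 (Or.inr hψ.2.ne)
    rw [mul_zero] at h0
    refine tendsto_of_tendsto_of_tendsto_of_le_of_le tendsto_const_nhds h0 (fun _ => zero_le)
      fun n => ?_
    simp only [← mul_sub]
    exact eLpNorm_mul_le hψ.1 (((hφ n).memLp 6 _).1.sub (h.memLp_coord i).1)
  have hχ3 : MemLp χ 3 dx(Ω) := hχ.memLp 3 _
  have hχ'3 : MemLp (fun x => fderiv ℝ χ x (bv j)) 3 dx(Ω) := hχ.memLp_fderiv _ 3 _
  have hm2 : ∀ {ψ w : E3 → ℝ}, MemLp ψ 3 dx(Ω) → MemLp w 6 dx(Ω) →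
      MemLp (fun x => ψ x * w x) 2 dx(Ω) := fun hψ hw => memLp_mul hψ hw
  have t1 := tendsto_integral_mul (p := 2) (p' := 2) (hb j) (hm2 hχ3 (h.memLp_coord i))
    (fun _ => hb j) (fun n => hm2 hχ3 ((hφ n).memLp 6 _)) (by simp) (hmul hχ3)
  have t2 := tendsto_integral_mul (p := 2) (p' := 2) ha (hm2 hχ'3 (h.memLp_coord i))
    (fun _ => ha) (fun n => hm2 hχ'3 ((hφ n).memLp 6 _)) (by simp) (hmul hχ'3)
  have haχ : MemLp (fun x => a x * χ x) 2 dx(Ω) := memLp_mul ha (hχ.memLp ⊤ _)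
  have t3 := tendsto_integral_mul (p := 2) (p' := 2) haχ (h.2.1 i j) (fun _ => haχ)
    (fun n => (hφ n).memLp_fderiv (bv j) 2 _) (by simp) (h2 j)
  have hi : ∀ {F G : E3 → ℝ}, MemLp F 2 dx(Ω) → MemLp G 2 dx(Ω) →
      Integrable (fun x => F x * G x) dx(Ω) :=
    fun hF hG => memLp_one_iff_integrable.1 (memLp_mul hF hG)
  have e2 : ∫ x in Ω, a x * (fderiv ℝ χ x (bv j) * v x i + χ x * G x i j)
      = (∫ x in Ω, a x * (fderiv ℝ χ x (bv j) * v x i)) + ∫ x in Ω, a x * χ x * G x i j := by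
    rw [← integral_add (hi ha (hm2 hχ'3 (h.memLp_coord i))) (hi haχ (h.2.1 i j))]
    exact integral_congr_ae (.of_forall fun x => by ring)
  rw [e2]
  refine tendsto_nhds_unique t1 ((t2.add t3).neg.congr fun n => ?_)
  have h1 := hab.eq j _ ((hφ n).smooth_mul hχ.1)
  simp only [fderiv_smooth_mul hχ.1 (hφ n).1] at h1
  rw [← integral_add (hi ha (hm2 hχ'3 ((hφ n).memLp 6 _)))
    (hi haχ ((hφ n).memLp_fderiv (bv j) 2 _)), ← neg_eq_iff_eq_neg.2 h1]
  congr 1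
  exact integral_congr_ae (.of_forall fun x => by ring)

lemma MemD012.hasWeakGrad (h : MemD012 Ω v G) (hΩ : IsOpen Ω) (i : Fin 3) :
    HasWeakGrad univ (Ω.indicator fun x => v x i) (fun j => Ω.indicator fun x => G x i j) := by
  have hloc : ∀ {p : ℝ≥0∞} {f : E3 → ℝ}, 1 ≤ p → MemLp f p dx(Ω) → ∀ K, IsCompact K →
      IntegrableOn (Ω.indicator f) K := by
    intro p f hp hf K hK
    have : MemLp (Ω.indicator f) p volume := (memLp_indicator_iff_restrict hΩ.measurableSet).2 hf
    exact (this.locallyIntegrable hp).integrableOn_isCompact hK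
  refine ⟨fun K hK _ => hloc (by norm_num) (h.memLp_coord i) K hK,
    fun j K hK _ => hloc (by norm_num) (h.2.1 i j) K hK, fun j χ hχ => ?_⟩
  obtain ⟨φ, hφ, h6, h2⟩ := h.exists_isTestOn i
  have : HolderTriple 6 (6 / 5) 1 := ⟨by
    rw [ENNReal.inv_div (by simp) (by simp), ← ENNReal.toReal_eq_toReal_iff' (by
      simp [ENNReal.div_eq_top]) (by simp), ENNReal.toReal_add (by simp) (by
      simp [ENNReal.div_eq_top])]
    norm_num⟩
  have t1 := tendsto_integral_mul (p := 6) (p' := 6 / 5) (h.memLp_coord i)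
    (hχ.memLp_fderiv (bv j) (6 / 5) dx(Ω)) (fun n => (hφ n).memLp 6 _)
    (fun _ => hχ.memLp_fderiv (bv j) (6 / 5) dx(Ω)) h6 (by simp)
  have t2 := tendsto_integral_mul (p := 2) (p' := 2) (h.2.1 i j)
    (hχ.memLp 2 dx(Ω)) (fun n => (hφ n).memLp_fderiv (bv j) 2 _)
    (fun _ => hχ.memLp 2 dx(Ω)) (h2 j) (by simp)
  have e : ∀ f ψ : E3 → ℝ, ∫ x in univ, Ω.indicator f x * ψ x = ∫ x in Ω, f x * ψ x := by
    intro f ψ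
    rw [Measure.restrict_univ, ← integral_indicator hΩ.measurableSet]
    refine integral_congr_ae (.of_forall fun x => ?_)
    by_cases hx : x ∈ Ω <;> simp [hx]
  rw [e, e]
  refine tendsto_nhds_unique t1 (t2.neg.congr fun n => ?_)
  have hset : ∀ f : E3 → ℝ, (∀ x ∉ Ω, f x = 0) → ∫ x in Ω, f x = ∫ x, f x := fun f hf =>
    setIntegral_eq_integral_of_forall_compl_eq_zero hf
  rw [hset _ fun x hx => by simp [(hφ n).fderiv_eq_zero hx],
    hset _ fun x hx => by rw [(hφ n).eq_zero hx, zero_mul]]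
  have hφc := (hφ n).continuous
  have hφ'c := (hφ n).continuous_fderiv (bv j)
  have h1 := integral_mul_fderiv_eq_neg_fderiv_mul_of_integrable (μ := (volume : Measure E3))
    (f := φ n) (g := χ) (v := bv j)
    ((hφ'c.mul hχ.continuous).integrable_of_hasCompactSupport hχ.2.1.mul_left)
    ((hφc.mul (hχ.continuous_fderiv _)).integrable_of_hasCompactSupport (hφ n).2.1.mul_right)
    ((hφc.mul hχ.continuous).integrable_of_hasCompactSupport hχ.2.1.mul_left)
    (fun x _ => (hφ n).1.differentiable (by simp) x) (fun x _ => hχ.1.differentiable (by simp) x)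
  exact h1.symm

lemma MemD012.integral_grad_mul_comm (h : MemD012 Ω v G) (i j : Fin 3) :
    ∫ x in Ω, G x i j * G x j i = ∫ x in Ω, G x i i * G x j j := by
  obtain ⟨φ, hφ, -, h2⟩ := h.exists_isTestOn i
  obtain ⟨ψ, hψ, -, h2'⟩ := h.exists_isTestOn j
  have t1 := tendsto_integral_mul (p := 2) (p' := 2) (h.2.1 i j) (h.2.1 j i)
    (fun n => (hφ n).memLp_fderiv (bv j) 2 _) (fun n => (hψ n).memLp_fderiv (bv i) 2 _)
    (h2 j) (h2' i)
  have t2 := tendsto_integral_mul (p := 2) (p' := 2) (h.2.1 i i) (h.2.1 j j)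
    (fun n => (hφ n).memLp_fderiv (bv i) 2 _) (fun n => (hψ n).memLp_fderiv (bv j) 2 _)
    (h2 i) (h2' j)
  refine tendsto_nhds_unique t1 (t2.congr fun n => ?_)
  have hset : ∀ f : E3 → ℝ, (∀ x ∉ Ω, f x = 0) → ∫ x in Ω, f x = ∫ x, f x := fun f hf =>
    setIntegral_eq_integral_of_forall_compl_eq_zero hf
  rw [hset _ fun x hx => by simp [(hφ n).fderiv_eq_zero hx],
    hset _ fun x hx => by simp [(hφ n).fderiv_eq_zero hx]]
  have hcd : ∀ (k : Fin 3), ContDiff ℝ ∞ (fun x => fderiv ℝ (ψ n) x (bv k)) := fun k =>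
    ((hψ n).1.fderiv_right (by simp)).clm_apply contDiff_const
  have hsupp : ∀ k : Fin 3, HasCompactSupport (fun x => fderiv ℝ (ψ n) x (bv k)) := fun k =>
    (hψ n).2.1.fderiv_apply ℝ (bv k)
  have ibp : ∀ k l : Fin 3, ∫ x, fderiv ℝ (φ n) x (bv k) * fderiv ℝ (ψ n) x (bv l)
      = - ∫ x, φ n x * fderiv ℝ (fun x => fderiv ℝ (ψ n) x (bv l)) x (bv k) := by
    intro k l
    have hc2 : Continuous (fun x => fderiv ℝ (fun x => fderiv ℝ (ψ n) x (bv l)) x (bv k)) :=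
      ((hcd l).continuous_fderiv (by simp)).clm_apply continuous_const
    have h1 := integral_mul_fderiv_eq_neg_fderiv_mul_of_integrable (μ := (volume : Measure E3))
      (f := φ n) (g := fun x => fderiv ℝ (ψ n) x (bv l)) (v := bv k)
      ((((hφ n).continuous_fderiv _).mul (hcd l).continuous).integrable_of_hasCompactSupport
        (hsupp l).mul_left)
      (((hφ n).continuous.mul hc2).integrable_of_hasCompactSupport (hφ n).2.1.mul_right)
      (((hφ n).continuous.mul (hcd l).continuous).integrable_of_hasCompactSupport
        (hφ n).2.1.mul_right)
      (fun x _ => (hφ n).1.differentiable (by simp) x)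
      (fun x _ => (hcd l).differentiable (by simp) x)
    rw [h1, neg_neg]
  rw [ibp, ibp]
  congr 1
  refine integral_congr_ae (.of_forall fun x => ?_)
  have hsymm : fderiv ℝ (fun x => fderiv ℝ (ψ n) x (bv j)) x (bv i)
      = fderiv ℝ (fun x => fderiv ℝ (ψ n) x (bv i)) x (bv j) := by
    have hd : Differentiable ℝ (fderiv ℝ (ψ n)) :=
      ((hψ n).1.fderiv_right (m := 1) (by norm_cast)).differentiable (by norm_num)
    have e : ∀ k l : Fin 3, fderiv ℝ (fun x => fderiv ℝ (ψ n) x (bv k)) x (bv l)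
        = fderiv ℝ (fderiv ℝ (ψ n)) x (bv l) (bv k) := fun k l => by
      rw [fderiv_clm_apply (hd x) (differentiableAt_const _)]
      simp
    rw [e, e]
    have hs : IsSymmSndFDerivAt ℝ (ψ n) x := (hψ n).1.contDiffAt.isSymmSndFDerivAt (by
        rw [minSmoothness_of_isRCLikeNormedField]
        exact WithTop.coe_le_coe.2 (le_top (a := (2 : ℕ∞))))
    exact hs _ _
  simp only [hsymm]

lemma contract_stress_self (μ η : ℝ) (A : M33) :
    contract (stress μ η A) A = μ * (∑ i, ∑ j, A i j ^ 2 + ∑ i, ∑ j, A i j * A j i)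
      + (η - 2 / 3 * μ) * ∑ i, ∑ j, A i i * A j j := by
  simp [contract, stress, Matrix.trace, Fin.sum_univ_three, Matrix.one_apply]
  ring

lemma MemD012.coercive (h : MemD012 Ω v G) (hμ : 0 < μ) (hη : 0 ≤ η) :
    IntegrableOn (fun x => contract (stress μ η (G x)) (G x)) Ω ∧
    IntegrableOn (fun x => ∑ i, ∑ j, G x i j ^ 2) Ω ∧
    μ * ∫ x in Ω, ∑ i, ∑ j, G x i j ^ 2 ≤ ∫ x in Ω, contract (stress μ η (G x)) (G x) := by
  have hi : ∀ i j k l, IntegrableOn (fun x => G x i j * G x k l) Ω := fun i j k l =>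
    memLp_one_iff_integrable.1 (memLp_mul (h.2.1 i j) (h.2.1 k l))
  have i1 : IntegrableOn (fun x => ∑ i, ∑ j, G x i j ^ 2) Ω :=
    integrable_finsetSum _ fun i _ => integrable_finsetSum _ fun j _ => by
      simp only [sq]
      exact hi i j i j
  have i2 : IntegrableOn (fun x => ∑ i, ∑ j, G x i j * G x j i) Ω :=
    integrable_finsetSum _ fun i _ => integrable_finsetSum _ fun j _ => hi i j j i
  have i3 : IntegrableOn (fun x => ∑ i, ∑ j, G x i i * G x j j) Ω :=
    integrable_finsetSum _ fun i _ => integrable_finsetSum _ fun j _ => hi i i j j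
  have e : ∫ x in Ω, ∑ i, ∑ j, G x i j * G x j i = ∫ x in Ω, ∑ i, ∑ j, G x i i * G x j j := by
    rw [integral_finsetSum _ fun i _ => integrable_finsetSum _ fun j _ => hi i j j i,
      integral_finsetSum _ fun i _ => integrable_finsetSum _ fun j _ => hi i i j j]
    refine Finset.sum_congr rfl fun i _ => ?_
    rw [integral_finsetSum _ fun j _ => hi i j j i, integral_finsetSum _ fun j _ => hi i i j j]
    exact Finset.sum_congr rfl fun j _ => h.integral_grad_mul_comm i j
  have i12 : IntegrableOn (fun x => μ * (∑ i, ∑ j, G x i j ^ 2 + ∑ i, ∑ j, G x i j * G x j i)) Ω :=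
    (i1.add i2).const_mul μ
  simp only [contract_stress_self]
  refine ⟨i12.add (i3.const_mul _), i1, ?_⟩
  rw [integral_add i12 (i3.const_mul _), integral_const_mul, integral_const_mul,
    integral_add i1 i2, e]
  have h3 : 0 ≤ ∫ x in Ω, ∑ i, ∑ j, G x i i * G x j j := by
    refine integral_nonneg fun x => ?_
    simp only [Pi.zero_apply]
    rw [← Finset.sum_mul_sum]
    exact mul_self_nonneg _
  nlinarith [mul_nonneg hη h3, mul_nonneg hμ.le h3]

lemma MemD012.sub {v' : E3 → E3} {G' : E3 → M33} (h : MemD012 Ω v G)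
    (h' : MemD012 Ω v' G') : MemD012 Ω (fun x => v x - v' x) (fun x => G x - G' x) := by
  obtain ⟨h1, h2, φ, hφ, h6, hG⟩ := h
  obtain ⟨h1', h2', φ', hφ', h6', hG'⟩ := h'
  have hc : ∀ {φ : E3 → E3}, ContDiff ℝ ∞ φ ∧ HasCompactSupport φ ∧ tsupport φ ⊆ Ω →
      MemLp φ 6 dx(Ω) := fun h => h.1.continuous.memLp_of_hasCompactSupport h.2.1
  have hz : Tendsto (fun n => eLpNorm (φ n - v) 6 dx(Ω)
      + eLpNorm (φ' n - v') 6 dx(Ω)) atTop (𝓝 0) := by simpa using h6.add h6'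
  refine ⟨h1.sub h1', fun i j => (h2 i j).sub (h2' i j), fun n x => φ n x - φ' n x, fun n => ?_,
    ?_, fun i j => ?_⟩
  · refine ⟨(hφ n).1.sub (hφ' n).1, (hφ n).2.1.sub (hφ' n).2.1, ?_⟩
    exact (tsupport_sub _ _).trans (union_subset (hφ n).2.2 (hφ' n).2.2)
  · refine tendsto_of_tendsto_of_tendsto_of_le_of_le tendsto_const_nhds hz (fun _ => zero_le)
      fun n => ?_
    have e : ((fun x => φ n x - φ' n x) - fun x => v x - v' x) = (φ n - v) - (φ' n - v') := by
      ext x : 1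
      simp only [Pi.sub_apply]
      abel
    rw [e]
    exact eLpNorm_sub_le ((hc (hφ n)).1.sub h1.1) ((hc (hφ' n)).1.sub h1'.1) (by norm_num)
  · have hz : Tendsto (fun n => eLpNorm (fun x => jac (φ n) x i j - G x i j) 2 dx(Ω)
      + eLpNorm (fun x => jac (φ' n) x i j - G' x i j) 2 dx(Ω)) atTop (𝓝 0) := by
      simpa using (hG i j).add (hG' i j)
    refine tendsto_of_tendsto_of_tendsto_of_le_of_le tendsto_const_nhds hz (fun _ => zero_le)
      fun n => ?_
    have hm : ∀ {φ : E3 → E3}, ContDiff ℝ ∞ φ ∧ HasCompactSupport φ ∧ tsupport φ ⊆ Ω →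
        AEStronglyMeasurable (fun x => jac φ x i j) dx(Ω) := fun h => by
      simp only [jac_eq h.1]
      exact ((isTestOn_coord h i).memLp_fderiv (bv j) 2 _).1
    have e : (fun x => jac (fun x => φ n x - φ' n x) x i j - (G x - G' x) i j)
        = (fun x => jac (φ n) x i j - G x i j) - fun x => jac (φ' n) x i j - G' x i j := by
      ext x
      simp only [Pi.sub_apply, Matrix.sub_apply, jac]
      rw [fderiv_fun_sub ((hφ n).1.differentiable (by simp) x)
        ((hφ' n).1.differentiable (by simp) x)]
      simp
      ring
    rw [e]
    exact eLpNorm_sub_le ((hm (hφ n)).sub (h2 i j).1) ((hm (hφ' n)).sub (h2' i j).1) (by norm_num)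

end D012

/-! ### Measurability and almost everywhere statements on products -/

section Prod

set_option linter.unusedSectionVars false

variable {ν : Measure β} [SFinite lam] [SFinite ν]

lemma ae_swap_of_ae_prod {P : α × β → Prop} (h : ∀ᵐ z ∂(lam.prod ν), P z) :
    ∀ᵐ y ∂ν, ∀ᵐ t ∂lam, P (t, y) := by
  have h1 : ∀ᵐ z ∂(ν.prod lam), P z.swap := by
    rw [← Measure.prod_swap] at h
    exact ae_of_ae_map measurable_swap.aemeasurable h
  exact ae_ae_of_ae_prod h1

lemma ae_eq_prod_of_ae_ae {f g : α × β → ℝ} (hf : AEStronglyMeasurable f (lam.prod ν))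
    (hg : AEStronglyMeasurable g (lam.prod ν)) (h : ∀ᵐ t ∂lam, ∀ᵐ y ∂ν, f (t, y) = g (t, y)) :
    f =ᵐ[lam.prod ν] g := by
  have h1 : hf.mk f =ᵐ[lam.prod ν] hg.mk g := by
    refine (Measure.ae_prod_iff_ae_ae (measurableSet_eq_fun hf.stronglyMeasurable_mk.measurable
      hg.stronglyMeasurable_mk.measurable)).2 ?_
    filter_upwards [h, ae_ae_of_ae_prod hf.ae_eq_mk, ae_ae_of_ae_prod hg.ae_eq_mk] with t h1 h2 h3
    filter_upwards [h1, h2, h3] with y h1 h2 h3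
    rw [← h2, ← h3, h1]
  exact hf.ae_eq_mk.trans (h1.trans hg.ae_eq_mk.symm)

lemma ae_eq_prod_of_ae_ae' {f g : α × β → ℝ} (hf : AEStronglyMeasurable f (lam.prod ν))
    (hg : AEStronglyMeasurable g (lam.prod ν)) (h : ∀ᵐ y ∂ν, ∀ᵐ t ∂lam, f (t, y) = g (t, y)) :
    f =ᵐ[lam.prod ν] g := by
  have h1 := ae_eq_prod_of_ae_ae (f := fun z : β × α => f z.swap) (g := fun z => g z.swap)
    (lam := ν) (ν := lam) hf.prod_swap hg.prod_swap h
  have h2 : ∀ᵐ z ∂(ν.prod lam), f z.swap = g z.swap := h1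
  have h3 : ∀ᵐ z ∂((ν.prod lam).map Prod.swap), f z = g z := by
    refine (MeasurableEmbedding.ae_map_iff ?_).2 h2
    exact MeasurableEquiv.prodComm.measurableEmbedding
  rwa [Measure.prod_swap] at h3

end Prod

lemma aestronglyMeasurable_primitive [SFinite ν] {a : ℝ → E3 → ℝ}
    (ha : AEStronglyMeasurable (uncurry a) (dt(T).prod ν)) :
    AEStronglyMeasurable (fun z : ℝ × E3 => ∫ t in 0..z.1, a t z.2) (dt(T).prod ν) := by
  set a' := ha.mk _ with ha'
  have hm : StronglyMeasurable a' := ha.stronglyMeasurable_mk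
  have h1 : StronglyMeasurable (fun w : (ℝ × E3) × ℝ =>
      {w : (ℝ × E3) × ℝ | 0 < w.2 ∧ w.2 ≤ w.1.1}.indicator (fun w => a' (w.2, w.1.2)) w) := by
    refine StronglyMeasurable.indicator (hm.comp_measurable (by fun_prop)) ?_
    exact (measurableSet_lt measurable_const measurable_snd).inter
      (measurableSet_le measurable_snd (measurable_fst.comp measurable_fst))
  have h2 := h1.integral_prod_right' (ν := (volume : Measure ℝ))
  refine ⟨_, h2, ?_⟩
  have h3 := ae_swap_of_ae_prod ha.ae_eq_mk
  have h4 := (Measure.quasiMeasurePreserving_snd (μ := dt(T)) (ν := ν)).ae h3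
  have h5 := (Measure.quasiMeasurePreserving_fst (μ := dt(T)) (ν := ν)).ae (ae_mem_Ioo)
  filter_upwards [h4, h5] with z hz hzT
  rw [integral_of_le hzT.1.le, ← integral_indicator measurableSet_Ioc]
  rw [ae_restrict_iff' measurableSet_Ioo] at hz
  refine integral_congr_ae ?_
  filter_upwards [hz] with t ht
  by_cases hz' : t ∈ Ioc 0 z.1
  · rw [indicator_of_mem hz', indicator_of_mem (by exact hz')]
    exact ht ⟨hz'.1, hz'.2.trans_lt hzT.2⟩
  · rw [indicator_of_notMem hz', indicator_of_notMem (by exact hz')]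

section Mollify

variable {κ : E3 → ℝ}

lemma aestronglyMeasurable_mollify [SFinite lam] (hκ : Continuous κ) {F : α → E3 → ℝ}
    (hF : AEStronglyMeasurable (uncurry F) (lam.prod volume)) :
    AEStronglyMeasurable (fun z : α × E3 => mollify κ (F z.1) z.2) (lam.prod volume) := by
  have hm : StronglyMeasurable (hF.mk _) := hF.stronglyMeasurable_mk
  have h1 : StronglyMeasurable (fun w : (α × E3) × E3 => hF.mk _ (w.1.1, w.2) * κ (w.1.2 - w.2)) :=
    (hm.comp_measurable (by fun_prop)).mul (hκ.stronglyMeasurable.comp_measurable (by fun_prop))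
  refine ⟨_, h1.integral_prod_right' (ν := (volume : Measure E3)), ?_⟩
  have h3 := ae_ae_of_ae_prod hF.ae_eq_mk
  have h4 := (Measure.quasiMeasurePreserving_fst (μ := lam) (ν := (volume : Measure E3))).ae h3
  filter_upwards [h4] with z hz
  refine integral_congr_ae ?_
  filter_upwards [hz] with x hx
  rw [← hx]
  rfl

lemma abs_mollify_le (hb : ∀ z, |κ z| ≤ C) (hF : Integrable F) (y : E3) :
    |mollify κ F y| ≤ C * ∫ x, ‖F x‖ := by
  rw [← integral_const_mul, mollify, ← Real.norm_eq_abs]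
  refine norm_integral_le_of_norm_le (hF.norm.const_mul C) (.of_forall fun x => ?_)
  rw [norm_mul, mul_comm]
  exact mul_le_mul_of_nonneg_right (hb _) (norm_nonneg _)

lemma integral_mollify_mul_comm (hκ : Continuous κ) (hb : ∀ z, |κ z| ≤ C) {G : E3 → ℝ}
    (hF : Integrable F) (hG : Integrable G) : Integrable (fun y => mollify κ F y * G y) ∧
      ∫ y, mollify κ F y * G y = ∫ x, F x * ∫ y, G y * κ (y - x) := by
  have h1 : Integrable (fun z : E3 × E3 => κ (z.1 - z.2) * (G z.1 * F z.2)) (volume.prod volume) :=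
    (hG.mul_prod hF).bdd_mul (hκ.comp (continuous_fst.sub continuous_snd)).aestronglyMeasurable
      (.of_forall fun z => hb _)
  have e1 : ∀ y, ∫ x, κ (y - x) * (G y * F x) = mollify κ F y * G y := fun y => by
    rw [mollify, ← integral_mul_const]
    exact integral_congr_ae (.of_forall fun x => by ring)
  have e2 : ∀ x, ∫ y, κ (y - x) * (G y * F x) = F x * ∫ y, G y * κ (y - x) := fun x => by
    rw [← integral_const_mul]
    exact integral_congr_ae (.of_forall fun x => by ring)
  refine ⟨?_, ?_⟩
  · simpa only [e1] using h1.integral_prod_left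
  · have := integral_integral_swap (f := fun y x => κ (y - x) * (G y * F x)) h1
    simpa only [e1, e2] using this

end Mollify

/-! ### The product rule with a mollified factor -/

section ProductRule

variable {R s a Φ : ℝ → E3 → ℝ} {b : Fin 3 → ℝ → E3 → ℝ} {R₀ Φ₀ : E3 → ℝ} {S : Set E3}

lemma Mix.ae_integrable {r : ℝ≥0∞} {lam : Measure ℝ} (h : Mix lam ν r 1 g) :
    ∀ᵐ t ∂lam, Integrable (g t) ν :=
  h.memLp.mono fun _ ht => memLp_one_iff_integrable.1 ht

/-- If `R` solves `∂_t R + div J = s` weakly against the kernel `k (y - ·)` for the points `y` of a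
set carrying `Φ`, and `Φ` has time derivative `a` and space gradient `b`, then the product of the
mollified `R` with `Φ` satisfies the product rule. -/
lemma integral_mollify_mul_eq (hk : ContDiff ℝ ∞ k) (hC : ∀ z, |k z| ≤ C)
    (hC' : ∀ j z, |fderiv ℝ k z (bv j)| ≤ C)
    (hR : Mix dt(T) volume ⊤ 1 R)
    (hJ : ∀ j, Mix dt(T) volume 1 1 (J j))
    (hs : Mix dt(T) volume 1 1 s)
    (ha : Mix dt(T) volume 1 1 a)
    (hΦ₀ : Integrable Φ₀)
    (hΦm : AEStronglyMeasurable (uncurry Φ) (dt(T).prod volume))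
    (hW : ∀ᵐ τ ∂dt(T), ∀ y ∈ S, mollify k (R τ) y = mollify k R₀ y
      + ∫ t in 0..τ, (mollify k (s t) y
        - ∑ j, mollify (fun z => fderiv ℝ k z (bv j)) (J j t) y))
    (hR₀ : Integrable R₀)
    (hS : ∀ y ∉ S, Φ₀ y = 0 ∧ ∀ t, a t y = 0)
    (hA : ∀ᵐ y, ∀ᵐ t ∂dt(T), Φ t y = Φ₀ y + ∫ s in 0..t, a s y)
    (hG : ∀ᵐ t ∂dt(T), ∀ j x,
      J j t x * ∫ y, Φ t y * fderiv ℝ k (y - x) (bv j) = - (J j t x * ∫ y, b j t y * k (y - x)))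
    (hb : ∀ j, Mix dt(T) volume 1 1 (b j)) :
    ∀ᵐ τ ∂dt(T), ∫ y, mollify k (R τ) y * Φ τ y = (∫ y, mollify k R₀ y * Φ₀ y)
        + ∫ t in 0..τ, ((∫ y, mollify k (R t) y * a t y)
          + (∫ y, mollify k (s t) y * Φ t y) + ∑ j, ∫ y, mollify k (J j t) y * b j t y) := by
  set lam := dt(T) with hlam
  have hkc := hk.continuous
  have hk'c : ∀ j, Continuous (fun z => fderiv ℝ k z (bv j)) := fun j =>
    (hk.continuous_fderiv (by simp)).clm_apply continuous_const
  have hC0 : 0 ≤ C := (abs_nonneg _).trans (hC 0)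
  set B : ℝ → E3 → ℝ := fun t y => mollify k (s t) y
    - ∑ j, mollify (fun z => fderiv ℝ k z (bv j)) (J j t) y with hB
  have hBm : AEStronglyMeasurable (uncurry B) (lam.prod volume) :=
    (aestronglyMeasurable_mollify hkc hs.meas).sub (Finset.aestronglyMeasurable_fun_sum _ fun j _ =>
        aestronglyMeasurable_mollify (hk'c j) (hJ j).meas)
  set β : ℝ → ℝ := fun t => C * ((∫ x, ‖s t x‖) + ∑ j, ∫ x, ‖J j t x‖) with hβ
  have hβi : Integrable β lam :=
    (hs.integrable.integral_norm_prod_left.add (integrable_finsetSum _ fun j _ =>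
      (hJ j).integrable.integral_norm_prod_left)).const_mul C
  have hJae : ∀ᵐ t ∂lam, ∀ j, Integrable (J j t) := ae_all_iff.2 fun j => (hJ j).ae_integrable
  have hBb : ∀ᵐ t ∂lam, ∀ y, |B t y| ≤ β t := by
    filter_upwards [hs.ae_integrable, hJae] with t h1 h2 y
    simp only [hB, hβ, mul_add, Finset.mul_sum]
    refine (abs_sub _ _).trans (add_le_add (abs_mollify_le hC h1 y) ?_)
    exact (Finset.abs_sum_le_sum_abs _ _).trans
      (Finset.sum_le_sum fun j _ => abs_mollify_le (hC' j) (h2 j) y)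
  -- time integrability for fixed `y`
  have hBi : ∀ᵐ y, Integrable (fun t => B t y) lam := by
    filter_upwards [ae_swap_of_ae_prod hBm.ae_eq_mk] with y hy
    refine hβi.mono' ((hBm.stronglyMeasurable_mk.comp_measurable
      (by fun_prop : Measurable fun t : ℝ => (t, y))).aestronglyMeasurable.congr
      (show (fun t => B t y) =ᵐ[lam] fun t => hBm.mk _ (t, y) from hy).symm) ?_
    filter_upwards [hBb] with t ht
    exact ht y
  have hai : ∀ᵐ y, Integrable (fun t => a t y) lam := ha.integrable.prod_left_ae
  have hint : ∀ {f : ℝ → ℝ} {τ : ℝ}, Integrable f lam → τ ∈ Ioo 0 T →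
      IntervalIntegrable f volume 0 τ := fun {f τ} hf hτ => by
    rw [intervalIntegrable_iff_integrableOn_Ioc_of_le hτ.1.le]
    exact hf.mono_measure (restrict_le (fun x (hx : x ∈ Ioc 0 τ) =>
      (⟨hx.1, hx.2.trans_lt hτ.2⟩ : x ∈ Ioo 0 T)))
  set g : E3 → ℝ := fun y => |Φ₀ y| + ∫ t, ‖a t y‖ ∂lam with hg
  have hgi : Integrable g := hΦ₀.norm.add ha.integrable.integral_norm_prod_right
  -- a.e. identities on the product
  have hAe : ∀ᵐ z ∂(lam.prod volume), Φ z.1 z.2 = Φ₀ z.2 + ∫ t in 0..z.1, a t z.2 :=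
    ae_eq_prod_of_ae_ae' hΦm ((hΦ₀.1.comp_snd).add (aestronglyMeasurable_primitive ha.meas)) hA
  have hΦb : ∀ᵐ z ∂(lam.prod volume), |Φ z.1 z.2| ≤ g z.2 := by
    have h5 := (Measure.quasiMeasurePreserving_fst (μ := lam) (ν := (volume : Measure E3))).ae
      (ae_mem_Ioo)
    have h6 := (Measure.quasiMeasurePreserving_snd (μ := lam) (ν := (volume : Measure E3))).ae hai
    filter_upwards [hAe, h5, h6] with z hz hzT hza
    rw [hz]
    refine (abs_add_le _ _).trans (add_le_add le_rfl ?_)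
    rw [integral_of_le hzT.1.le, ← Real.norm_eq_abs]
    refine (norm_integral_le_integral_norm _).trans ?_
    refine integral_mono_measure (restrict_le (fun x (hx : x ∈ Ioc 0 z.1) =>
      (⟨hx.1, hx.2.trans_lt hzT.2⟩ : x ∈ Ioo 0 T))) (.of_forall fun _ => norm_nonneg _) hza.norm
  have hRk : AEStronglyMeasurable (fun z : ℝ × E3 => mollify k (R z.1) z.2) (lam.prod volume) :=
    aestronglyMeasurable_mollify hkc hR.meas
  have hi1 : Integrable (fun z : ℝ × E3 => B z.1 z.2 * Φ z.1 z.2) (lam.prod volume) := by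
    refine (hβi.mul_prod hgi).mono' (hBm.mul hΦm) ?_
    have h5 := (Measure.quasiMeasurePreserving_fst (μ := lam) (ν := (volume : Measure E3))).ae hBb
    filter_upwards [hΦb, h5] with z h1 h2
    rw [norm_mul]
    exact mul_le_mul (h2 z.2) h1 (norm_nonneg _) ((abs_nonneg _).trans (h2 z.2))
  obtain ⟨N, hN⟩ : ∃ N, ∀ᵐ t ∂lam, ∀ y, |mollify k (R t) y| ≤ N := by
    refine ⟨C * (eLpNorm (fun t => (eLpNorm (R t) 1 volume).toReal) ⊤ lam).toReal, ?_⟩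
    have h1 := ae_le_eLpNormEssSup (f := fun t => (eLpNorm (R t) 1 volume).toReal) (μ := lam)
    filter_upwards [h1, hR.ae_integrable] with t h2 h3 y
    refine (abs_mollify_le hC h3 y).trans (mul_le_mul_of_nonneg_left ?_ hC0)
    have h4 := toReal_mono (by
      have := hR.norm.2.ne
      rwa [eLpNorm_exponent_top] at this) h2
    rw [eLpNorm_exponent_top]
    refine le_trans (le_of_eq ?_) h4
    rw [toReal_enorm, Real.norm_eq_abs, abs_of_nonneg toReal_nonneg, toReal_eLpNorm h3.1,
      lpNorm_one_eq_integral_norm h3.1]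
  have hi2 : Integrable (fun z : ℝ × E3 => mollify k (R z.1) z.2 * a z.1 z.2)
    (lam.prod volume) := by
    refine ha.integrable.bdd_mul (c := N) hRk ?_
    have h5 := (Measure.quasiMeasurePreserving_fst (μ := lam) (ν := (volume : Measure E3))).ae hN
    filter_upwards [h5] with z h1
    exact h1 z.2
  -- the pointwise identity
  have hWe : ∀ᵐ y, ∀ᵐ t ∂lam, y ∈ S → mollify k (R t) y = mollify k R₀ y
      + ∫ t in 0..t, B t y := by
    have hm1 : AEStronglyMeasurable (fun z : ℝ × E3 => mollify k R₀ z.2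
        + ∫ t in 0..z.1, B t z.2) (lam.prod volume) := by
      refine AEStronglyMeasurable.add ?_ (aestronglyMeasurable_primitive hBm)
      have := aestronglyMeasurable_mollify (lam := lam) hkc (F := fun _ => R₀) (hR₀.1.comp_snd)
      exact this
    have h0 : ∀ᵐ z ∂(lam.prod volume), z.2 ∈ S → mollify k (R z.1) z.2 = mollify k R₀ z.2
      + ∫ t in 0..z.1, B t z.2 := by
      have := (Measure.quasiMeasurePreserving_fst (μ := lam) (ν := (volume : Measure E3))).ae hW
      filter_upwards [this] with z hz hzS
      exact hz z.2 hzS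
    exact ae_swap_of_ae_prod h0
  have hpt : ∀ᵐ τ ∂lam, ∀ᵐ y, mollify k (R τ) y * Φ τ y = mollify k R₀ y * Φ₀ y
      + ∫ t in 0..τ, (B t y * Φ t y + mollify k (R t) y * a t y) := by
    filter_upwards [hW, ae_ae_of_ae_prod hAe, ae_mem_Ioo] with τ h1 h2 hτ
    filter_upwards [h2, hWe, hA, hBi, hai] with y h2 h3 h4 h5 h6
    by_cases hy : y ∈ S
    · rw [h1 y hy, h2, primitive_mul_primitive_eq (hint h5 hτ) (hint h6 hτ)]
      congr 1
      refine intervalIntegral.integral_congr_ae ?_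
      rw [uIoc_of_le hτ.1.le]
      rw [ae_restrict_iff' measurableSet_Ioo] at h3 h4
      filter_upwards [h3, h4] with t h3 h4 ht
      have htT : t ∈ Ioo 0 T := ⟨ht.1, ht.2.trans_lt hτ.2⟩
      rw [h3 htT hy, h4 htT]
    · have e0 := hS y hy
      have e1 : ∀ t, ∫ s in 0..t, a s y = 0 := fun t => by simp [e0.2]
      rw [h2, e1, e0.1]
      simp only [e0.2, mul_zero, add_zero, zero_add]
      refine ((intervalIntegral.integral_congr_ae (g := fun _ => (0 : ℝ)) ?_).trans
        intervalIntegral.integral_zero).symm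
      rw [uIoc_of_le hτ.1.le]
      rw [ae_restrict_iff' measurableSet_Ioo] at h4
      filter_upwards [h4] with t h4 ht
      have htT : t ∈ Ioo 0 T := ⟨ht.1, ht.2.trans_lt hτ.2⟩
      rw [h4 htT, e1, e0.1]
      simp
  -- integration in space
  have hspace : ∀ᵐ t ∂lam, ∫ y, (B t y * Φ t y + mollify k (R t) y * a t y)
      = (∫ y, mollify k (R t) y * a t y)
          + (∫ y, mollify k (s t) y * Φ t y) + ∑ j, ∫ y, mollify k (J j t) y * b j t y := by
    have hΦi : ∀ᵐ t ∂lam, Integrable (Φ t) := by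
      filter_upwards [ae_ae_of_ae_prod hΦb, ae_ae_of_ae_prod hΦm.ae_eq_mk] with t h1 h2
      refine hgi.mono' ?_ h1
      exact (hΦm.stronglyMeasurable_mk.comp_measurable
        (by fun_prop : Measurable fun y : E3 => (t, y))).aestronglyMeasurable.congr
        (show Φ t =ᵐ[volume] fun y => hΦm.mk _ (t, y) from h2).symm
    have hbae : ∀ᵐ t ∂lam, ∀ j, Integrable (b j t) := ae_all_iff.2 fun j => (hb j).ae_integrable
    filter_upwards [hΦi, hs.ae_integrable, hJae, hbae, ha.ae_integrable, hR.ae_integrable, hG]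
      with t h1 h2 h3 h4 h5 h6 h7
    have c1 := integral_mollify_mul_comm hkc hC h2 h1
    have c2 := fun j => integral_mollify_mul_comm (hk'c j) (hC' j) (h3 j) h1
    have c3 := fun j => integral_mollify_mul_comm hkc hC (h3 j) (h4 j)
    have c4 := integral_mollify_mul_comm hkc hC h6 h5
    have e1 : ∀ y, B t y * Φ t y = mollify k (s t) y * Φ t y
        - ∑ j, mollify (fun z => fderiv ℝ k z (bv j)) (J j t) y * Φ t y := fun y => by
      simp only [hB]
      rw [sub_mul, Finset.sum_mul]
    have i2 : Integrable (fun y => ∑ j, mollify (fun z => fderiv ℝ k z (bv j)) (J j t) y * Φ t y) :=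
      integrable_finsetSum _ fun j _ => (c2 j).1
    have i1 : Integrable (fun y => B t y * Φ t y) := by
      simp only [e1]
      exact c1.1.sub i2
    rw [integral_add i1 c4.1, add_comm, add_assoc]
    congr 1
    simp only [e1]
    rw [integral_sub c1.1 i2, integral_finsetSum _ fun j _ => (c2 j).1, sub_eq_add_neg,
      ← Finset.sum_neg_distrib]
    congr 1
    refine Finset.sum_congr rfl fun j _ => ?_
    rw [(c2 j).2, (c3 j).2, ← integral_neg]
    exact integral_congr_ae (.of_forall fun x => by simp only [h7 j x, neg_neg])
  have hi0 : Integrable (fun y => mollify k R₀ y * Φ₀ y) :=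
    (integral_mollify_mul_comm hkc hC hR₀ hΦ₀).1
  filter_upwards [hpt, ae_mem_Ioo] with τ h1 hτ
  have hsub : volume.restrict (Ioc 0 τ) ≤ lam := restrict_le (fun x (hx : x ∈ Ioc 0 τ) =>
      (⟨hx.1, hx.2.trans_lt hτ.2⟩ : x ∈ Ioo 0 T))
  have hi3 : Integrable (fun z : ℝ × E3 => B z.1 z.2 * Φ z.1 z.2
      + mollify k (R z.1) z.2 * a z.1 z.2) ((volume.restrict (uIoc 0 τ)).prod volume) := by
    rw [uIoc_of_le hτ.1.le]
    exact (hi1.add hi2).mono_measure (Measure.prod_mono hsub le_rfl)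
  rw [integral_congr_ae h1, integral_add hi0]
  · congr 1
    rw [← intervalIntegral_integral_swap (f := fun t y => B t y * Φ t y + mollify k (R t) y * a t y)
      hi3]
    refine intervalIntegral.integral_congr_ae ?_
    rw [uIoc_of_le hτ.1.le]
    rw [ae_restrict_iff' measurableSet_Ioo] at hspace
    filter_upwards [hspace] with t ht htτ
    exact ht ⟨htτ.1, htτ.2.trans_lt hτ.2⟩
  · simp only [integral_of_le hτ.1.le]
    rw [uIoc_of_le hτ.1.le] at hi3
    exact hi3.integral_prod_right

end ProductRule

/-! ### Pairings that are stable under mollification -/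

/-- The products of the mollified `F` with `G` converge to `F G` under an integrable bound. -/
structure Pairing (lam : Measure ℝ) (F G : ℝ → E3 → ℝ) : Prop where
  meas_left : AEStronglyMeasurable (uncurry F) (lam.prod volume)
  meas_right : AEStronglyMeasurable (uncurry G) (lam.prod volume)
  ae_left : ∀ᵐ t ∂lam, Integrable (F t)
  ae_right : ∀ᵐ t ∂lam, Integrable (G t)
  ae_mul : ∀ᵐ t ∂lam, Integrable (fun y => F t y * G t y)
  bound : ∃ b : ℝ → ℝ, Integrable b lam ∧ ∀ᵐ t ∂lam, ∀ k ε, IsKernel k ε →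
    |∫ y, mollify k (F t) y * G t y| ≤ b t
  tendsto : ∀ᵐ t ∂lam, ∀ (k : ℕ → E3 → ℝ) (ε : ℕ → ℝ), (∀ n, IsKernel (k n) (ε n)) →
    Tendsto ε atTop (𝓝 0) →
    Tendsto (fun n => ∫ y, mollify (k n) (F t) y * G t y) atTop (𝓝 (∫ y, F t y * G t y))

lemma IsKernel.exists_bound (hk : IsKernel k ε) : ∃ C, (∀ z, |k z| ≤ C) ∧
    ∀ j z, |fderiv ℝ k z (bv j)| ≤ C := by
  obtain ⟨C₀, h₀⟩ := hk.contDiff.continuous.bounded_above_of_compact_support hk.hasCompactSupport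
  have h1 : ∀ j : Fin 3, ∃ C, ∀ z, ‖fderiv ℝ k z (bv j)‖ ≤ C := fun j =>
    ((hk.contDiff.continuous_fderiv (by simp)).clm_apply
      continuous_const).bounded_above_of_compact_support (hk.hasCompactSupport.fderiv_apply ℝ _)
  choose C₁ h₁ using h1
  refine ⟨max C₀ (∑ j, |C₁ j|), fun z => (h₀ z).trans (le_max_left _ _), fun j z => ?_⟩
  refine ((h₁ j z).trans ((le_abs_self _).trans ?_)).trans (le_max_right _ _)
  exact Finset.single_le_sum (f := fun j => |C₁ j|) (fun _ _ => abs_nonneg _) (Finset.mem_univ j)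

section Pairing

variable {lam : Measure ℝ} {F G G₁ G₂ : ℝ → E3 → ℝ} {r₁ r₂ s₁ s₂ : ℝ≥0∞}

lemma Pairing.of_mix [HolderTriple r₁ r₂ 1] [HolderTriple s₁ s₂ 1] (hs₁ : 1 ≤ s₁)
    (hs₁t : s₁ ≠ ⊤) (hF : Mix lam volume r₁ s₁ F) (hG : Mix lam volume r₂ s₂ G)
    (hF1 : ∀ᵐ t ∂lam, Integrable (F t)) (hG1 : ∀ᵐ t ∂lam, Integrable (G t)) : Pairing lam F G where
  meas_left := hF.meas
  meas_right := hG.meas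
  ae_left := hF1
  ae_right := hG1
  ae_mul := by
    filter_upwards [hF.memLp, hG.memLp] with t h1 h2
    exact memLp_one_iff_integrable.1 (memLp_mul h1 h2)
  bound := by
    refine ⟨_, memLp_one_iff_integrable.1 (memLp_mul hF.norm hG.norm), ?_⟩
    filter_upwards [hF.memLp, hG.memLp] with t h1 h2 k ε hk
    exact abs_integral_mollify_mul_le hk h1 h2
  tendsto := by
    filter_upwards [hF.memLp, hG.memLp] with t h1 h2 k ε hk hε
    exact tendsto_integral_mollify_mul hk hε hs₁ hs₁t h1 h2

lemma Pairing.add_right (h₁ : Pairing lam F G₁) (h₂ : Pairing lam F G₂) :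
    Pairing lam F (fun t y => G₁ t y + G₂ t y) where
  meas_left := h₁.meas_left
  meas_right := h₁.meas_right.add h₂.meas_right
  ae_left := h₁.ae_left
  ae_right := by
    filter_upwards [h₁.ae_right, h₂.ae_right] with t a b
    exact a.add b
  ae_mul := by
    filter_upwards [h₁.ae_mul, h₂.ae_mul] with t a b
    simp only [mul_add]
    exact a.add b
  bound := by
    obtain ⟨b₁, hb₁, hb₁'⟩ := h₁.bound
    obtain ⟨b₂, hb₂, hb₂'⟩ := h₂.bound
    refine ⟨_, hb₁.add hb₂, ?_⟩
    filter_upwards [hb₁', hb₂', h₁.ae_left, h₁.ae_right, h₂.ae_right] with t a b c d e k ε hk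
    obtain ⟨C, hC, -⟩ := hk.exists_bound
    simp only [mul_add]
    rw [integral_add (integral_mollify_mul_comm hk.contDiff.continuous hC c d).1
      (integral_mollify_mul_comm hk.contDiff.continuous hC c e).1]
    exact (abs_add_le _ _).trans (add_le_add (a k ε hk) (b k ε hk))
  tendsto := by
    filter_upwards [h₁.tendsto, h₂.tendsto, h₁.ae_left, h₁.ae_right, h₂.ae_right, h₁.ae_mul,
      h₂.ae_mul] with t a b c d e f g k ε hk hε
    simp only [mul_add]
    rw [integral_add f g]
    refine ((a k ε hk hε).add (b k ε hk hε)).congr fun n => ?_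
    obtain ⟨C, hC, -⟩ := (hk n).exists_bound
    rw [integral_add (integral_mollify_mul_comm (hk n).contDiff.continuous hC c d).1
      (integral_mollify_mul_comm (hk n).contDiff.continuous hC c e).1]

lemma Pairing.aestronglyMeasurable [SFinite lam] (h : Pairing lam F G) (hk : IsKernel k ε) :
    AEStronglyMeasurable (fun t => ∫ y, mollify k (F t) y * G t y) lam :=
  ((aestronglyMeasurable_mollify hk.contDiff.continuous h.meas_left).mul
    h.meas_right).integral_prod_right'

end Pairing

lemma pairing_limit {R s a Φ : ℝ → E3 → ℝ} {b : Fin 3 → ℝ → E3 → ℝ} {R₀ Φ₀ : E3 → ℝ}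
    {k : ℕ → E3 → ℝ} {ε : ℕ → ℝ} (hk : ∀ n, IsKernel (k n) (ε n)) (hε : Tendsto ε atTop (𝓝 0))
    (hRΦ : Pairing dt(T) R Φ) (hRa : Pairing dt(T) R a) (hsΦ : Pairing dt(T) s Φ)
    (hJb : ∀ j, Pairing dt(T) (J j) (b j))
    (h0 : Tendsto (fun n => ∫ y, mollify (k n) R₀ y * Φ₀ y) atTop (𝓝 (∫ y, R₀ y * Φ₀ y)))
    (H : ∀ n, ∀ᵐ τ ∂dt(T), ∫ y, mollify (k n) (R τ) y * Φ τ y =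
      (∫ y, mollify (k n) R₀ y * Φ₀ y) + ∫ t in 0..τ,
      ((∫ y, mollify (k n) (R t) y * a t y) + (∫ y, mollify (k n) (s t) y * Φ t y) + ∑ j, ∫ y,
      mollify (k n) (J j t) y * b j t y)) :
    ∀ᵐ τ ∂dt(T), ∫ y, R τ y * Φ τ y = (∫ y, R₀ y * Φ₀ y)
        + ∫ t in 0..τ, ((∫ y, R t y * a t y) + (∫ y, s t y * Φ t y)
          + ∑ j, ∫ y, J j t y * b j t y) := by
  obtain ⟨b₁, hb₁, hb₁'⟩ := hRa.bound
  obtain ⟨b₂, hb₂, hb₂'⟩ := hsΦ.bound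
  choose b₃ hb₃ hb₃' using fun j => (hJb j).bound
  have hb₃a := ae_all_iff.2 hb₃'
  have hJt := ae_all_iff.2 fun j => (hJb j).tendsto
  filter_upwards [ae_all_iff.2 H, hRΦ.tendsto, ae_mem_Ioo] with τ h1 h2 hτ
  have hsub : volume.restrict (uIoc 0 τ) ≤ dt(T) := by
    rw [uIoc_of_le hτ.1.le]
    exact restrict_le (fun x (hx : x ∈ Ioc 0 τ) =>
      (⟨hx.1, hx.2.trans_lt hτ.2⟩ : x ∈ Ioo 0 T))
  refine tendsto_nhds_unique ((h2 k ε hk hε).congr h1) (h0.add ?_)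
  refine intervalIntegral.tendsto_integral_filter_of_dominated_convergence
    (fun t => b₁ t + b₂ t + ∑ j, b₃ j t) (.of_forall fun n => ?_)
    (.of_forall fun n => ?_) ?_ ?_
  · refine AEStronglyMeasurable.mono_measure ?_ hsub
    exact ((hRa.aestronglyMeasurable (hk n)).add (hsΦ.aestronglyMeasurable (hk n))).add
      (Finset.aestronglyMeasurable_fun_sum _ fun j _ => (hJb j).aestronglyMeasurable (hk n))
  · rw [← ae_restrict_iff' measurableSet_uIoc]
    refine ae_mono hsub ?_
    filter_upwards [hb₁', hb₂', hb₃a] with t c1 c2 c3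
    rw [Real.norm_eq_abs]
    refine (abs_add_le _ _).trans (add_le_add ((abs_add_le _ _).trans
      (add_le_add (c1 _ _ (hk n)) (c2 _ _ (hk n)))) ?_)
    exact (Finset.abs_sum_le_sum_abs _ _).trans (Finset.sum_le_sum fun j _ => c3 j _ _ (hk n))
  · rw [intervalIntegrable_iff]
    exact ((hb₁.add hb₂).add (integrable_finsetSum _ fun j _ => hb₃ j)).mono_measure hsub
  · rw [← ae_restrict_iff' measurableSet_uIoc]
    refine ae_mono hsub ?_
    filter_upwards [hRa.tendsto, hsΦ.tendsto, hJt] with t c1 c2 c3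
    exact ((c1 k ε hk hε).add (c2 k ε hk hε)).add (tendsto_finsetSum _ fun j _ => c3 j k ε hk hε)

/-! ### Mollified form of the weak formulation -/

lemma setIntegral_cyl_eq (hΩ : MeasurableSet Ω) {H : ℝ → E3 → ℝ}
    (hH : Integrable (uncurry H) (dt(T).prod volume)) (hτ : τ ∈ Ioo 0 T) {f : ℝ × E3 → ℝ}
    (hf : ∀ t ∈ Ioo 0 τ, ∀ x ∈ Ω, f (t, x) = H t x) (h0 : ∀ t, ∀ x ∉ Ω, H t x = 0) :
    ∫ z in cyl τ Ω, f z = ∫ t in 0..τ, ∫ x, H t x := by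
  have hm : MeasurableSet (cyl τ Ω) := measurableSet_Ioo.prod hΩ
  have e1 : ∫ z in cyl τ Ω, f z = ∫ z in cyl τ Ω, uncurry H z :=
    setIntegral_congr_fun hm fun z hz => hf z.1 hz.1 z.2 hz.2
  have e2 : ∫ z in cyl τ Ω, uncurry H z = ∫ z in Ioo 0 τ ×ˢ (univ : Set E3), uncurry H z := by
    refine (setIntegral_eq_of_subset_of_forall_sdiff_eq_zero (measurableSet_Ioo.prod
      MeasurableSet.univ) (prod_mono le_rfl (subset_univ _)) fun z hz => ?_).symm
    refine h0 _ _ fun hz' => hz.2 ⟨hz.1.1, hz'⟩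
  have hsub : dt(τ) ≤ dt(T) := restrict_le (Ioo_subset_Ioo_right hτ.2.le)
  have hHi := hH.mono_measure (Measure.prod_mono hsub (le_refl (volume : Measure E3)))
  rw [e1, e2, intervalIntegral_eq_Ioo hτ.1.le,
    Measure.volume_eq_prod, ← Measure.prod_restrict, Measure.restrict_univ, integral_prod _ hHi]
  rfl

lemma setIntegral_cyl_eq_mollify (hΩ : MeasurableSet Ω) {s : ℝ → E3 → ℝ}
    (hs : Mix dt(T) volume 1 1 s) (hJ : ∀ j, Mix dt(T) volume 1 1 (J j))
    (hs0 : ∀ t, ∀ x ∉ Ω, s t x = 0) (hJ0 : ∀ j t, ∀ x ∉ Ω, J j t x = 0) (hk : ContDiff ℝ ∞ k)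
    (hC : ∀ z, |k z| ≤ C) (hC' : ∀ j z, |fderiv ℝ k z (bv j)| ≤ C) (hτ : τ ∈ Ioo 0 T) (y : E3)
    {f : ℝ × E3 → ℝ}
    (hf : ∀ t ∈ Ioo 0 τ, ∀ x ∈ Ω, f (t, x) = s t x * k (y - x) - ∑ j,
      J j t x * fderiv ℝ k (y - x) (bv j)) :
    ∫ z in cyl τ Ω, f z = ∫ t in 0..τ, (mollify k (s t) y
        - ∑ j, mollify (fun z => fderiv ℝ k z (bv j)) (J j t) y) := by
  have hkc : Continuous (fun x => k (y - x)) := hk.continuous.comp (by fun_prop)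
  have hk'c : ∀ j : Fin 3, Continuous (fun x => fderiv ℝ k (y - x) (bv j)) := fun j =>
    ((hk.continuous_fderiv (by simp)).comp (by fun_prop)).clm_apply continuous_const
  have i1 : Integrable (fun z : ℝ × E3 => s z.1 z.2 * k (y - z.2)) (dt(T).prod volume) :=
    hs.integrable.mul_bdd (hkc.comp continuous_snd).aestronglyMeasurable (.of_forall fun z => hC _)
  have i2 : ∀ j, Integrable (fun z : ℝ × E3 => J j z.1 z.2 * fderiv ℝ k (y - z.2) (bv j))
      (dt(T).prod volume) := fun j =>
    (hJ j).integrable.mul_bdd ((hk'c j).comp continuous_snd).aestronglyMeasurable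
      (.of_forall fun z => hC' _ _)
  rw [setIntegral_cyl_eq hΩ (H := fun t x => s t x * k (y - x)
    - ∑ j, J j t x * fderiv ℝ k (y - x) (bv j)) (i1.sub (integrable_finsetSum _ fun j _ => i2 j))
    hτ hf (fun t x hx => by simp [hs0 t x hx, hJ0 _ t x hx])]
  refine intervalIntegral.integral_congr_ae ?_
  have h1 := i1.prod_right_ae
  have h2 := ae_all_iff.2 fun j => (i2 j).prod_right_ae
  rw [ae_restrict_iff' measurableSet_Ioo] at h1 h2
  filter_upwards [h1, h2] with t h1 h2 ht
  rw [uIoc_of_le hτ.1.le] at ht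
  have htT : t ∈ Ioo 0 T := ⟨ht.1, ht.2.trans_lt hτ.2⟩
  rw [integral_sub (h1 htT) (integrable_finsetSum _ fun j _ => h2 htT j),
    integral_finsetSum _ fun j _ => h2 htT j]
  rfl

lemma exists_time_cutoff (hT : 0 < T) : ∃ θ : ℝ → ℝ, ContDiff ℝ ∞ θ ∧ HasCompactSupport θ ∧
    (∀ t ∈ Icc 0 T, θ t = 1) ∧ ∀ t ∈ Icc 0 T, ∀ c : ℝ, deriv (fun t => θ t * c) t = 0 := by
  let φ : ContDiffBump (0 : ℝ) := ⟨T + 1, T + 2, by linarith, by linarith⟩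
  have h1 : ∀ t ∈ Icc 0 T, closedBall (0 : ℝ) (T + 1) ∈ 𝓝 t := fun t ht => by
    refine Filter.mem_of_superset (Metric.isOpen_ball.mem_nhds (?_ : t ∈ ball (0 : ℝ) (T + 1)))
      Metric.ball_subset_closedBall
    rw [mem_ball_zero_iff, Real.norm_eq_abs, abs_of_nonneg ht.1]
    linarith [ht.2]
  refine ⟨φ, φ.contDiff, φ.hasCompactSupport, fun t ht =>
    φ.one_of_mem_closedBall (mem_of_mem_nhds (h1 t ht)), fun t ht c => ?_⟩
  have h2 : (fun t => φ t * c) =ᶠ[𝓝 t] fun _ => c := by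
    filter_upwards [h1 t ht] with s hs
    rw [φ.one_of_mem_closedBall hs, one_mul]
  rw [h2.deriv_eq, deriv_const]

lemma mollify_indicator_eq (hΩ : MeasurableSet Ω) (hKΩ : K ⊆ Ω) {y : E3}
    (hk0 : ∀ x ∈ Ω, x ∉ K → k (y - x) = 0) :
    mollify k (K.indicator F) y = ∫ x in Ω, F x * k (y - x) := by
  rw [mollify, ← integral_indicator hΩ]
  refine integral_congr_ae (.of_forall fun x => ?_)
  by_cases hx : x ∈ K
  · simp [hx, hKΩ hx]
  · by_cases hx' : x ∈ Ω
    · simp [hx, hx', hk0 x hx' hx]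
    · simp [hx, hx']

lemma hasCompactSupport_mul_comp {θ : ℝ → ℝ} (hθ : HasCompactSupport θ) (hψ : HasCompactSupport ψ) :
    HasCompactSupport (fun z : ℝ × E3 => θ z.1 * ψ z.2) ∧
    tsupport (fun z : ℝ × E3 => θ z.1 * ψ z.2) ⊆ univ ×ˢ tsupport ψ := by
  have hc : IsCompact (tsupport θ ×ˢ tsupport ψ) := hθ.isCompact.prod hψ.isCompact
  have hsub : tsupport (fun z : ℝ × E3 => θ z.1 * ψ z.2) ⊆ tsupport θ ×ˢ tsupport ψ := by
    refine closure_minimal (fun z hz => ⟨subset_tsupport _ fun h => hz ?_,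
      subset_tsupport _ fun h => hz ?_⟩) hc.isClosed
    · simp [h]
    · simp [h]
  exact ⟨hc.of_isClosed_subset isClosed_closure hsub, hsub.trans (prod_mono (subset_univ _) le_rfl)⟩

section WeakForm

variable {y : E3}

lemma continuity_mollified (hT : 0 < T) (hΩ : MeasurableSet Ω) (hKΩ : K ⊆ Ω) {ρc : ℝ → E3 → ℝ}
    (hweak : ∀ τ ∈ Icc 0 T, ∀ φ : ℝ → E3 → ℝ, IsScalarTest φ →
      (∫ x in Ω, ρc τ x * φ τ x) - ∫ x in Ω, ρ₀ x * φ 0 x = ∫ z in cyl τ Ω,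
      (ρ z.1 z.2 * deriv (fun t => φ t z.2) z.1 + ρ z.1 z.2 * fderiv ℝ (φ z.1) z.2 (u z.1 z.2)))
    (hJ : ∀ j, Mix dt(T) volume 1 1 (fun t => K.indicator fun x => ρ t x * u t x j))
    (hk : IsKernel k ε) (hk0 : ∀ x ∈ Ω, x ∉ K → k (y - x) = 0 ∧ fderiv ℝ k (y - x) = 0)
    (hτ : τ ∈ Ioo 0 T) (hρ : ρc τ =ᵐ[dx(Ω)] ρ τ) :
    mollify k (K.indicator (ρ τ)) y = mollify k (K.indicator ρ₀) y
      + ∫ t in 0..τ, (mollify k (fun _ => 0) y - ∑ j, mollify (fun z => fderiv ℝ k z (bv j))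
          (K.indicator fun x => ρ t x * u t x j) y) := by
  obtain ⟨θ, hθ, hθc, hθ1, hθ'⟩ := exists_time_cutoff hT
  obtain ⟨C, hC, hC'⟩ := hk.exists_bound
  have hψ : IsTestOn univ (fun x => k (y - x)) := hk.isTestOn (subset_univ _)
  have htest : IsScalarTest (fun t x => θ t * k (y - x)) :=
    ⟨(hθ.comp contDiff_fst).mul (hψ.1.comp contDiff_snd), (hasCompactSupport_mul_comp hθc hψ.2.1).1⟩
  have h := hweak τ ⟨hτ.1.le, hτ.2.le⟩ _ htest
  rw [setIntegral_cyl_eq_mollify (s := fun _ _ => 0)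
    (J := fun j t => K.indicator fun x => ρ t x * u t x j) hΩ Mix.zero hJ (by simp)
    (fun j t x hx => indicator_of_notMem (fun h => hx (hKΩ h)) _) hk.contDiff hC hC' hτ y
    (fun t ht x hx => ?_)] at h
  · rw [hθ1 τ ⟨hτ.1.le, hτ.2.le⟩, hθ1 0 ⟨le_rfl, hT.le⟩] at h
    simp only [one_mul] at h
    rw [mollify_indicator_eq hΩ hKΩ fun x h1 h2 => (hk0 x h1 h2).1,
      mollify_indicator_eq hΩ hKΩ fun x h1 h2 => (hk0 x h1 h2).1, ← h]
    have e : ∫ x in Ω, ρc τ x * k (y - x) = ∫ x in Ω, ρ τ x * k (y - x) := by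
      refine integral_congr_ae ?_
      filter_upwards [hρ] with x hx
      rw [hx]
    rw [e]
    ring
  · have htT : t ∈ Icc 0 T := ⟨ht.1.le, (ht.2.trans hτ.2).le⟩
    simp only [hθ' t htT, mul_zero, hθ1 t htT, one_mul, zero_add, zero_mul, zero_sub]
    rw [fderiv_comp_const_sub (hk.contDiff.differentiable (by simp))]
    by_cases hxK : x ∈ K
    · simp only [indicator_of_mem hxK]
      conv_lhs => rw [← sum_coord_smul (u t x)]
      rw [map_sum, mul_neg, Finset.mul_sum]
      congr 1
      refine Finset.sum_congr rfl fun j _ => ?_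
      rw [map_smul, smul_eq_mul]
      ring
    · simp [hxK, (hk0 x hx hxK).2]

lemma momentum_mollified (hT : 0 < T) (hΩ : MeasurableSet Ω) (hKΩ : K ⊆ Ω) {m : ℝ → E3 → E3}
    (hweak : ∀ τ ∈ Icc 0 T, ∀ φ : ℝ → E3 → E3, IsVectorTest Ω φ →
      (∫ x in Ω, inner ℝ (m τ x) (φ τ x)) - ∫ x in Ω, ρ₀ x * inner ℝ (u₀ x) (φ 0 x) =
      ∫ z in cyl τ Ω, (ρ z.1 z.2 * inner ℝ (u z.1 z.2) (deriv (fun t => φ t z.2) z.1) + ρ z.1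
      z.2 * contract (tensor (u z.1 z.2) (u z.1 z.2)) (jac (φ z.1) z.2) + p
      (ρ z.1 z.2) * (jac (φ z.1) z.2).trace - contract (stress μ η (Du z.1 z.2))
      (jac (φ z.1) z.2) + ρ z.1 z.2 * inner ℝ (f z.1 z.2) (φ z.1 z.2)))
    (i : Fin 3)
    (hJ : ∀ j, Mix dt(T) volume 1 1 (fun t => K.indicator fun x =>
      ρ t x * u t x i * u t x j + (if i = j then p (ρ t x) else 0) - stress μ η (Du t x) i j))
    (hs : Mix dt(T) volume 1 1 (fun t => K.indicator fun x => ρ t x * f t x i)) (hk : IsKernel k ε)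
    (hktest : IsTestOn Ω (fun x => k (y - x)))
    (hk0 : ∀ x ∈ Ω, x ∉ K → k (y - x) = 0 ∧ fderiv ℝ k (y - x) = 0) (hτ : τ ∈ Ioo 0 T)
    (hm : m τ =ᵐ[dx(Ω)] fun x => ρ τ x • u τ x) : mollify k (K.indicator fun x => ρ τ x * u τ x i) y
      = mollify k (K.indicator fun x => ρ₀ x * u₀ x i) y
      + ∫ t in 0..τ, (mollify k (K.indicator fun x => ρ t x * f t x i) y
        - ∑ j, mollify (fun z => fderiv ℝ k z (bv j))
          (K.indicator fun x => ρ t x * u t x i * u t x j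
            + (if i = j then p (ρ t x) else 0) - stress μ η (Du t x) i j) y) := by
  obtain ⟨θ, hθ, hθc, hθ1, hθ'⟩ := exists_time_cutoff hT
  obtain ⟨C, hC, hC'⟩ := hk.exists_bound
  have hcs := hasCompactSupport_mul_comp hθc hktest.2.1
  have hsupp : Function.support (uncurry fun t x => (θ t * k (y - x)) • bv i)
      ⊆ Function.support (fun z : ℝ × E3 => θ z.1 * k (y - z.2)) := fun z hz h0 => hz (by
    change (θ z.1 * k (y - z.2)) • bv i = 0
    rw [show θ z.1 * k (y - z.2) = 0 from h0, zero_smul])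
  have htest : IsVectorTest Ω (fun t x => (θ t * k (y - x)) • bv i) := by
    refine ⟨((hθ.comp contDiff_fst).mul (hktest.1.comp contDiff_snd)).smul contDiff_const,
      hcs.1.of_isClosed_subset isClosed_closure (closure_mono hsupp),
      (closure_mono hsupp).trans (hcs.2.trans (prod_mono le_rfl hktest.2.2))⟩
  have hinner : ∀ (v : E3) (c : ℝ), inner ℝ v (c • bv i) = v i * c := fun v c => by
    rw [inner_smul_right, EuclideanSpace.inner_single_right]
    simp
    ring
  have hdk := hk.contDiff.differentiable (by simp : (∞ : WithTop ℕ∞) ≠ 0)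
  have hjac : ∀ t ∈ Icc 0 T, ∀ x i' j, jac (fun x => (θ t * k (y - x)) • bv i) x i' j
      = if i' = i then - fderiv ℝ k (y - x) (bv j) else 0 := by
    intro t ht x i' j
    simp only [hθ1 t ht, one_mul, jac]
    have hd : HasFDerivAt (fun x => k (y - x)) _ x :=
      (hktest.1.differentiable (by simp) x).hasFDerivAt
    rw [(hd.smul_const (bv i)).fderiv]
    simp only [ContinuousLinearMap.smulRight_apply, PiLp.smul_apply, smul_eq_mul]
    rw [fderiv_comp_const_sub hdk]
    simp [bv]
  have hderiv : ∀ t ∈ Icc 0 T, ∀ x, deriv (fun t => (θ t * k (y - x)) • bv i) t = 0 := by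
    intro t ht x
    have hd : DifferentiableAt ℝ (fun t => θ t * k (y - x)) t :=
      (hθ.differentiable (by simp) t).mul_const _
    rw [deriv_smul_const hd, hθ' t ht, zero_smul]
  have h := hweak τ ⟨hτ.1.le, hτ.2.le⟩ _ htest
  rw [setIntegral_cyl_eq_mollify (s := fun t => K.indicator fun x => ρ t x * f t x i)
    (J := fun j t => K.indicator fun x => ρ t x * u t x i * u t x j
        + (if i = j then p (ρ t x) else 0) - stress μ η (Du t x) i j) hΩ hs hJ
    (fun t x hx => indicator_of_notMem (fun h => hx (hKΩ h)) _)
    (fun j t x hx => indicator_of_notMem (fun h => hx (hKΩ h)) _) hk.contDiff hC hC' hτ y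
    (fun t ht x hx => ?_)] at h
  · rw [hθ1 τ ⟨hτ.1.le, hτ.2.le⟩, hθ1 0 ⟨le_rfl, hT.le⟩] at h
    simp only [one_mul, hinner] at h
    rw [mollify_indicator_eq hΩ hKΩ fun x h1 h2 => (hk0 x h1 h2).1,
      mollify_indicator_eq hΩ hKΩ fun x h1 h2 => (hk0 x h1 h2).1, ← h]
    have e : ∫ x in Ω, m τ x i * k (y - x) = ∫ x in Ω, ρ τ x * (u τ x i * k (y - x)) := by
      refine integral_congr_ae ?_
      filter_upwards [hm] with x hx
      rw [hx]
      simp [mul_assoc]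
    rw [e]
    simp only [mul_assoc]
    ring
  · have htT : t ∈ Icc 0 T := ⟨ht.1.le, (ht.2.trans hτ.2).le⟩
    simp only [hderiv t htT, inner_zero_right, mul_zero, zero_add, hinner, hθ1 t htT, one_mul]
    have hj : jac (fun x => (θ t * k (y - x)) • bv i) x
        = fun i' j => if i' = i then - fderiv ℝ k (y - x) (bv j) else 0 := by
      ext i' j
      exact hjac t htT x i' j
    simp only [hθ1 t htT, one_mul] at hj
    rw [hj]
    by_cases hxK : x ∈ K
    · simp only [indicator_of_mem hxK]
      simp only [contract, tensor, Matrix.trace, Matrix.diag]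
      fin_cases i <;> simp [Fin.sum_univ_three] <;> ring
    · have hz : (fun i' j => if i' = i then - fderiv ℝ k (y - x) (bv j) else 0)
          = (0 : M33) := by
        ext i' j
        simp [(hk0 x hx hxK).2]
      rw [hz]
      simp [hxK, (hk0 x hx hxK).1, contract]

end WeakForm

/-! ### Slices of weak derivatives on the cylinder -/

lemma volume_restrict_cyl (T : ℝ) (Ω : Set E3) : volume.restrict (cyl T Ω) = dt(T).prod dx(Ω) := by
  rw [Measure.prod_restrict, ← Measure.volume_eq_prod]; rfl

lemma integrable_of_locallyIntegrableOn_cyl (hh : LocallyIntegrableOn (uncurry h) (cyl T Ω))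
    {I : Set ℝ} (hI : IsCompact I) (hIT : I ⊆ Ioo 0 T) (hK : IsCompact K) (hKΩ : K ⊆ Ω) :
    Integrable (uncurry h) ((volume.restrict I).prod dx(K)) := by
  have := hh.integrableOn_compact_subset (prod_mono hIT hKΩ) (hI.prod hK)
  rwa [IntegrableOn, Measure.volume_eq_prod, ← Measure.prod_restrict] at this

lemma integrableOn_mul_of_tsupport_subset_cyl (hh : LocallyIntegrableOn (uncurry h) (cyl T Ω))
    {ψ : ℝ × E3 → ℝ} (hψ : Continuous ψ) (hc : HasCompactSupport ψ) (hs : tsupport ψ ⊆ cyl T Ω) :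
    IntegrableOn (fun z => h z.1 z.2 * ψ z) (cyl T Ω) := by
  have h1 : IntegrableOn (fun z : ℝ × E3 => h z.1 z.2) (tsupport ψ) :=
    hh.integrableOn_compact_subset hs hc
  obtain ⟨C, hC⟩ := hψ.bounded_above_of_compact_support hc
  have h2 : IntegrableOn (fun z : ℝ × E3 => h z.1 z.2 * ψ z) (tsupport ψ) :=
    Integrable.mul_bdd h1 hψ.aestronglyMeasurable (.of_forall hC)
  refine (h2.integrable_of_forall_notMem_eq_zero fun z hz => ?_).integrableOn
  rw [image_eq_zero_of_notMem_tsupport hz, mul_zero]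

lemma isTestOn_prod_mul {ψ : ℝ → ℝ} (hψ : IsTestOn (Ioo 0 T) ψ) (hφ : IsTestOn Ω φ) :
    ContDiff ℝ ∞ (fun z : ℝ × E3 => ψ z.1 * φ z.2) ∧
      HasCompactSupport (fun z : ℝ × E3 => ψ z.1 * φ z.2) ∧
      tsupport (fun z : ℝ × E3 => ψ z.1 * φ z.2) ⊆ cyl T Ω := by
  have hsub : tsupport (fun z : ℝ × E3 => ψ z.1 * φ z.2) ⊆ tsupport ψ ×ˢ tsupport φ := by
    refine closure_minimal (fun z hz => ?_) ((isClosed_tsupport _).prod (isClosed_tsupport _))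
    simp only [Function.mem_support, ne_eq, mul_eq_zero, not_or] at hz
    exact ⟨subset_tsupport _ hz.1, subset_tsupport _ hz.2⟩
  refine ⟨(hψ.1.comp contDiff_fst).mul (hφ.1.comp contDiff_snd), ?_,
    hsub.trans (prod_mono hψ.2.2 hφ.2.2)⟩
  exact (hψ.2.1.prod hφ.2.1).of_isClosed_subset (isClosed_tsupport _) hsub

lemma fderiv_prod_mul {ψ : ℝ → ℝ} (hψ : ContDiff ℝ ∞ ψ) (hφ : ContDiff ℝ ∞ φ) (z e : ℝ × E3) :
    fderiv ℝ (fun z : ℝ × E3 => ψ z.1 * φ z.2) z e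
      = ψ z.1 * fderiv ℝ φ z.2 e.2 + φ z.2 * fderiv ℝ ψ z.1 e.1 := by
  have h1 : HasFDerivAt (fun z : ℝ × E3 => ψ z.1)
      ((fderiv ℝ ψ z.1).comp (ContinuousLinearMap.fst ℝ ℝ E3)) z :=
    (hψ.differentiable (by simp) z.1).hasFDerivAt.comp z hasFDerivAt_fst
  have h2 : HasFDerivAt (fun z : ℝ × E3 => φ z.2)
      ((fderiv ℝ φ z.2).comp (ContinuousLinearMap.snd ℝ ℝ E3)) z :=
    (hφ.differentiable (by simp) z.2).hasFDerivAt.comp z hasFDerivAt_snd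
  have h3 : HasFDerivAt (fun z : ℝ × E3 => ψ z.1 * φ z.2) _ z := h1.mul h2
  rw [h3.fderiv]
  simp

lemma ae_hasWeakGrad (hΩ : IsOpen Ω) {g : Fin 3 → ℝ → E3 → ℝ}
    (H : ∀ j, HasWeakDeriv T Ω (dirX j) h (g j)) :
    ∀ᵐ t ∂dt(T), HasWeakGrad Ω (h t) (fun j => g j t) := by
  have key : ∀ j, ∀ᵐ t ∂dt(T), (∀ K, IsCompact K → K ⊆ Ω → IntegrableOn (fun a => h t a) K volume ∧
        IntegrableOn (fun a => g j t a) K volume) ∧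
      ∀ φ, IsTestOn Ω φ → ∫ a in Ω, h t a * fderiv ℝ φ a (bv j) = - ∫ a in Ω, g j t a * φ a := by
    intro j
    obtain ⟨h1, h2, h3⟩ := H j
    refine ae_slice_weak_derivative (h := fun x t => h t x) (g := fun x t => g j t x) hΩ isOpen_Ioo
      (bv j) (fun K I hK hKΩ hI hIT => ?_) (fun K I hK hKΩ hI hIT => ?_) fun φ ψ hφ hψ => ?_
    · exact (integrable_of_locallyIntegrableOn_cyl h1 hI hIT hK hKΩ).swap
    · exact (integrable_of_locallyIntegrableOn_cyl h2 hI hIT hK hKΩ).swap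
    · obtain ⟨c1, c2, c3⟩ := isTestOn_prod_mul hψ hφ
      have e := h3 _ c1 c2 c3
      have hd : ∀ z : ℝ × E3, fderiv ℝ (fun z : ℝ × E3 => ψ z.1 * φ z.2) z (dirX j)
          = ψ z.1 * fderiv ℝ φ z.2 (bv j) := fun z => by
        rw [fderiv_prod_mul hψ.1 hφ.1]
        simp [dirX, bv]
      have i1 : IntegrableOn (fun z : ℝ × E3 => h z.1 z.2 * fderiv ℝ (fun z : ℝ × E3 =>
          ψ z.1 * φ z.2) z (dirX j)) (cyl T Ω) := by
        refine integrableOn_mul_of_tsupport_subset_cyl h1 ?_ (c2.fderiv_apply ℝ _) ?_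
        · exact (c1.continuous_fderiv (by simp)).clm_apply continuous_const
        · exact (tsupport_fderiv_apply_subset ℝ _).trans c3
      have i2 : IntegrableOn (fun z : ℝ × E3 => g j z.1 z.2 * (ψ z.1 * φ z.2)) (cyl T Ω) :=
        integrableOn_mul_of_tsupport_subset_cyl h2 c1.continuous c2 c3
      have e2 : ∫ z in cyl T Ω, ψ z.1 * (h z.1 z.2 * fderiv ℝ φ z.2 (bv j)
          + g j z.1 z.2 * φ z.2) = 0 := by
        rw [← sub_eq_zero, sub_neg_eq_add, ← integral_add i1 i2] at e
        rw [← e]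
        refine integral_congr_ae (.of_forall fun z => ?_)
        simp only [hd]; ring
      have i3 : Integrable (fun z : ℝ × E3 => ψ z.1 * (h z.1 z.2 * fderiv ℝ φ z.2 (bv j)
          + g j z.1 z.2 * φ z.2)) (dt(T).prod dx(Ω)) := by
        rw [← volume_restrict_cyl]
        refine (i1.add i2).congr (.of_forall fun z => ?_)
        simp only [Pi.add_apply, hd]; ring
      rw [volume_restrict_cyl, integral_prod _ i3] at e2
      refine Eq.trans ?_ e2
      rw [← integral_indicator measurableSet_Ioo]
      refine integral_congr_ae (.of_forall fun t => ?_)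
      by_cases ht : t ∈ Ioo 0 T
      · simp only [indicator_of_mem ht, integral_const_mul]
      · simp only [indicator_of_notMem ht, hψ.eq_zero ht, zero_mul]
  filter_upwards [ae_all_iff.2 key] with t ht
  exact ⟨fun K hK hKΩ => ((ht 0).1 K hK hKΩ).1, fun j K hK hKΩ => ((ht j).1 K hK hKΩ).2,
    fun j φ hφ => (ht j).2 φ hφ⟩

lemma ae_time_weak_derivative (hΩ : IsOpen Ω) {a : ℝ → E3 → ℝ} (H : HasWeakDeriv T Ω dirT h a) :
    ∀ᵐ x ∂dx(Ω), ∀ φ, IsTestOn (Ioo 0 T) φ →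
      ∫ t in Ioo 0 T, h t x * fderiv ℝ φ t 1 = - ∫ t in Ioo 0 T, a t x * φ t := by
  obtain ⟨h1, h2, h3⟩ := H
  refine (ae_slice_weak_derivative (h := h) (g := a) (isOpen_Ioo (a := (0 : ℝ)) (b := T)) hΩ 1
    (fun I K hI hIT hK hKΩ => ?_) (fun I K hI hIT hK hKΩ => ?_) fun ψ φ hψ hφ => ?_).mono
      fun x hx => hx.2
  · exact integrable_of_locallyIntegrableOn_cyl h1 hI hIT hK hKΩ
  · exact integrable_of_locallyIntegrableOn_cyl h2 hI hIT hK hKΩ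
  · obtain ⟨c1, c2, c3⟩ := isTestOn_prod_mul hψ hφ
    have e := h3 _ c1 c2 c3
    have hd : ∀ z : ℝ × E3, fderiv ℝ (fun z : ℝ × E3 => ψ z.1 * φ z.2) z dirT
        = φ z.2 * fderiv ℝ ψ z.1 1 := fun z => by
      rw [fderiv_prod_mul hψ.1 hφ.1]
      simp [dirT]
    have i1 : IntegrableOn (fun z : ℝ × E3 => h z.1 z.2 * fderiv ℝ (fun z : ℝ × E3 =>
        ψ z.1 * φ z.2) z dirT) (cyl T Ω) := by
      refine integrableOn_mul_of_tsupport_subset_cyl h1 ?_ (c2.fderiv_apply ℝ _) ?_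
      · exact (c1.continuous_fderiv (by simp)).clm_apply continuous_const
      · exact (tsupport_fderiv_apply_subset ℝ _).trans c3
    have i2 : IntegrableOn (fun z : ℝ × E3 => a z.1 z.2 * (ψ z.1 * φ z.2)) (cyl T Ω) :=
      integrableOn_mul_of_tsupport_subset_cyl h2 c1.continuous c2 c3
    have e2 : ∫ z in cyl T Ω, φ z.2 * (h z.1 z.2 * fderiv ℝ ψ z.1 1 + a z.1 z.2 * ψ z.1) = 0 := by
      rw [← sub_eq_zero, sub_neg_eq_add, ← integral_add i1 i2] at e
      rw [← e]
      refine integral_congr_ae (.of_forall fun z => ?_)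
      simp only [hd]; ring
    have i3 : Integrable (fun z : ℝ × E3 => φ z.2 * (h z.1 z.2 * fderiv ℝ ψ z.1 1
        + a z.1 z.2 * ψ z.1)) (dt(T).prod dx(Ω)) := by
      rw [← volume_restrict_cyl]
      refine (i1.add i2).congr (.of_forall fun z => ?_)
      simp only [Pi.add_apply, hd]; ring
    rw [volume_restrict_cyl, integral_prod_symm _ i3] at e2
    refine Eq.trans ?_ e2
    rw [← integral_indicator hΩ.measurableSet]
    refine integral_congr_ae (.of_forall fun x => ?_)
    by_cases hx : x ∈ Ω
    · simp only [indicator_of_mem hx, integral_const_mul]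
    · simp only [indicator_of_notMem hx, hφ.eq_zero hx, zero_mul]

lemma neBot_nhds_inf_ae (hT : 0 < T) : (𝓝 (0 : ℝ) ⊓ ae dt(T)).NeBot := by
  rw [Filter.inf_neBot_iff]
  intro s hs s' hs'
  obtain ⟨ε, hε, hball⟩ := Metric.mem_nhds_iff.1 hs
  by_contra hne
  have hsub' : Ioo 0 (min ε T) ⊆ s'ᶜ := fun t ht hts' => hne
    ⟨t, hball (by simpa [abs_of_pos ht.1] using ht.2.trans_le (min_le_left _ _)), hts'⟩
  have hz : dt(T) s'ᶜ = 0 := hs'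
  have hz' := measure_mono_null hsub' hz
  rw [Measure.restrict_apply measurableSet_Ioo, inter_eq_self_of_subset_left
    (Ioo_subset_Ioo_right (min_le_right _ _)), Real.volume_Ioo] at hz'
  simp only [sub_zero, ENNReal.ofReal_eq_zero] at hz'
  exact absurd hz' (not_le.2 (lt_min hε hT))

/-- A function with an integrable time derivative is the primitive that starts at the attained
initial value. -/
lemma ae_eq_initial_add_primitive (hT : 0 < T) (hΩ : IsOpen Ω) {a : ℝ → E3 → ℝ} {h₀ : E3 → ℝ}
    (H : HasWeakDeriv T Ω dirT h a)
    (hh : ∀ K, IsCompact K → K ⊆ Ω → Integrable (uncurry h) (dt(T).prod dx(K)))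
    (ha : ∀ K, IsCompact K → K ⊆ Ω → Integrable (uncurry a) (dt(T).prod dx(K)))
    (hi : AttainsInitially T Ω h h₀) (h0 : AEStronglyMeasurable h₀ dx(Ω)) :
    ∀ᵐ x ∂dx(Ω), ∀ᵐ t ∂dt(T), h t x = h₀ x + ∫ s in 0..t, a s x := by
  obtain ⟨K, hK, hKex⟩ := exists_compact_exhaustion hΩ
  suffices hmain : ∀ n, ∀ᵐ x ∂dx(K n), ∀ᵐ t ∂dt(T), h t x = h₀ x + ∫ s in 0..t, a s x by
    have hU : (⋃ n, K n) = Ω := by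
      refine subset_antisymm (iUnion_subset fun n => (hK n).2) fun x hx => ?_
      obtain ⟨n, hn⟩ := hKex {x} isCompact_singleton (singleton_subset_iff.2 hx)
      exact mem_iUnion.2 ⟨n, hn rfl⟩
    rw [← hU, ae_restrict_iUnion_iff]
    exact hmain
  intro n
  have hsub : dx(K n) ≤ dx(Ω) := dx_le (hK n).2
  have hw := ae_mono hsub (ae_time_weak_derivative hΩ H)
  have ih := hh _ (hK n).1 (hK n).2
  have ia := ha _ (hK n).1 (hK n).2
  have hc : ∀ᵐ x ∂dx(K n), ∃ c, ∀ᵐ t ∂dt(T), h t x = c + ∫ s in 0..t, a s x := by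
    filter_upwards [hw, ih.prod_left_ae, ia.prod_left_ae] with x h1 h2 h3
    exact exists_ae_eq_primitive hT h2 h3 h1
  have hPm := aestronglyMeasurable_primitive ia.aestronglyMeasurable
  set c : E3 → ℝ := fun x => T⁻¹ * ∫ t in Ioo 0 T, (h t x - ∫ s in 0..t, a s x) with hcdef
  have hcm : AEStronglyMeasurable c dx(K n) := by
    refine AEStronglyMeasurable.const_mul ?_ _
    have := (ih.aestronglyMeasurable.sub hPm).prod_swap.integral_prod_right'
    exact this
  have hc1 : ∀ᵐ x ∂dx(K n), ∀ᵐ t ∂dt(T), h t x = c x + ∫ s in 0..t, a s x := by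
    filter_upwards [hc] with x ⟨c', hx⟩
    have : c x = c' := by
      have e : ∫ t in Ioo 0 T, (h t x - ∫ s in 0..t, a s x) = ∫ t in Ioo 0 T, c' := by
        refine integral_congr_ae (hx.mono fun t ht => ?_)
        simp only [ht]; ring
      rw [hcdef]
      simp only [e]
      simp [hT.le]
      field_simp
    rw [this]; exact hx
  have hc2 : ∀ᵐ t ∂dt(T), ∀ᵐ x ∂dx(K n), h t x = c x + ∫ s in 0..t, a s x :=
    ae_ae_of_ae_prod (ae_eq_prod_of_ae_ae' (f := uncurry h)
      (g := fun z : ℝ × E3 => c z.2 + ∫ s in 0..z.1, a s z.2) ih.aestronglyMeasurable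
      (hcm.comp_snd.add hPm) hc1)
  have hh0 := h0.mono_measure hsub
  set F : Filter ℝ := 𝓝 0 ⊓ ae dt(T) with hF
  have hFne : F.NeBot := neBot_nhds_inf_ae hT
  have hlim : Tendsto (fun t => ∫⁻ s in Ioc 0 t, (∫⁻ x, ‖a s x‖ₑ ∂dx(K n)) ∂dt(T)) F (𝓝 0) := by
    refine tendsto_setLIntegral_zero ?_ ?_
    · rw [← lintegral_prod (fun z : ℝ × E3 => ‖a z.1 z.2‖ₑ) ia.aestronglyMeasurable.enorm]
      exact ia.2.ne
    · have h1 : Tendsto (fun t : ℝ => ofReal t) (𝓝 0) (𝓝 0) := by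
        simpa using ENNReal.continuous_ofReal.tendsto 0
      refine tendsto_of_tendsto_of_tendsto_of_le_of_le tendsto_const_nhds
        (h1.mono_left inf_le_left) (fun _ => zero_le) fun t => ?_
      refine (Measure.restrict_apply_le _ _).trans ?_
      simp
  have hsum := (hi _ (hK n).1 (hK n).2).add hlim
  rw [add_zero] at hsum
  have hle : ∀ᶠ t in F, eLpNorm (fun x => c x - h₀ x) 1 dx(K n)
      ≤ eLpNorm (h t - h₀) 1 dx(K n) + ∫⁻ s in Ioc 0 t, (∫⁻ x, ‖a s x‖ₑ ∂dx(K n)) ∂dt(T) := by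
    refine Filter.mem_inf_of_right ?_
    filter_upwards [hc2, ae_mem_Ioo, ih.prod_right_ae] with t ht htT hti
    have hm : AEMeasurable (fun x => ‖(h t - h₀) x‖ₑ) dx(K n) :=
      (hti.aestronglyMeasurable.sub hh0).enorm
    rw [eLpNorm_one_eq_lintegral_enorm, eLpNorm_one_eq_lintegral_enorm]
    rw [lintegral_lintegral_swap (f := fun s x => ‖a s x‖ₑ) (ia.aestronglyMeasurable.enorm.mono_ac
        (Measure.restrict_le_self.absolutelyContinuous.prod Measure.AbsolutelyContinuous.rfl)),
      ← lintegral_add_left' hm]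
    refine lintegral_mono_ae (ht.mono fun x hx => ?_)
    have e : c x - h₀ x = (h t - h₀) x - ∫ s in 0..t, a s x := by
      simp only [Pi.sub_apply, hx]; ring
    rw [e]
    refine enorm_sub_le.trans (add_le_add le_rfl ?_)
    rw [integral_of_le htT.1.le, Measure.restrict_restrict measurableSet_Ioc,
      inter_eq_self_of_subset_left (show Ioc 0 t ⊆ Ioo 0 T from
        fun s hs => ⟨hs.1, hs.2.trans_lt htT.2⟩)]
    exact enorm_integral_le_lintegral_enorm _
  have hz : eLpNorm (fun x => c x - h₀ x) 1 dx(K n) = 0 :=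
    le_antisymm (ge_of_tendsto hsum hle) zero_le
  replace hz := (eLpNorm_eq_zero_iff (hcm.sub hh0) one_ne_zero).1 hz
  filter_upwards [hz, hc1] with x hx hx1
  rwa [← (sub_eq_zero.1 hx : c x = h₀ x)]

/-! ### Minkowski's integral inequality -/

section Minkowski

variable {ν : Measure β}

lemma lintegral_rpow_lintegral_le [SFinite lam] [SigmaFinite ν] (hq : 1 < q) {g : α → β → ℝ≥0∞}
    (hg : AEMeasurable (uncurry g) (lam.prod ν)) :
    (∫⁻ x, (∫⁻ t, g t x ∂lam) ^ q ∂ν) ^ (1 / q) ≤ ∫⁻ t, (∫⁻ x, g t x ^ q ∂ν) ^ (1 / q) ∂lam := by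
  have hq0 : 0 < q := by linarith
  set F : β → ℝ≥0∞ := fun x => ∫⁻ t, g t x ∂lam with hF
  have hFm : AEMeasurable F ν := by
    have h1 : AEMeasurable (fun z : β × α => g z.2 z.1) (ν.prod lam) := hg.prod_swap
    exact h1.lintegral_prod_right'
  set M : ℝ≥0∞ := ∫⁻ t, (∫⁻ x, g t x ^ q ∂ν) ^ (1 / q) ∂lam with hM
  set Fn : ℕ → β → ℝ≥0∞ := fun n => (spanningSets ν n).indicator (fun x => min (F x) n) with hFn
  have hFnm : ∀ n, AEMeasurable (Fn n) ν := fun n =>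
    (hFm.min aemeasurable_const).indicator (measurableSet_spanningSets ν n)
  have hFnle : ∀ n x, Fn n x ≤ F x := fun n x => by
    by_cases hx : x ∈ spanningSets ν n
    · simp [hFn, hx]
    · simp [hFn, hx]
  have hfin : ∀ n, ∫⁻ x, Fn n x ^ q ∂ν ≠ ⊤ := fun n => by
    have h1 : ∀ x, Fn n x ^ q ≤ (spanningSets ν n).indicator (fun _ => (n : ℝ≥0∞) ^ q) x :=
      fun x => by
      by_cases hx : x ∈ spanningSets ν n
      · simp only [hFn, hx, indicator_of_mem]
        exact ENNReal.rpow_le_rpow (min_le_right _ _) hq0.le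
      · simp [hFn, hx, hq0]
    refine ne_top_of_le_ne_top ?_ (lintegral_mono h1)
    rw [lintegral_indicator (measurableSet_spanningSets ν n), setLIntegral_const]
    exact ENNReal.mul_ne_top (ENNReal.rpow_ne_top_of_nonneg hq0.le (by simp))
      (measure_spanningSets_lt_top ν n).ne
  have hpq : (q / (q - 1)).HolderConjugate q := by
    have := (Real.HolderConjugate.conjExponent hq).symm
    simpa [Real.conjExponent] using this
  have hstep : ∀ n, (∫⁻ x, Fn n x ^ q ∂ν) ^ (1 / q) ≤ M := fun n => by
    set I := ∫⁻ x, Fn n x ^ q ∂ν with hI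
    by_cases hI0 : I = 0
    · rw [hI0, ENNReal.zero_rpow_of_pos (by positivity)]; exact zero_le
    have e1 : I ≤ ∫⁻ x, Fn n x ^ (q - 1) * F x ∂ν := by
      refine lintegral_mono fun x => ?_
      have : Fn n x ^ q = Fn n x ^ (q - 1) * Fn n x := by
        conv_rhs => rw [← ENNReal.rpow_one (Fn n x), ← ENNReal.rpow_mul]
        rw [← ENNReal.rpow_add_of_nonneg _ _ (by linarith) zero_le_one]; congr 1; ring
      simp only [this]
      gcongr
      exact hFnle n x
    have e2 : ∫⁻ x, Fn n x ^ (q - 1) * F x ∂ν = ∫⁻ t, ∫⁻ x, Fn n x ^ (q - 1) * g t x ∂ν ∂lam := by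
      have hm : AEMeasurable (fun z : α × β => Fn n z.2 ^ (q - 1) * g z.1 z.2) (lam.prod ν) :=
        ((hFnm n).comp_snd.pow_const _).mul hg
      rw [lintegral_lintegral_swap (f := fun t x => Fn n x ^ (q - 1) * g t x) hm]
      refine lintegral_congr_ae ?_
      have hsw : AEMeasurable (fun z : β × α => g z.2 z.1) (ν.prod lam) := hg.prod_swap
      filter_upwards [hsw.aestronglyMeasurable.prodMk_left] with x hx
      rw [lintegral_const_mul'' _ hx.aemeasurable]
    have e3 : ∫⁻ t, ∫⁻ x, Fn n x ^ (q - 1) * g t x ∂ν ∂lam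
        ≤ ∫⁻ t, I ^ (1 / (q / (q - 1))) * (∫⁻ x, g t x ^ q ∂ν) ^ (1 / q) ∂lam := by
      refine lintegral_mono_ae ?_
      filter_upwards [hg.aestronglyMeasurable.prodMk_left] with t ht
      have := ENNReal.lintegral_mul_le_Lp_mul_Lq ν hpq ((hFnm n).pow_const (q - 1)) ht.aemeasurable
      refine this.trans (le_of_eq ?_)
      congr 2
      refine lintegral_congr fun x => ?_
      rw [← ENNReal.rpow_mul]; congr 1
      have : q - 1 ≠ 0 := by linarith
      field_simp
    have hIt := hfin n
    rw [lintegral_const_mul' _ _ (ENNReal.rpow_ne_top_of_nonneg (by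
      have : 0 < q - 1 := by linarith
      positivity) hIt)] at e3
    have e4 := e1.trans (e2.le.trans e3)
    set s := 1 / (q / (q - 1)) with hs
    have hs1 : 1 / q = 1 - s := by
      have : q - 1 ≠ 0 := by linarith
      rw [hs]; field_simp; ring
    rw [hs1, ENNReal.rpow_sub _ _ hI0 hIt, ENNReal.rpow_one]
    exact ENNReal.div_le_of_le_mul (by rwa [mul_comm])
  have hsup : ∫⁻ x, F x ^ q ∂ν = ⨆ n, ∫⁻ x, Fn n x ^ q ∂ν := by
    rw [← lintegral_iSup' (fun n => (hFnm n).pow_const q)]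
    · refine lintegral_congr fun x => ?_
      refine le_antisymm ?_ (iSup_le fun n => ENNReal.rpow_le_rpow (hFnle n x) hq0.le)
      have h1 : F x ≤ ⨆ n, Fn n x := by
        refine le_of_forall_lt fun a ha => ?_
        obtain ⟨n₁, hn₁⟩ := ENNReal.exists_nat_gt (ne_top_of_lt ha)
        obtain ⟨n₂, hn₂⟩ := mem_iUnion.1 ((iUnion_spanningSets ν).ge (mem_univ x))
        refine lt_iSup_iff.2 ⟨max n₁ n₂, ?_⟩
        have : x ∈ spanningSets ν (max n₁ n₂) := monotone_spanningSets ν (le_max_right _ _) hn₂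
        simp only [hFn, this, indicator_of_mem, lt_min_iff]
        exact ⟨ha, hn₁.trans_le (by exact_mod_cast le_max_left _ _)⟩
      refine (ENNReal.rpow_le_rpow h1 hq0.le).trans (le_of_eq ?_)
      exact (ENNReal.orderIsoRpow q hq0).map_iSup _
    · refine .of_forall fun x n m hnm => ENNReal.rpow_le_rpow ?_ hq0.le
      by_cases hx : x ∈ spanningSets ν n
      · have := monotone_spanningSets ν hnm hx
        simp only [hFn, this, hx, indicator_of_mem]
        gcongr
      · simp [hFn, hx]
  simp only [one_div, ENNReal.rpow_inv_le_iff hq0] at hstep ⊢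
  rw [hsup]
  exact iSup_le hstep

end Minkowski

lemma Mix.primitive [SigmaFinite ν] (hq : 1 < q) {a : ℝ → E3 → ℝ}
    (ha : Mix dt(T) ν 1 (ofReal q) a) :
    Mix dt(T) ν ⊤ (ofReal q) (fun t x => ∫ s in 0..t, a s x) := by
  have hq0 : 0 < q := by linarith
  have hq1 : ofReal q ≠ 0 := by simpa using hq0
  have key := lintegral_rpow_lintegral_le (g := fun t x => ‖a t x‖ₑ) hq ha.meas.enorm
  have e1 : ∀ t, (∫⁻ x, ‖a t x‖ₑ ^ q ∂ν) ^ (1 / q) = eLpNorm (a t) (ofReal q) ν := fun t => by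
    rw [eLpNorm_eq_lintegral_rpow_enorm_toReal hq1 ofReal_ne_top, ENNReal.toReal_ofReal hq0.le]
  simp only [e1] at key
  have hM : ∫⁻ t, eLpNorm (a t) (ofReal q) ν ∂dt(T) ≠ ⊤ := by
    have h1 := (memLp_one_iff_integrable.1 ha.norm).2
    refine ne_of_lt (lt_of_le_of_lt (lintegral_mono_ae ?_) h1)
    filter_upwards [ha.memLp] with t ht
    rw [Real.enorm_of_nonneg toReal_nonneg, ofReal_toReal ht.2.ne]
  refine Mix.of_bound (N := fun _ => (∫⁻ t, eLpNorm (a t) (ofReal q) ν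
    ∂dt(T)).toReal) (aestronglyMeasurable_primitive ha.meas)
    (memLp_const _) ?_
  filter_upwards [ae_mem_Ioo] with t ht
  rw [ofReal_toReal hM, eLpNorm_eq_lintegral_rpow_enorm_toReal hq1 ofReal_ne_top,
    ENNReal.toReal_ofReal hq0.le]
  refine le_trans ?_ key
  gcongr with x
  rw [integral_of_le ht.1.le]
  refine (enorm_integral_le_lintegral_enorm _).trans (lintegral_mono' ?_ le_rfl)
  exact restrict_le (show Ioc 0 t ⊆ Ioo 0 T from fun s hs => ⟨hs.1, hs.2.trans_lt ht.2⟩)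

/-! ### Classes of the strong solution -/

section Mix

variable {ν : Measure β} {r : ℝ≥0∞} {g : α → β → ℝ}

lemma inv_ofReal_eq (hq : 0 < q) : (ofReal q)⁻¹ = ofReal q⁻¹ := (ENNReal.ofReal_inv_of_pos hq).symm

lemma two_inv_eq_ofReal : (2 : ℝ≥0∞)⁻¹ = ofReal 2⁻¹ := by
  rw [← inv_ofReal_eq two_pos]; norm_num

lemma Mix.interpolate_two_top [SFinite ν] (hq : 2 < q) (h2 : Mix lam ν r 2 g)
    (ht : Mix lam ν r ⊤ g) :
    Mix lam ν r (ofReal q) g := by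
  refine Mix.interpolate (θ := 2 / q) ⟨by positivity, (div_lt_one (by linarith)).2 hq⟩ ?_ h2 ht
  rw [inv_ofReal_eq (by linarith), ENNReal.inv_top, mul_zero, add_zero, two_inv_eq_ofReal,
    ← ENNReal.ofReal_mul (by positivity)]
  congr 1; field_simp

lemma Mix.interpolate_one_top [SFinite ν] (hq : 1 < q) (h2 : Mix lam ν r 1 g)
    (ht : Mix lam ν r ⊤ g) :
    Mix lam ν r (ofReal q) g := by
  refine Mix.interpolate (θ := 1 / q) ⟨by positivity, (div_lt_one (by linarith)).2 hq⟩ ?_ h2 ht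
  rw [inv_ofReal_eq (by linarith), ENNReal.inv_top, mul_zero, add_zero, inv_one, mul_one]
  congr 1; field_simp

lemma Mix.interpolate_two [SFinite ν] {Q : ℝ} (hq : 2 < q) (hQ : q < Q) (h2 : Mix lam ν r 2 g)
    (ht : Mix lam ν r (ofReal Q) g) : Mix lam ν r (ofReal q) g := by
  have hQ2 : 0 < Q - 2 := by linarith
  have hq0 : 0 < q := by linarith
  have hQ0 : 0 < Q := by linarith
  have hθ : 0 < 2 * (Q - q) / (q * (Q - 2)) := by
    have : 0 < Q - q := by linarith
    positivity
  have h1θ : 1 - 2 * (Q - q) / (q * (Q - 2)) = Q * (q - 2) / (q * (Q - 2)) := by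
    field_simp; ring
  have h1 : 0 < 1 - 2 * (Q - q) / (q * (Q - 2)) := by
    rw [h1θ]
    have : 0 < q - 2 := by linarith
    positivity
  refine Mix.interpolate (θ := 2 * (Q - q) / (q * (Q - 2))) ⟨hθ, by linarith⟩ ?_ h2 ht
  rw [inv_ofReal_eq hq0, inv_ofReal_eq hQ0, two_inv_eq_ofReal, ← ENNReal.ofReal_mul hθ.le,
    ← ENNReal.ofReal_mul h1.le, ← ENNReal.ofReal_add (by positivity) (by positivity)]
  congr 1
  rw [h1θ]
  field_simp
  ring

lemma eLpNorm_le_of_rpow_le {f e : β → ℝ} (hs : 0 < s) (he : Integrable e ν)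
    (h : ∀ᵐ x ∂ν, |f x| ^ s ≤ e x) (hM : ∫ x, e x ∂ν ≤ M) :
    eLpNorm f (ofReal s) ν ≤ ofReal (M ^ (1 / s)) := by
  have he0 : ∀ᵐ x ∂ν, 0 ≤ e x := h.mono fun x hx => (Real.rpow_nonneg (abs_nonneg _) _).trans hx
  have hM0 : 0 ≤ M := (integral_nonneg_of_ae he0).trans hM
  rw [eLpNorm_eq_lintegral_rpow_enorm_toReal (by simpa using hs) ofReal_ne_top,
    ENNReal.toReal_ofReal hs.le, ← ENNReal.ofReal_rpow_of_nonneg hM0 (by positivity)]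
  refine ENNReal.rpow_le_rpow ?_ (by positivity)
  refine le_trans ?_ (ofReal_le_ofReal hM)
  rw [ofReal_integral_eq_lintegral_ofReal he he0]
  refine lintegral_mono_ae (h.mono fun x hx => ?_)
  rw [Real.enorm_eq_ofReal_abs, ENNReal.ofReal_rpow_of_nonneg (abs_nonneg _) hs.le]
  exact ofReal_le_ofReal hx

lemma Mix.top_of_rpow_le [SFinite ν] {e : α → β → ℝ} (hs : 0 < s)
    (hg : AEStronglyMeasurable (uncurry g) (lam.prod ν)) [IsFiniteMeasure lam]
    (he : ∀ᵐ t ∂lam, Integrable (e t) ν ∧ ∫ x, e t x ∂ν ≤ M)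
    (h : ∀ᵐ t ∂lam, ∀ᵐ x ∂ν, |g t x| ^ s ≤ e t x) : Mix lam ν ⊤ (ofReal s) g := by
  refine Mix.of_bound (N := fun _ => M ^ (1 / s)) hg (memLp_const _) ?_
  filter_upwards [he, h] with t h1 h2
  exact eLpNorm_le_of_rpow_le hs h1.1 h2 h1.2

lemma Mix.of_ofReal_two (h : Mix lam ν r (ofReal 2) g) : Mix lam ν r 2 g := by
  rwa [show ofReal 2 = 2 by norm_num] at h

/-- A function is in `L^∞L^s` if its power `s` is dominated by integrable functions. -/
lemma Mix.top_of_energy_le [SFinite ν] [IsFiniteMeasure lam] {b e : α → β → ℝ} {L : ℝ}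
    (he : ∀ᵐ t ∂lam, Integrable (e t) ν ∧ ∫ x, e t x ∂ν ≤ M) (hb : Mix lam ν ⊤ 2 b)
    (hg : AEStronglyMeasurable (uncurry g) (lam.prod ν)) (hs : 0 < s) (hL : 0 ≤ L)
    (hle : ∀ᵐ t ∂lam, ∀ᵐ x ∂ν, |g t x| ^ s ≤ L * (e t x + b t x * b t x)) :
    Mix lam ν ⊤ (ofReal s) g := by
  have hbb : Mix lam ν ⊤ 1 (fun t x => b t x * b t x) := hb.mul hb
  refine Mix.top_of_rpow_le hs hg (M := L * (M + (eLpNorm (fun t => (eLpNorm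
    (fun x => b t x * b t x) 1 ν).toReal) ⊤ lam).toReal)) ?_ hle
  filter_upwards [he, hbb.memLp, ae_le_eLpNormEssSup (f := fun t => (eLpNorm
    (fun x => b t x * b t x) 1 ν).toReal)] with t h1 h2 h3
  have i2 := memLp_one_iff_integrable.1 h2
  refine ⟨(h1.1.add i2).const_mul _, ?_⟩
  rw [integral_const_mul, integral_add h1.1 i2]
  refine mul_le_mul_of_nonneg_left (add_le_add h1.2 ?_) hL
  rw [← eLpNorm_exponent_top, Real.enorm_eq_ofReal toReal_nonneg,
    ← ofReal_toReal hbb.norm.2.ne, ENNReal.ofReal_le_ofReal_iff toReal_nonneg,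
    toReal_eLpNorm h2.1] at h3
  refine le_trans (le_of_eq ?_) h3
  simp [lpNorm_one_eq_integral_norm h2.1]

end Mix

lemma Mix.mono_set [SFinite lam] {r s : ℝ≥0∞} {g : α → E3 → ℝ} (h : Mix lam dx(Ω) r s g)
    (hK : K ⊆ Ω) : Mix lam dx(K) r s g :=
  h.restrict_right (restrict_le hK)

lemma stress_apply (μ η : ℝ) (G : M33) (i j : Fin 3) : stress μ η G i j = μ * (G i j + G j i)
      + ((η - 2 / 3 * μ) * if i = j then 1 else 0) * ∑ k, G k k := by
  simp only [stress, Matrix.add_apply, Matrix.smul_apply, Matrix.sub_apply, Matrix.transpose_apply,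
    Matrix.one_apply, smul_eq_mul, Matrix.trace, Matrix.diag_apply]
  ring

lemma Mix.stress {ν : Measure β} [SFinite ν] {r s : ℝ≥0∞} (hs : 1 ≤ s) {G : α → β → M33}
    (h : ∀ i j, Mix lam ν r s (fun t x => G t x i j)) (μ η : ℝ) (i j : Fin 3) :
    Mix lam ν r s (fun t x => CNS.stress μ η (G t x) i j) := by
  simp only [stress_apply]
  exact (((h i j).add hs (h j i)).const_mul _).add hs
    ((Mix.sum Finset.univ hs fun k _ => h k k).const_mul _)

lemma MemLtLx.mix {r s : ℝ≥0∞} (hr : r ≠ 0) (h : MemLtLx T Ω r s g) : Mix dt(T) dx(Ω) r s g :=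
  Mix.of_eLpNorm (by rw [← volume_restrict_cyl]; exact h.1) hr h.2

lemma MemLtLx.mix_coord {r s : ℝ≥0∞} (hr : r ≠ 0) {g : ℝ → E3 → E3} (h : MemLtLx T Ω r s g)
    (j : Fin 3) : Mix dt(T) dx(Ω) r s (fun t x => g t x j) := by
  refine Mix.of_eLpNorm ?_ hr (lt_of_le_of_lt ?_ h.2)
  · rw [← volume_restrict_cyl]; exact aestronglyMeasurable_coord h.1 j
  · exact eLpNorm_mono_enorm fun t => by simpa using eLpNorm_coord_le s (g t) j

lemma EnergyInequality.exists_bound (h : EnergyInequality T Ω μ η p ρbar f ρ₀ u₀ ρ u Du) :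
    ∃ M, ∀ᵐ τ ∂dt(T), IntegrableOn (fun x => energyDensity p ρbar (ρ τ x) (u τ x)) Ω ∧
      ∫ x in Ω, energyDensity p ρbar (ρ τ x) (u τ x) ≤ M := by
  have key : ∀ g : ℝ × E3 → ℝ, IntegrableOn g (cyl T Ω) → ∀ τ ∈ Ioo 0 T,
      |∫ z in cyl τ Ω, g z| ≤ ∫ z in cyl T Ω, ‖g z‖ := fun g hg τ hτ => by
    refine (norm_integral_le_integral_norm g).trans ?_
    refine setIntegral_mono_set hg.norm (.of_forall fun _ => norm_nonneg _) (.of_forall ?_)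
    exact prod_mono (Ioo_subset_Ioo_right hτ.2.le) le_rfl
  refine ⟨(∫ x in Ω, energyDensity p ρbar (ρ₀ x) (u₀ x))
    + (∫ z in cyl T Ω, ‖ρ z.1 z.2 * inner ℝ (f z.1 z.2) (u z.1 z.2)‖)
    + ∫ z in cyl T Ω, ‖contract (CNS.stress μ η (Du z.1 z.2)) (Du z.1 z.2)‖, ?_⟩
  filter_upwards [h.inequality, ae_mem_Ioo] with τ h1 hτ
  refine ⟨h1.1, ?_⟩
  have a1 := key _ h.integrable_dissipation τ hτ
  have a2 := key _ h.integrable_work τ hτ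
  linarith [h1.2, neg_abs_le (∫ z in cyl τ Ω, contract (CNS.stress μ η (Du z.1 z.2)) (Du z.1 z.2)),
    le_abs_self (∫ z in cyl τ Ω, ρ z.1 z.2 * inner ℝ (f z.1 z.2) (u z.1 z.2))]

/-- The divergence of the stress of a velocity field with second gradient `D2`. -/
def divStress (μ η : ℝ) (D2 : Fin 3 → Fin 3 → Fin 3 → ℝ) (i : Fin 3) : ℝ :=
  ∑ j, stress μ η (fun a b => D2 a b j) i j

/-- The acceleration of the fluid due to the stress and the pressure. -/
def innerAccel (μ η : ℝ) (p : ℝ → ℝ) (s : ℝ) (g : E3) (D2 : Fin 3 → Fin 3 → Fin 3 → ℝ)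
    (i : Fin 3) : ℝ := (divStress μ η D2 i - deriv p s * g i) / s

/-- The part of `∂_t U` that comes from the force and the convection. -/
def outerAccel (f v : E3) (G : M33) (i : Fin 3) : ℝ := f i - ∑ j, v j * G i j

/-- `∂_t r` as determined by the continuity equation. -/
def densityRate (s : ℝ) (g v : E3) (G : M33) : ℝ := -(∑ j, v j * g j) - s * ∑ j, G j j

/-- The flux of momentum. -/
def momentumFlux (μ η : ℝ) (p : ℝ → ℝ) (s : ℝ) (v : E3) (G : M33)
    (i j : Fin 3) : ℝ := s * v i * v j + (if i = j then p s else 0) - stress μ η G i j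

/-- The multiplier of the continuity equation. -/
def headPot (p : ℝ → ℝ) (ρbar s : ℝ) (v : E3) : ℝ :=
  (∑ i, 1 / 2 * v i ^ 2) + (potentialDeriv p ρbar ρbar - potentialDeriv p ρbar s)

/-- A derivative of `headPot`, given the derivatives `a` of the velocity and `b` of the density. -/
def headDeriv (p : ℝ → ℝ) (s : ℝ) (v : E3) (a : Fin 3 → ℝ) (b : ℝ) : ℝ :=
  (∑ i, v i * a i) + -(deriv p s / s) * b

lemma aestronglyMeasurable_comp_of_mem_Icc {ν : Measure α} {v : α → ℝ} {a : ℝ} (hab : a ≤ b)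
    (hG : ContinuousOn G (Icc a b)) (hv : AEStronglyMeasurable v ν) (h : ∀ᵐ x ∂ν, v x ∈ Icc a b) :
    AEStronglyMeasurable (fun x => G (v x)) ν := by
  have hcont : Continuous (IccExtend hab (fun x : Icc a b => G x)) :=
    (continuousOn_iff_continuous_domRestrict.1 hG).Icc_extend'
  refine (hcont.comp_aestronglyMeasurable hv).congr ?_
  filter_upwards [h] with x hx using IccExtend_of_mem hab _ hx

/-- A reference density with values in the interval `[c, C]`. -/
structure RefDensity (T : ℝ) (Ω : Set E3) (ρbar c C : ℝ) (r : ℝ → E3 → ℝ) : Prop where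
  pos : 0 < c
  far : ρbar ∈ Icc c C
  meas : AEStronglyMeasurable (uncurry r) (dt(T).prod dx(Ω))
  bounds : ∀ᵐ t ∂dt(T), ∀ᵐ x ∂dx(Ω), r t x ∈ Icc c C
  r_top_two : Mix dt(T) dx(Ω) ⊤ 2 (fun t x => r t x - ρbar)

namespace RefDensity

lemma const (hρ : 0 < ρbar) : RefDensity T Ω ρbar ρbar ρbar fun _ _ => ρbar :=
  ⟨hρ, ⟨le_rfl, le_rfl⟩, aestronglyMeasurable_const,
    .of_forall fun _ => .of_forall fun _ => ⟨le_rfl, le_rfl⟩, by simpa using Mix.zero⟩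

lemma le (h : RefDensity T Ω ρbar c C r) : c ≤ C := h.far.1.trans h.far.2

lemma far_pos (h : RefDensity T Ω ρbar c C r) : 0 < ρbar := h.pos.trans_le h.far.1

lemma bounds_prod (h : RefDensity T Ω ρbar c C r) :
    ∀ᵐ z ∂(dt(T).prod dx(Ω)), r z.1 z.2 ∈ Icc c C := by
  have h1 : Continuous fun s : ℝ => max c (min s C) := by fun_prop
  have h2 := ae_eq_prod_of_ae_ae h.meas (h1.comp_aestronglyMeasurable h.meas)
    (h.bounds.mono fun t ht => ht.mono fun x hx => by
      simp only [uncurry]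
      rw [min_eq_left hx.2, max_eq_right hx.1])
  filter_upwards [h2] with z hz
  have : r z.1 z.2 = max c (min (r z.1 z.2) C) := hz
  rw [this]
  exact ⟨le_max_left _ _, max_le h.le (min_le_right _ _)⟩

lemma comp_mix (h : RefDensity T Ω ρbar c C r) (hG : ContinuousOn G (Icc c C)) :
    Mix dt(T) dx(Ω) ⊤ ⊤ (fun t x => G (r t x)) := by
  obtain ⟨B, hB⟩ := isCompact_Icc.exists_bound_of_continuousOn hG
  exact Mix.of_abs_le (C := B) (aestronglyMeasurable_comp_of_mem_Icc h.le hG h.meas h.bounds_prod)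
    (h.bounds.mono fun t ht => ht.mono fun x hx => hB _ hx)

lemma comp_sub_two (h : RefDensity T Ω ρbar c C r) (hG : ∀ s ∈ Icc c C, HasDerivAt G (G' s) s)
    (hG' : ContinuousOn G' (Icc c C)) : Mix dt(T) dx(Ω) ⊤ 2 (fun t x => G (r t x) - G ρbar) := by
  obtain ⟨L, hL⟩ := isCompact_Icc.exists_bound_of_continuousOn hG'
  refine (h.r_top_two.const_mul L).mono_ae (h.comp_mix (G := fun s => G s - G ρbar) fun s hs =>
    ((hG s hs).continuousAt.sub continuousAt_const).continuousWithinAt).meas ?_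
  filter_upwards [h.bounds] with t ht
  filter_upwards [ht] with x hx
  have := (convex_Icc c C).norm_image_sub_le_of_norm_hasDerivWithin_le
    (fun s hs => (hG s hs).hasDerivWithinAt) hL h.far hx
  rw [abs_mul]
  exact this.trans (mul_le_mul_of_nonneg_right (le_abs_self _) (abs_nonneg _))

lemma continuousOn_deriv (h : RefDensity T Ω ρbar c C r) (hp : PressureLaw p γ) :
    ContinuousOn (deriv p) (Icc c C) :=
  hp.continuousOn_deriv.mono fun _ hs => h.pos.trans_le hs.1

lemma continuousOn_coef (h : RefDensity T Ω ρbar c C r) (hp : PressureLaw p γ) :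
    ContinuousOn (fun s => -(deriv p s / s)) (Icc c C) :=
  ((h.continuousOn_deriv hp).div continuousOn_id fun _ hs => (h.pos.trans_le hs.1).ne').neg

lemma hasDerivAt_head (h : RefDensity T Ω ρbar c C r) (hp : PressureLaw p γ) :
    ∀ s ∈ Icc c C, HasDerivAt
      (fun s => potentialDeriv p ρbar ρbar - potentialDeriv p ρbar s) (-(deriv p s / s)) s :=
  fun _ hs => (hasDerivAt_potentialDeriv hp h.far_pos (h.pos.trans_le hs.1)).const_sub _

/-- `∂_t U` in `L²L^s`, up to the contribution of `outerAccel`. -/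
lemma innerAccel_mix (h : RefDensity T Ω ρbar c C r) (hp : PressureLaw p γ) {s : ℝ≥0∞}
    (hs : 1 ≤ s) {g : ℝ → E3 → E3} {D : ℝ → E3 → Fin 3 → Fin 3 → Fin 3 → ℝ}
    (hg : ∀ j, Mix dt(T) dx(Ω) 2 s (fun t x => g t x j))
    (hD : ∀ i j k, Mix dt(T) dx(Ω) 2 s (fun t x => D t x i j k)) (i : Fin 3) :
    Mix dt(T) dx(Ω) 2 s (fun t x => innerAccel μ η p (r t x) (g t x) (D t x) i) := by
  simp only [innerAccel, div_eq_inv_mul]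
  exact (h.comp_mix (G := fun s => s⁻¹) (continuousOn_inv₀.mono fun x hx =>
    (h.pos.trans_le hx.1).ne')).mul (Mix.sub hs (Mix.sum _ hs fun j _ =>
      Mix.stress hs (fun a b => hD a b j) μ η i j)
        ((h.comp_mix (h.continuousOn_deriv hp)).mul (hg i)))

end RefDensity

/-- The properties of the strong solution used in the relative energy argument. -/
structure StrongReg (T : ℝ) (Ω : Set E3) (μ η : ℝ) (p : ℝ → ℝ) (γ ρbar : ℝ)
    (f : ℝ → E3 → E3) (q c C : ℝ) (ρ₀ : E3 → ℝ) (u₀ : E3 → E3) (r : ℝ → E3 → ℝ) (U : ℝ → E3 → E3)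
    (gr : ℝ → E3 → E3) (DU : ℝ → E3 → M33)
    (D2U : ℝ → E3 → Fin 3 → Fin 3 → Fin 3 → ℝ) : Prop extends RefDensity T Ω ρbar c C r where
  T_pos : 0 < T
  isOpen : IsOpen Ω
  lip : UniformlyLipschitzBoundary Ω
  law : PressureLaw p γ
  force : MemLtLx T Ω 1 ⊤ f
  three_lt : 3 < q
  le_six : q ≤ 6
  exponent : 3 < q * (γ - 1)
  meas₀ : AEStronglyMeasurable ρ₀ dx(Ω)
  data : ∀ᵐ x ∂dx(Ω), ρ₀ x ∈ Icc c C
  u₀_q : ∀ i, MemLp (fun x => u₀ x i) (ofReal q) dx(Ω)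
  memD012 : ∀ᵐ t ∂dt(T), MemD012 Ω (U t) (DU t)
  grad_r : ∀ᵐ t ∂dt(T), HasWeakGrad Ω (r t) (fun j x => gr t x j)
  grad_U : ∀ i, ∀ᵐ t ∂dt(T), HasWeakGrad Ω (fun x => U t x i) (fun j x => DU t x i j)
  grad_DU : ∀ i j, ∀ᵐ t ∂dt(T), HasWeakGrad Ω (fun x => DU t x i j) (fun k x => D2U t x i j k)
  gr_two : ∀ j, Mix dt(T) dx(Ω) 2 2 (fun t x => gr t x j)
  gr_q : ∀ j, Mix dt(T) dx(Ω) 2 (ofReal q) (fun t x => gr t x j)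
  D2U_two : ∀ i j k, Mix dt(T) dx(Ω) 2 2 (fun t x => D2U t x i j k)
  D2U_q : ∀ i j k, Mix dt(T) dx(Ω) 2 (ofReal q) (fun t x => D2U t x i j k)
  DU_two : ∀ i j, Mix dt(T) dx(Ω) 2 2 (fun t x => DU t x i j)
  DU_top : ∀ i j, Mix dt(T) dx(Ω) 2 ⊤ (fun t x => DU t x i j)
  U_top_two : ∀ i, Mix dt(T) dx(Ω) ⊤ 2 (fun t x => U t x i)
  U_two_top : ∀ i, Mix dt(T) dx(Ω) 2 ⊤ (fun t x => U t x i)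
  U_top_q : ∀ i, Mix dt(T) dx(Ω) ⊤ (ofReal q) (fun t x => U t x i)
  time_U : ∀ i, ∀ᵐ x ∂dx(Ω), ∀ᵐ t ∂dt(T),
    U t x i = u₀ x i + ∫ s in 0..t, (innerAccel μ η p (r s x) (gr s x) (D2U s x) i
      + outerAccel (f s x) (U s x) (DU s x) i)
  time_r : ∀ᵐ x ∂dx(Ω), ∀ᵐ t ∂dt(T),
    r t x = ρ₀ x + ∫ s in 0..t, densityRate (r s x) (gr s x) (U s x) (DU s x)

local notation:max "ai(" t "," x ")" => innerAccel μ η p (r t x) (gr t x) (D2U t x)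
local notation:max "ao(" t "," x ")" => outerAccel (f t x) (U t x) (DU t x)
local notation:max "dr(" t "," x ")" => densityRate (r t x) (gr t x) (U t x) (DU t x)
local notation:max "hd(" t "," x ")" => headPot p ρbar (r t x) (U t x)
local notation:max "fl(" t "," x ")" => momentumFlux μ η p (ρ t x) (u t x) (Du t x)

lemma energyDensity_eq_of_nonneg (hp : PressureLaw p γ) (hρ : 0 < ρbar) (hs : 0 ≤ s) (v : E3) :
    1 / 2 * s * ‖v‖ ^ 2 ≤ energyDensity p ρbar s v ∧
      relPot p ρbar s ρbar ≤ energyDensity p ρbar s v := by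
  rw [energyDensity_eq hp hρ]
  have := relPot_nonneg hp hρ hs hρ
  constructor
  · linarith
  · have : 0 ≤ 1 / 2 * s * ‖v‖ ^ 2 := by positivity
    linarith

lemma sq_coord_le (v : E3) (i : Fin 3) : v i ^ 2 ≤ ‖v‖ ^ 2 := by
  rw [← sq_abs]
  exact pow_le_pow_left₀ (abs_nonneg _) (abs_coord_le v i) 2

lemma inner_eq_sum (v w : E3) : inner ℝ v w = ∑ i, v i * w i := by
  simp [PiLp.inner_apply, mul_comm]

/-- The initial value of a primitive is bounded like the function itself. -/
lemma mem_Icc_of_ae_primitive (hT : 0 < T) {h : ℝ → ℝ} {h₀ : ℝ} (ha : IntegrableOn a (Ioo 0 T))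
    (hh : ∀ᵐ t ∂dt(T), h t ∈ Icc c C) (he : ∀ᵐ t ∂dt(T), h t = h₀ + ∫ s in 0..t, a s) :
    h₀ ∈ Icc c C := by
  have := neBot_nhds_inf_ae hT
  have hai : IntegrableOn a (uIcc 0 T) := by
    rw [uIcc_of_le hT.le, integrableOn_Icc_iff_integrableOn_Ioo]; exact ha
  have hc : ContinuousWithinAt (fun t => ∫ s in 0..t, a s) (uIcc 0 T) 0 :=
    intervalIntegral.continuousOn_primitive_interval hai 0 left_mem_uIcc
  have hle : 𝓝 (0 : ℝ) ⊓ ae dt(T) ≤ 𝓝[uIcc 0 T] 0 := by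
    refine inf_le_inf le_rfl (le_principal_iff.2 ?_)
    filter_upwards [ae_mem_Ioo] with t ht
    rw [uIcc_of_le hT.le]; exact ⟨ht.1.le, ht.2.le⟩
  have hlim : Tendsto (fun t => h₀ + ∫ s in 0..t, a s)
      (𝓝 (0 : ℝ) ⊓ ae dt(T)) (𝓝 (h₀ + 0)) := by
    refine tendsto_const_nhds.add ?_
    have := hc.tendsto.mono_left hle
    simpa using this
  rw [add_zero] at hlim
  refine isClosed_Icc.mem_of_tendsto hlim (mem_inf_of_right ?_)
  filter_upwards [hh, he] with t h1 h2
  rwa [← h2]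

lemma IsStrongSolutionWithDerivatives.exists_strongReg (hT : 0 < T) (hΩ : IsOpen Ω)
    (hL : UniformlyLipschitzBoundary Ω) (hp : PressureLaw p γ) (hρbar : 0 < ρbar)
    (hf_one : MemLtLx T Ω 1 1 f) (hf_top : MemLtLx T Ω 1 ⊤ f)
    (hdata : FiniteEnergyData Ω p ρbar ρ₀ u₀) {Q : ℝ} (hQ3 : 3 < Q) (hQq : Q ≤ q) (hQ6 : Q ≤ 6)
      (hQγ : 3 < Q * (γ - 1)) {rt : ℝ → E3 → ℝ}
    {Ut : ℝ → E3 → E3}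
    (h : IsStrongSolutionWithDerivatives T Ω μ η p ρbar f q ρ₀ u₀ r U rt gr Ut DU D2U) :
    ∃ c C, StrongReg T Ω μ η p γ ρbar f Q c C ρ₀ u₀ r U gr DU D2U := by
  obtain ⟨c', C', hc', hbd'⟩ := h.density_bounds
  set c := min c' ρbar
  set C := max C' ρbar
  have hc : 0 < c := lt_min hc' hρbar
  have hcC : ρbar ∈ Icc c C := ⟨min_le_right _ _, le_max_right _ _⟩
  set lam := dt(T) with hlam
  set ν := dx(Ω) with hν
  have hcyl : volume.restrict (cyl T Ω) = lam.prod ν := volume_restrict_cyl T Ω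
  have hbdp : ∀ᵐ z ∂(lam.prod ν), r z.1 z.2 ∈ Icc c C := by
    rw [← hcyl]
    filter_upwards [hbd'] with z hz
    exact ⟨(min_le_left _ _).trans hz.1, hz.2.trans (le_max_left _ _)⟩
  have hbd : ∀ᵐ t ∂lam, ∀ᵐ x ∂ν, r t x ∈ Icc c C := ae_ae_of_ae_prod hbdp
  have hrm : AEStronglyMeasurable (uncurry r) (lam.prod ν) :=
    hcyl ▸ h.density_dt.1.aestronglyMeasurable
  have hUm : AEStronglyMeasurable (uncurry U) (lam.prod ν) := hcyl ▸ h.velocity_class.1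
  have hUim : ∀ i, AEStronglyMeasurable (fun z : ℝ × E3 => U z.1 z.2 i) (lam.prod ν) :=
    fun i => aestronglyMeasurable_coord hUm i
  -- gradients in space
  have hgr := ae_hasWeakGrad hΩ h.density_dx
  have hgU := fun i => ae_hasWeakGrad hΩ (h.velocity_dx i)
  have hgDU := fun i j => ae_hasWeakGrad hΩ (h.velocity_dxx i j)
  have down : ∀ {g : ℝ → E3 → ℝ}, Mix lam ν 2 2 g → Mix lam ν 2 (ofReal q) g →
      Mix lam ν 2 (ofReal Q) g := fun {g} h2 hq' => by
    rcases hQq.eq_or_lt with hQ | hQ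
    · rwa [hQ]
    · exact Mix.interpolate_two (by linarith) hQ h2 hq'
  have gr2 := fun j => h.density_reg.1.mix_coord two_ne_zero j
  have grq := fun j => down (gr2 j) (h.density_reg.2.mix_coord two_ne_zero j)
  have D2U2 := fun i j k => (h.velocity_reg i j k).1.mix two_ne_zero
  have D2Uq := fun i j k => down (D2U2 i j k) ((h.velocity_reg i j k).2.mix two_ne_zero)
  have DU2 := fun i j => (h.velocity_class.2.2 i j).mix two_ne_zero
  -- energy
  obtain ⟨M, hM⟩ := h.energy.exists_bound
  obtain ⟨B, κ, M₁, HB⟩ := exists_relPotBounds hp hρbar hc (hcC.1.trans hcC.2)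
  have U_top2 : ∀ i, Mix lam ν ⊤ 2 (fun t x => U t x i) := fun i => by
    refine (Mix.top_of_energy_le (g := fun t x => U t x i) hM Mix.zero (hUim i) (L := 2 / c) two_pos
      (by positivity) ?_).of_ofReal_two
    filter_upwards [hbd] with t ht
    filter_upwards [ht] with x hx
    have h0 : 0 ≤ r t x := hc.le.trans hx.1
    have h1 := (energyDensity_eq_of_nonneg hp hρbar h0 (U t x)).1
    have h3 := mul_le_mul hx.1 (sq_coord_le (U t x) i) (sq_nonneg _) h0
    rw [Real.rpow_two, sq_abs, div_mul_eq_mul_div, le_div_iff₀ hc]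
    linarith
  have HR : RefDensity T Ω ρbar c C r := by
    refine ⟨hc, hcC, hrm, hbd, (Mix.top_of_energy_le (g := fun t x => r t x - ρbar) hM
      Mix.zero (hrm.sub aestronglyMeasurable_const) (L := κ⁻¹) two_pos (inv_nonneg.2 HB.κ_pos.le)
        ?_).of_ofReal_two⟩
    filter_upwards [hbd] with t ht
    filter_upwards [ht] with x hx
    have h0 : 0 ≤ r t x := hc.le.trans hx.1
    refine le_trans ?_ ((HB.lower ρbar hcC _ h0).trans (mul_le_mul_of_nonneg_left
      (b := relPot p ρbar (r t x) ρbar) ?_ (inv_nonneg.2 HB.κ_pos.le)))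
    · rw [devEnergy, if_pos (hx.2.trans HB.lt.le), Real.rpow_two]; simp
    · simpa using (energyDensity_eq_of_nonneg hp hρbar h0 (U t x)).2
  -- Morrey
  have morrey : ∀ {v : ℝ → E3 → ℝ} {g : Fin 3 → ℝ → E3 → ℝ},
      AEStronglyMeasurable (uncurry v) (lam.prod ν) →
      (∀ᵐ t ∂lam, HasWeakGrad Ω (v t) (fun j => g j t)) → Mix lam ν 2 2 v →
      (∀ j, Mix lam ν 2 (ofReal Q) (g j)) → Mix lam ν 2 ⊤ v := by
    intro v g hvm hvg hv hg
    obtain ⟨K, hK0, hK⟩ := exists_morrey hΩ hL hQ3 (r := 2) (r' := 2) (by norm_num)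
    refine Mix.of_bound (N := fun t => K * ((eLpNorm (v t) 2 ν).toReal
      + ∑ j, (eLpNorm (g j t) (ofReal Q) ν).toReal)) hvm ?_ ?_
    · exact (hv.norm.add (memLp_finsetSum _ fun j _ => (hg j).norm)).const_mul K
    · filter_upwards [hvg, hv.memLp, ae_all_iff.2 fun j => (hg j).memLp] with t h1 h2 h3
      rw [eLpNorm_exponent_top]
      refine eLpNormEssSup_le_of_ae_bound ?_
      exact hK _ _ h1 h2 h3
  have DUtop := fun i j => morrey (DU2 i j).meas (hgDU i j) (DU2 i j) (D2Uq i j)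
  have DUq := fun i j => (DU2 i j).interpolate_two_top (by linarith : 2 < Q) (DUtop i j)
  have U2 := fun i => (U_top2 i).mono_left (le_top : (2 : ℝ≥0∞) ≤ ⊤)
  have Utop := fun i => morrey (U2 i).meas (hgU i) (U2 i) (DUq i)
  have Uq := fun i => (U2 i).interpolate_two_top (by linarith : 2 < Q) (Utop i)
  -- accelerations
  have A2 := HR.innerAccel_mix (μ := μ) (η := η) hp (by norm_num) gr2 D2U2
  have hQ1 : (1 : ℝ≥0∞) ≤ ofReal Q := one_le_ofReal.2 (by linarith)
  have Aq := HR.innerAccel_mix (μ := μ) (η := η) hp hQ1 grq D2Uq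
  have f1 := fun i => hf_one.mix_coord one_ne_zero i
  have ftop := fun i => hf_top.mix_coord one_ne_zero i
  have fq := fun i => (f1 i).interpolate_one_top (by linarith : 1 < Q) (ftop i)
  have B1 : ∀ i, Mix lam ν 1 1 (fun t x => ao(t,x) i) := fun i =>
    (f1 i).sub le_rfl (Mix.sum _ le_rfl fun j _ => (U2 j).mul (DU2 i j))
  have Bq : ∀ i, Mix lam ν 1 (ofReal Q) (fun t x => ao(t,x) i) := fun i =>
    (fq i).sub hQ1 (Mix.sum _ hQ1 fun j _ => (Uq j).mul (DUtop i j))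
  have accq : ∀ i, Mix lam ν 1 (ofReal Q) (fun t x => ai(t,x) i + ao(t,x) i) := fun i =>
    ((Aq i).mono_left (by norm_num)).add hQ1 (Bq i)
  have hacc : ∀ᵐ z ∂(lam.prod ν), ∀ i, Ut z.1 z.2 i = ai(z.1,z.2) i + ao(z.1,z.2) i := by
    have := h.momentum_eq
    rw [hcyl] at this
    filter_upwards [this, hbdp] with z h1 h2 i
    have h3 := h1 i
    have h0 : r z.1 z.2 ≠ 0 := (hc.trans_le h2.1).ne'
    rw [innerAccel, outerAccel, divStress]
    field_simp
    linarith
  have hrate : ∀ᵐ z ∂(lam.prod ν), rt z.1 z.2 = dr(z.1,z.2) := by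
    have := h.continuity_eq
    rw [hcyl] at this
    filter_upwards [this] with z h1
    rw [inner_eq_sum, Matrix.trace] at h1
    simp only [Matrix.diag_apply] at h1
    rw [densityRate]
    linarith
  have restr : ∀ {s s' : ℝ≥0∞} {g : ℝ → E3 → ℝ}, 1 ≤ s → 1 ≤ s' → Mix lam ν s s' g → ∀ K,
    IsCompact K → K ⊆ Ω → Integrable (uncurry g) (lam.prod dx(K)) := by
    intro s s' g hs hs' hg K hK hKΩ
    have : IsFiniteMeasure dx(K) := ⟨by simpa using hK.measure_lt_top⟩
    exact (((hg.mono_set hKΩ).mono_left hs).mono_right hs').integrable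
  have acprod : ∀ {K : Set E3}, K ⊆ Ω → lam.prod dx(K) ≪ lam.prod ν := fun hK =>
    Measure.AbsolutelyContinuous.rfl.prod (restrict_le hK).absolutelyContinuous
  have prim : ∀ {v : ℝ → ℝ} {a b : ℝ → ℝ} {v₀ : ℝ}, (∀ᵐ t ∂lam, v t = v₀ + ∫ s in 0..t, a s) →
      a =ᵐ[lam] b → ∀ᵐ t ∂lam, v t = v₀ + ∫ s in 0..t, b s := fun h1 h2 => by
    filter_upwards [h1, ae_mem_Ioo] with t h3 ht
    rw [h3, intervalIntegral_congr_dt ht h2]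
  have timeU : ∀ i, ∀ᵐ x ∂ν, ∀ᵐ t ∂lam, U t x i = u₀ x i + ∫ s in 0..t, (ai(s,x) i
        + ao(s,x) i) := fun i => by
    have e := ae_eq_initial_add_primitive hT hΩ (h₀ := fun x => u₀ x i) (h.velocity_dt i)
      (fun K hK hKΩ => restr le_top (by norm_num) (U_top2 i) K hK hKΩ)
      (fun K hK hKΩ => (restr le_rfl hQ1 (accq i) K hK hKΩ).congr
        ((acprod hKΩ) (hacc.mono fun z hz => (hz i).symm)))
      (fun K hK hKΩ => tendsto_of_tendsto_of_tendsto_of_le_of_le tendsto_const_nhds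
        (h.velocity_initial K hK hKΩ) (fun _ => zero_le) fun t =>
          eLpNorm_coord_le 1 (U t - u₀) i)
      (aestronglyMeasurable_coord hdata.measurable_velocity i)
    filter_upwards [e, ae_swap_of_ae_prod hacc] with x h1 h2 using
      prim h1 (h2.mono fun s hs => hs i)
  have rtop : Mix lam ν ⊤ ⊤ r := HR.comp_mix continuousOn_id
  have rate1 : ∀ K, IsCompact K → K ⊆ Ω → Integrable (uncurry fun t x =>
      dr(t,x)) (lam.prod dx(K)) := by
    intro K hK hKΩ
    have e1 : Mix lam ν 1 1 (fun t x => -(∑ j, U t x j * gr t x j)) :=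
      (Mix.sum _ le_rfl fun j _ => (U2 j).mul (gr2 j)).neg
    have e2 : Mix lam ν 2 2 (fun t x => r t x * ∑ j, DU t x j j) :=
      rtop.mul (Mix.sum _ (by norm_num) fun j _ => DU2 j j)
    exact (restr le_rfl le_rfl e1 K hK hKΩ).sub (restr (by norm_num) (by norm_num) e2 K hK hKΩ)
  have timer : ∀ᵐ x ∂ν, ∀ᵐ t ∂lam, r t x = ρ₀ x + ∫ s in 0..t, dr(s,x) := by
    have e := ae_eq_initial_add_primitive hT hΩ h.density_dt
      (fun K hK hKΩ => restr le_top le_top rtop K hK hKΩ)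
      (fun K hK hKΩ => (rate1 K hK hKΩ).congr ((acprod hKΩ) (hrate.mono fun z hz => hz.symm)))
      h.density_initial hdata.measurable_density
    filter_upwards [e, ae_swap_of_ae_prod hrate] with x h1 h2 using prim h1 h2
  have hdat : ∀ᵐ x ∂ν, ρ₀ x ∈ Icc c C := by
    obtain ⟨K, hK, hKex⟩ := exists_compact_exhaustion hΩ
    have hU : (⋃ n, K n) = Ω := by
      refine subset_antisymm (iUnion_subset fun n => (hK n).2) fun x hx => ?_
      obtain ⟨n, hn⟩ := hKex {x} isCompact_singleton (singleton_subset_iff.2 hx)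
      exact mem_iUnion.2 ⟨n, hn rfl⟩
    rw [hν, ← hU, ae_restrict_iUnion_iff]
    intro n
    have hle : dx(K n) ≤ ν := dx_le (hK n).2
    filter_upwards [ae_mono hle timer, ae_mono hle (ae_swap_of_ae_prod hbdp),
      (rate1 _ (hK n).1 (hK n).2).prod_left_ae] with x h1 h2 h3
    exact mem_Icc_of_ae_primitive hT h3 h2 h1
  have hu : ∀ i, MemLp (fun x => u₀ x i) (ofReal Q) ν ∧
      Mix lam ν ⊤ (ofReal Q) (fun t x => U t x i) := fun i => by
    have hPr := (accq i).primitive (by linarith : 1 < Q)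
    have hu0m : AEStronglyMeasurable (fun x => u₀ x i) ν :=
      aestronglyMeasurable_coord hdata.measurable_velocity i
    have heq : (fun z : ℝ × E3 => U z.1 z.2 i) =ᵐ[lam.prod ν] fun z => u₀ z.2 i
        + ∫ s in 0..z.1, (ai(s,z.2) i
        + ao(s,z.2) i) :=
      ae_eq_prod_of_ae_ae' (hUim i) (hu0m.comp_snd.add hPr.meas) (timeU i)
    have hu0 : MemLp (fun x => u₀ x i) (ofReal Q) ν := by
      have : (ae lam).NeBot := by
        rw [ae_neBot, hlam, Ne, Measure.restrict_eq_zero]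
        simpa using hT
      obtain ⟨t, ⟨h1, h2⟩, h3⟩ := (((Uq i).memLp.and hPr.memLp).and (ae_ae_of_ae_prod heq)).exists
      refine (h1.sub h2).ae_eq ?_
      filter_upwards [h3] with x hx
      simp only [Pi.sub_apply, hx]; ring
    have hu0' : Mix lam ν ⊤ (ofReal Q) (fun _ x => u₀ x i) := by
      refine Mix.of_bound (N := fun _ => (eLpNorm (fun x => u₀ x i) (ofReal Q) ν).toReal)
        hu0m.comp_snd (memLp_const _) (.of_forall fun t => ?_)
      rw [ofReal_toReal hu0.2.ne]
    exact ⟨hu0, (hu0'.add hQ1 hPr).congr heq⟩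
  exact ⟨c, C, HR, hT, hΩ, hL, hp, hf_top, hQ3, hQ6, hQγ, hdata.measurable_density, hdat, fun i =>
    (hu i).1, h.velocity_class.2.1, hgr, hgU, hgDU, gr2, grq, D2U2,
    D2Uq, DU2, DUtop, U_top2, Utop, fun i => (hu i).2, timeU, timer⟩

/-! ### Classes of the weak solution -/

lemma holderTriple_ofReal {a : ℝ} (ha : 0 < a) (hb : 0 < b) (hc : 0 < c) (h : a⁻¹ + b⁻¹ = c⁻¹) :
    HolderTriple (ofReal a) (ofReal b) (ofReal c) where
  inv_add_inv_eq_inv := by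
    rw [inv_ofReal_eq ha, inv_ofReal_eq hb, inv_ofReal_eq hc,
      ← ENNReal.ofReal_add (by positivity) (by positivity), h]

lemma holderTriple_ofReal_one {a : ℝ} (ha : 0 < a) (hb : 0 < b) (h : a⁻¹ + b⁻¹ = 1) :
    HolderTriple (ofReal a) (ofReal b) 1 := by
  rw [← ofReal_one]
  exact holderTriple_ofReal ha hb one_pos (by simpa using h)

/-- The properties of the weak solution used in the relative energy argument, apart from the
equations. -/
structure WeakReg (T : ℝ) (Ω : Set E3) (p : ℝ → ℝ) (γ ρbar M : ℝ) (ρ : ℝ → E3 → ℝ)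
    (u : ℝ → E3 → E3) (Du : ℝ → E3 → M33) : Prop where
  law : PressureLaw p γ
  far : 0 < ρbar
  meas_ρ : AEStronglyMeasurable (uncurry ρ) (dt(T).prod dx(Ω))
  nonneg : ∀ᵐ t ∂dt(T), ∀ᵐ x ∂dx(Ω), 0 ≤ ρ t x
  meas_u : AEStronglyMeasurable (uncurry u) (dt(T).prod dx(Ω))
  memD012 : ∀ᵐ t ∂dt(T), MemD012 Ω (u t) (Du t)
  Du_two : ∀ i j, Mix dt(T) dx(Ω) 2 2 (fun t x => Du t x i j)
  u_six : ∀ i, Mix dt(T) dx(Ω) 2 (ofReal 6) (fun t x => u t x i)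
  energy : ∀ᵐ t ∂dt(T), Integrable (fun x => energyDensity p ρbar (ρ t x) (u t x)) dx(Ω) ∧
      ∫ x in Ω, energyDensity p ρbar (ρ t x) (u t x) ≤ M

lemma mix_six_of_memD012 (hΩ : IsOpen Ω) (hu : AEStronglyMeasurable (uncurry u) (dt(T).prod dx(Ω)))
    (h : ∀ᵐ t ∂dt(T), MemD012 Ω (u t) (Du t))
    (hD : ∀ i j, Mix dt(T) dx(Ω) 2 2 (fun t x => Du t x i j)) (i : Fin 3) :
    Mix dt(T) dx(Ω) 2 (ofReal 6) (fun t x => u t x i) := by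
  obtain ⟨C, hC⟩ := exists_sobolev_memD012
  rw [show ofReal 6 = 6 by norm_num]
  refine Mix.of_bound (N := fun t => C * ∑ j, (eLpNorm (fun x => Du t x i j) 2
    dx(Ω)).toReal) (aestronglyMeasurable_coord hu i)
    ((memLp_finsetSum _ fun j _ => (hD i j).norm).const_mul _) ?_
  filter_upwards [h, ae_all_iff.2 fun j => (hD i j).memLp] with t h1 h2
  have key : ∀ a : Fin 3 → ℝ≥0∞, (∀ j, a j ≠ ⊤) →
      (C : ℝ≥0∞) * ∑ j, a j = ofReal (C * ∑ j, (a j).toReal) := fun a ha => by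
    rw [ENNReal.ofReal_mul C.coe_nonneg, ENNReal.ofReal_sum_of_nonneg fun _ _ => toReal_nonneg]
    simp only [ofReal_toReal (ha _), ENNReal.ofReal_coe_nnreal]
  exact (hC Ω _ _ hΩ h1 i).trans (key _ fun j => (h2 j).2.ne).le

lemma IsFEWSWithGradient.exists_weakReg (hΩ : IsOpen Ω) (hp : PressureLaw p γ) (hρbar : 0 < ρbar)
    (h : IsFEWSWithGradient T Ω μ η p γ ρbar f ρ₀ u₀ ρ u Du) :
    ∃ M, WeakReg T Ω p γ ρbar M ρ u Du := by
  obtain ⟨M, hM⟩ := h.energy.exists_bound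
  have h1 := h.density_class.1
  have h2 := h.velocity_class.1
  have h3 := h.density_nonneg
  rw [volume_restrict_cyl] at h1 h2 h3
  have hD := fun i j => (h.velocity_class.2.2 i j).mix two_ne_zero
  refine ⟨M, hp, hρbar, ?_, ae_ae_of_ae_prod h3, h2, h.velocity_class.2.1, hD,
    mix_six_of_memD012 hΩ h2 h.velocity_class.2.1 hD, hM⟩
  have := h1.add (aestronglyMeasurable_const (b := ρbar))
  refine this.congr (.of_forall fun z => ?_)
  simp [uncurry]

lemma PressureLaw.continuous_comp_max (hp : PressureLaw p γ) : Continuous fun s => p (max s 0) :=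
  hp.continuousOn.comp_continuous (by fun_prop) fun s => le_max_right s 0

lemma conj_exponent_facts (hγ : 3 / 2 < γ) (hq3 : 3 < q) (hq6 : q ≤ 6) (hqγ : 3 < q * (γ - 1)) :
    1 < q / (q - 1) ∧ q / (q - 1) ≤ 6 * q / (5 * q - 6) ∧ 6 * q / (5 * q - 6) ≤ γ ∧
    3 / 2 ≤ 6 * q / (5 * q - 6) ∧ 6 * q / (5 * q - 6) < 2 := by
  have h1 : 0 < q - 1 := by linarith
  have h2 : 0 < 5 * q - 6 := by linarith
  refine ⟨?_, ?_, ?_, ?_, ?_⟩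
  · rw [lt_div_iff₀ h1]; linarith
  · rw [div_le_div_iff₀ h1 h2]; nlinarith
  · rw [div_le_iff₀ h2]
    rcases le_total 2 γ with h | h
    · nlinarith
    · nlinarith [mul_nonneg (by linarith : 0 ≤ 2 * γ - 3) (by linarith : 0 ≤ 2 - γ)]
  · rw [le_div_iff₀ h2]; linarith
  · rw [div_lt_iff₀ h2]; linarith

lemma holderTriple_conj (hq : 3 < q) : HolderTriple (ofReal (6 * q / (5 * q - 6))) (ofReal 6)
    (ofReal (q / (q - 1))) := by
  have h1 : 0 < 5 * q - 6 := by linarith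
  have h2 : 0 < q - 1 := by linarith
  have h3 : 0 < q := by linarith
  exact holderTriple_ofReal (by positivity) (by norm_num) (by positivity) (by field_simp; ring)

lemma WeakReg.meas_ρ_mul (h : WeakReg T Ω p γ ρbar M ρ u Du) (i : Fin 3) :
    AEStronglyMeasurable (uncurry fun t x => ρ t x * u t x i) (dt(T).prod dx(Ω)) :=
  h.meas_ρ.mul (aestronglyMeasurable_coord h.meas_u i)

lemma WeakReg.meas_p (h : WeakReg T Ω p γ ρbar M ρ u Du) :
    AEStronglyMeasurable (uncurry fun t x => p (ρ t x)) (dt(T).prod dx(Ω)) := by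
  have h1 : AEStronglyMeasurable (fun z : ℝ × E3 => p (max (ρ z.1 z.2) 0)) (dt(T).prod dx(Ω)) :=
    h.law.continuous_comp_max.comp_aestronglyMeasurable h.meas_ρ
  obtain ⟨ρ', hρ', hρe⟩ := h.meas_ρ
  refine ⟨fun z => p (max (ρ' z) 0), h.law.continuous_comp_max.comp_stronglyMeasurable hρ', ?_⟩
  have hms : MeasurableSet {z : ℝ × E3 | 0 ≤ ρ' z} :=
    measurableSet_le measurable_const hρ'.measurable
  have h2 : ∀ᵐ z ∂(dt(T).prod dx(Ω)), 0 ≤ ρ' z := by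
    rw [Measure.ae_prod_iff_ae_ae hms]
    filter_upwards [h.nonneg, ae_ae_of_ae_prod hρe] with t h3 h4
    filter_upwards [h3, h4] with x h5 h6
    rw [← h6]; exact h5
  filter_upwards [hρe, h2] with z h3 h4
  rw [max_eq_left h4, ← h3]; rfl

/-- The kinetic energy. -/
lemma WeakReg.kinetic (h : WeakReg T Ω p γ ρbar M ρ u Du) (i j : Fin 3) :
    Mix dt(T) dx(Ω) ⊤ 1 (fun t x => ρ t x * u t x i * u t x j) := by
  rw [← ofReal_one]
  refine Mix.top_of_energy_le (g := fun t x => ρ t x * u t x i * u t x j) h.energy Mix.zero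
    ((h.meas_ρ_mul i).mul (aestronglyMeasurable_coord h.meas_u j)) (L := 2) one_pos two_pos.le ?_
  filter_upwards [h.nonneg] with t ht
  filter_upwards [ht] with x hx
  have h1 := (energyDensity_eq_of_nonneg h.law h.far hx (u t x)).1
  rw [Real.rpow_one, mul_assoc, abs_mul, abs_of_nonneg hx, abs_mul]
  have h2 : |u t x i| * |u t x j| ≤ ‖u t x‖ ^ 2 := by
    rw [sq]; exact mul_le_mul (abs_coord_le _ _) (abs_coord_le _ _) (abs_nonneg _) (norm_nonneg _)
  have h3 := mul_le_mul_of_nonneg_left h2 hx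
  linarith

/-- The deviation of the density from the reference density `r`, where the density is at most
`B`. -/
def lowDev (B s r : ℝ) : ℝ := if s ≤ B then s - r else 0

/-- The deviation of the density from the reference density `r`, where the density exceeds `B`. -/
def highDev (B s r : ℝ) : ℝ := if s ≤ B then 0 else s - r

lemma lowDev_add_highDev (B s r : ℝ) : lowDev B s r + highDev B s r = s - r := by
  unfold lowDev highDev; split_ifs <;> simp

lemma measurable_dev (B : ℝ) : Measurable (uncurry (lowDev B)) ∧ Measurable (uncurry (highDev B)) :=
  have h : MeasurableSet {z : ℝ × ℝ | z.1 ≤ B} := measurableSet_le measurable_fst measurable_const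
  ⟨.ite h (measurable_fst.sub measurable_snd) measurable_const,
    .ite h measurable_const (measurable_fst.sub measurable_snd)⟩

lemma lowDev_sq_le (hs : 0 ≤ s) (r : ℝ) : |lowDev B s r| ^ (2 : ℝ) ≤ devEnergy γ B s r := by
  rw [Real.rpow_two, sq_abs, lowDev, devEnergy]
  split_ifs
  · rfl
  · simpa using Real.rpow_nonneg hs γ

lemma RelPotBounds.highDev_rpow_le {r : ℝ} (HB : RelPotBounds p γ ρbar c C B κ L) (hc : 0 < c)
    (hr : r ∈ Icc c C) (hs : 0 ≤ s) (h0 : 0 < σ) (hσ : σ ≤ γ) :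
    |highDev B s r| ^ σ ≤ devEnergy γ B s r := by
  rw [highDev, devEnergy]
  split_ifs with h
  · rw [abs_zero, Real.zero_rpow h0.ne']; exact sq_nonneg _
  · have h3 : |s - r| ≤ s := abs_le.2 ⟨by linarith [hr.2, HB.lt], by linarith [hr.1]⟩
    exact (Real.rpow_le_rpow (abs_nonneg _) h3 h0.le).trans
      (Real.rpow_le_rpow_of_exponent_le (by linarith [HB.one_le]) hσ)

section Deviation

variable {r : ℝ → E3 → ℝ} (HR : RefDensity T Ω ρbar c C r) (HW : WeakReg T Ω p γ ρbar M ρ u Du)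
  (HB : RelPotBounds p γ ρbar c C B κ L)
include HR HW HB

lemma devEnergy_le_energyDensity : 0 ≤ κ⁻¹ + 1 ∧ ∀ᵐ t ∂dt(T), ∀ᵐ x ∂dx(Ω),
    0 ≤ ρ t x ∧ r t x ∈ Icc c C ∧ devEnergy γ B (ρ t x) (r t x) ≤ 2 * (κ⁻¹ + 1) *
      (energyDensity p ρbar (ρ t x) (u t x) + (r t x - ρbar) * (r t x - ρbar)) := by
  have hκ := (inv_pos.2 HB.κ_pos).le
  refine ⟨by linarith, ?_⟩
  filter_upwards [HR.bounds, HW.nonneg] with t h1 h2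
  filter_upwards [h1, h2] with x h1 h2
  have h3 := (energyDensity_eq_of_nonneg HW.law HW.far h2 (u t x)).2
  refine ⟨h2, h1, (devEnergy_le h2 _ ρbar).trans ?_⟩
  nlinarith [HB.lower _ HR.far _ h2, mul_le_mul_of_nonneg_left h3 hκ, mul_nonneg hκ
    (mul_self_nonneg (r t x - ρbar)), relPot_nonneg HW.law HW.far h2 HW.far]

lemma mix_of_le_devEnergy {g : ℝ → E3 → ℝ}
    (hg : AEStronglyMeasurable (uncurry g) (dt(T).prod dx(Ω)))
    (hs : 0 < s) (hδ : 0 ≤ δ) (h : ∀ t x, 0 ≤ ρ t x → r t x ∈ Icc c C →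
      |g t x| ^ s ≤ δ * devEnergy γ B (ρ t x) (r t x)) : Mix dt(T) dx(Ω) ⊤ (ofReal s) g := by
  obtain ⟨h0, h1⟩ := devEnergy_le_energyDensity HR HW HB
  refine Mix.top_of_energy_le HW.energy HR.r_top_two hg hs (L := δ * (2 * (κ⁻¹ + 1)))
    (by positivity) ?_
  filter_upwards [h1] with t ht
  filter_upwards [ht] with x ⟨h1, h2, h3⟩
  rw [mul_assoc]
  exact (h t x h1 h2).trans (mul_le_mul_of_nonneg_left h3 hδ)

lemma lowDev_mix : Mix dt(T) dx(Ω) ⊤ 2 (fun t x => lowDev B (ρ t x) (r t x)) :=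
  (mix_of_le_devEnergy (g := fun t x => lowDev B (ρ t x) (r t x)) HR HW HB
    ((measurable_dev B).1.comp_aemeasurable
    (HW.meas_ρ.aemeasurable.prodMk HR.meas.aemeasurable)).aestronglyMeasurable two_pos zero_le_one
    fun _ _ h1 _ => (lowDev_sq_le h1 _).trans_eq (one_mul _).symm).of_ofReal_two

lemma lowDev_top : Mix dt(T) dx(Ω) ⊤ ⊤ (fun t x => lowDev B (ρ t x) (r t x)) := by
  refine Mix.of_abs_le (C := B) (lowDev_mix HR HW HB).meas ?_
  filter_upwards [(devEnergy_le_energyDensity HR HW HB).2] with t ht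
  filter_upwards [ht] with x ⟨h1, h2, _⟩
  unfold lowDev
  split_ifs
  · exact abs_le.2 ⟨by linarith [h2.2, HB.lt], by linarith [h2.1, HR.pos]⟩
  · simpa using zero_le_one.trans HB.one_le

lemma highDev_mix (h0 : 0 < σ) (hσ : σ ≤ γ) :
    Mix dt(T) dx(Ω) ⊤ (ofReal σ) (fun t x => highDev B (ρ t x) (r t x)) :=
  mix_of_le_devEnergy (g := fun t x => highDev B (ρ t x) (r t x)) HR HW HB
    ((measurable_dev B).2.comp_aemeasurable
    (HW.meas_ρ.aemeasurable.prodMk HR.meas.aemeasurable)).aestronglyMeasurable h0 zero_le_one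
    fun _ _ h1 h2 => (HB.highDev_rpow_le HR.pos h2 h1 h0 hσ).trans_eq (one_mul _).symm

lemma pressure_remainder_mix : Mix dt(T) dx(Ω) ⊤ 1
    (fun t x => p (ρ t x) - p (r t x) - deriv p (r t x) * (ρ t x - r t x)) := by
  have hp := HW.law
  rw [← ofReal_one]
  refine mix_of_le_devEnergy HR HW HB ((HW.meas_p.sub (HR.comp_mix (hp.continuousOn.mono fun s hs =>
    HR.pos.le.trans hs.1)).meas).sub ((HR.comp_mix (HR.continuousOn_deriv hp)).meas.mul
      (HW.meas_ρ.sub HR.meas))) one_pos HB.K_pos.le fun t x h1 h2 => ?_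
  rw [Real.rpow_one]
  exact HB.remainder _ h2 _ h1

end Deviation

lemma WeakReg.density_local (h : WeakReg T Ω p γ ρbar M ρ u Du) (hKΩ : K ⊆ Ω)
    [IsFiniteMeasure dx(K)] : Mix dt(T) dx(K) ⊤ (ofReal γ) ρ := by
  have hγ := h.law.three_halves_lt
  have hR : RefDensity T Ω ρbar ρbar ρbar fun _ _ => ρbar := .const h.far
  obtain ⟨B, κ, L, HB⟩ := exists_relPotBounds h.law h.far h.far le_rfl
  have h1 : (1 : ℝ≥0∞) ≤ ofReal γ := one_le_ofReal.2 (by linarith)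
  refine ((((hR.comp_mix continuousOn_id).add le_top (lowDev_top hR h HB)).mono_set hKΩ).mono_right
    le_top |>.add h1 ((highDev_mix hR h HB (by linarith) le_rfl).mono_set hKΩ)).congr
      (.of_forall fun z => ?_)
  simp only [uncurry, id]
  linarith [lowDev_add_highDev B (ρ z.1 z.2) ρbar]

lemma WeakReg.density_local_one (h : WeakReg T Ω p γ ρbar M ρ u Du) (hKΩ : K ⊆ Ω)
    [IsFiniteMeasure dx(K)] : Mix dt(T) dx(K) ⊤ 1 ρ :=
  (h.density_local hKΩ).mono_right (one_le_ofReal.2 (by linarith [h.law.three_halves_lt]))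

lemma WeakReg.pressure_local (h : WeakReg T Ω p γ ρbar M ρ u Du) (hKΩ : K ⊆ Ω)
    [IsFiniteMeasure dx(K)] : Mix dt(T) dx(K) ⊤ 1 (fun t x => p (ρ t x)) := by
  have hR : RefDensity T Ω ρbar ρbar ρbar fun _ _ => ρbar := .const h.far
  obtain ⟨B, κ, L, HB⟩ := exists_relPotBounds h.law h.far h.far le_rfl
  have hc : ∀ a : ℝ, Mix dt(T) dx(K) ⊤ 1 (fun _ _ => a) :=
    fun a => (Mix.of_abs_le (C := |a|) aestronglyMeasurable_const
      (.of_forall fun _ => .of_forall fun _ => le_rfl)).mono_right le_top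
  refine ((((h.density_local_one hKΩ).sub le_rfl (hc ρbar)).const_mul (deriv p ρbar)).add le_rfl
    (((pressure_remainder_mix hR h HB).mono_set hKΩ).add le_rfl (hc (p ρbar)))).congr
      (.of_forall fun z => ?_)
  simp only [uncurry]; ring

lemma WeakReg.momentum_local (h : WeakReg T Ω p γ ρbar M ρ u Du) (hKΩ : K ⊆ Ω)
    [IsFiniteMeasure dx(K)] (i : Fin 3) :
    Mix dt(T) dx(K) ⊤ 1 (fun t x => ρ t x * u t x i) := by
  refine ((h.density_local_one hKΩ).add le_rfl ((h.kinetic i i).mono_set hKΩ)).mono_ae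
    ((h.meas_ρ_mul i).mono_ac (Measure.AbsolutelyContinuous.rfl.prod
      (restrict_le hKΩ).absolutelyContinuous)) ?_
  filter_upwards [h.nonneg] with t ht
  filter_upwards [ae_mono (restrict_le hKΩ) ht] with x hx
  refine le_trans ?_ (le_abs_self _)
  rw [abs_mul, abs_of_nonneg hx]
  nlinarith [mul_nonneg hx (sq_nonneg (|u t x i| - 1)), sq_abs (u t x i),
    mul_nonneg hx (abs_nonneg (u t x i))]

lemma WeakReg.momentum_local_conj (h : WeakReg T Ω p γ ρbar M ρ u Du) (hKΩ : K ⊆ Ω)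
    [IsFiniteMeasure dx(K)] (hq3 : 3 < q) (hq6 : q ≤ 6) (hqγ : 3 < q * (γ - 1)) (i : Fin 3) :
    Mix dt(T) dx(K) 2 (ofReal (q / (q - 1))) (fun t x => ρ t x * u t x i) := by
  obtain ⟨h1, h2, h3, h4, h5⟩ := conj_exponent_facts h.law.three_halves_lt hq3 hq6 hqγ
  have hσ : Mix dt(T) dx(K) ⊤ (ofReal (6 * q / (5 * q - 6))) ρ :=
    (h.density_local hKΩ).mono_right (ofReal_le_ofReal h3)
  have := holderTriple_conj hq3
  exact hσ.mul ((h.u_six i).mono_set hKΩ)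

/-! ### Compositions -/

/-- A `C¹` function on an interval has a `C¹` extension to the line with bounded derivative. -/
lemma exists_bounded_extension {a : ℝ} (hab : a ≤ b) (hG : ∀ x ∈ Icc a b, HasDerivAt G (G' x) x)
    (hG' : ContinuousOn G' (Icc a b)) :
    ∃ F F' : ℝ → ℝ, (∀ x, HasDerivAt F (F' x) x) ∧ Continuous F' ∧ (∃ C, ∀ x, |F' x| ≤ C) ∧
      ∀ x ∈ Icc a b, F x = G x ∧ F' x = G' x := by
  have hcont : Continuous (IccExtend hab (fun x : Icc a b => G' x)) :=
    (continuousOn_iff_continuous_domRestrict.1 hG').Icc_extend'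
  have heq : ∀ x ∈ Icc a b, IccExtend hab (fun x : Icc a b => G' x) x = G' x := fun x hx =>
    IccExtend_of_mem hab _ hx
  refine ⟨fun x => G a + ∫ s in a..x, IccExtend hab (fun x : Icc a b => G' x) s, _, fun x => ?_,
    hcont, ?_, fun x hx => ⟨?_, heq x hx⟩⟩
  · exact (hcont.integral_hasStrictDerivAt a x).hasDerivAt.const_add _
  · obtain ⟨C, hC⟩ := isCompact_Icc.exists_bound_of_continuousOn hG'
    exact ⟨C, fun x => hC _ (projIcc a b hab x).2⟩
  · have h1 : ∫ s in a..x, IccExtend hab (fun x : Icc a b => G' x) s = ∫ s in a..x, G' s := by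
      refine intervalIntegral.integral_congr fun s hs => heq s ?_
      rw [uIcc_of_le hx.1] at hs
      exact ⟨hs.1, hs.2.trans hx.2⟩
    have hsub : uIcc a x ⊆ Icc a b := by
      rw [uIcc_of_le hx.1]; exact Icc_subset_Icc_right hx.2
    simp only [h1]
    rw [intervalIntegral.integral_eq_sub_of_hasDerivAt (f := G) (fun s hs => hG s (hsub hs))
      ((hG'.mono hsub).intervalIntegrable)]
    ring

lemma HasWeakGrad.congr_ae {v' : E3 → ℝ} {g g' : Fin 3 → E3 → ℝ} (h : HasWeakGrad Ω v g)
    (hv : v =ᵐ[dx(Ω)] v') (hg : ∀ j, g j =ᵐ[dx(Ω)] g' j) : HasWeakGrad Ω v' g' where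
  integrableOn K hK hKΩ := (h.integrableOn K hK hKΩ).congr (ae_mono (restrict_le hKΩ) hv)
  integrableOn_grad j K hK hKΩ := (h.integrableOn_grad j K hK hKΩ).congr
    (ae_mono (restrict_le hKΩ) (hg j))
  eq j φ hφ := by
    have e1 : ∫ x in Ω, v' x * fderiv ℝ φ x (bv j) = ∫ x in Ω, v x * fderiv ℝ φ x (bv j) :=
      integral_congr_ae (hv.mono fun x hx => by simp only [hx])
    have e2 : ∫ x in Ω, g' j x * φ x = ∫ x in Ω, g j x * φ x :=
      integral_congr_ae ((hg j).mono fun x hx => by simp only [hx])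
    rw [e1, e2, h.eq j φ hφ]

lemma HasWeakGrad.comp_of_mem_Icc (hΩ : IsOpen Ω) {g : Fin 3 → E3 → ℝ} (hv : HasWeakGrad Ω v g)
    {a : ℝ} (hab : a ≤ b) (hG : ∀ x ∈ Icc a b, HasDerivAt G (G' x) x)
    (hG' : ContinuousOn G' (Icc a b)) (hvab : ∀ᵐ x ∂dx(Ω), v x ∈ Icc a b) :
    HasWeakGrad Ω (fun x => G (v x)) (fun j x => G' (v x) * g j x) := by
  obtain ⟨F, F', h1, h2, ⟨C, hC⟩, h3⟩ := exists_bounded_extension hab hG hG'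
  refine (hv.comp hΩ h1 h2 hC).congr_ae ?_ fun j => ?_
  · filter_upwards [hvab] with x hx using (h3 _ hx).1
  · filter_upwards [hvab] with x hx
    rw [(h3 _ hx).2]

lemma HasWeakGrad.half_sq (hΩ : IsOpen Ω) {g : Fin 3 → E3 → ℝ} (hv : HasWeakGrad Ω v g)
    (h : MemLp v ⊤ dx(Ω)) : HasWeakGrad Ω (fun x => 1 / 2 * v x ^ 2) (fun j x => v x * g j x) := by
  set N := (eLpNorm v ⊤ dx(Ω)).toReal
  have hN : ∀ᵐ x ∂dx(Ω), v x ∈ Icc (-N) N := by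
    filter_upwards [ae_le_eLpNormEssSup (f := v) (μ := dx(Ω))] with x hx
    rw [← eLpNorm_exponent_top, ← ofReal_toReal h.2.ne, Real.enorm_eq_ofReal_abs,
      ENNReal.ofReal_le_ofReal_iff toReal_nonneg] at hx
    exact abs_le.1 hx
  have hN0 : 0 ≤ N := toReal_nonneg
  refine hv.comp_of_mem_Icc hΩ (G := fun x => 1 / 2 * x ^ 2) (G' := fun x => x) (by linarith)
    (fun x _ => ?_) continuousOn_id hN
  have := (hasDerivAt_pow 2 x).const_mul (1 / 2)
  exact this.congr_deriv (by norm_num; ring)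

/-- The chain rule in time. -/
lemma ae_comp_primitive_eq (hT : 0 < T) {h : ℝ → ℝ} {h₀ : ℝ} (ha : IntegrableOn a (Ioo 0 T))
    (he : ∀ᵐ t ∂dt(T), h t = h₀ + ∫ s in 0..t, a s) (hG : ∀ x, HasDerivAt G (G' x) x)
    (hG' : Continuous G') : IntegrableOn (fun t => G' (h t) * a t) (Ioo 0 T) ∧
    ∀ᵐ t ∂dt(T), G (h t) = G h₀ + ∫ s in 0..t, G' (h s) * a s := by
  have hai : ∀ t ∈ Ioc 0 T, IntervalIntegrable a volume 0 t := fun t ht => by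
    rw [intervalIntegrable_iff_integrableOn_Ioo_of_le ht.1.le]
    exact ha.mono_set (Ioo_subset_Ioo_right ht.2)
  have hsub : ∀ t ∈ Ioc 0 T, ∀ᵐ s ∂dt(t), h s = h₀ + ∫ s in 0..s, a s :=
    fun t ht => ae_mono (restrict_le (Ioo_subset_Ioo_right ht.2)) he
  constructor
  · have := (comp_primitive_eq (c := h₀) hG hG' (hai T ⟨hT, le_rfl⟩)).1
    rw [intervalIntegrable_iff_integrableOn_Ioo_of_le hT.le] at this
    exact this.congr (he.mono fun t ht => by simp only [ht])
  · filter_upwards [he, ae_mem_Ioo] with t ht htT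
    rw [ht, (comp_primitive_eq (c := h₀) hG hG' (hai t ⟨htT.1, htT.2.le⟩)).2]
    congr 1
    rw [integral_of_le htT.1.le, intervalIntegral_eq_Ioo htT.1.le, integral_Ioc_eq_integral_Ioo]
    exact integral_congr_ae ((hsub t ⟨htT.1, htT.2.le⟩).mono fun s hs => by simp only [hs])

lemma ae_comp_primitive_eq_of_mem_Icc (hT : 0 < T) {h : ℝ → ℝ} {h₀ : ℝ}
    (ha : IntegrableOn a (Ioo 0 T)) (he : ∀ᵐ t ∂dt(T), h t = h₀ + ∫ s in 0..t, a s)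
    (hab : c ≤ C) (hG : ∀ x ∈ Icc c C, HasDerivAt G (G' x) x) (hG' : ContinuousOn G' (Icc c C))
    (hh : ∀ᵐ t ∂dt(T), h t ∈ Icc c C) (h0 : h₀ ∈ Icc c C) :
    IntegrableOn (fun t => G' (h t) * a t) (Ioo 0 T) ∧
    ∀ᵐ t ∂dt(T), G (h t) = G h₀ + ∫ s in 0..t, G' (h s) * a s := by
  obtain ⟨F, F', h1, h2, -, h3⟩ := exists_bounded_extension hab hG hG'
  obtain ⟨e1, e2⟩ := ae_comp_primitive_eq hT ha he h1 h2
  refine ⟨e1.congr (hh.mono fun t ht => by simp only [(h3 _ ht).2]), ?_⟩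
  filter_upwards [e2, hh, ae_mem_Ioo] with t ht hth htT
  rw [← (h3 _ hth).1, ht, (h3 _ h0).1]
  congr 1
  refine intervalIntegral_congr_dt htT ?_
  filter_upwards [hh] with s hs
  simp only [(h3 _ hs).2]

/-! ### Zero extensions -/

lemma Mix.indicator [SFinite lam] (hK : MeasurableSet K) {r s : ℝ≥0∞} {g : α → E3 → ℝ}
    (h : Mix lam dx(K) r s g) : Mix lam volume r s (fun t => K.indicator (g t)) where
  meas := by
    have e : (uncurry fun t => K.indicator (g t)) = (univ ×ˢ K).indicator (uncurry g) := by
      ext z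
      by_cases hz : z.2 ∈ K
      · simp [uncurry, hz]
      · simp [uncurry, hz]
    rw [e, aestronglyMeasurable_indicator_iff (MeasurableSet.univ.prod hK), ← Measure.prod_restrict,
      Measure.restrict_univ]
    exact h.meas
  memLp := h.memLp.mono fun t ht => (memLp_indicator_iff_restrict hK).2 ht
  norm := by
    simp only [eLpNorm_indicator_eq_eLpNorm_restrict hK]
    exact h.norm

lemma Pairing.of_indicator (hK : MeasurableSet K) [IsFiniteMeasure dx(K)] {lam : Measure ℝ}
    [SFinite lam] {F G : ℝ → E3 → ℝ} {r₁ r₂ s₁ s₂ : ℝ≥0∞} [HolderTriple r₁ r₂ 1]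
    [HolderTriple s₁ s₂ 1] (hs₁ : 1 ≤ s₁) (hs₂ : 1 ≤ s₂) (hs₁t : s₁ ≠ ⊤)
    (hF : Mix lam dx(K) r₁ s₁ F) (hG : Mix lam dx(K) r₂ s₂ G) :
    Pairing lam (fun t => K.indicator (F t)) (fun t => K.indicator (G t)) := by
  refine Pairing.of_mix hs₁ hs₁t (hF.indicator hK) (hG.indicator hK) ?_ ?_
  · filter_upwards [hF.memLp] with t ht
    exact (integrable_indicator_iff hK).2 (ht.integrable hs₁)
  · filter_upwards [hG.memLp] with t ht
    exact (integrable_indicator_iff hK).2 (ht.integrable hs₂)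

lemma IsKernel.fderiv_eq_zero (hk : IsKernel k ε) {z : E3} (hz : ε < ‖z‖) : fderiv ℝ k z = 0 := by
  have : k =ᶠ[𝓝 z] fun _ => 0 := by
    filter_upwards [(isOpen_lt continuous_const continuous_norm).mem_nhds hz] with w hw
    exact hk.eq_zero w hw
  rw [this.fderiv_eq]
  simp

/-! ### Tested identities in integrated form -/

/-- `h` is the primitive of `a` with initial value `h₀`. -/
structure IsPrim (T : ℝ) (h : ℝ → ℝ) (h₀ : ℝ) (a : ℝ → ℝ) : Prop where
  integrable : IntegrableOn a (Ioo 0 T)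
  eq : ∀ᵐ t ∂dt(T), h t = h₀ + ∫ s in 0..t, a s

lemma IntegrableOn.intervalIntegrable_of_mem {t : ℝ} (ha : IntegrableOn a (Ioo 0 T))
    (ht : t ∈ Ioo 0 T) : IntervalIntegrable a volume 0 t := by
  rw [intervalIntegrable_iff_integrableOn_Ioo_of_le ht.1.le]
  exact ha.mono_set (Ioo_subset_Ioo_right ht.2.le)

lemma IsPrim.add {h₁ h₂ a₁ a₂ : ℝ → ℝ} {c₁ c₂ : ℝ} (H₁ : IsPrim T h₁ c₁ a₁)
    (H₂ : IsPrim T h₂ c₂ a₂) :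
    IsPrim T (fun t => h₁ t + h₂ t) (c₁ + c₂) (fun t => a₁ t + a₂ t) := by
  refine ⟨H₁.integrable.add H₂.integrable, ?_⟩
  filter_upwards [H₁.eq, H₂.eq, ae_mem_Ioo] with t e1 e2 ht
  rw [e1, e2, intervalIntegral.integral_add
    (IntegrableOn.intervalIntegrable_of_mem H₁.integrable ht)
    (IntegrableOn.intervalIntegrable_of_mem H₂.integrable ht)]
  ring

lemma IsPrim.const_mul {h : ℝ → ℝ} (d : ℝ) (H : IsPrim T h c a) :
    IsPrim T (fun t => d * h t) (d * c) (fun t => d * a t) := by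
  refine ⟨H.integrable.const_mul d, ?_⟩
  filter_upwards [H.eq] with t e1
  rw [e1, intervalIntegral.integral_const_mul]
  ring

lemma IsPrim.const (d : ℝ) : IsPrim T (fun _ => d) d (fun _ => 0) :=
  ⟨integrableOn_zero, .of_forall fun t => by simp⟩

lemma IsPrim.sum {ι : Type*} (S : Finset ι) {h a : ι → ℝ → ℝ} {c : ι → ℝ}
    (H : ∀ i ∈ S, IsPrim T (h i) (c i) (a i)) :
    IsPrim T (fun t => ∑ i ∈ S, h i t) (∑ i ∈ S, c i) (fun t => ∑ i ∈ S, a i t) := by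
  classical
  induction S using Finset.induction_on with
  | empty => simpa using IsPrim.const (T := T) 0
  | insert i S hi ih =>
    simp only [Finset.sum_insert hi]
    exact (H i (Finset.mem_insert_self _ _)).add (ih fun j hj => H j (Finset.mem_insert_of_mem hj))

/-- `∫ X(τ) = ∫ X₀ + ∫₀^τ ∫ N` for almost all `τ`, with integrable integrands. -/
structure Tested (T : ℝ) (ν : Measure E3) (X : ℝ → E3 → ℝ) (X₀ : E3 → ℝ) (N : ℝ → E3 → ℝ) :
    Prop where
  integrable : ∀ᵐ t ∂dt(T), Integrable (X t) ν
  integrable_initial : Integrable X₀ ν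
  integrable_source : Integrable (uncurry N) (dt(T).prod ν)
  eq : ∀ᵐ τ ∂dt(T), ∫ x, X τ x ∂ν = (∫ x, X₀ x ∂ν) + ∫ t in 0..τ, ∫ x, N t x ∂ν

section Tested

variable {X X₁ X₂ N N₁ N₂ : ℝ → E3 → ℝ} {Y Y₁ Y₂ : E3 → ℝ}

lemma Tested.add [SFinite ν] (h₁ : Tested T ν X₁ Y₁ N₁) (h₂ : Tested T ν X₂ Y₂ N₂) :
    Tested T ν (fun t x => X₁ t x + X₂ t x) (fun x => Y₁ x + Y₂ x)
      (fun t x => N₁ t x + N₂ t x) := by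
  refine ⟨?_, h₁.integrable_initial.add h₂.integrable_initial,
    h₁.integrable_source.add h₂.integrable_source, ?_⟩
  · filter_upwards [h₁.integrable, h₂.integrable] with t a b using a.add b
  · filter_upwards [h₁.integrable, h₂.integrable, h₁.eq, h₂.eq, ae_mem_Ioo]
      with τ a b e1 e2 hτ
    rw [integral_add a b, integral_add h₁.integrable_initial h₂.integrable_initial, e1, e2]
    have e3 : ∫ t in 0..τ, ∫ x, (N₁ t x + N₂ t x) ∂ν
        = ∫ t in 0..τ, ((∫ x, N₁ t x ∂ν) + ∫ x, N₂ t x ∂ν) := by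
      refine intervalIntegral_congr_dt hτ ?_
      filter_upwards [h₁.integrable_source.prod_right_ae, h₂.integrable_source.prod_right_ae]
        with t a b using integral_add a b
    have i1 : IntegrableOn (fun t => ∫ x, N₁ t x ∂ν) (Ioo 0 T) :=
      h₁.integrable_source.integral_prod_left
    have i2 : IntegrableOn (fun t => ∫ x, N₂ t x ∂ν) (Ioo 0 T) :=
      h₂.integrable_source.integral_prod_left
    rw [e3, intervalIntegral.integral_add (IntegrableOn.intervalIntegrable_of_mem i1 hτ)
      (IntegrableOn.intervalIntegrable_of_mem i2 hτ)]
    ring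

lemma Tested.const_mul (c : ℝ) (h : Tested T ν X Y N) :
    Tested T ν (fun t x => c * X t x) (fun x => c * Y x) (fun t x => c * N t x) := by
  refine ⟨h.integrable.mono fun t ht => ht.const_mul c, h.integrable_initial.const_mul c,
    h.integrable_source.const_mul c, ?_⟩
  filter_upwards [h.eq] with τ e
  simp only [integral_const_mul, intervalIntegral.integral_const_mul, e]
  ring

lemma Tested.zero : Tested T ν (fun _ _ => 0) (fun _ => 0) (fun _ _ => 0) :=
  ⟨.of_forall fun _ => integrable_zero _ _ _, integrable_zero _ _ _,
    integrable_zero _ _ _, .of_forall fun _ => by simp⟩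

lemma Tested.sum [SFinite ν] {ι : Type*} (S : Finset ι) {X N : ι → ℝ → E3 → ℝ} {Y : ι → E3 → ℝ}
    (H : ∀ i ∈ S, Tested T ν (X i) (Y i) (N i)) :
    Tested T ν (fun t x => ∑ i ∈ S, X i t x) (fun x => ∑ i ∈ S, Y i x)
      (fun t x => ∑ i ∈ S, N i t x) := by
  classical
  induction S using Finset.induction_on with
  | empty => simpa using Tested.zero
  | insert i S hi ih =>
    simp only [Finset.sum_insert hi]
    exact (H i (Finset.mem_insert_self _ _)).add (ih fun j hj => H j (Finset.mem_insert_of_mem hj))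

lemma Tested.congr (h : Tested T ν X₁ Y₁ N₁) (hX : ∀ᵐ t ∂dt(T), X₁ t =ᵐ[ν] X₂ t) (hY : Y₁ =ᵐ[ν] Y₂)
    (hN : uncurry N₁ =ᵐ[dt(T).prod ν] uncurry N₂)
    [SFinite ν] : Tested T ν X₂ Y₂ N₂ := by
  refine ⟨?_, h.integrable_initial.congr hY, h.integrable_source.congr hN, ?_⟩
  · filter_upwards [h.integrable, hX] with t a b using a.congr b
  · filter_upwards [h.eq, hX, ae_mem_Ioo] with τ e b hτ
    rw [← integral_congr_ae b, ← integral_congr_ae hY, e]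
    congr 1
    refine intervalIntegral_congr_dt hτ ?_
    filter_upwards [ae_ae_of_ae_prod hN] with t a using integral_congr_ae a

/-- Integrands that vanish outside `K` may be integrated over `Ω`. -/
lemma Tested.of_subset (hΩ : MeasurableSet Ω) (hKΩ : K ⊆ Ω) (h : Tested T dx(K) X Y N)
    (hX : ∀ t, ∀ x ∈ Ω, x ∉ K → X t x = 0) (hY : ∀ x ∈ Ω, x ∉ K → Y x = 0)
    (hN : ∀ t, ∀ x ∈ Ω, x ∉ K → N t x = 0) : Tested T dx(Ω) X Y N := by
  have key : ∀ F : E3 → ℝ, (∀ x ∈ Ω, x ∉ K → F x = 0) → ∫ x in Ω, F x = ∫ x in K, F x :=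
    fun F hF => setIntegral_eq_of_subset_of_forall_sdiff_eq_zero hΩ hKΩ fun x hx => hF x hx.1 hx.2
  have keyi : ∀ F : E3 → ℝ, (∀ x ∈ Ω, x ∉ K → F x = 0) → IntegrableOn F K → IntegrableOn F Ω :=
    fun F hF h => h.of_forall_sdiff_eq_zero hΩ fun x hx => hF x hx.1 hx.2
  refine ⟨h.integrable.mono fun t ht => keyi _ (hX t) ht, keyi _ hY h.integrable_initial, ?_, ?_⟩
  · have h1 := h.integrable_source
    rw [Measure.prod_restrict] at h1 ⊢
    refine IntegrableOn.of_forall_sdiff_eq_zero h1 (measurableSet_Ioo.prod hΩ) fun z hz => ?_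
    exact hN z.1 z.2 hz.1.2 fun hzK => hz.2 ⟨hz.1.1, hzK⟩
  · filter_upwards [h.eq] with τ e
    simp only [key _ (hX τ), key _ hY, e]
    congr 2
    ext t
    exact (key _ (hN t)).symm

end Tested

/-- Integration of a primitive in space. -/
lemma tested_of_isPrim [SFinite ν] {Φ a : ℝ → E3 → ℝ} {Φ₀ : E3 → ℝ}
    (hΦ : AEStronglyMeasurable (uncurry Φ) (dt(T).prod ν)) (h0 : Integrable Φ₀ ν)
    (ha : Integrable (uncurry a) (dt(T).prod ν))
    (h : ∀ᵐ x ∂ν, IsPrim T (fun t => Φ t x) (Φ₀ x) (fun t => a t x)) : Tested T ν Φ Φ₀ a := by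
  have hP := aestronglyMeasurable_primitive ha.aestronglyMeasurable
  have heq : ∀ᵐ t ∂dt(T), ∀ᵐ x ∂ν, Φ t x = Φ₀ x + ∫ s in 0..t, a s x :=
    ae_ae_of_ae_prod (ae_eq_prod_of_ae_ae' hΦ (h0.aestronglyMeasurable.comp_snd.add hP)
      (h.mono fun x hx => hx.eq))
  have hle : ∀ t ∈ Ioo 0 T, (volume.restrict (Ioc 0 t)).prod ν ≤ dt(T).prod ν := by
    intro t ht
    have h1 : (volume.restrict (Ioc 0 t)).prod ν = (dt(T).prod ν).restrict (Ioc 0 t ×ˢ univ) := by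
      rw [← Measure.prod_restrict, Measure.restrict_univ,
        Measure.restrict_restrict measurableSet_Ioc,
        inter_eq_self_of_subset_left (show Ioc 0 t ⊆ Ioo 0 T from
          fun s hs => ⟨hs.1, hs.2.trans_lt ht.2⟩)]
    rw [h1]
    exact Measure.restrict_le_self
  have hint : ∀ t ∈ Ioo 0 T, Integrable (fun x => ∫ s in 0..t, a s x) ν ∧
      ∫ x, (∫ s in 0..t, a s x) ∂ν = ∫ s in 0..t, ∫ x, a s x ∂ν := by
    intro t ht
    have hi := ha.mono_measure (hle t ht)
    simp only [integral_of_le ht.1.le]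
    exact ⟨hi.integral_prod_right, (integral_integral_swap hi).symm⟩
  refine ⟨?_, h0, ha, ?_⟩
  · filter_upwards [heq, ae_mem_Ioo] with t e ht
    exact (h0.add (hint t ht).1).congr (e.mono fun x hx => hx.symm)
  · filter_upwards [heq, ae_mem_Ioo] with t e ht
    rw [integral_congr_ae e, integral_add h0 (hint t ht).1, (hint t ht).2]

lemma integral_indicator_mul_indicator (hK : MeasurableSet K) (F G : E3 → ℝ) :
    ∫ x, K.indicator F x * K.indicator G x = ∫ x in K, F x * G x := by
  rw [← integral_indicator hK]
  congr 1
  ext x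
  by_cases hx : x ∈ K <;> simp [hx]

/-- Testing a mollified balance law with a function that has derivatives in space and time. -/
lemma tested_of_mollified {S : Set E3} (hK : MeasurableSet K) {k : ℕ → E3 → ℝ} {ε : ℕ → ℝ}
    (hk : ∀ n, IsKernel (k n) (ε n)) (hε : Tendsto ε atTop (𝓝 0)) {R s a Φ : ℝ → E3 → ℝ}
    {b : Fin 3 → ℝ → E3 → ℝ} {R₀ Φ₀ : E3 → ℝ} (hR : Mix dt(T) dx(K) ⊤ 1 R)
    (hs : Mix dt(T) dx(K) 1 1 s) (ha : Mix dt(T) dx(K) 1 1 a) (hJ : ∀ j, Mix dt(T) dx(K) 1 1 (J j))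
    (hb : ∀ j, Mix dt(T) dx(K) 1 1 (b j)) (hR₀ : IntegrableOn R₀ K) (hΦ₀ : IntegrableOn Φ₀ K)
    (hRΦ₀ : IntegrableOn (fun x => R₀ x * Φ₀ x) K)
    (hN : Mix dt(T) dx(K) 1 1 (fun t x => R t x * a t x + s t x * Φ t x + ∑ j, J j t x * b j t x))
    (hRΦ : Pairing dt(T) (fun t => K.indicator (R t)) (fun t => K.indicator (Φ t)))
    (hRa : Pairing dt(T) (fun t => K.indicator (R t)) (fun t => K.indicator (a t)))
    (hsΦ : Pairing dt(T) (fun t => K.indicator (s t)) (fun t => K.indicator (Φ t)))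
    (hJb : ∀ j, Pairing dt(T) (fun t => K.indicator (J j t)) (fun t => K.indicator (b j t)))
    (h0 : Tendsto (fun n => ∫ y, mollify (k n) (K.indicator R₀) y * K.indicator Φ₀ y) atTop
      (𝓝 (∫ y, K.indicator R₀ y * K.indicator Φ₀ y)))
    (hW : ∀ n, ∀ᵐ τ ∂dt(T), ∀ y ∈ S, mollify (k n) (K.indicator (R τ)) y =
      mollify (k n) (K.indicator R₀) y + ∫ t in 0..τ,
      (mollify (k n) (K.indicator (s t)) y - ∑ j, mollify (fun z => fderiv ℝ (k n) z (bv j))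
      (K.indicator (J j t)) y))
    (hS : ∀ y ∈ K, y ∉ S → Φ₀ y = 0 ∧ ∀ t, a t y = 0)
    (hA : ∀ᵐ y ∂dx(K), ∀ᵐ t ∂dt(T), Φ t y = Φ₀ y + ∫ s in 0..t, a s y)
    (hG : ∀ n, ∀ᵐ t ∂dt(T), ∀ j, ∀ x ∈ K, ∫ y in K, Φ t y * fderiv ℝ (k n) (y - x) (bv j)
      = - ∫ y in K, b j t y * k n (y - x)) :
    Tested T dx(K) (fun t x => R t x * Φ t x) (fun x => R₀ x * Φ₀ x)
      (fun t x => R t x * a t x + s t x * Φ t x + ∑ j, J j t x * b j t x) := by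
  have hind : ∀ (F : E3 → ℝ) (H : E3 → ℝ), ∫ y, K.indicator F y * H y = ∫ y in K, F y * H y := by
    intro F H
    rw [← integral_indicator hK]
    congr 1
    ext x
    by_cases hx : x ∈ K <;> simp [hx]
  have hlim := pairing_limit hk hε hRΦ hRa hsΦ hJb h0 fun n => by
    obtain ⟨C, hC, hC'⟩ := (hk n).exists_bound
    refine integral_mollify_mul_eq (S := S) (hk n).contDiff hC hC' (hR.indicator hK)
      (fun j => (hJ j).indicator hK) (hs.indicator hK) (ha.indicator hK)
      ((integrable_indicator_iff hK).2 hΦ₀) hRΦ.meas_right (hW n)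
      ((integrable_indicator_iff hK).2 hR₀) (fun y hy => ?_) ?_ ?_
      (fun j => (hb j).indicator hK)
    · by_cases hyK : y ∈ K
      · simpa [hyK] using hS y hyK hy
      · simp [hyK]
    · filter_upwards [(ae_restrict_iff' hK).1 hA] with y hy
      by_cases hyK : y ∈ K
      · simpa [hyK] using hy hyK
      · simp [hyK]
    · filter_upwards [hG n] with t ht j x
      by_cases hxK : x ∈ K
      · rw [indicator_of_mem hxK, hind, hind, ht j x hxK, mul_neg]
      · rw [indicator_of_notMem hxK]; simp
  have hJm := ae_all_iff.2 fun j => (hJb j).ae_mul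
  have hiff : ∀ F G : E3 → ℝ, Integrable (fun y => K.indicator F y * K.indicator G y) →
      IntegrableOn (fun y => F y * G y) K := fun F G h => by
    rw [← integrable_indicator_iff hK]
    refine h.congr (.of_forall fun x => ?_)
    by_cases hx : x ∈ K <;> simp [hx]
  refine ⟨hRΦ.ae_mul.mono fun t ht => hiff _ _ ht, hRΦ₀, hN.integrable, ?_⟩
  filter_upwards [hlim, ae_mem_Ioo] with τ e hτ
  simp only [integral_indicator_mul_indicator hK] at e
  rw [e]
  congr 1
  refine intervalIntegral_congr_dt hτ ?_
  filter_upwards [hRa.ae_mul, hsΦ.ae_mul, hJm] with t i1 i2 i3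
  have i12 : IntegrableOn (fun x => R t x * a t x + s t x * Φ t x) K :=
    (hiff _ _ i1).add (hiff _ _ i2)
  rw [integral_add i12
    (integrable_finsetSum _ fun j _ => hiff _ _ (i3 j)), integral_add (hiff _ _ i1) (hiff _ _ i2),
    integral_finsetSum _ fun j _ => hiff _ _ (i3 j)]

/-! ### The balance laws tested with the strong solution -/

/-- Mollifiers that are compactly supported in `Ω` when centred in a small ball. -/
structure InteriorKernels (Ω : Set E3) (x₀ : E3) (h : ℝ) (k : ℕ → E3 → ℝ) (ε : ℕ → ℝ) : Prop where
  kernel : ∀ n, IsKernel (k n) (ε n)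
  tendsto : Tendsto ε atTop (𝓝 0)
  lt : ∀ n, ε n < h / 2
  test : ∀ n, ∀ y ∈ Ω ∩ ball x₀ h, IsTestOn Ω (fun x => k n (x - y))

lemma InteriorKernels.far {x₀ x y : E3} {h : ℝ} {k : ℕ → E3 → ℝ} {ε : ℕ → ℝ}
    (H : InteriorKernels Ω x₀ h k ε) (hy : y ∈ ball x₀ (h / 2)) (hx : x ∉ ball x₀ h) (n : ℕ) :
    ε n < ‖y - x‖ := by
  rw [Metric.mem_ball] at hx hy
  have h4 := dist_triangle x y x₀
  rw [dist_comm x y, dist_eq_norm y x] at h4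
  linarith [H.lt n]

lemma IsTestOn.eq_zero_of_notMem_ball {x₀ x : E3} {h : ℝ} (hh : 0 < h)
    (hζ : IsTestOn (ball x₀ (h / 2)) ζ) (hx : x ∉ ball x₀ h) : ζ x = 0 ∧ fderiv ℝ ζ x = 0 :=
  have h := fun hyb => hx (Metric.ball_subset_ball (by linarith) hyb)
  ⟨hζ.eq_zero h, hζ.fderiv_eq_zero h⟩

lemma exists_interior_kernels (hΩ : IsOpen Ω) (hL : UniformlyLipschitzBoundary Ω) :
    ∃ h : ℝ, 0 < h ∧ ∀ x₀ : E3, ∃ k ε, InteriorKernels Ω x₀ h k ε := by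
  obtain ⟨h, δ, hh, hδ, hδ1, H⟩ := hL.exists_cone hΩ
  obtain ⟨κ, hκ⟩ := exists_isKernel hδ
  refine ⟨h, hh, fun x₀ => ?_⟩
  obtain ⟨e, he, hcone⟩ := H x₀
  have hs : ∀ n : ℕ, 0 < h / 8 / ((n : ℝ) + 1) := fun n => by positivity
  have hsle : ∀ n : ℕ, h / 8 / ((n : ℝ) + 1) ≤ h / 8 := fun n =>
    div_le_self (by positivity) (by linarith [n.cast_nonneg (α := ℝ)])
  refine ⟨fun n => coneKernel κ e (h / 8 / ((n : ℝ) + 1)), fun n => 2 * (h / 8 / ((n : ℝ) + 1)),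
    fun n => isKernel_coneKernel hκ he hδ1 (hs n), ?_, fun n => ?_, fun n y hy => ?_⟩
  · have := ((tendsto_const_div_atTop_nhds_zero_nat (h / 8)).comp
      (tendsto_add_atTop_nat 1)).const_mul 2
    simpa using this
  · linarith [hsle n]
  · refine isTestOn_of_cone (fun b hb => hcone y hy _ ⟨hs n, by linarith [hsle n]⟩ b hb)
      (contDiff_coneKernel hκ) fun z hz => coneKernel_eq_zero hκ (hs n) hz

lemma IsTestOn.mix [SFinite lam] [SFinite ν] {U : Set E3} (hζ : IsTestOn U ζ) :
    Mix lam ν ⊤ ⊤ (fun _ x => ζ x) := by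
  obtain ⟨C, hC⟩ := hζ.continuous.bounded_above_of_compact_support hζ.2.1
  exact Mix.of_abs_le (C := C) (hζ.continuous.aestronglyMeasurable.comp_snd)
    (.of_forall fun _ => .of_forall hC)

lemma IsTestOn.mix_fderiv [SFinite lam] [SFinite ν] {U : Set E3} (hζ : IsTestOn U ζ) (e : E3) :
    Mix lam ν ⊤ ⊤ (fun _ x => fderiv ℝ ζ x e) := by
  obtain ⟨C, hC⟩ := (hζ.continuous_fderiv e).bounded_above_of_compact_support
    (hζ.2.1.fderiv_apply ℝ e)
  exact Mix.of_abs_le (C := C) ((hζ.continuous_fderiv e).aestronglyMeasurable.comp_snd)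
    (.of_forall fun _ => .of_forall hC)

section Local

lemma WeakReg.flux_local (h : WeakReg T Ω p γ ρbar M ρ u Du) (hKΩ : K ⊆ Ω) [IsFiniteMeasure dx(K)]
    (i j : Fin 3) : Mix dt(T) dx(K) 2 1 (fun t x => fl(t,x) i j) := by
  refine Mix.sub le_rfl (Mix.add le_rfl
    (((h.kinetic i j).mono_set hKΩ).mono_left le_top) ?_) ?_
  · by_cases hij : i = j
    · simp only [hij, if_true]
      exact (h.pressure_local hKΩ).mono_left le_top
    · simp only [hij, if_false]
      exact Mix.zero
  · exact (Mix.stress (by norm_num) (fun a b => (h.Du_two a b).mono_set hKΩ) μ η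
      i j).mono_right (by norm_num)

lemma isFiniteMeasure_inter_ball (Ω : Set E3) (x₀ : E3) (h : ℝ) :
    IsFiniteMeasure dx(Ω ∩ ball x₀ h) := ⟨by
  rw [Measure.restrict_apply_univ]
  exact (measure_mono inter_subset_right).trans_lt measure_ball_lt_top⟩

section

variable (HS : StrongReg T Ω μ η p γ ρbar f q c C ρ₀ u₀ r U gr DU D2U)
include HS

lemma StrongReg.exponents : 1 < q / (q - 1) ∧ q / (q - 1) ≤ 6 * q / (5 * q - 6) ∧
    6 * q / (5 * q - 6) ≤ γ ∧ 3 / 2 ≤ 6 * q / (5 * q - 6) ∧ 6 * q / (5 * q - 6) < 2 :=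
  conj_exponent_facts HS.law.three_halves_lt HS.three_lt HS.le_six HS.exponent

lemma StrongReg.one_le_q : (1 : ℝ≥0∞) ≤ ofReal q := one_le_ofReal.2 (by linarith [HS.three_lt])

lemma StrongReg.one_le_conj : (1 : ℝ≥0∞) ≤ ofReal (q / (q - 1)) := one_le_ofReal.2 HS.exponents.1.le

lemma StrongReg.holderTriple : HolderTriple (ofReal (q / (q - 1))) (ofReal q) 1 := by
  have := HS.three_lt
  have : 0 < q - 1 := by linarith
  exact holderTriple_ofReal_one (by positivity) (by linarith) (by field_simp; ring)

lemma StrongReg.innerAccel_q : ∀ i, Mix dt(T) dx(Ω) 2 (ofReal q) (fun t x => ai(t,x) i) :=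
  HS.innerAccel_mix HS.law HS.one_le_q HS.gr_q HS.D2U_q

lemma StrongReg.outerAccel_top (i : Fin 3) : Mix dt(T) dx(Ω) 1 ⊤ (fun t x => ao(t,x) i) :=
  (HS.force.mix_coord one_ne_zero i).sub le_top
    (Mix.sum _ le_top fun j _ => (HS.U_two_top j).mul (HS.DU_top i j))

lemma StrongReg.density_conj (HW : WeakReg T Ω p γ ρbar M ρ u Du) (hKΩ : K ⊆ Ω)
    [IsFiniteMeasure dx(K)] : Mix dt(T) dx(K) ⊤ (ofReal (q / (q - 1))) ρ :=
  (HW.density_local hKΩ).mono_right (ofReal_le_ofReal (HS.exponents.2.1.trans HS.exponents.2.2.1))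

lemma StrongReg.momentum_tested (HW : WeakReg T Ω p γ ρbar M ρ u Du)
    (H : IsFEWSWithGradient T Ω μ η p γ ρbar f ρ₀ u₀ ρ u Du) {x₀ : E3} {h : ℝ} (hh : 0 < h)
    {k : ℕ → E3 → ℝ} {ε : ℕ → ℝ} (Hk : InteriorKernels Ω x₀ h k ε)
    (hζ : IsTestOn (ball x₀ (h / 2)) ζ) (i : Fin 3) :
    Tested T dx(Ω ∩ ball x₀ h)
      (fun t x => ρ t x * u t x i * (ζ x * U t x i)) (fun x => ρ₀ x * u₀ x i * (ζ x * u₀ x i))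
      (fun t x => ρ t x * u t x i * (ζ x * ai(t,x) i + ζ x * ao(t,x) i)
        + ρ t x * f t x i * (ζ x * U t x i)
        + ∑ j, fl(t,x) i j * (fderiv ℝ ζ x (bv j) * U t x i + ζ x * DU t x i j)) := by
  obtain ⟨m, -, hm, hweak⟩ := H.momentum_eq
  have hT := HS.T_pos
  have hΩ := HS.isOpen
  have hq1 := HS.one_le_q
  have hq'1 := HS.one_le_conj
  have hconj := HS.holderTriple
  have hk := Hk.kernel
  set K := Ω ∩ ball x₀ h
  have hK : MeasurableSet K := hΩ.measurableSet.inter measurableSet_ball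
  have hKΩ : K ⊆ Ω := inter_subset_left
  have hfin : IsFiniteMeasure dx(K) := isFiniteMeasure_inter_ball Ω x₀ h
  have hle := dx_le hKΩ
  have hζm : Mix dt(T) dx(K) ⊤ ⊤ (fun _ x => ζ x) := hζ.mix
  have hdζ : ∀ j, Mix dt(T) dx(K) ⊤ ⊤ (fun _ x => fderiv ℝ ζ x (bv j)) := fun j => hζ.mix_fderiv _
  have Rtop := HW.momentum_local hKΩ i
  have Rconj := HW.momentum_local_conj hKΩ HS.three_lt HS.le_six HS.exponent i
  have sconj : Mix dt(T) dx(K) 1 (ofReal (q / (q - 1))) (fun t x => ρ t x * f t x i) :=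
    (HS.density_conj HW hKΩ).mul ((HS.force.mix_coord one_ne_zero i).mono_set hKΩ)
  have Jone := HW.flux_local (μ := μ) (η := η) hKΩ i
  have Utop := (HS.U_two_top i).mono_set hKΩ
  have Uq := (HS.U_top_q i).mono_set hKΩ
  have Φtop : Mix dt(T) dx(K) 2 ⊤ (fun t x => ζ x * U t x i) := hζm.mul Utop
  have Φq : Mix dt(T) dx(K) ⊤ (ofReal q) (fun t x => ζ x * U t x i) := hζm.mul Uq
  have bm : ∀ j, Mix dt(T) dx(K) 2 ⊤
      (fun t x => fderiv ℝ ζ x (bv j) * U t x i + ζ x * DU t x i j) := fun j =>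
    ((hdζ j).mul Utop).add le_top (hζm.mul ((HS.DU_top i j).mono_set hKΩ))
  have Am : Mix dt(T) dx(K) 2 (ofReal q) (fun t x => ζ x * ai(t,x) i) :=
    hζm.mul ((HS.innerAccel_q i).mono_set hKΩ)
  have Bm : Mix dt(T) dx(K) 1 ⊤ (fun t x => ζ x * ao(t,x) i) :=
    hζm.mul ((HS.outerAccel_top i).mono_set hKΩ)
  have Φtop1 : Mix dt(T) dx(K) 1 ⊤ (fun t x => ζ x * U t x i) := Φtop.mono_left (by norm_num)
  have am1 : Mix dt(T) dx(K) 1 1 (fun t x => ζ x * ai(t,x) i + ζ x * ao(t,x) i) :=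
    ((Am.mono_left (by norm_num)).mono_right hq1).add le_rfl (Bm.mono_right le_top)
  have hu0 : MemLp (fun x => u₀ x i) 2 dx(K) := ((HS.u₀_q i).mono_measure hle).mono_exponent (by
      rw [← ENNReal.ofReal_ofNat]; exact ofReal_le_ofReal (by linarith [HS.three_lt]))
  have hρ0 : MemLp ρ₀ ⊤ dx(K) := (memLp_top_of_bound HS.meas₀ C (HS.data.mono fun x hx => by
      rw [Real.norm_eq_abs, abs_of_nonneg (HS.pos.le.trans hx.1)]; exact hx.2)).mono_measure hle
  have hR0 : MemLp (fun x => ρ₀ x * u₀ x i) 2 dx(K) := memLp_mul hρ0 hu0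
  have hΦ0 : MemLp (fun x => ζ x * u₀ x i) 2 dx(K) := memLp_mul (hζ.memLp ⊤ _) hu0
  have hS0 : ∀ y ∈ K, y ∉ Ω ∩ ball x₀ (h / 2) → ζ y = 0 := fun y hy hyS =>
    hζ.eq_zero fun hyb => hyS ⟨hy.1, hyb⟩
  have hζK : ∀ y ∈ Ω, y ∉ K → ζ y = 0 ∧ fderiv ℝ ζ y = 0 := fun y hy hyK =>
    hζ.eq_zero_of_notMem_ball hh fun h => hyK ⟨hy, h⟩
  refine tested_of_mollified (S := Ω ∩ ball x₀ (h / 2)) hK (fun n => (hk n).neg) Hk.tendsto Rtop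
    (sconj.mono_right hq'1) am1 (fun j => (Jone j).mono_left (by norm_num))
    (fun j => ((bm j).mono_left (by norm_num)).mono_right le_top) (hR0.integrable (by norm_num))
    (hΦ0.integrable (by norm_num)) (hR0.integrable_mul hΦ0) ?_
    (Pairing.of_indicator (s₁ := 1) (s₂ := ⊤) (r₁ := ⊤) (r₂ := 1) hK le_rfl le_top (by norm_num)
      Rtop Φtop1) ?_
    (Pairing.of_indicator (r₁ := 1) (r₂ := ⊤) hK hq'1 hq1 ofReal_ne_top sconj Φq)
    (fun j => Pairing.of_indicator (s₁ := 1) (s₂ := ⊤) (r₁ := 2) (r₂ := 2) hK le_rfl le_top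
      (by norm_num) (Jone j) (bm j)) ?_ (fun n => ?_) ?_ ?_ fun n => ?_
  · refine Mix.add le_rfl (Mix.add le_rfl ?_ (sconj.mul Φq))
      (Mix.sum _ le_rfl fun j _ => (Jone j).mul (bm j))
    simp only [mul_add]
    exact (Rconj.mul Am).add le_rfl (Rtop.mul Bm)
  · have e : (fun t => K.indicator (fun x => ζ x * ai(t,x) i
        + ζ x * ao(t,x) i))
        = fun t y => K.indicator (fun x => ζ x * ai(t,x) i) y
          + K.indicator (fun x => ζ x * ao(t,x) i) y := by
      ext t y
      by_cases hy : y ∈ K <;> simp [hy]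
    rw [e]
    exact (Pairing.of_indicator (r₁ := 2) (r₂ := 2) hK hq'1 hq1 ofReal_ne_top Rconj
      Am).add_right (Pairing.of_indicator (s₁ := 1) (s₂ := ⊤) (r₁ := ⊤) (r₂ := 1) hK le_rfl le_top
      (by norm_num) Rtop Bm)
  · exact tendsto_integral_mollify_mul (p := 2) (p' := 2) (fun n => (hk n).neg) Hk.tendsto
      (by norm_num)
      (by norm_num) ((memLp_indicator_iff_restrict hK).2 hR0)
      ((memLp_indicator_iff_restrict hK).2 hΦ0)
  · filter_upwards [hm, ae_mem_Ioo] with τ hmτ hτ y hy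
    have hyK : y ∈ K := ⟨hy.1, Metric.ball_subset_ball (by linarith) hy.2⟩
    refine momentum_mollified hT hΩ.measurableSet hKΩ hweak i
      (fun j => ((Jone j).mono_left (by norm_num)).indicator hK)
      ((sconj.mono_right hq'1).indicator hK) (hk n).neg ?_ (fun x hx hxK => ?_) hτ hmτ
    · simpa only [neg_sub] using Hk.test n y hyK
    · have h1 := Hk.far hy.2 (fun h => hxK ⟨hx, h⟩) n
      exact ⟨(hk n).neg.eq_zero _ h1, (hk n).neg.fderiv_eq_zero h1⟩
  · intro y hy hyS
    simp [hS0 y hy hyS]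
  · filter_upwards [ae_mono hle (HS.time_U i),
      (((HS.innerAccel_q i).mono_set hKΩ).mono_left
        (by norm_num) |>.mono_right hq1).integrable.prod_left_ae,
      (((HS.outerAccel_top i).mono_set hKΩ).mono_right le_top).integrable.prod_left_ae]
      with y hy i1 i2
    have := (IsPrim.mk (i1.add i2) hy).const_mul (ζ y)
    filter_upwards [this.eq] with t ht
    rw [ht]
    congr 1
    refine intervalIntegral.integral_congr fun s _ => ?_
    simp only [Pi.add_apply, uncurry]
    ring
  · filter_upwards [HS.memD012] with t ht j x hx
    have h1 := ((ht.hasWeakGrad hΩ i).smooth_mul hζ.1).eq j (fun y => (k n) (-(y - x))) (by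
      have := (hk n).isTestOn (y := x) (U := univ) (subset_univ _)
      simpa only [neg_sub] using this)
    have h2 : ∀ y, fderiv ℝ (fun y => k n (-(y - x))) y = fderiv ℝ (fun z => k n (-z)) (y - x) :=
      fun y => fderiv_comp_sub_const (fun z => k n (-z)) x y
    simp only [h2, Measure.restrict_univ] at h1
    have h3 : ∀ F G : E3 → ℝ, (∀ y ∈ K, F y = G y) → (∀ y ∉ K, F y = 0) →
        ∫ y, F y = ∫ y in K, G y := fun F G h4 h5 => by
      rw [← setIntegral_eq_integral_of_forall_compl_eq_zero h5]
      exact setIntegral_congr_fun hK h4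
    rw [h3 _ (fun y => ζ y * U t y i * fderiv ℝ (fun z => k n (-z)) (y - x) (bv j)),
      h3 _ (fun y => (fderiv ℝ ζ y (bv j) * U t y i + ζ y * DU t y i j) * k n (-(y - x)))] at h1
    · exact h1
    · intro y hy
      simp only [indicator_of_mem (hKΩ hy)]
    · intro y hy
      by_cases hyΩ : y ∈ Ω
      · simp [hζK y hyΩ hy]
      · simp [hyΩ]
    · intro y hy
      simp only [indicator_of_mem (hKΩ hy)]
    · intro y hy
      by_cases hyΩ : y ∈ Ω
      · simp [hζK y hyΩ hy]
      · simp [hyΩ]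

end

end Local

lemma memLp_top_comp_of_mem_Icc {ν : Measure α} {v : α → ℝ} {a : ℝ} (hab : a ≤ b)
    (hG : ContinuousOn G (Icc a b)) (hv : AEStronglyMeasurable v ν) (h : ∀ᵐ x ∂ν, v x ∈ Icc a b) :
    MemLp (fun x => G (v x)) ⊤ ν := by
  obtain ⟨C, hC⟩ := isCompact_Icc.exists_bound_of_continuousOn hG
  exact memLp_top_of_bound (aestronglyMeasurable_comp_of_mem_Icc hab hG hv h) C
    (h.mono fun x hx => hC _ hx)

section

variable (HS : StrongReg T Ω μ η p γ ρbar f q c C ρ₀ u₀ r U gr DU D2U)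
include HS

lemma StrongReg.continuousOn_head :
    ContinuousOn (fun s => potentialDeriv p ρbar ρbar - potentialDeriv p ρbar s) (Icc c C) :=
  fun s hs => (HS.hasDerivAt_head HS.law s hs).continuousAt.continuousWithinAt

lemma StrongReg.head_hasWeakGrad : ∀ᵐ t ∂dt(T), HasWeakGrad Ω (fun x => hd(t,x))
    (fun j x => headDeriv p (r t x) (U t x) (fun i => DU t x i j) (gr t x j)) := by
  filter_upwards [ae_all_iff.2 HS.grad_U, ae_all_iff.2 fun i => (HS.U_two_top i).memLp, HS.grad_r,
    HS.bounds] with t h1 h2 h3 h4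
  have e := fun i => (h1 i).half_sq HS.isOpen (h2 i)
  have := (((e 0).add (e 1)).add (e 2)).add (h3.comp_of_mem_Icc HS.isOpen HS.le
    (HS.hasDerivAt_head HS.law) (HS.continuousOn_coef HS.law) h4)
  simp only [headPot, headDeriv, Fin.sum_univ_three]
  exact this

lemma StrongReg.accel_one (hKΩ : K ⊆ Ω) [IsFiniteMeasure dx(K)] (i : Fin 3) :
    Mix dt(T) dx(K) 1 1 (fun t x => ai(t,x) i + ao(t,x) i) := by
  have h1 := (HS.innerAccel_mix (μ := μ) (η := η) HS.law (by norm_num) HS.gr_two HS.D2U_two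
    i).mono_set hKΩ
  exact ((h1.mono_left (by norm_num)).mono_right (by norm_num)).add le_rfl
    (((HS.outerAccel_top i).mono_set hKΩ).mono_right le_top)

lemma StrongReg.densityRate_q (hKΩ : K ⊆ Ω) [IsFiniteMeasure dx(K)] :
    Mix dt(T) dx(K) 1 (ofReal q) (fun t x => dr(t,x)) := by
  have e2 : Mix dt(T) dx(Ω) 2 ⊤ (fun t x => r t x * ∑ j, DU t x j j) :=
    (HS.comp_mix (G := fun s => s) continuousOn_id).mul (Mix.sum _ le_top fun j _ => HS.DU_top j j)
  exact ((Mix.sum _ HS.one_le_q fun j _ => (HS.U_two_top j).mul (HS.gr_q j)).neg.mono_set hKΩ).sub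
    HS.one_le_q (((e2.mono_set hKΩ).mono_left (by norm_num)).mono_right le_top)

lemma StrongReg.head_isPrim (hKΩ : K ⊆ Ω) [IsFiniteMeasure dx(K)] :
    ∀ᵐ x ∂dx(K), IsPrim T (fun t => hd(t,x)) (headPot p ρbar (ρ₀ x) (u₀ x))
      (fun t => headDeriv p (r t x) (U t x) (fun i => ai(t,x) i + ao(t,x) i) dr(t,x)) := by
  have hle := dx_le hKΩ
  filter_upwards [ae_mono hle (ae_all_iff.2 HS.time_U), ae_mono hle HS.time_r,
    ae_all_iff.2 fun i => (HS.accel_one hKΩ i).integrable.prod_left_ae,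
    ((HS.densityRate_q hKΩ).mono_right HS.one_le_q).integrable.prod_left_ae,
    ae_mono hle HS.data, ae_mono hle (ae_swap_of_ae_prod HS.bounds_prod)] with x h1 h2 h3 h4 h5 h6
  have e1 : ∀ i, IsPrim T (fun t => 1 / 2 * U t x i ^ 2) (1 / 2 * u₀ x i ^ 2)
      (fun t => U t x i * (ai(t,x) i + ao(t,x) i)) := fun i => by
    have := ae_comp_primitive_eq HS.T_pos (h3 i) (h1 i) (G := fun x => 1 / 2 * x ^ 2)
      (G' := fun x => x)
      (fun x => ((hasDerivAt_pow 2 x).const_mul (1 / 2 : ℝ)).congr_deriv (by norm_num; ring))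
      continuous_id
    exact ⟨this.1, this.2⟩
  have e2 := ae_comp_primitive_eq_of_mem_Icc HS.T_pos h4 h2 HS.le (HS.hasDerivAt_head HS.law)
    (HS.continuousOn_coef HS.law) h6 h5
  exact (IsPrim.sum Finset.univ fun i _ => e1 i).add ⟨e2.1, e2.2⟩

lemma StrongReg.pressure_tested (hKΩ : K ⊆ Ω) [IsFiniteMeasure dx(K)] {V : Set E3}
    (hζ : IsTestOn V ζ) : Tested T dx(K) (fun t x => ζ x * (p (r t x) - p ρbar))
      (fun x => ζ x * (p (ρ₀ x) - p ρbar)) (fun t x => ζ x * (deriv p (r t x) * dr(t,x))) := by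
  have hle := dx_le hKΩ
  have hpc : ContinuousOn (fun s => p s - p ρbar) (Icc c C) :=
    (HS.law.continuousOn.mono fun s hs => HS.pos.le.trans hs.1).sub continuousOn_const
  have hζm : Mix dt(T) dx(K) ⊤ ⊤ (fun _ x => ζ x) := hζ.mix
  have hc := (HS.comp_mix (HS.continuousOn_deriv HS.law)).mono_set hKΩ
  have i1 : Mix dt(T) dx(K) ⊤ ⊤
      (fun t x => ζ x * (p (r t x) - p ρbar)) := hζm.mul ((HS.comp_mix hpc).mono_set hKΩ)
  have i2 : MemLp (fun x => ζ x * (p (ρ₀ x) - p ρbar)) ⊤ dx(K) := memLp_mul (hζ.memLp ⊤ _)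
    ((memLp_top_comp_of_mem_Icc HS.le hpc HS.meas₀ HS.data).mono_measure hle)
  have i0 : Mix dt(T) dx(K) 1 (ofReal q) (fun t x => deriv p (r t x) * dr(t,x)) :=
    hc.mul (HS.densityRate_q hKΩ)
  have i3 : Mix dt(T) dx(K) 1 (ofReal q)
      (fun t x => ζ x * (deriv p (r t x) * dr(t,x))) := hζm.mul i0
  refine tested_of_isPrim i1.meas (i2.integrable le_top) (i3.mono_right HS.one_le_q).integrable ?_
  filter_upwards [ae_mono hle HS.time_r,
    ((HS.densityRate_q hKΩ).mono_right HS.one_le_q).integrable.prod_left_ae,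
    ae_mono hle HS.data, ae_mono hle (ae_swap_of_ae_prod HS.bounds_prod)] with x h2 h4 h5 h6
  have e2 := ae_comp_primitive_eq_of_mem_Icc HS.T_pos h4 h2 HS.le
    (fun s hs => HS.law.differentiableAt (HS.pos.trans_le hs.1))
      (HS.continuousOn_deriv HS.law) h6 h5
  have := ((IsPrim.mk e2.1 e2.2).add (IsPrim.const (-p ρbar))).const_mul (ζ x)
  simp only [add_zero] at this
  exact this

lemma StrongReg.continuity_tested (HW : WeakReg T Ω p γ ρbar M ρ u Du)
    (H : IsFEWSWithGradient T Ω μ η p γ ρbar f ρ₀ u₀ ρ u Du) {x₀ : E3} {h : ℝ} (hh : 0 < h)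
    {k : ℕ → E3 → ℝ} {ε : ℕ → ℝ} (Hk : InteriorKernels Ω x₀ h k ε)
    (hζ : IsTestOn (ball x₀ (h / 2)) ζ) : Tested T dx(Ω ∩ ball x₀ h)
      (fun t x => ρ t x * (ζ x * hd(t,x)))
      (fun x => ρ₀ x * (ζ x * headPot p ρbar (ρ₀ x) (u₀ x)))
      (fun t x => ρ t x * (ζ x * headDeriv p (r t x) (U t x)
          (fun i => ai(t,x) i + ao(t,x) i) dr(t,x))
        + 0 * (ζ x * hd(t,x))
        + ∑ j, ρ t x * u t x j * (fderiv ℝ ζ x (bv j) * hd(t,x)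
          + ζ x * headDeriv p (r t x) (U t x) (fun i => DU t x i j) (gr t x j))) := by
  obtain ⟨ρc, -, hm, hweak⟩ := H.continuity_eq
  have hΩ := HS.isOpen.measurableSet
  have hq1 := HS.one_le_q
  have hq'1 := HS.one_le_conj
  have hconj := HS.holderTriple
  have hk := Hk.kernel
  set K := Ω ∩ ball x₀ h
  have hK : MeasurableSet K := hΩ.inter measurableSet_ball
  have hKΩ : K ⊆ Ω := inter_subset_left
  have hfin : IsFiniteMeasure dx(K) := isFiniteMeasure_inter_ball Ω x₀ h
  have hle := dx_le hKΩ
  have hζm : Mix dt(T) dx(K) ⊤ ⊤ (fun _ x => ζ x) := hζ.mix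
  have hdζ : ∀ j, Mix dt(T) dx(K) ⊤ ⊤ (fun _ x => fderiv ℝ ζ x (bv j)) := fun j => hζ.mix_fderiv _
  have Rconj := HS.density_conj HW hKΩ
  have Rone := Rconj.mono_right hq'1
  have Jone := fun j => HW.momentum_local hKΩ j
  have Jconj := fun j => HW.momentum_local_conj hKΩ HS.three_lt HS.le_six HS.exponent j
  have Utop := fun i => (HS.U_two_top i).mono_set hKΩ
  have Uq := fun i => (HS.U_top_q i).mono_set hKΩ
  have Gm := (HS.comp_mix HS.continuousOn_head).mono_set hKΩ
  have Cm := (HS.comp_mix (HS.continuousOn_coef HS.law)).mono_set hKΩ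
  have Htop : Mix dt(T) dx(K) 1 ⊤ (fun t x => hd(t,x)) := by
    refine (Mix.sum _ le_top fun i _ => ?_).add le_top (Gm.mono_left le_top)
    simp only [sq]
    exact ((Utop i).mul (Utop i)).const_mul _
  have Hq : Mix dt(T) dx(K) 2 (ofReal q) (fun t x => hd(t,x)) := by
    refine (Mix.sum _ hq1 fun i _ => ?_).add hq1 ((Gm.mono_left le_top).mono_right le_top)
    simp only [sq]
    exact ((Uq i).mul (Utop i)).const_mul _
  have Hd : ∀ j, Mix dt(T) dx(K) 2 (ofReal q)
      (fun t x => headDeriv p (r t x) (U t x) (fun i => DU t x i j) (gr t x j)) := fun j =>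
    (Mix.sum _ hq1 fun i _ => (Uq i).mul ((HS.DU_top i j).mono_set hKΩ)).add hq1
      (Cm.mul ((HS.gr_q j).mono_set hKΩ))
  have Hr : Mix dt(T) dx(K) 1 (ofReal q)
      (fun t x => headDeriv p (r t x) (U t x) (fun i => ai(t,x) i + ao(t,x) i) dr(t,x)) := by
    refine (Mix.sum _ hq1 fun i _ => ?_).add hq1 (Cm.mul (HS.densityRate_q hKΩ))
    simp only [mul_add]
    exact ((Utop i).mul ((HS.innerAccel_q i).mono_set hKΩ)).add hq1
      ((Uq i).mul ((HS.outerAccel_top i).mono_set hKΩ))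
  have Φtop1 : Mix dt(T) dx(K) 1 ⊤ (fun t x => ζ x * hd(t,x)) := hζm.mul Htop
  have aq : Mix dt(T) dx(K) 1 (ofReal q) (fun t x => ζ x * headDeriv p (r t x) (U t x)
      (fun i => ai(t,x) i + ao(t,x) i) dr(t,x)) := hζm.mul Hr
  have bq : ∀ j, Mix dt(T) dx(K) 2 (ofReal q) (fun t x => fderiv ℝ ζ x (bv j) * hd(t,x)
      + ζ x * headDeriv p (r t x) (U t x) (fun i => DU t x i j) (gr t x j)) := fun j =>
    ((hdζ j).mul Hq).add hq1 (hζm.mul (Hd j))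
  have h33 : HolderTriple (ofReal 3) (ofReal 3) (ofReal (3 / 2)) :=
    holderTriple_ofReal (by norm_num) (by norm_num) (by norm_num) (by norm_num)
  have h31 : HolderTriple (ofReal 3) (ofReal (3 / 2)) 1 :=
    holderTriple_ofReal_one (by norm_num) (by norm_num) (by norm_num)
  have h3one : (1 : ℝ≥0∞) ≤ ofReal 3 := one_le_ofReal.2 (by norm_num)
  have hu0 : ∀ i, MemLp (fun x => u₀ x i) (ofReal 3) dx(K) := fun i =>
    ((HS.u₀_q i).mono_measure hle).mono_exponent (ofReal_le_ofReal HS.three_lt.le)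
  have h0 : ∀ {G : ℝ → ℝ} {s : ℝ≥0∞}, ContinuousOn G (Icc c C) →
    MemLp (fun x => G (ρ₀ x)) s dx(K) :=
    fun hG => ((memLp_top_comp_of_mem_Icc HS.le hG HS.meas₀ HS.data).mono_measure hle).mono_exponent
      le_top
  have hR0 : MemLp ρ₀ (ofReal 3) dx(K) := h0 continuousOn_id
  have hH0 : MemLp (fun x => headPot p ρbar (ρ₀ x) (u₀ x)) (ofReal (3 / 2)) dx(K) := by
    refine (memLp_finsetSum _ fun i _ => ?_).add (h0 HS.continuousOn_head)
    simp only [sq]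
    exact (memLp_mul (hu0 i) (hu0 i)).const_mul _
  have hΦ0 : MemLp (fun x => ζ x * headPot p ρbar (ρ₀ x) (u₀ x)) (ofReal (3 / 2)) dx(K) :=
    memLp_mul (hζ.memLp ⊤ _) hH0
  have hS0 : ∀ y ∈ K, y ∉ Ω ∩ ball x₀ (h / 2) → ζ y = 0 := fun y hy hyS =>
    hζ.eq_zero fun hyb => hyS ⟨hy.1, hyb⟩
  have hζK : ∀ y ∈ Ω, y ∉ K → ζ y = 0 ∧ fderiv ℝ ζ y = 0 := fun y hy hyK =>
    hζ.eq_zero_of_notMem_ball hh fun h => hyK ⟨hy, h⟩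
  refine tested_of_mollified (s := fun _ _ => 0) (S := Ω ∩ ball x₀ (h / 2)) hK hk Hk.tendsto Rone
    Mix.zero (aq.mono_right hq1) (fun j => (Jone j).mono_left le_top)
    (fun j => ((bq j).mono_left (by norm_num)).mono_right hq1) (hR0.integrable h3one)
    (hΦ0.integrable (one_le_ofReal.2 (by norm_num)))
    (memLp_one_iff_integrable.1 (memLp_mul hR0 hΦ0)) ?_
    (Pairing.of_indicator (s₁ := 1) (s₂ := ⊤) (r₁ := ⊤) (r₂ := 1) hK le_rfl le_top (by norm_num)
      Rone Φtop1)
    (Pairing.of_indicator (r₁ := ⊤) (r₂ := 1) hK hq'1 hq1 ofReal_ne_top Rconj aq)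
    (Pairing.of_indicator (s₁ := 1) (s₂ := ⊤) (r₁ := ⊤) (r₂ := 1) hK le_rfl le_top (by norm_num)
      Mix.zero Φtop1)
    (fun j => Pairing.of_indicator (r₁ := 2) (r₂ := 2) hK hq'1 hq1
      ofReal_ne_top (Jconj j) (bq j)) ?_ (fun n => ?_) ?_ ?_ fun n => ?_
  · refine Mix.add le_rfl (Mix.add le_rfl (Rconj.mul aq) ?_)
      (Mix.sum _ le_rfl fun j _ => (Jconj j).mul (bq j))
    simp only [zero_mul]
    exact Mix.zero
  · exact tendsto_integral_mollify_mul (p := ofReal 3) (p' := ofReal (3 / 2)) hk Hk.tendsto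
      h3one ofReal_ne_top ((memLp_indicator_iff_restrict hK).2 hR0)
      ((memLp_indicator_iff_restrict hK).2 hΦ0)
  · filter_upwards [hm, ae_mem_Ioo] with τ hmτ hτ y hy
    have := continuity_mollified (y := y) HS.T_pos hΩ hKΩ hweak
      (fun j => ((Jone j).mono_left le_top).indicator hK) (hk n) (fun x hx hxK => ?_) hτ hmτ
    · simpa only [indicator_zero] using this
    · have h1 := Hk.far hy.2 (fun h => hxK ⟨hx, h⟩) n
      exact ⟨(hk n).eq_zero _ h1, (hk n).fderiv_eq_zero h1⟩
  · intro y hy hyS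
    simp [hS0 y hy hyS]
  · filter_upwards [HS.head_isPrim hKΩ] with y hy
    exact (hy.const_mul (ζ y)).eq
  · filter_upwards [HS.head_hasWeakGrad] with t ht j x hx
    have h1 := (ht.smooth_mul hζ.1).eq j _ (Hk.test n x hx)
    simp only [fderiv_comp_sub_const] at h1
    rw [setIntegral_eq_of_subset_of_forall_sdiff_eq_zero hΩ hKΩ,
      setIntegral_eq_of_subset_of_forall_sdiff_eq_zero hΩ hKΩ] at h1
    · exact h1
    all_goals
      intro y hy
      simp [hζK y hy.1 hy.2]

end

/-! ### The relative energy balance with a cut-off -/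

/-- The difference of the relative energy and the energy of the weak solution. -/
def crossEnergy (p : ℝ → ℝ) (ρbar s : ℝ) (v : E3) (r : ℝ) (V : E3) : ℝ :=
  -(∑ i, s * v i * V i) + s * headPot p ρbar r V + (p r - p ρbar)

lemma cross_source_eq (μ η : ℝ) (p : ℝ → ℝ) (ρbar : ℝ) {r : ℝ} (hr : r ≠ 0) (v V g f : E3)
    (G DV : M33) (D2 : Fin 3 → Fin 3 → Fin 3 → ℝ) (z : ℝ) (dz : Fin 3 → ℝ) :
    -1 * (∑ i, (s * v i * (z * innerAccel μ η p r g D2 i + z * outerAccel f V DV i)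
        + s * f i * (z * V i)
        + ∑ j, momentumFlux μ η p s v G i j * (dz j * V i + z * DV i j)))
      + (s * (z * headDeriv p r V (fun i => innerAccel μ η p r g D2 i + outerAccel f V DV i)
          (densityRate r g V DV)) + 0 * (z * headPot p ρbar r V)
        + ∑ j, s * v j * (dz j * headPot p ρbar r V + z * headDeriv p r V (fun i => DV i j) (g j)))
      + z * (deriv p r * densityRate r g V DV)
    = z * (-(∑ i, ∑ j, s * (v i - V i) * (v j - V j) * DV i j)
        - s * ∑ i, (v i - V i) * (divStress μ η D2 i / r) - s * ∑ i, f i * v i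
        + contract (stress μ η G) DV - (p s - deriv p r * (s - r)) * ∑ j, DV j j
        - deriv p r * ∑ j, V j * g j)
      + ∑ j, dz j * (s * v j * headPot p ρbar r V - ∑ i, momentumFlux μ η p s v G i j * V i) := by
  obtain ⟨A, hA⟩ : ∃ A : Fin 3 → ℝ, A = innerAccel μ η p r g D2 := ⟨_, rfl⟩
  obtain ⟨k, hk⟩ : ∃ k, k = deriv p r / r := ⟨_, rfl⟩
  have hF : ∀ i, divStress μ η D2 i / r = A i + k * g i := fun i => by
    rw [hA, hk, innerAccel]; field_simp; ring
  have hd : deriv p r = k * r := by rw [hk]; field_simp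
  have e1 : ∀ a b, headDeriv p r V a b = (∑ i, V i * a i) + -k * b := fun a b => by
    rw [headDeriv, hk]
  generalize headPot p ρbar r V = X
  simp only [hF, e1, hd, ← hA, momentumFlux, contract, densityRate, outerAccel]
  generalize stress μ η G = S
  simp only [Fin.sum_univ_three]
  simp
  ring

/-- A localized identity holds for all cut-offs if it holds for those with small support. -/
lemma Tested.of_locally {h : ℝ} (hh : 0 < h) [SFinite ν] {X I : ℝ → E3 → ℝ} {Y : E3 → ℝ}
    (H : ∀ x₀ ζ, IsTestOn (ball x₀ (h / 2)) ζ →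
      Tested T ν (fun t x => ζ x * X t x) (fun x => ζ x * Y x) (fun t x => ζ x * I t x + ∑ j,
      fderiv ℝ ζ x (bv j) * J j t x))
    (hζ : IsTestOn univ ζ) : Tested T ν (fun t x => ζ x * X t x)
      (fun x => ζ x * Y x) (fun t x => ζ x * I t x + ∑ j, fderiv ℝ ζ x (bv j) * J j t x) := by
  obtain ⟨S, -, hS⟩ := hζ.2.1.isCompact.elim_nhds_subcover (fun x => ball x (h / 2))
    fun x _ => Metric.ball_mem_nhds x (by positivity)
  obtain ⟨χ, hχ⟩ := SmoothPartitionOfUnity.exists_isSubordinate (modelWithCornersSelf ℝ E3)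
    (isClosed_tsupport ζ) (fun x : S => ball x.1 (h / 2)) (fun _ => Metric.isOpen_ball)
    (by rw [iUnion_subtype]; exact hS)
  have hχs : ∀ i, ContDiff ℝ ∞ (χ i) := fun i => (χ i).contMDiff.contDiff
  have h1 : ∀ i : S, IsTestOn (ball i.1 (h / 2)) (fun x => χ i x * ζ x) := fun i =>
    ⟨(hχs i).mul hζ.1, hζ.2.1.mul_left, tsupport_mul_subset_left.trans (hχ i)⟩
  have hsum : ∀ x, ζ x = ∑ i, χ i x * ζ x := fun x => by
    by_cases hx : x ∈ tsupport ζ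
    · rw [← Finset.sum_mul, ← finsum_eq_sum_of_fintype, χ.sum_eq_one hx, one_mul]
    · simp [image_eq_zero_of_notMem_tsupport hx]
  have hd : ∀ x e, fderiv ℝ ζ x e = ∑ i, fderiv ℝ (fun x => χ i x * ζ x) x e := fun x e => by
    conv_lhs => rw [funext hsum]
    rw [fderiv_fun_sum fun i _ => (h1 i).1.differentiable (by simp) x]
    simp
  refine (Tested.sum Finset.univ fun i _ => H _ _ (h1 i)).congr ?_ ?_ ?_
  · exact .of_forall fun t => .of_forall fun x => by
      simp only [← Finset.sum_mul, ← hsum]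
  · exact .of_forall fun x => by simp only [← Finset.sum_mul, ← hsum]
  · refine .of_forall fun z => ?_
    simp only [uncurry, Finset.sum_add_distrib]
    rw [Finset.sum_comm]
    simp only [← Finset.sum_mul, ← hsum, ← hd]

lemma relative_tested (HS : StrongReg T Ω μ η p γ ρbar f q c C ρ₀ u₀ r U gr DU D2U)
    (HW : WeakReg T Ω p γ ρbar M ρ u Du) (H : IsFEWSWithGradient T Ω μ η p γ ρbar f ρ₀ u₀ ρ u Du)
    (hζ : IsTestOn univ ζ) : Tested T dx(Ω)
      (fun t x => ζ x * crossEnergy p ρbar (ρ t x) (u t x) (r t x) (U t x))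
      (fun x => ζ x * crossEnergy p ρbar (ρ₀ x) (u₀ x) (ρ₀ x) (u₀ x))
      (fun t x => ζ x * (-(∑ i, ∑ j, ρ t x * (u t x i - U t x i) * (u t x j - U t x j) * DU t x i j)
        - ρ t x * ∑ i, (u t x i - U t x i) * (divStress μ η (D2U t x) i / r t x)
        - ρ t x * ∑ i, f t x i * u t x i + contract (stress μ η (Du t x)) (DU t x)
        - (p (ρ t x) - deriv p (r t x) * (ρ t x - r t x)) * ∑ j, DU t x j j
        - deriv p (r t x) * ∑ j, U t x j * gr t x j)
        + ∑ j, fderiv ℝ ζ x (bv j) * (ρ t x * u t x j * hd(t,x) - ∑ i, fl(t,x) i j * U t x i)) := by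
  obtain ⟨h, hh, Hk⟩ := exists_interior_kernels HS.isOpen HS.lip
  refine Tested.of_locally hh (J := fun j t x => ρ t x * u t x j * hd(t,x)
    - ∑ i, fl(t,x) i j * U t x i) (fun x₀ ζ hζ => ?_) hζ
  obtain ⟨k, ε, Hk⟩ := Hk x₀
  have hfin := isFiniteMeasure_inter_ball Ω x₀ h
  have a1 := Tested.sum Finset.univ fun i _ => HS.momentum_tested HW H hh Hk hζ i
  have a2 := HS.continuity_tested HW H hh Hk hζ
  have a3 := HS.pressure_tested (inter_subset_left : Ω ∩ ball x₀ h ⊆ Ω) hζ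
  have h0 : ∀ x ∈ Ω, x ∉ Ω ∩ ball x₀ h → ζ x = 0 ∧ fderiv ℝ ζ x = 0 := fun x hx hxK =>
    hζ.eq_zero_of_notMem_ball hh fun h => hxK ⟨hx, h⟩
  have a4 := (((a1.const_mul (-1)).add a2).add a3).of_subset HS.isOpen.measurableSet
    inter_subset_left
    (fun t x hx hxK => by simp [h0 x hx hxK]) (fun x hx hxK => by simp [h0 x hx hxK])
    (fun t x hx hxK => by simp [h0 x hx hxK])
  refine a4.congr (X₂ := fun t x => ζ x * crossEnergy p ρbar (ρ t x) (u t x) (r t x) (U t x))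
    (Y₂ := fun x => ζ x * crossEnergy p ρbar (ρ₀ x) (u₀ x) (ρ₀ x) (u₀ x)) (N₂ := _)
    (.of_forall fun t => .of_forall fun x => ?_)
    (.of_forall fun x => ?_)
    (HS.bounds_prod.mono fun z hz => cross_source_eq μ η p ρbar (HS.pos.trans_le hz.1).ne'
      (u z.1 z.2) (U z.1 z.2) (gr z.1 z.2) (f z.1 z.2) (Du z.1 z.2) (DU z.1 z.2) (D2U z.1 z.2)
      (ζ z.2) (fun j => fderiv ℝ ζ z.2 (bv j)))
  all_goals simp only [crossEnergy, Fin.sum_univ_three]; ring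

/-! ### Global integrability -/

lemma WeakReg.u_two (h : WeakReg T Ω p γ ρbar M ρ u Du) (i : Fin 3) :
    Mix dt(T) dx(Ω) 2 2 (fun t x => u t x i) := by
  obtain ⟨B, κ, K, HB⟩ := exists_relPotBounds h.law h.far h.far le_rfl
  have h0 := h.far
  have hθ : Measurable fun s : ℝ => if s < ρbar / 2 then (1 : ℝ) else 0 :=
    Measurable.ite measurableSet_Iio measurable_const measurable_const
  have hm : AEStronglyMeasurable (uncurry fun t x => if ρ t x < ρbar / 2 then (1 : ℝ) else 0) _ :=
    (hθ.comp_aemeasurable h.meas_ρ.aemeasurable).aestronglyMeasurable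
  have hκ := inv_pos.2 HB.κ_pos
  have h1 : Mix dt(T) dx(Ω) ⊤ (ofReal 3) (fun t x => if ρ t x < ρbar / 2 then (1 : ℝ) else 0) := by
    refine Mix.top_of_energy_le h.energy Mix.zero hm (L := κ⁻¹ * (4 / ρbar ^ 2)) (by norm_num)
      (by positivity) ?_
    filter_upwards [h.nonneg] with t ht
    filter_upwards [ht] with x hx
    have h2 := (energyDensity_eq_of_nonneg h.law h.far hx (u t x)).2
    have h3 := relPot_nonneg h.law h.far hx h.far
    have h5 := HB.lower _ ⟨le_rfl, le_rfl⟩ _ hx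
    rw [mul_zero, add_zero, mul_comm (κ⁻¹), mul_assoc, div_mul_eq_mul_div,
      le_div_iff₀ (by positivity)]
    split_ifs with h4
    · rw [devEnergy, if_pos (by linarith [HB.lt])] at h5
      simp only [abs_one, Real.one_rpow]
      nlinarith [mul_le_mul_of_nonneg_left h2 hκ.le]
    · rw [abs_zero, Real.zero_rpow (by norm_num), zero_mul]
      exact mul_nonneg zero_le_four (mul_nonneg hκ.le (h3.trans h2))
  have h2 : Mix dt(T) dx(Ω) ⊤ 2
      (fun t x => (1 - if ρ t x < ρbar / 2 then (1 : ℝ) else 0) * u t x i) := by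
    refine (Mix.top_of_energy_le (g := fun t x =>
      (1 - if ρ t x < ρbar / 2 then (1 : ℝ) else 0) * u t x i) h.energy Mix.zero
      ((aestronglyMeasurable_const.sub hm).mul (aestronglyMeasurable_coord h.meas_u i))
      (L := 4 / ρbar) two_pos (by positivity) ?_).of_ofReal_two
    filter_upwards [h.nonneg] with t ht
    filter_upwards [ht] with x hx
    have h2 := energyDensity_eq_of_nonneg h.law h.far hx (u t x)
    have h3 := relPot_nonneg h.law h.far hx h.far
    rw [Real.rpow_two, sq_abs, div_mul_eq_mul_div, le_div_iff₀ (by positivity)]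
    split_ifs with h4
    · linarith
    · push Not at h4
      have h5 := mul_le_mul_of_nonneg_left (sq_coord_le (u t x) i) hx
      have h6 := mul_le_mul_of_nonneg_right h4 (sq_nonneg (u t x i))
      linarith [h2.1]
  have : HolderTriple (ofReal 3) (ofReal 6) 2 := by
    rw [show (2 : ℝ≥0∞) = ofReal 2 by norm_num]
    exact holderTriple_ofReal (by norm_num) (by norm_num) (by norm_num) (by norm_num)
  refine ((h1.mul (h.u_six i)).add (by norm_num) (h2.mono_left le_top)).congr
    (.of_forall fun z => ?_)
  simp only [uncurry]; ring

section

variable (HS : StrongReg T Ω μ η p γ ρbar f q c C ρ₀ u₀ r U gr DU D2U)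
include HS

lemma StrongReg.U_two (i : Fin 3) : Mix dt(T) dx(Ω) 2 2 (fun t x => U t x i) :=
  (HS.U_top_two i).mono_left le_top

lemma StrongReg.U_six (i : Fin 3) : Mix dt(T) dx(Ω) 2 (ofReal 6) (fun t x => U t x i) :=
  Mix.interpolate_two_top (by norm_num) (HS.U_two i) (HS.U_two_top i)

variable (HW : WeakReg T Ω p γ ρbar M ρ u Du) (HB : RelPotBounds p γ ρbar c C B κ L)
include HW HB

lemma dev_mul_mix (j : Fin 3) : Mix dt(T) dx(Ω) 1 1 (fun t x => (ρ t x - r t x) * U t x j) := by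
  have h1 : Mix dt(T) dx(Ω) 2 1 (fun t x => lowDev B (ρ t x) (r t x) * U t x j) :=
    (lowDev_mix HS.toRefDensity HW HB).mul (HS.U_two j)
  have h2 := highDev_mix HS.toRefDensity HW HB one_pos (by linarith [HW.law.three_halves_lt])
  rw [ofReal_one] at h2
  have h3 : Mix dt(T) dx(Ω) 2 1 (fun t x => highDev B (ρ t x) (r t x) * U t x j) :=
    h2.mul (HS.U_two_top j)
  simp only [← lowDev_add_highDev B, add_mul]
  exact (h1.add le_rfl h3).mono_left (by norm_num)

lemma density_mul_mix {v : ℝ → E3 → ℝ} (hv2 : Mix dt(T) dx(Ω) 2 2 v)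
    (hv6 : Mix dt(T) dx(Ω) 2 (ofReal 6) v) (hg2 : Mix dt(T) dx(Ω) 2 2 g)
    (hgq : Mix dt(T) dx(Ω) 2 (ofReal q) g) :
    Mix dt(T) dx(Ω) 1 1 (fun t x => ρ t x * v t x * g t x) := by
  obtain ⟨-, -, e3, e4, -⟩ := HS.exponents
  have := holderTriple_conj HS.three_lt
  have := HS.holderTriple
  have h1 : Mix dt(T) dx(Ω) ⊤ ⊤ (fun t x => r t x + lowDev B (ρ t x) (r t x)) :=
    (HS.comp_mix continuousOn_id).add le_top (lowDev_top HS.toRefDensity HW HB)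
  have h2 : Mix dt(T) dx(Ω) 2 2
      (fun t x => (r t x + lowDev B (ρ t x) (r t x)) * v t x) := h1.mul hv2
  have h3 : Mix dt(T) dx(Ω) 2 (ofReal (q / (q - 1)))
      (fun t x => highDev B (ρ t x) (r t x) * v t x) :=
    (highDev_mix HS.toRefDensity HW HB (by linarith) e3).mul hv6
  have h4 : Mix dt(T) dx(Ω) 1 1 _ := (h2.mul hg2).add le_rfl (h3.mul hgq)
  refine h4.congr (.of_forall fun z => ?_)
  simp only [uncurry]
  linear_combination (-(v z.1 z.2 * g z.1 z.2)) * lowDev_add_highDev B (ρ z.1 z.2) (r z.1 z.2)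

end

/-! ### Integration by parts in the relative energy balance -/

lemma tested_null [SFinite ν] {Z : ℝ → E3 → ℝ} (hZ : Mix dt(T) ν 1 1 Z)
    (h : ∀ᵐ t ∂dt(T), ∫ x, Z t x ∂ν = 0) : Tested T ν (fun _ _ => 0) (fun _ => 0) Z := by
  refine ⟨.of_forall fun _ => integrable_zero _ _ _, integrable_zero _ _ _, hZ.integrable, ?_⟩
  filter_upwards [ae_mem_Ioo] with τ hτ
  rw [intervalIntegral_eq_Ioo hτ.1.le,
    integral_congr_ae (ae_mono (restrict_le (Ioo_subset_Ioo_right hτ.2.le)) h)]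
  simp

lemma tested_parts {a : ℝ → E3 → ℝ} {b : Fin 3 → ℝ → E3 → ℝ} {v : ℝ → E3 → E3} {G : ℝ → E3 → M33}
    (hv : ∀ᵐ t ∂dt(T), MemD012 Ω (v t) (G t))
    (hab : ∀ᵐ t ∂dt(T), HasWeakGrad Ω (a t) (fun j => b j t)) (ha : Mix dt(T) dx(Ω) 2 2 a)
    (hb : ∀ j, Mix dt(T) dx(Ω) 2 2 (b j)) (hv2 : ∀ i, Mix dt(T) dx(Ω) 2 2 (fun t x => v t x i))
    (hG : ∀ i j, Mix dt(T) dx(Ω) 2 2 (fun t x => G t x i j)) (hζ : IsTestOn univ ζ) (i j : Fin 3) :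
    Tested T dx(Ω) (fun _ _ => 0) (fun _ => 0) (fun t x => b j t x * (ζ x * v t x i)
        + a t x * (fderiv ℝ ζ x (bv j) * v t x i + ζ x * G t x i j)) := by
  have h1 : Mix dt(T) dx(Ω) 2 2 (fun t x => ζ x * v t x i) := hζ.mix.mul (hv2 i)
  have h2 : Mix dt(T) dx(Ω) 2 2 (fun t x => fderiv ℝ ζ x (bv j) * v t x i + ζ x * G t x i j) :=
    ((hζ.mix_fderiv _).mul (hv2 i)).add (by norm_num) (hζ.mix.mul (hG i j))
  have h3 : Mix dt(T) dx(Ω) 1 1 _ := (hb j).mul h1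
  have h4 : Mix dt(T) dx(Ω) 1 1 _ := ha.mul h2
  refine tested_null (h3.add le_rfl h4) ?_
  filter_upwards [hv, hab, ha.memLp, ae_all_iff.2 fun j => (hb j).memLp, h3.memLp, h4.memLp]
    with t e1 e2 e3 e4 e5 e6
  rw [integral_add (memLp_one_iff_integrable.1 e5) (memLp_one_iff_integrable.1 e6),
    e1.integral_mul_eq e2 e3 e4 hζ i j, neg_add_cancel]

lemma tested_divergence (hΩ : IsOpen Ω) {v : ℝ → E3 → E3} {G : ℝ → E3 → M33}
    (hv : ∀ᵐ t ∂dt(T), MemD012 Ω (v t) (G t)) (hv2 : ∀ i, Mix dt(T) dx(Ω) 2 2 (fun t x => v t x i))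
    (hG : ∀ i j, Mix dt(T) dx(Ω) 2 2 (fun t x => G t x i j)) (hζ : IsTestOn univ ζ) (j : Fin 3) :
    Tested T dx(Ω) (fun _ _ => 0) (fun _ => 0)
      (fun t x => v t x j * fderiv ℝ ζ x (bv j) + G t x j j * ζ x) := by
  have hmix : ∀ {ψ : E3 → ℝ} {g : ℝ → E3 → ℝ}, MemLp ψ 2 dx(Ω) → Mix dt(T) dx(Ω) 2 2 g →
      Mix dt(T) dx(Ω) 1 1 (fun t x => g t x * ψ x) :=
    fun {ψ g} hψ hg => by
      have : Mix dt(T) dx(Ω) ⊤ 2 (fun _ x => ψ x) :=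
        ⟨hψ.1.comp_snd, .of_forall fun _ => hψ, memLp_top_const _⟩
      have h1 : Mix dt(T) dx(Ω) 2 1 _ := hg.mul this
      exact h1.mono_left (by norm_num)
  have h3 := hmix (hζ.memLp_fderiv (bv j) 2 _) (hv2 j)
  have h4 := hmix (hζ.memLp 2 _) (hG j j)
  refine tested_null (h3.add le_rfl h4) ?_
  filter_upwards [hv, h3.memLp, h4.memLp] with t e1 e5 e6
  have := (e1.hasWeakGrad hΩ j).eq j ζ hζ
  have hind : ∀ F H : E3 → ℝ, ∫ y, Ω.indicator F y * H y = ∫ y in Ω, F y * H y := fun F H => by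
    rw [← integral_indicator hΩ.measurableSet]
    exact integral_congr_ae (.of_forall fun x => by by_cases hx : x ∈ Ω <;> simp [hx])
  rw [setIntegral_univ, setIntegral_univ, hind, hind] at this
  rw [integral_add (memLp_one_iff_integrable.1 e5) (memLp_one_iff_integrable.1 e6), this,
    neg_add_cancel]

/-- The source of the relative energy. -/
def relSource (μ η : ℝ) (p : ℝ → ℝ) (s : ℝ) (v : E3) (r : ℝ) (V f : E3)
    (G DV : M33) (D2 : Fin 3 → Fin 3 → Fin 3 → ℝ) : ℝ :=
  -(∑ i, ∑ j, s * (v i - V i) * (v j - V j) * DV i j)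
    - (s - r) * ∑ i, (v i - V i) * (divStress μ η D2 i / r) - s * ∑ i, f i * v i
    + contract (stress μ η G) DV + contract (stress μ η DV) (G - DV)
    - (p s - p r - deriv p r * (s - r)) * ∑ j, DV j j

/-- The flux of the relative energy. -/
def relFlux (μ η : ℝ) (p : ℝ → ℝ) (ρbar s : ℝ) (v : E3) (r : ℝ) (V : E3)
    (G DV : M33) (j : Fin 3) : ℝ :=
  s * v j * headPot p ρbar r V - (∑ i, s * v i * v j * V i) + (∑ i, stress μ η G i j * V i)
    + (∑ i, stress μ η DV i j * (v i - V i)) - (p s - p r) * V j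

lemma divStress_parts (μ η : ℝ) (w : E3) (G DV : M33)
    (D2 : Fin 3 → Fin 3 → Fin 3 → ℝ) (z : ℝ) (dz : Fin 3 → ℝ)
    {Z : Fin 3 → Fin 3 → Fin 3 → Fin 3 → ℝ} (hZ : ∀ a b k i, Z a b k i
      = D2 a b k * (z * w i) + DV a b * (dz k * w i + z * G i k)) :
    ∑ i, ∑ j, (μ * (Z i j j i + Z j i j i)
      + ((η - 2 / 3 * μ) * if i = j then 1 else 0) * ∑ k, Z k k j i)
    = z * (∑ i, w i * divStress μ η D2 i + contract (stress μ η DV) G)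
      + ∑ j, dz j * ∑ i, stress μ η DV i j * w i := by
  have hd : ∀ i, divStress μ η D2 i = ∑ j, (μ * (D2 i j j + D2 j i j)
      + ((η - 2 / 3 * μ) * if i = j then 1 else 0) * ∑ k, D2 k k j) :=
    fun i => Finset.sum_congr rfl fun j _ => stress_apply μ η _ i j
  simp only [hd, contract, stress_apply, hZ, Fin.sum_univ_three, Fin.isValue, Fin.reduceEq,
    if_true, if_false]
  ring

lemma relative_tested_parts (HS : StrongReg T Ω μ η p γ ρbar f q c C ρ₀ u₀ r U gr DU D2U)
    (HW : WeakReg T Ω p γ ρbar M ρ u Du) (H : IsFEWSWithGradient T Ω μ η p γ ρbar f ρ₀ u₀ ρ u Du)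
    (hζ : IsTestOn univ ζ) : Tested T dx(Ω)
      (fun t x => ζ x * crossEnergy p ρbar (ρ t x) (u t x) (r t x) (U t x))
      (fun x => ζ x * crossEnergy p ρbar (ρ₀ x) (u₀ x) (ρ₀ x) (u₀ x))
      (fun t x => ζ x * relSource μ η p (ρ t x) (u t x) (r t x) (U t x) (f t x) (Du t x) (DU t x)
          (D2U t x)
        + ∑ j, fderiv ℝ ζ x (bv j)
          * relFlux μ η p ρbar (ρ t x) (u t x) (r t x) (U t x) (Du t x) (DU t x) j) := by
  have hp := HW.law
  have hw : ∀ᵐ t ∂dt(T), MemD012 Ω (fun x => u t x - U t x) (fun x => Du t x - DU t x) := by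
    filter_upwards [HW.memD012, HS.memD012] with t h1 h2 using h1.sub h2
  have hw2 := fun i => (HW.u_two i).sub (by norm_num) (HS.U_two i)
  have hG2 := fun i j => (HW.Du_two i j).sub (by norm_num) (HS.DU_two i j)
  have Z1 := fun a b k i => tested_parts hw (HS.grad_DU a b) (HS.DU_two a b) (HS.D2U_two a b)
    hw2 hG2 hζ i k
  have hp' := fun s (hs : s ∈ Icc c C) => hp.differentiableAt (HS.pos.trans_le hs.1)
  have hP : ∀ᵐ t ∂dt(T), HasWeakGrad Ω (fun x => p (r t x) - p ρbar)
      (fun j x => deriv p (r t x) * gr t x j) := by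
    filter_upwards [HS.grad_r, HS.bounds] with t h1 h2
    exact h1.comp_of_mem_Icc HS.isOpen HS.le (G := fun s => p s - p ρbar)
      (fun s hs => (hp' s hs).sub_const _) (HS.continuousOn_deriv hp) h2
  have Z2 := fun j => tested_parts (b := fun j t x => deriv p (r t x) * gr t x j) HS.memD012 hP
    ((HS.comp_sub_two hp' (HS.continuousOn_deriv hp)).mono_left le_top)
    (fun j => (HS.comp_mix (HS.continuousOn_deriv hp)).mul (HS.gr_two j)) HS.U_two HS.DU_two hζ j j
  have Z3 := fun j => tested_divergence HS.isOpen HS.memD012 HS.U_two HS.DU_two hζ j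
  refine ((((relative_tested HS HW H hζ).add
    (Tested.sum Finset.univ fun i _ => Tested.sum Finset.univ fun j _ =>
      (((Z1 i j j i).add (Z1 j i j i)).const_mul μ).add
        ((Tested.sum Finset.univ fun k _ => Z1 k k j i).const_mul
          ((η - 2 / 3 * μ) * if i = j then 1 else 0)))).add
    (Tested.sum Finset.univ fun j _ => Z2 j)).add
    ((Tested.sum Finset.univ fun j _ => Z3 j).const_mul (p ρbar))).congr
    (.of_forall fun t => .of_forall fun x => by simp)
    (.of_forall fun x => by simp) ?_
  filter_upwards [HS.bounds_prod] with ⟨t, x⟩ hz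
  have hr : r t x ≠ 0 := (HS.pos.trans_le hz.1).ne'
  simp only [uncurry]
  rw [divStress_parts μ η (u t x - U t x) (Du t x - DU t x) (DU t x) (D2U t x) (ζ x)
    (fun j => fderiv ℝ ζ x (bv j)) fun _ _ _ _ => rfl]
  obtain ⟨F, hF⟩ : ∃ F : Fin 3 → ℝ, ∀ i, divStress μ η (D2U t x) i = r t x * F i :=
    ⟨fun i => divStress μ η (D2U t x) i / r t x, fun i => by field_simp⟩
  have hF' : ∀ i, r t x * F i / r t x = F i := fun i => mul_div_cancel_left₀ _ hr
  simp only [hF, hF', relSource, relFlux, momentumFlux, PiLp.sub_apply]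
  generalize contract (stress μ η (DU t x)) (Du t x - DU t x) = k1
  generalize contract (stress μ η (Du t x)) (DU t x) = k2
  generalize stress μ η (DU t x) = S1
  generalize stress μ η (Du t x) = S2
  simp only [Fin.sum_univ_three]
  simp
  ring

/-! ### The relative energy inequality -/

lemma Mix.mul_two {lam : Measure ℝ} [IsFiniteMeasure lam] [SFinite ν] (hg : Mix lam ν 2 2 g)
    (hh : Mix lam ν 2 2 h) : Mix lam ν 1 1 (fun t x => g t x * h t x) := hg.mul hh

lemma Mix.mul_top {lam : Measure ℝ} [IsFiniteMeasure lam] [SFinite ν] (hg : Mix lam ν ⊤ 1 g)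
    (hh : Mix lam ν 2 ⊤ h) : Mix lam ν 1 1 (fun t x => g t x * h t x) := by
  have : Mix lam ν 2 1 (fun t x => g t x * h t x) := hg.mul hh
  exact this.mono_left (by norm_num)

section

variable (HS : StrongReg T Ω μ η p γ ρbar f q c C ρ₀ u₀ r U gr DU D2U)
include HS

/-- The viscous force per unit mass. -/
lemma StrongReg.force_mix {s : ℝ≥0∞} (hs : 1 ≤ s) (hgr : ∀ j, Mix dt(T) dx(Ω) 2 s
    (fun t x => gr t x j)) (hD : ∀ i j k, Mix dt(T) dx(Ω) 2 s (fun t x => D2U t x i j k))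
    (i : Fin 3) : Mix dt(T) dx(Ω) 2 s (fun t x => divStress μ η (D2U t x) i / r t x) := by
  refine ((HS.innerAccel_mix (μ := μ) (η := η) HS.law hs hgr hD i).sub hs
    ((HS.comp_mix (HS.continuousOn_coef HS.law)).mul (hgr i))).congr (.of_forall fun z => ?_)
  simp only [uncurry, innerAccel]; ring

lemma StrongReg.head_mix : Mix dt(T) dx(Ω) 2 2 (fun t x => hd(t,x)) ∧
    Mix dt(T) dx(Ω) 2 (ofReal q) (fun t x => hd(t,x)) := by
  have hq := HS.three_lt
  have g2 := (HS.comp_sub_two (HS.hasDerivAt_head HS.law) (HS.continuousOn_coef HS.law)).mono_left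
    (r₂ := 2) le_top
  simp only [sub_self, sub_zero] at g2
  have gt := (HS.comp_mix HS.continuousOn_head).mono_left (r₂ := 2) le_top
  simp only [headPot, sq]
  exact ⟨(Mix.sum _ (by norm_num) fun i _ =>
      ((HS.U_top_two i).mul (HS.U_two_top i)).const_mul _).add (by norm_num) g2,
    (Mix.sum _ HS.one_le_q fun i _ => ((HS.U_top_q i).mul (HS.U_two_top i)).const_mul _).add
      HS.one_le_q (Mix.interpolate_two_top (by linarith) g2 gt)⟩

variable (HW : WeakReg T Ω p γ ρbar M ρ u Du) (HB : RelPotBounds p γ ρbar c C B κ L)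
include HW HB

lemma relFlux_mix (j : Fin 3) : Mix dt(T) dx(Ω) 1 1
    (fun t x => relFlux μ η p ρbar (ρ t x) (u t x) (r t x) (U t x) (Du t x) (DU t x) j) := by
  obtain ⟨h2, hq⟩ := HS.head_mix
  have m1 := density_mul_mix HS HW HB (HW.u_two j) (HW.u_six j) h2 hq
  have m2 := (pressure_remainder_mix HS.toRefDensity HW HB).mul_top (HS.U_two_top j)
  have m3 : Mix dt(T) dx(Ω) 1 1 _ :=
    (HS.comp_mix (HS.continuousOn_deriv HW.law)).mul (dev_mul_mix HS HW HB j)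
  refine ((((m1.sub le_rfl (Mix.sum Finset.univ le_rfl fun i _ => (HW.kinetic i j).mul_top
    (HS.U_two_top i))).add le_rfl (Mix.sum Finset.univ le_rfl fun i _ =>
      (Mix.stress (by norm_num) HW.Du_two μ η i j).mul_two (HS.U_two i))).add le_rfl
    (Mix.sum Finset.univ le_rfl fun i _ => (Mix.stress (by norm_num) HS.DU_two μ η i j).mul_two
      ((HW.u_two i).sub (by norm_num) (HS.U_two i)))).sub le_rfl (m2.add le_rfl m3)).congr
    (.of_forall fun z => ?_)
  simp only [uncurry, relFlux]; ring

lemma relSource_mix (hwork : IntegrableOn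
      (fun z : ℝ × E3 => ρ z.1 z.2 * inner ℝ (f z.1 z.2) (u z.1 z.2)) (cyl T Ω)) :
    Mix dt(T) dx(Ω) 1 1 (fun t x =>
      relSource μ η p (ρ t x) (u t x) (r t x) (U t x) (f t x) (Du t x) (DU t x) (D2U t x)) := by
  have D := fun {v g} => density_mul_mix (v := v) (g := g) HS HW HB
  have F2 := HS.force_mix (by norm_num) HS.gr_two HS.D2U_two
  have Fq := HS.force_mix HS.one_le_q HS.gr_q HS.D2U_q
  have UD2 : ∀ i k l, Mix dt(T) dx(Ω) 2 2
    (fun t x => U t x i * DU t x k l) := fun i k l => (HS.U_top_two i).mul (HS.DU_top k l)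
  have UDq : ∀ i k l, Mix dt(T) dx(Ω) 2 (ofReal q)
    (fun t x => U t x i * DU t x k l) := fun i k l => (HS.U_top_q i).mul (HS.DU_top k l)
  have m1 := fun i j => (((HW.kinetic i j).mul_top (HS.DU_top i j)).sub le_rfl
    (D (HW.u_two i) (HW.u_six i) (UD2 j i j) (UDq j i j))).sub le_rfl
    ((D (HW.u_two j) (HW.u_six j) (UD2 i i j) (UDq i i j)).sub le_rfl
      (D (HS.U_two i) (HS.U_six i) (UD2 j i j) (UDq j i j)))
  have m2 := fun i => ((D (HW.u_two i) (HW.u_six i) (F2 i) (Fq i)).sub le_rfl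
    (D (HS.U_two i) (HS.U_six i) (F2 i) (Fq i))).sub le_rfl
    (((HS.comp_mix (G := fun s => s) continuousOn_id).mul
      ((HW.u_two i).sub (by norm_num) (HS.U_two i))).mul_two (F2 i))
  rw [IntegrableOn, volume_restrict_cyl] at hwork
  have m3 : Mix dt(T) dx(Ω) 1 1
    (fun t x => ρ t x * inner ℝ (f t x) (u t x)) := Mix.of_integrable hwork
  simp only [inner_eq_sum] at m3
  have m4 := Mix.sum Finset.univ le_rfl fun i _ => Mix.sum Finset.univ le_rfl fun j _ =>
    (Mix.stress (by norm_num) HW.Du_two μ η i j).mul_two (HS.DU_two i j)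
  have m5 := Mix.sum Finset.univ le_rfl fun i _ => Mix.sum Finset.univ le_rfl fun j _ =>
    (Mix.stress (by norm_num) HS.DU_two μ η i j).mul_two
      ((HW.Du_two i j).sub (by norm_num) (HS.DU_two i j))
  have m6 := (pressure_remainder_mix HS.toRefDensity HW HB).mul_top
    (Mix.sum Finset.univ le_top fun j _ => HS.DU_top j j)
  refine (((((Mix.sum Finset.univ le_rfl fun i _ => Mix.sum Finset.univ le_rfl fun j _ =>
    m1 i j).neg.sub le_rfl (Mix.sum Finset.univ le_rfl fun i _ => m2 i)).sub le_rfl m3).add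
      le_rfl m4).add le_rfl m5 |>.sub le_rfl m6).congr (.of_forall fun z => ?_)
  simp only [uncurry, relSource, contract, Matrix.sub_apply, Fin.sum_univ_three]
  ring

end

/-! #### Removal of the cut-off -/

lemma exists_cutoffs : ∃ (χ : ℕ → E3 → ℝ) (D : ℝ), (∀ n, IsTestOn univ (χ n)) ∧
    (∀ n x, 0 ≤ χ n x ∧ χ n x ≤ 1) ∧ (∀ x, Tendsto (fun n => χ n x) atTop (𝓝 1)) ∧
    (∀ n x j, |fderiv ℝ (χ n) x (bv j)| ≤ D) ∧
    ∀ x j, Tendsto (fun n => fderiv ℝ (χ n) x (bv j)) atTop (𝓝 0) := by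
  let φ : ContDiffBump (0 : E3) := ⟨1, 2, one_pos, one_lt_two⟩
  have hφ : IsTestOn univ φ := ⟨φ.contDiff, φ.hasCompactSupport, subset_univ _⟩
  choose D hD using fun j => (hφ.continuous_fderiv (bv j)).bounded_above_of_compact_support
    (hφ.2.1.fderiv_apply ℝ (bv j))
  have hD0 : ∀ j, 0 ≤ D j := fun j => (norm_nonneg _).trans (hD j 0)
  have hs : ∀ n : ℕ, (0 : ℝ) < ((n : ℝ) + 1)⁻¹ := fun n => by positivity
  have hlim := tendsto_one_div_add_atTop_nhds_zero_nat (𝕜 := ℝ)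
  simp only [one_div] at hlim
  have hfd : ∀ (n : ℕ) x e, fderiv ℝ (fun x => φ (((n : ℝ) + 1)⁻¹ • x)) x e
      = ((n : ℝ) + 1)⁻¹ * fderiv ℝ φ (((n : ℝ) + 1)⁻¹ • x) e := fun n x e => by
    rw [fderiv_comp_smul]; rfl
  have hbd : ∀ (n : ℕ) x j, |fderiv ℝ (fun x => φ (((n : ℝ) + 1)⁻¹ • x)) x (bv j)|
      ≤ ((n : ℝ) + 1)⁻¹ * ∑ j, D j := fun n x j => by
    rw [hfd, abs_mul, abs_of_pos (hs n)]
    exact mul_le_mul_of_nonneg_left ((hD j _).trans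
      (Finset.single_le_sum (fun j _ => hD0 j) (Finset.mem_univ j))) (hs n).le
  refine ⟨fun n x => φ (((n : ℝ) + 1)⁻¹ • x), ∑ j, D j, fun n => ⟨?_, ?_, subset_univ _⟩,
    fun n x => ⟨φ.nonneg, φ.le_one⟩, fun x => ?_, fun n x j => (hbd n x j).trans ?_,
    fun x j => ?_⟩
  · exact φ.contDiff.comp (contDiff_const_smul _)
  · exact hφ.2.1.comp_homeomorph (Homeomorph.smulOfNeZero _ (hs n).ne')
  · have h1 := ((φ.continuous.tendsto ((0 : ℝ) • x)).comp (hlim.smul_const x))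
    rwa [zero_smul, φ.one_of_mem_closedBall (by simp [φ])] at h1
  · exact mul_le_of_le_one_left (Finset.sum_nonneg fun j _ => hD0 j)
      (inv_le_one_of_one_le₀ (by linarith [n.cast_nonneg (α := ℝ)]))
  · refine squeeze_zero_norm (fun n => hbd n x j) ?_
    simpa using hlim.mul_const (∑ j, D j)

lemma integral_le_of_tendsto_cutoff {A : E3 → ℝ} {χ : ℕ → E3 → ℝ} {L : ℝ} (hA : ∀ᵐ x ∂ν, 0 ≤ A x)
    (h0 : ∀ n x, 0 ≤ χ n x) (h1 : ∀ x, Tendsto (fun n => χ n x) atTop (𝓝 1))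
    (hi : ∀ n, Integrable (fun x => χ n x * A x) ν)
    (hL : Tendsto (fun n => ∫ x, χ n x * A x ∂ν) atTop (𝓝 L)) :
    Integrable A ν ∧ ∫ x, A x ∂ν ≤ L := by
  have hlim : ∀ x, Tendsto (fun n => χ n x * A x) atTop (𝓝 (A x)) := fun x => by
    simpa using (h1 x).mul_const (A x)
  have hm : AEStronglyMeasurable A ν :=
    aestronglyMeasurable_of_tendsto_ae atTop (fun n => (hi n).1) (.of_forall hlim)
  have hn : ∀ n, ∀ᵐ x ∂ν, 0 ≤ χ n x * A x := fun n => hA.mono fun x hx => mul_nonneg (h0 n x) hx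
  have hle : ∫⁻ x, ofReal (A x) ∂ν ≤ ofReal L := by
    have e : ∀ x, liminf (fun n => ofReal (χ n x * A x)) atTop = ofReal (A x) :=
      fun x => ((ENNReal.continuous_ofReal.tendsto _).comp (hlim x)).liminf_eq
    have h2 := lintegral_liminf_le' (μ := ν) (u := atTop)
      fun n => ((hi n).1.aemeasurable.ennreal_ofReal)
    simp only [e, ← ofReal_integral_eq_lintegral_ofReal (hi _) (hn _)] at h2
    exact h2.trans ((ENNReal.continuous_ofReal.tendsto _).comp hL).liminf_eq.le
  refine ⟨⟨hm, (hasFiniteIntegral_iff_ofReal hA).2 (hle.trans_lt ENNReal.ofReal_lt_top)⟩, ?_⟩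
  rw [integral_eq_lintegral_of_nonneg_ae hA hm]
  exact toReal_le_of_le_ofReal (ge_of_tendsto' hL fun n => integral_nonneg_of_ae (hn n)) hle

lemma integral_of_le_eq_prod [SFinite ν] (hτ : τ ∈ Ioo 0 T) {N : ℝ → E3 → ℝ}
    (hN : Integrable (uncurry N) (dt(T).prod ν)) : Integrable (uncurry N) (dt(τ).prod ν) ∧
    ∫ t in 0..τ, ∫ x, N t x ∂ν = ∫ z, N z.1 z.2 ∂(dt(τ).prod ν) := by
  have h1 := hN.mono_measure (Measure.prod_mono
    (restrict_le (Ioo_subset_Ioo_right hτ.2.le) : _ ≤ dt(T))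
    (le_refl ν))
  refine ⟨h1, ?_⟩
  rw [intervalIntegral_eq_Ioo hτ.1.le]
  exact (integral_prod _ h1).symm

lemma tested_limit [SFinite ν] {X I e : ℝ → E3 → ℝ} {Y : E3 → ℝ}
    (H : ∀ ζ, IsTestOn univ ζ → Tested T ν (fun t x => ζ x * X t x) (fun x => ζ x * Y x)
      (fun t x => ζ x * I t x + ∑ j, fderiv ℝ ζ x (bv j) * J j t x))
    (hI : Mix dt(T) ν 1 1 I) (hJ : ∀ j, Mix dt(T) ν 1 1 (J j)) (hY : Integrable Y ν)
    (he : ∀ᵐ t ∂dt(T), Integrable (e t) ν) (h0 : ∀ᵐ t ∂dt(T), ∀ᵐ x ∂ν, 0 ≤ e t x + X t x) :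
    ∀ᵐ τ ∂dt(T), Integrable (fun x => e τ x + X τ x) ν ∧ ∫ x, e τ x + X τ x ∂ν
        ≤ (∫ x, e τ x ∂ν) + ((∫ x, Y x ∂ν) + ∫ t in 0..τ, ∫ x, I t x ∂ν) := by
  obtain ⟨χ, D, hχ, hχ01, hχ1, hD, hD0⟩ := exists_cutoffs
  have hc : ∀ n, Continuous (χ n) := fun n => (hχ n).continuous
  have hb : ∀ {g : E3 → ℝ}, Integrable g ν → (∀ n, Integrable (fun x => χ n x * g x) ν) ∧
      Tendsto (fun n => ∫ x, χ n x * g x ∂ν) atTop (𝓝 (∫ x, g x ∂ν)) := fun {g} hg => by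
    have hm := fun n => (hc n).aestronglyMeasurable.mul hg.1
    have hle : ∀ n, ∀ᵐ x ∂ν, ‖χ n x * g x‖ ≤ ‖g x‖ := fun n => .of_forall fun x => by
      rw [norm_mul, Real.norm_of_nonneg (hχ01 n x).1]
      exact mul_le_of_le_one_left (norm_nonneg _) (hχ01 n x).2
    exact ⟨fun n => hg.mono (hm n) (hle n), tendsto_integral_of_dominated_convergence _ hm hg.norm
      hle (.of_forall fun x => by simpa using (hχ1 x).mul_const (g x))⟩
  filter_upwards [ae_all_iff.2 fun n => (H _ (hχ n)).eq, ae_all_iff.2 fun n =>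
    (H _ (hχ n)).integrable, he, h0, ae_mem_Ioo] with τ h1 h2 h3 h4 hτ
  refine integral_le_of_tendsto_cutoff h4 (fun n x => (hχ01 n x).1) hχ1 (fun n => ?_) ?_
  · simp only [mul_add]; exact ((hb h3).1 n).add (h2 n)
  simp only [mul_add]
  refine ((hb h3).2.add ((hb hY).2.add ?_)).congr fun n => by
    rw [integral_add ((hb h3).1 n) (h2 n), h1 n]
  simp only [fun n => (integral_of_le_eq_prod hτ (H _ (hχ n)).integrable_source).2,
    (integral_of_le_eq_prod hτ hI.integrable).2]
  have iI := (integral_of_le_eq_prod hτ hI.integrable).1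
  have iJ := fun j => (integral_of_le_eq_prod hτ (hJ j).integrable).1
  refine tendsto_integral_of_dominated_convergence (fun z => ‖I z.1 z.2‖ + ∑ j, D * ‖J j z.1 z.2‖)
    (fun n => (integral_of_le_eq_prod hτ (H _ (hχ n)).integrable_source).1.1)
    (iI.norm.add (integrable_finsetSum _ fun j _ => (iJ j).norm.const_mul D))
    (fun n => .of_forall fun z => ?_) (.of_forall fun z => ?_)
  · refine (norm_add_le _ _).trans (add_le_add ?_ ((norm_sum_le _ _).trans
      (Finset.sum_le_sum fun j _ => ?_)))
    · rw [norm_mul, Real.norm_of_nonneg (hχ01 n z.2).1]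
      exact mul_le_of_le_one_left (norm_nonneg _) (hχ01 n z.2).2
    · rw [norm_mul]; exact mul_le_mul_of_nonneg_right (hD n z.2 j) (norm_nonneg _)
  · simpa using ((hχ1 z.2).mul_const (I z.1 z.2)).add
      (tendsto_finsetSum Finset.univ fun j _ => (hD0 z.2 j).mul_const (J j z.1 z.2))

/-! ### Estimates for the relative energy -/

/-- The relative energy density. -/
def relEnergy (p : ℝ → ℝ) (ρbar s : ℝ) (v : E3) (r : ℝ) (V : E3) : ℝ :=
  1 / 2 * s * ‖v - V‖ ^ 2 + relPot p ρbar s r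

/-- The source of the relative energy inequality. -/
def netSource (μ η : ℝ) (p : ℝ → ℝ) (s : ℝ) (v : E3) (r : ℝ) (V f : E3)
    (G DV : M33) (D2 : Fin 3 → Fin 3 → Fin 3 → ℝ) : ℝ :=
  relSource μ η p s v r V f G DV D2 + s * inner ℝ f v - contract (stress μ η G) G

lemma energyDensity_add_crossEnergy (hp : PressureLaw p γ) (hρ : 0 < ρbar) (s : ℝ) (v : E3) {r : ℝ}
    (hr : r ≠ 0) (V : E3) :
    energyDensity p ρbar s v + crossEnergy p ρbar s v r V = relEnergy p ρbar s v r V := by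
  have h1 := mul_potentialDeriv (p := p) (ρbar := ρbar) hr
  have h2 := mul_potentialDeriv (p := p) (ρbar := ρbar) hρ.ne'
  simp only [energyDensity_eq hp hρ, relEnergy, relPot, crossEnergy, headPot,
    EuclideanSpace.real_norm_sq_eq, Fin.sum_univ_three, PiLp.sub_apply]
  linear_combination h2 - h1

lemma contract_stress_sub (μ η : ℝ) (G D : M33) :
    contract (stress μ η G) D + contract (stress μ η D) (G - D) - contract (stress μ η G) G
      = -contract (stress μ η (G - D)) (G - D) := by
  simp only [contract, stress_apply, Matrix.sub_apply, Fin.sum_univ_three]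
  ring

lemma netSource_le {r : ℝ} (HB : RelPotBounds p γ ρbar c C B κ L) (hp : PressureLaw p γ)
    (hρ : 0 < ρbar) (hc : 0 < c) (hs : 0 ≤ s) (hr : r ∈ Icc c C) (v V f : E3) (G DV : M33)
    (D2 : Fin 3 → Fin 3 → Fin 3 → ℝ) {d : Fin 3 → Fin 3 → ℝ} (hd : ∀ i j, |DV i j| ≤ d i j) :
    netSource μ η p s v r V f G DV D2 ≤ -contract (stress μ η (G - DV)) (G - DV)
      + (2 + L * κ⁻¹) * (∑ i, ∑ j, d i j) * relEnergy p ρbar s v r V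
      + ∑ i, (|lowDev B s r * ((v - V) i * (divStress μ η D2 i / r))|
        + |highDev B s r * ((v - V) i * (divStress μ η D2 i / r))|) := by
  have hΛ := relPot_nonneg hp hρ hs (hc.trans_le hr.1)
  have hd0 : ∀ i j, 0 ≤ d i j := fun i j => (abs_nonneg _).trans (hd i j)
  have hK : 0 < L * κ⁻¹ := mul_pos HB.K_pos (inv_pos.2 HB.κ_pos)
  have t1 : -(∑ i, ∑ j, s * (v i - V i) * (v j - V j) * DV i j)
      ≤ (∑ i, ∑ j, d i j) * (s * ‖v - V‖ ^ 2) := by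
    simp only [← Finset.sum_neg_distrib, Finset.sum_mul]
    refine Finset.sum_le_sum fun i _ => Finset.sum_le_sum fun j _ => (neg_le_abs _).trans ?_
    rw [abs_mul, mul_comm, mul_assoc s, abs_mul s, abs_of_nonneg hs, abs_mul, sq]
    refine mul_le_mul (hd i j) (mul_le_mul_of_nonneg_left ?_ hs) (by positivity) (hd0 i j)
    exact mul_le_mul (abs_coord_le (v - V) i) (abs_coord_le (v - V) j) (abs_nonneg _)
      (norm_nonneg _)
  have t2 : -((p s - p r - deriv p r * (s - r)) * ∑ j, DV j j)
      ≤ L * κ⁻¹ * relPot p ρbar s r * ∑ i, ∑ j, d i j := by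
    refine (neg_le_abs _).trans ?_
    rw [abs_mul]
    refine mul_le_mul ((HB.remainder r hr s hs).trans (by
      rw [mul_assoc]; exact mul_le_mul_of_nonneg_left (HB.lower r hr s hs) HB.K_pos.le))
        ((Finset.abs_sum_le_sum_abs _ _).trans
      (Finset.sum_le_sum fun i _ => (hd i i).trans ?_)) (abs_nonneg _) (by positivity)
    exact Finset.single_le_sum (fun j _ => hd0 i j) (Finset.mem_univ i)
  have t3 : -((s - r) * ∑ i, (v i - V i) * (divStress μ η D2 i / r))
      ≤ ∑ i, (|lowDev B s r * ((v - V) i * (divStress μ η D2 i / r))|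
        + |highDev B s r * ((v - V) i * (divStress μ η D2 i / r))|) := by
    rw [← lowDev_add_highDev B, Finset.mul_sum, ← Finset.sum_neg_distrib]
    refine Finset.sum_le_sum fun i _ => ?_
    rw [add_mul, neg_add]
    exact add_le_add (neg_le_abs _) (neg_le_abs _)
  have t4 := contract_stress_sub μ η G DV
  have t5 : 0 ≤ (∑ i, ∑ j, d i j) * (L * κ⁻¹ * (1 / 2 * s * ‖v - V‖ ^ 2) + 2 * relPot p ρbar s r) :=
    mul_nonneg (Finset.sum_nonneg fun i _ => Finset.sum_nonneg fun j _ => hd0 i j) (by positivity)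
  simp only [netSource, relSource, relEnergy, inner_eq_sum]
  linarith

lemma MemD012.exists_sum_sq_le : ∃ S : ℝ, 0 ≤ S ∧ ∀ (Ω : Set E3) (v : E3 → E3)
    (G : E3 → M33), IsOpen Ω → MemD012 Ω v G →
    ∑ i, (eLpNorm (fun x => v x i) (ofReal 6) dx(Ω)).toReal ^ 2
      ≤ S * ∫ x in Ω, ∑ i, ∑ j, G x i j ^ 2 := by
  obtain ⟨C, hC⟩ := exists_sobolev_memD012
  refine ⟨C ^ 2 * 3, by positivity, fun Ω v G hΩ h => ?_⟩
  have hi : ∀ i j, Integrable (fun x => G x i j ^ 2) dx(Ω) := fun i j =>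
    (h.2.1 i j).integrable_sq
  rw [integral_finsetSum _ fun i _ => integrable_finsetSum _ fun j _ => hi i j, Finset.mul_sum]
  refine Finset.sum_le_sum fun i _ => ?_
  rw [integral_finsetSum _ fun j _ => hi i j, show ofReal 6 = 6 by norm_num]
  have h1 : ∀ j, (eLpNorm (fun x => G x i j) 2 dx(Ω)).toReal ^ 2
      ≤ ∫ x in Ω, G x i j ^ 2 := fun j => by
    have h0 : 0 ≤ ∫ x in Ω, G x i j ^ 2 := integral_nonneg fun x => sq_nonneg _
    have := eLpNorm_le_of_rpow_le (f := fun x => G x i j) two_pos (hi i j)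
      (.of_forall fun x => by rw [Real.rpow_two, sq_abs]) le_rfl
    rw [show ofReal 2 = 2 by norm_num, ← Real.sqrt_eq_rpow] at this
    refine (pow_le_pow_left₀ toReal_nonneg
      (toReal_le_of_le_ofReal (Real.sqrt_nonneg _) this) 2).trans_eq (Real.sq_sqrt h0)
  have h2 := toReal_mono (ENNReal.mul_ne_top ENNReal.coe_ne_top
    (ENNReal.sum_ne_top.2 fun j _ => (h.2.1 i j).2.ne)) (hC Ω v G hΩ h i)
  rw [ENNReal.toReal_mul, ENNReal.toReal_sum fun j _ => (h.2.1 i j).2.ne] at h2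
  refine (pow_le_pow_left₀ toReal_nonneg h2 2).trans ?_
  rw [mul_pow, mul_assoc]
  refine mul_le_mul_of_nonneg_left ((sq_sum_le_card_mul_sum_sq).trans ?_) (sq_nonneg _)
  simpa using Finset.sum_le_sum fun j _ => h1 j

/-- Hölder's and Young's inequality for a product of three functions. -/
lemma integral_abs_mul_mul_le {α w e : E3 → ℝ} {σ L : ℝ} (hσ : 0 < σ)
    [HolderTriple (ofReal 6) (ofReal q) (ofReal s)]
    [HolderTriple (ofReal σ) (ofReal s) 1] (hδ : 0 < δ) (hα : AEStronglyMeasurable α ν)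
    (he : Integrable e ν) (hαe : ∀ᵐ x ∂ν, |α x| ^ σ ≤ e x) (hL : ∫ x, e x ∂ν ≤ L)
    (hw : MemLp w (ofReal 6) ν) (hF : MemLp F (ofReal q) ν) :
    Integrable (fun x => |α x * (w x * F x)|) ν ∧ ∫ x, |α x * (w x * F x)| ∂ν
      ≤ δ * (eLpNorm w (ofReal 6) ν).toReal ^ 2
        + (4 * δ)⁻¹ * (L ^ (2 / σ) * (eLpNorm F (ofReal q) ν).toReal ^ 2) := by
  have hL0 : 0 ≤ L := (integral_nonneg_of_ae (hαe.mono fun x hx =>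
    (Real.rpow_nonneg (abs_nonneg _) _).trans hx)).trans hL
  have h1 := eLpNorm_le_of_rpow_le hσ he hαe hL
  have hαL : MemLp α (ofReal σ) ν := ⟨hα, h1.trans_lt ENNReal.ofReal_lt_top⟩
  have hwF : MemLp (fun x => w x * F x) (ofReal s) ν := memLp_mul hw hF
  refine ⟨(memLp_one_iff_integrable.1 (memLp_mul hαL hwF)).abs, ?_⟩
  have h2 := toReal_mono (ENNReal.mul_ne_top hw.2.ne hF.2.ne)
    (eLpNorm_mul_le (r := ofReal s) hw.1 hF.1)
  have h3 := (le_abs_self _).trans (abs_integral_mul_le (F := fun x => |α x|)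
    (G := fun x => |w x * F x|) hαL.abs hwF.abs)
  have e1 : ∀ {g : E3 → ℝ} {a : ℝ≥0∞}, eLpNorm (fun x => |g x|) a ν = eLpNorm g a ν :=
    fun {g a} => eLpNorm_norm g
  simp only [← abs_mul, e1] at h3
  rw [ENNReal.toReal_mul] at h2
  have h4 := toReal_le_of_le_ofReal (by positivity) h1
  refine h3.trans ((mul_le_mul h4 h2 toReal_nonneg (by positivity)).trans ?_)
  have e2 : L ^ (2 / σ) = (L ^ (1 / σ)) ^ 2 := by
    rw [← Real.rpow_mul_natCast hL0]; congr 1; push_cast; ring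
  rw [e2]
  set x := (eLpNorm w (ofReal 6) ν).toReal
  set y := (eLpNorm F (ofReal q) ν).toReal
  have : 0 ≤ δ * (x - (2 * δ)⁻¹ * (L ^ (1 / σ) * y)) ^ 2 := by positivity
  have e3 : δ * (x - (2 * δ)⁻¹ * (L ^ (1 / σ) * y)) ^ 2
      = δ * x ^ 2 - L ^ (1 / σ) * (x * y) + (4 * δ)⁻¹ * ((L ^ (1 / σ)) ^ 2 * y ^ 2) := by
    field_simp; ring
  linarith

lemma ae_primitive_le_zero (hT : 0 < T) {N : ℝ → ℝ} (hN : IntegrableOn N (Ioo 0 T))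
    (ha : IntegrableOn a (Ioo 0 T))
    (h : ∀ᵐ t ∂dt(T), 0 ≤ a t ∧ 0 ≤ ∫ s in 0..t, N s ∧ N t ≤ a t * ∫ s in 0..t, N s) :
    ∀ᵐ t ∂dt(T), ∫ s in 0..t, N s ≤ 0 := by
  set Y := fun t => ∫ s in 0..t, N s with hY
  have hle : ∀ {g : ℝ → ℝ}, IntegrableOn g (Ioo 0 T) → ∀ t ∈ Ioo 0 T,
      |∫ s in 0..t, g s| ≤ ∫ s in Ioo 0 T, |g s| := fun {g} hg t ht => by
    rw [intervalIntegral_eq_Ioo ht.1.le]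
    exact (norm_integral_le_integral_norm g).trans (setIntegral_mono_set hg.norm
      (.of_forall fun _ => norm_nonneg _)
      (Ioo_subset_Ioo_right ht.2.le).eventuallyLE)
  set S := ∫ s in Ioo 0 T, |N s|
  set A := ∫ s in Ioo 0 T, |a s|
  have hS : 0 ≤ S := integral_nonneg fun _ => abs_nonneg _
  have key : ∀ n : ℕ, ∀ᵐ t ∂dt(T), Y t ≤ 1 / ((n : ℝ) + 1) * Real.exp A := fun n => by
    have hε : (0 : ℝ) < 1 / ((n : ℝ) + 1) := by positivity
    set ε := 1 / ((n : ℝ) + 1)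
    have hpos : ∀ x ∈ Icc ε (ε + S), x ≠ 0 := fun x hx => (hε.trans_le hx.1).ne'
    obtain ⟨i1, e1⟩ := ae_comp_primitive_eq_of_mem_Icc hT hN (h := fun t => ε + Y t)
      (.of_forall fun _ => rfl) (by linarith : ε ≤ ε + S)
      (fun x hx => Real.hasDerivAt_log (hpos x hx)) (continuousOn_inv₀.mono hpos) (by
        filter_upwards [h, ae_mem_Ioo] with t h1 ht
        exact ⟨by linarith [h1.2.1], by linarith [(le_abs_self _).trans (hle hN t ht)]⟩)
      ⟨le_rfl, by linarith⟩
    filter_upwards [e1, h, ae_mem_Ioo] with t e1 h1 ht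
    have h2 : ∫ s in 0..t, (ε + Y s)⁻¹ * N s ≤ A := by
      refine le_trans ?_ ((le_abs_self _).trans (hle ha t ht))
      rw [integral_of_le ht.1.le, intervalIntegral_eq_Ioo ht.1.le, integral_Ioc_eq_integral_Ioo]
      have hs : Ioo 0 t ⊆ Ioo 0 T := Ioo_subset_Ioo_right ht.2.le
      refine setIntegral_mono_on_ae (i1.mono_set hs) (ha.mono_set hs) measurableSet_Ioo ?_
      filter_upwards [(ae_restrict_iff' measurableSet_Ioo).1 h] with s h3 h4
      obtain ⟨h5, h6, h7⟩ := h3 (hs h4)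
      have h6 : 0 ≤ Y s := h6
      rw [inv_mul_le_iff₀ (by linarith)]
      have : 0 ≤ ε * a s := by positivity
      have h7 : N s ≤ a s * Y s := h7
      linarith
    have h3 : ε + Y t = Real.exp (Real.log (ε + Y t)) := (Real.exp_log (by linarith [h1.2.1])).symm
    have h4 : Real.exp (Real.log (ε + Y t)) ≤ ε * Real.exp A := by
      rw [e1, Real.exp_add, Real.exp_log hε]
      exact mul_le_mul_of_nonneg_left (Real.exp_le_exp.2 h2) hε.le
    linarith
  filter_upwards [ae_all_iff.2 key] with t ht
  have := (tendsto_one_div_add_atTop_nhds_zero_nat (𝕜 := ℝ)).mul_const (Real.exp A)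
  rw [zero_mul] at this
  exact ge_of_tendsto' this ht

local notation:max "re(" t "," x ")" => relEnergy p ρbar (ρ t x) (u t x) (r t x) (U t x)
local notation:max "ns(" t "," x ")" => netSource μ η p (ρ t x) (u t x) (r t x) (U t x) (f t x)
  (Du t x) (DU t x) (D2U t x)
local notation:max "vn(" t "," i "," s ")" =>
  ENNReal.toReal (eLpNorm (fun x => divStress μ η (D2U t x) i / r t x) (ofReal s) dx(Ω))
local notation:max "wn(" t "," i ")" =>
  ENNReal.toReal (eLpNorm (fun x => (u t x - U t x) i) (ofReal 6) dx(Ω))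

/-! ### Conclusion -/

lemma relEnergy_nonneg {r : ℝ} (hp : PressureLaw p γ) (hρ : 0 < ρbar) (hs : 0 ≤ s) (hr : 0 < r)
    (v V : E3) : 0 ≤ relPot p ρbar s r ∧ relPot p ρbar s r ≤ relEnergy p ρbar s v r V := by
  have h : 0 ≤ 1 / 2 * s * ‖v - V‖ ^ 2 := by positivity
  exact ⟨relPot_nonneg hp hρ hs hr, by unfold relEnergy; linarith⟩

lemma RelPotBounds.eq_of_relEnergy_eq_zero {r : ℝ} (h : RelPotBounds p γ ρbar c C B κ L)
    (hp : PressureLaw p γ) (hρ : 0 < ρbar) (hc : 0 < c) (hr : r ∈ Icc c C) (hs : 0 ≤ s) {v V : E3}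
    (h0 : relEnergy p ρbar s v r V = 0) : s = r ∧ v = V := by
  obtain ⟨h1, h2⟩ := relEnergy_nonneg hp hρ hs (hc.trans_le hr.1) v V
  have h3 : relPot p ρbar s r = 0 := le_antisymm (h2.trans h0.le) h1
  have hr0 := hc.trans_le hr.1
  have h4 := h.lower r hr s hs
  rw [h3, mul_zero, devEnergy] at h4
  have hsr : s = r := by
    split_ifs at h4 with hsB
    · exact sub_eq_zero.1 (pow_eq_zero_iff two_ne_zero |>.1 (le_antisymm h4 (sq_nonneg _)))
    · linarith [Real.rpow_pos_of_pos (by linarith [h.one_le] : 0 < s) γ]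
  subst hsr
  refine ⟨rfl, ?_⟩
  rw [relEnergy, h3, add_zero] at h0
  have h5 : ‖v - V‖ ^ 2 = 0 := by
    rcases mul_eq_zero.1 h0 with h6 | h6
    · exfalso; linarith
    · exact h6
  exact sub_eq_zero.1 (norm_eq_zero.1 (pow_eq_zero_iff two_ne_zero |>.1 h5))

section

variable (HS : StrongReg T Ω μ η p γ ρbar f q c C ρ₀ u₀ r U gr DU D2U)
  (HB : RelPotBounds p γ ρbar c C B κ L)
include HS HB

lemma integral_netSource_le (hμ : 0 < μ) (hη : 0 ≤ η) {S t : ℝ} (hS : 0 ≤ S) {d : Fin 3 → Fin 3 → ℝ}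
    (hsob : ∑ i, wn(t,i) ^ 2 ≤ S * ∫ x in Ω, ∑ i, ∑ j, (Du t x - DU t x) i j ^ 2)
    (hw : MemD012 Ω (fun x => u t x - U t x) (fun x => Du t x - DU t x))
      (hsm : AEStronglyMeasurable (ρ t) dx(Ω)) (hrm : AEStronglyMeasurable (r t) dx(Ω))
      (hsr : ∀ᵐ x ∂dx(Ω), 0 ≤ ρ t x ∧ r t x ∈ Icc c C)
    (hd : ∀ i j, ∀ᵐ x ∂dx(Ω), |DU t x i j| ≤ d i j)
    (hF3 : ∀ i, MemLp (fun x => divStress μ η (D2U t x) i / r t x) (ofReal 3) dx(Ω))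
    (hFq : ∀ i, MemLp (fun x => divStress μ η (D2U t x) i / r t x) (ofReal q) dx(Ω))
    (hN : Integrable (fun x => ns(t,x)) dx(Ω)) (hE : Integrable (fun x => re(t,x)) dx(Ω))
    (hL : κ⁻¹ * ∫ x in Ω, re(t,x) ≤ b) : ∫ x in Ω, ns(t,x)
      ≤ ((2 + L * κ⁻¹) * (∑ i, ∑ j, d i j) + (4 * (μ / (2 * (S + 1))))⁻¹ * κ⁻¹ * ∑ i,
        (vn(t,i,3) ^ 2 + b ^ (2 / (6 * q / (5 * q - 6)) - 1) * vn(t,i,q) ^ 2))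
        * ∫ x in Ω, re(t,x) := by
  obtain ⟨-, -, e3, e4, e5⟩ := HS.exponents
  have hp := HS.law
  have hρ := HS.far_pos
  have hc := HS.pos
  set σ := 6 * q / (5 * q - 6) with hσ
  set δ := μ / (2 * (S + 1)) with hδ
  have hδ0 : 0 < δ := by positivity
  have hκ := HB.κ_pos
  have hσ0 : 0 < σ := by linarith
  have t1 : HolderTriple (ofReal 6) (ofReal 3) (ofReal 2) :=
    holderTriple_ofReal (by norm_num) (by norm_num) (by norm_num) (by norm_num)
  have t2 : HolderTriple (ofReal 2) (ofReal 2) 1 :=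
    holderTriple_ofReal_one (by norm_num) (by norm_num) (by norm_num)
  have q0 : 0 < q := by linarith [HS.three_lt]
  have q1 : 0 < q + 6 := by linarith
  have q2 : 0 < 5 * q - 6 := by linarith [HS.three_lt]
  have t3 : HolderTriple (ofReal 6) (ofReal q) (ofReal (6 * q / (q + 6))) :=
    holderTriple_ofReal (by norm_num) q0 (by positivity) (by field_simp)
  have t4 : HolderTriple (ofReal σ) (ofReal (6 * q / (q + 6))) 1 :=
    holderTriple_ofReal_one hσ0 (by positivity) (by rw [hσ]; field_simp; ring)
  set e := fun x => re(t,x) with he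
  set E := ∫ x in Ω, e x with hEdef
  have hE0 : 0 ≤ E := integral_nonneg_of_ae <| hsr.mono fun x hx => by
    obtain ⟨h1, h2⟩ := relEnergy_nonneg hp hρ hx.1 (hc.trans_le hx.2.1) (u t x) (U t x)
    exact h1.trans h2
  have hκe : ∫ x in Ω, κ⁻¹ * e x = κ⁻¹ * E := integral_const_mul _ _
  have hwi : ∀ i, MemLp (fun x => (u t x - U t x) i) (ofReal 6) dx(Ω) :=
    fun i => by simpa using memLp_coord hw.1 i
  have hdom : ∀ {x}, 0 ≤ ρ t x ∧ r t x ∈ Icc c C →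
      devEnergy γ B (ρ t x) (r t x) ≤ κ⁻¹ * e x := fun {x} hx =>
    (HB.lower _ hx.2 _ hx.1).trans (mul_le_mul_of_nonneg_left
      (relEnergy_nonneg hp hρ hx.1 (hc.trans_le hx.2.1) (u t x) (U t x)).2 (inv_nonneg.2 hκ.le))
  have hm := hsm.aemeasurable.prodMk hrm.aemeasurable
  have low := fun i => integral_abs_mul_mul_le (σ := 2) (s := 2)
    (α := fun x => lowDev B (ρ t x) (r t x)) two_pos hδ0
    ((measurable_dev B).1.comp_aemeasurable hm).aestronglyMeasurable (hE.const_mul κ⁻¹)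
    (hsr.mono fun x hx => (lowDev_sq_le hx.1 _).trans (hdom hx)) hκe.le (hwi i) (hF3 i)
  have high := fun i => integral_abs_mul_mul_le (σ := σ) (s := 6 * q / (q + 6))
    (α := fun x => highDev B (ρ t x) (r t x)) hσ0 hδ0
    ((measurable_dev B).2.comp_aemeasurable hm).aestronglyMeasurable (hE.const_mul κ⁻¹)
    (hsr.mono fun x hx => (HB.highDev_rpow_le hc hx.2 hx.1 hσ0 e3).trans (hdom hx))
    hκe.le (hwi i) (hFq i)
  obtain ⟨c1, c2, c3⟩ := hw.coercive hμ hη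
  have iE := hE.const_mul ((2 + L * κ⁻¹) * ∑ i, ∑ j, d i j)
  have iS := integrable_finsetSum Finset.univ fun i _ => (low i).1.add (high i).1
  have hmono := integral_mono_ae hN ((c1.neg.add iE).add iS) (by
    filter_upwards [hsr, ae_all_iff.2 fun i => ae_all_iff.2 (hd i)] with x hx h1
    exact netSource_le HB hp hρ hc hx.1 hx.2 (u t x) (U t x) (f t x) (Du t x) (DU t x) (D2U t x) h1)
  refine hmono.trans ?_
  have e6 : ∀ i, ∫ x in Ω, (|lowDev B (ρ t x) (r t x)
      * ((u t x - U t x) i * (divStress μ η (D2U t x) i / r t x))|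
      + |highDev B (ρ t x) (r t x) * ((u t x - U t x) i * (divStress μ η (D2U t x) i / r t x))|)
      ≤ 2 * δ * wn(t,i) ^ 2 + (4 * δ)⁻¹ * κ⁻¹ * (vn(t,i,3) ^ 2
          + b ^ (2 / σ - 1) * vn(t,i,q) ^ 2) * E := fun i => by
    rw [integral_add (low i).1 (high i).1]
    refine (add_le_add (low i).2 (high i).2).trans ?_
    have hx0 : 0 ≤ κ⁻¹ * E := by positivity
    have h2σ : 0 ≤ 2 / σ - 1 := by rw [sub_nonneg, le_div_iff₀ hσ0]; linarith
    have e7 : (κ⁻¹ * E) ^ (2 / σ) ≤ κ⁻¹ * E * b ^ (2 / σ - 1) := by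
      rw [show 2 / σ = 1 + (2 / σ - 1) by ring, Real.rpow_add' hx0 (by linarith), Real.rpow_one]
      simp only [add_sub_cancel_left]
      exact mul_le_mul_of_nonneg_left (Real.rpow_le_rpow hx0 hL h2σ) hx0
    rw [div_self two_ne_zero, Real.rpow_one]
    have e8 := mul_le_mul_of_nonneg_left (mul_le_mul_of_nonneg_right e7
      (sq_nonneg vn(t,i,q))) (inv_nonneg.2 (by positivity : 0 ≤ 4 * δ))
    linarith
  rw [integral_add' (c1.neg.add iE) iS, integral_add' c1.neg iE, integral_neg',
    integral_const_mul, integral_finsetSum _ fun i _ => (low i).1.add (high i).1]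
  have e9 := Finset.sum_le_sum fun i (_ : i ∈ Finset.univ) => e6 i
  rw [Finset.sum_add_distrib, ← Finset.mul_sum, ← Finset.sum_mul, ← Finset.mul_sum] at e9
  have e10 : 2 * δ * ∑ i, wn(t,i) ^ 2 ≤ μ * ∫ x in Ω, ∑ i, ∑ j, (Du t x - DU t x) i j ^ 2 := by
    have h0 : 0 ≤ ∫ x in Ω, ∑ i, ∑ j, (Du t x - DU t x) i j ^ 2 := integral_nonneg fun x =>
      Finset.sum_nonneg fun i _ => Finset.sum_nonneg fun j _ => sq_nonneg _
    refine (mul_le_mul_of_nonneg_left hsob (by positivity)).trans ?_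
    rw [← mul_assoc]
    refine mul_le_mul_of_nonneg_right ?_ h0
    rw [hδ]
    field_simp
    linarith
  simp only [Pi.add_apply]
  linarith

variable (HW : WeakReg T Ω p γ ρbar M ρ u Du)
include HW

omit HB in
lemma ae_relEnergy_nonneg : ∀ᵐ t ∂dt(T), ∀ᵐ x ∂dx(Ω), 0 ≤ re(t,x) := by
  filter_upwards [HS.bounds, HW.nonneg] with t h1 h2
  filter_upwards [h1, h2] with x h1 h2
  obtain ⟨h3, h4⟩ := relEnergy_nonneg HW.law HW.far h2 (HS.pos.trans_le h1.1) (u t x) (U t x)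
  exact h3.trans h4

variable (hdata : FiniteEnergyData Ω p ρbar ρ₀ u₀)
  (H : IsFEWSWithGradient T Ω μ η p γ ρbar f ρ₀ u₀ ρ u Du)
include hdata H

lemma relEnergy_inequality : Mix dt(T) dx(Ω) 1 1 (fun t x => ns(t,x)) ∧
    ∀ᵐ τ ∂dt(T), Integrable (fun x => re(τ,x)) dx(Ω) ∧
      ∫ x in Ω, re(τ,x) ≤ ∫ t in 0..τ, ∫ x in Ω, ns(t,x) := by
  have hp := HW.law
  have hr0 : ∀ {x : ℝ}, x ∈ Icc c C → 0 < x := fun hx => HS.pos.trans_le hx.1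
  have mI := relSource_mix HS HW HB H.energy.integrable_work
  have i1 := H.energy.integrable_work
  have i2 := H.energy.integrable_dissipation
  rw [IntegrableOn, volume_restrict_cyl] at i1 i2
  have mN : Mix dt(T) dx(Ω) 1 1 (fun t x => ns(t,x)) :=
    (mI.add le_rfl (Mix.of_integrable (g := fun t x => ρ t x * inner ℝ (f t x) (u t x))
    i1)).sub le_rfl (Mix.of_integrable (g := fun t x => contract (stress μ η (Du t x)) (Du t x)) i2)
  refine ⟨mN, ?_⟩
  have hY : (fun x => crossEnergy p ρbar (ρ₀ x) (u₀ x) (ρ₀ x) (u₀ x))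
      =ᵐ[dx(Ω)] fun x => -energyDensity p ρbar (ρ₀ x) (u₀ x) := by
    filter_upwards [HS.data] with x hx
    have := energyDensity_add_crossEnergy hp HW.far (ρ₀ x) (u₀ x) (hr0 hx).ne' (u₀ x)
    simp only [relEnergy, sub_self, norm_zero, relPot_self] at this
    linarith
  have key : ∀ᵐ t ∂dt(T), ∀ᵐ x ∂dx(Ω),
      energyDensity p ρbar (ρ t x) (u t x) + crossEnergy p ρbar (ρ t x) (u t x) (r t x) (U t x)
        = re(t,x) ∧ 0 ≤ re(t,x) := by
    filter_upwards [HS.bounds, ae_relEnergy_nonneg HS HW] with t h1 h2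
    filter_upwards [h1, h2] with x h1 h2
    exact ⟨energyDensity_add_crossEnergy hp HW.far _ _ (hr0 h1).ne' _, h2⟩
  have hlim := tested_limit (fun ζ hζ => relative_tested_parts HS HW H hζ) mI
    (fun j => relFlux_mix HS HW HB j)
    ((integrable_congr hY).2 hdata.integrable.neg) (HW.energy.mono fun t ht => ht.1) (by
      filter_upwards [key] with t ht
      filter_upwards [ht] with x hx
      rw [hx.1]; exact hx.2)
  filter_upwards [hlim, key, H.energy.inequality, ae_mem_Ioo] with τ h1 h2 h3 hτ
  have h2' := h2.mono fun x hx => hx.1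
  refine ⟨(integrable_congr h2').1 h1.1, ?_⟩
  rw [← integral_congr_ae h2']
  refine h1.2.trans ?_
  have h4 := h3.2
  rw [volume_restrict_cyl] at h4
  have jI := integral_of_le_eq_prod hτ mI.integrable
  have j1 := (integral_of_le_eq_prod (N := fun t x => ρ t x * inner ℝ (f t x) (u t x)) hτ i1).1
  have j2 := (integral_of_le_eq_prod
    (N := fun t x => contract (stress μ η (Du t x)) (Du t x)) hτ i2).1
  rw [jI.2, (integral_of_le_eq_prod hτ mN.integrable).2, integral_congr_ae hY, integral_neg]
  have h5 : ∫ z, _ ∂(dt(τ).prod dx(Ω)) = _ := integral_sub (jI.1.add j1) j2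
  have h6 := integral_add jI.1 j1
  simp only [Pi.add_apply, uncurry] at h5 h6
  simp only [netSource] at h5 ⊢
  linarith

lemma relEnergy_eq_zero (hμ : 0 < μ) (hη : 0 ≤ η) : ∀ᵐ t ∂dt(T), ∀ᵐ x ∂dx(Ω), re(t,x) = 0 := by
  obtain ⟨mN, hE⟩ := relEnergy_inequality HS HB HW hdata H
  obtain ⟨S, hS, hsob⟩ := MemD012.exists_sum_sq_le
  set N := fun t => ∫ x in Ω, ns(t,x) with hNdef
  have hN : IntegrableOn N (Ioo 0 T) := mN.integrable.integral_prod_left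
  set b := κ⁻¹ * ∫ t in Ioo 0 T, ‖N t‖
  have F2 := HS.force_mix (by norm_num) HS.gr_two HS.D2U_two
  have Fq := HS.force_mix HS.one_le_q HS.gr_q HS.D2U_q
  have F3 := fun i => (F2 i).interpolate_two (by norm_num) HS.three_lt (Fq i)
  set a : ℝ → ℝ := fun t => (2 + L * κ⁻¹) * (∑ i, ∑ j,
      (eLpNorm (fun x => DU t x i j) ⊤ dx(Ω)).toReal)
    + (4 * (μ / (2 * (S + 1))))⁻¹ * κ⁻¹ * ∑ i,
      (vn(t,i,3) ^ 2 + b ^ (2 / (6 * q / (5 * q - 6)) - 1) * vn(t,i,q) ^ 2)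
  have hκ := HB.κ_pos
  have hK := HB.K_pos
  have hL0 : 0 ≤ b := mul_nonneg (inv_nonneg.2 hκ.le) (integral_nonneg fun _ => norm_nonneg _)
  have hL1 : 0 ≤ b ^ (2 / (6 * q / (5 * q - 6)) - 1) := Real.rpow_nonneg hL0 _
  have ha0 : ∀ t, 0 ≤ a t := fun t => by
    refine add_nonneg (mul_nonneg (by positivity) (Finset.sum_nonneg fun i _ =>
      Finset.sum_nonneg fun j _ => toReal_nonneg)) (mul_nonneg (by positivity)
        (Finset.sum_nonneg fun i _ => by positivity))
  have hai : IntegrableOn a (Ioo 0 T) :=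
    ((integrable_finsetSum _ fun i _ => integrable_finsetSum _ fun j _ =>
      (HS.DU_top i j).norm.integrable (by norm_num)).const_mul _).add
      ((integrable_finsetSum _ fun i _ => (F3 i).norm.integrable_sq.add
        ((Fq i).norm.integrable_sq.const_mul _)).const_mul _)
  have hE0 := ae_relEnergy_nonneg HS HW
  have hY := ae_primitive_le_zero HS.T_pos hN hai (by
    filter_upwards [hE, hE0, HS.bounds, HW.nonneg, HS.memD012, HW.memD012, HS.meas.prodMk_left,
      HW.meas_ρ.prodMk_left, ae_all_iff.2 fun i => (F3 i).memLp,
      ae_all_iff.2 fun i => (Fq i).memLp, ae_all_iff.2 fun i => ae_all_iff.2 fun j =>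
        (HS.DU_top i j).memLp, mN.memLp, ae_mem_Ioo]
      with t h1 h2 h3 h4 h5 h6 h7 h8 h9 h10 h11 h12 ht
    have hw := h6.sub h5
    have hE0' := integral_nonneg_of_ae h2
    have hle : ∫ s in 0..t, N s ≤ ∫ s in Ioo 0 T, ‖N s‖ := by
      rw [intervalIntegral_eq_Ioo ht.1.le]
      exact (le_abs_self _).trans ((norm_integral_le_integral_norm N).trans (setIntegral_mono_set
        hN.norm (.of_forall fun _ => norm_nonneg _)
        (Ioo_subset_Ioo_right ht.2.le).eventuallyLE))
    refine ⟨ha0 t, hE0'.trans h1.2, ?_⟩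
    refine (integral_netSource_le HS HB hμ hη hS
      (hsob Ω _ _ HS.isOpen hw) hw h8 h7 (h4.and h3) (fun i j => ?_) h9 h10
      (memLp_one_iff_integrable.1 h12) h1.1
      (mul_le_mul_of_nonneg_left (h1.2.trans hle) (inv_nonneg.2 hκ.le))).trans
      (mul_le_mul_of_nonneg_left h1.2 (ha0 t))
    filter_upwards [ae_le_eLpNormEssSup (f := fun x => DU t x i j) (μ := dx(Ω))] with x hx
    rw [← eLpNorm_exponent_top, Real.enorm_eq_ofReal_abs] at hx
    exact (ENNReal.ofReal_le_iff_le_toReal (h11 i j).2.ne).1 hx)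
  filter_upwards [hE, hE0, hY] with t h1 h2 h3
  exact (integral_eq_zero_iff_of_nonneg_ae h2 h1.1).1
    (le_antisymm (h1.2.trans h3) (integral_nonneg_of_ae h2))

lemma eq_of_relEnergy (hμ : 0 < μ) (hη : 0 ≤ η)
    (hU : AEStronglyMeasurable (uncurry U) (volume.restrict (cyl T Ω))) :
    ∀ᵐ z ∂(volume.restrict (cyl T Ω)), ρ z.1 z.2 = r z.1 z.2 ∧ u z.1 z.2 = U z.1 z.2 := by
  have key : ∀ᵐ t ∂dt(T), ∀ᵐ x ∂dx(Ω), ρ t x = r t x ∧ u t x = U t x := by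
    filter_upwards [relEnergy_eq_zero HS HB HW hdata H hμ hη, HS.bounds, HW.nonneg] with t h1 h2 h3
    filter_upwards [h1, h2, h3] with x h1 h2 h3
    exact HB.eq_of_relEnergy_eq_zero HW.law HW.far HS.pos h2 h3 h1
  rw [volume_restrict_cyl] at hU ⊢
  have h1 := ae_eq_prod_of_ae_ae HW.meas_ρ HS.meas (key.mono fun t ht => ht.mono fun x hx => hx.1)
  have h2 := fun i => ae_eq_prod_of_ae_ae (aestronglyMeasurable_coord HW.meas_u i)
    (aestronglyMeasurable_coord hU i)
    (key.mono fun t ht => ht.mono fun x hx => congrArg (fun v : E3 => v i) hx.2)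
  filter_upwards [h1, ae_all_iff.2 h2] with z h1 h2
  exact ⟨h1, PiLp.ext h2⟩

end

end CNS

end

theorem theorem4p2
    (Ω : Set CNS.E3) (hΩ_open : IsOpen Ω) (hΩ_conn : IsConnected Ω)
    (hΩ_unbdd : ¬ Bornology.IsBounded Ω) (hΩ_lip : CNS.UniformlyLipschitzBoundary Ω)
    (T : ℝ) (hT : 0 < T) (μ η : ℝ) (hμ : 0 < μ) (hη : 0 ≤ η)
    (p : ℝ → ℝ) (γ : ℝ) (hp : CNS.PressureLaw p γ)
    (ρbar : ℝ) (hρbar : 0 < ρbar)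
    (f : ℝ → CNS.E3 → CNS.E3)
    (hf_one : CNS.MemLtLx T Ω 1 1 f) (hf_top : CNS.MemLtLx T Ω 1 ⊤ f)
    (ρ₀ : CNS.E3 → ℝ) (u₀ : CNS.E3 → CNS.E3) (hdata : CNS.FiniteEnergyData Ω p ρbar ρ₀ u₀)
    (q : ℝ) (hq : max 3 (3 / (γ - 1)) < q)
    (ρ : ℝ → CNS.E3 → ℝ) (u : ℝ → CNS.E3 → CNS.E3)
    (hweak : CNS.IsFiniteEnergyWeakSolution T Ω μ η p γ ρbar f ρ₀ u₀ ρ u)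
    (ρ' : ℝ → CNS.E3 → ℝ) (u' : ℝ → CNS.E3 → CNS.E3)
    (hstrong : CNS.IsStrongSolution T Ω μ η p ρbar f q ρ₀ u₀ ρ' u') :
    ∀ᵐ z ∂(MeasureTheory.volume.restrict (CNS.cyl T Ω)),
      ρ z.1 z.2 = ρ' z.1 z.2 ∧ u z.1 z.2 = u' z.1 z.2 := by
  obtain ⟨Du, hweak⟩ := hweak
  obtain ⟨rt, gr, Ut, DU, D2U, hstrong⟩ := hstrong
  have hγ : 0 < γ - 1 := by linarith [hp.three_halves_lt]
  obtain ⟨hq3, hqγ⟩ := max_lt_iff.1 hq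
  have hQγ : 3 < min q 6 * (γ - 1) := by
    rw [← div_lt_iff₀ hγ]
    refine lt_min hqγ ?_
    rw [div_lt_iff₀ hγ]
    linarith [hp.three_halves_lt]
  have hQ3 : 3 < min q 6 := lt_min hq3 (by norm_num)
  obtain ⟨c, C, HS⟩ := hstrong.exists_strongReg hT hΩ_open hΩ_lip hp hρbar hf_one hf_top hdata
    hQ3 (min_le_left q 6) (min_le_right q 6) hQγ
  obtain ⟨M, HW⟩ := hweak.exists_weakReg hΩ_open hp hρbar
  obtain ⟨B, κ, L, HB⟩ := CNS.exists_relPotBounds hp hρbar HS.pos HS.le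
  exact CNS.eq_of_relEnergy HS HB HW hdata hweak hμ hη hstrong.velocity_class.1
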